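/- **Setting.** Fix $d\in\mathbb N$, $\Lambda\ge 0$, $\alpha\ge 1$. Let $T>0$, let $(\Omega,\mathcal F,(\mathcal F_t),\mathbb P)$ be a filtered probability space with $(\Omega,\mathcal F_0,\mathbb P)$ atomless, carrying a $d$-dimensional $(\mathcal F_t)$-Brownian motion $W$ on $[0,T]$. Write $[\theta]$ for the law of $\theta$, $\|\cdot\|_p$ for the $L^p(\mathbb P)$-norm (possibly $+\infty$), and $\mathcal W_2$ for the Wasserstein distance on the measures with finite second moment. Let $b(x,y,\nu)\in\mathbb R^d$, $\sigma(x,\mu)\in\mathbb R^{d\times d}$, $f(x,y,z,\nu)\in\mathbb R$, $g(x,\mu)\in\mathbb R$ be defined for $x,z\in\mathbb R^d$, $y\in\mathbb R$, $\mu\in\mathcal P_2(\mathbb R^d)$, $\nu\in\mathcal P_2(\mathbb R^d\times\mathbb R)$, and put $a=\sigma\sigma^\dagger$. Assume: * **(H0)** $b,\sigma,f,g$ are $\Lambda$-Lipschitz in all variables (with $\mathcal W_2$ for the measure arguments), and $|\sigma|\le\Lambda$. * **(H1)** $\mathcal U:[0,T]\times\mathbb R^d\times\mathcal P_2(\mathbb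 R^d)\to\mathbb R$ is a classical solution of the master equation: for $t<T$, with $\nu$ the image of $\mu$ by $x\mapsto(x,\mathcal U(t,x,\mu))$, $$\partial_t\mathcal U+b(x,\mathcal U,\nu)\cdot\partial_x\mathcal U+\tfrac12\mathrm{Tr}[\partial^2_{xx}\mathcal U\,a(x,\mu)]+f(x,\mathcal U,\sigma^\dagger(x,\mu)\partial_x\mathcal U,\nu)+\int\partial_\mu\mathcal U(t,x,\mu)(v)\cdot b(v,\mathcal U(t,v,\mu),\nu)\,d\mu(v)+\int\tfrac12\mathrm{Tr}[\partial_v\partial_\mu\mathcal U(t,x,\mu)(v)\,a(v,\mu)]\,d\mu(v)=0,$$ and $\mathcal U(T,\cdot)=g$. Here $\partial_\mu$ is Lions' derivative, i.e. $\partial_\mu\mathcal U(t,x,[X])(X)$ is the Fréchet gradient at $X$ of $X\mapsto\mathcal U(t,x,[X])$ on $L^2(\Omega,\mathcal F_0,\mathbb P;\mathbb R^d)$; $v\mapsto\partial_\mu\mathcal U(t,x,\mu)(v)$ is differentiable; $\partial_t\mathcal U$ (on $[0,T)$), $\partial_x\mathcal U$ and $\partial^2_{xx}\mathcal U$ are jointly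 continuous, and $\partial_\mu\mathcal U,\partial_v\partial_\mu\mathcal U$ are continuous at all $(t,x,\mu,v)$ with $v\in\mathrm{supp}\,\mu$. Moreover, for all arguments, $|\mathcal U(t,x,\mu)-\mathcal U(t,x,\mu')|+|\partial_x\mathcal U(t,x,\mu)-\partial_x\mathcal U(t,x,\mu')|\le\Lambda\mathcal W_2(\mu,\mu')$; $|\partial_x\mathcal U(t,x,\mu)|+\|\partial_\mu\mathcal U(t,x,\mu)\|_{L^2(\mu)}\le\Lambda$; $|\partial^2_{xx}\mathcal U(t,x,\mu)|+\|\partial_v\partial_\mu\mathcal U(t,x,\mu)\|_{L^2(\mu)}\le\Lambda$; $|\partial^2_{xx}\mathcal U(t,x,\mu)-\partial^2_{xx}\mathcal U(t,x',\mu)|\le\Lambda|x-x'|$; $|\mathcal U(t+h,x,\mu)-\mathcal U(t,x,\mu)|+|\partial_x\mathcal U(t+h,x,\mu)-\partial_x\mathcal U(t,x,\mu)|\le\Lambda h^{1/2}(1+|x|+m_2(\mu))$ for $0\le h<T$, $0\le t\le T-h$; $|\partial_v\partial_\mu\mathcal U(t,x,\mu)(v)-\partial_v\partial_\mu\mathcal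 U(t,x,\mu)(v')|\le\Lambda\{1+|v|^{2\alpha}+|v'|^{2\alpha}+m_2(\mu)^{2\alpha}\}^{1/2}|v-v'|$; where $m_2(\mu)=(\int|x|^2d\mu)^{1/2}$. (Solvability of the associated McKean–Vlasov forward-backward SDE is not needed as an assumption.) **Scheme.** Let $N\ge1$, $\delta=T/N$, $r_k=k\delta$; let $\pi=\{0=t_0<\dots<t_n=T\}$ contain all $r_k=t_{j_k}$; $h_i=t_{i+1}-t_i$, $|\pi|=\max_i h_i$. Let $\Gamma:\mathbb R^d\to\mathbb R^d$ be measurable with finite range, bounded by $\Lambda$, and such that $\Gamma(G)$, $G\sim N(0,I_d)$, is centred with covariance $I_d$; put $\Delta\bar W_i=h_i^{1/2}\,\Gamma\bigl(h_i^{-1/2}(W_{t_{i+1}}-W_{t_i})\bigr)$. For $0\le k<N$, an adapted square-integrable input $(\bar{\mathfrak X}_{t_i})_{j_k\le i\le j_{k+1}}$ and $\eta\in L^2(\mathcal F_{r_{k+1}})$, an output of the scheme is an adapted square-integrable $(\bar X,\bar Y,\bar Z)$ with $\bar Y_{r_{k+1}}=\eta$, $\bar Z_{r_{k+1}}=0$,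 $\bar X_{r_k}=\bar{\mathfrak X}_{r_k}=:\xi$ and, for $j_k\le i<j_{k+1}$, $$\bar Y_{t_i}=\mathbb E_{t_i}\bigl[\bar Y_{t_{i+1}}+h_i f(\bar{\mathfrak X}_{t_i},\bar Y_{t_i},\bar Z_{t_i},[\bar{\mathfrak X}_{t_i},\bar Y_{t_i}])\bigr],\qquad \bar Z_{t_i}=\mathbb E_{t_i}\bigl[h_i^{-1}\Delta\bar W_i\,\bar Y_{t_{i+1}}\bigr],$$ $$\bar X_{t_{i+1}}=\bar X_{t_i}+h_i\,b(\bar X_{t_i},\bar Y_{t_i},[\bar X_{t_i},\bar Y_{t_i}])+\sigma(\bar X_{t_i},[\bar X_{t_i}])\Delta\bar W_i .$$ **Lemma.** There are constants $\Lambda'\ge0$ and $c_0>0$ depending only on $(d,\Lambda,\alpha)$ such that, in every setting as above, there are a constant $C$ and functions $\mathcal D^1,\mathcal D^2:[0,\infty)\to[0,\infty)$, independent of $N,\pi,\Gamma,k,\bar{\mathfrak X},\eta$, with $\lim_{h\downarrow0}\mathcal D^i(h)=0$ and $\mathcal D^i(h)\le C\sqrt h$ for all $h\ge 0$, such that whenever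 $\delta\le c_0$ every output of the scheme satisfies $$\textbf{(A1)}\quad \max_{t\in\pi,\,r_k\le t\le r_{k+1}}\|\mathcal U(t,\bar X_t,[\bar X_t])-\bar Y_t\|_{2\alpha}\le e^{\Lambda'\delta}\,\|\mathcal U(r_{k+1},\bar X_{r_{k+1}},[\bar X_{r_{k+1}}])-\bar Y_{r_{k+1}}\|_{2\alpha}+\Lambda'\max_{j_k\le i<j_{k+1}}\|\bar X_{t_i}-\bar{\mathfrak X}_{t_i}\|_{2\alpha}+\mathcal D^1(|\pi|)+\mathcal D^2(|\pi|)\bigl(1+\|\xi\|_{2\alpha}^{\alpha}\bigr).$$ -/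

import Mathlib

open MeasureTheory ProbabilityTheory Filter Topology Set
open scoped NNReal ENNReal InnerProductSpace

namespace MKV

noncomputable section

/-- The state space `ℝ^d` with its Euclidean norm. -/
abbrev St (d : ℕ) : Type := EuclideanSpace ℝ (Fin d)

/-! ### Probability measures with a finite second moment and the Wasserstein distance -/

/-- `μ` is a probability measure with a finite second moment. -/
def IsP2 {X : Type*} [NormedAddCommGroup X] [MeasurableSpace X] (μ : Measure X) : Prop :=
  IsProbabilityMeasure μ ∧ MemLp id 2 μ

/-- Optimal transport cost between `μ` and `ν` for the cost function `c`. -/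
def transportCost {X : Type*} [MeasurableSpace X] (c : X → X → ℝ≥0∞) (μ ν : Measure X) : ℝ≥0∞ :=
  ⨅ γ : {γ : Measure (X × X) // γ.map Prod.fst = μ ∧ γ.map Prod.snd = ν},
    ∫⁻ p, c p.1 p.2 ∂γ.1

/-- The 2-Wasserstein distance on `P₂(ℝ^d)`. -/
def W2 {d : ℕ} (μ ν : Measure (St d)) : ℝ :=
  ((transportCost (fun x x' => ‖x - x'‖ₑ ^ 2) μ ν) ^ (1 / 2 : ℝ)).toReal

/-- The 2-Wasserstein distance on `P₂(ℝ^d × ℝ)`, where `ℝ^d × ℝ = ℝ^(d+1)` carries the Euclidean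
distance. -/
def W2joint {d : ℕ} (μ ν : Measure (St d × ℝ)) : ℝ :=
  ((transportCost (fun p p' => ‖p.1 - p'.1‖ₑ ^ 2 + ‖p.2 - p'.2‖ₑ ^ 2) μ ν) ^ (1 / 2 : ℝ)).toReal

/-- `‖ξ‖₂` for any `ξ ∼ μ`. -/
def l2norm {d : ℕ} (μ : Measure (St d)) : ℝ := (eLpNorm id 2 μ).toReal

/-- Neighbourhood filter of `μ` in `(P₂(ℝ^d), W₂)`. -/
def nhdsP2 {d : ℕ} (μ : Measure (St d)) : Filter (Measure (St d)) :=
  ⨅ ε : {ε : ℝ // 0 < ε}, 𝓟 {ν | IsP2 ν ∧ W2 μ ν < ε}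

/-! ### Coefficients and the master equation -/

/-- The coefficients `b, σ, f, g` of the McKean-Vlasov forward-backward system.  They are only ever
constrained and used at measures in `P₂`. -/
structure Coeffs (d : ℕ) where
  b : St d → ℝ → Measure (St d × ℝ) → St d
  σ : St d → Measure (St d) → (St d →L[ℝ] St d)
  f : St d → ℝ → St d → Measure (St d × ℝ) → ℝ
  g : St d → Measure (St d) → ℝ

/-- `σ†`. -/
def Coeffs.σadj {d : ℕ} (c : Coeffs d) (x : St d) (μ : Measure (St d)) : St d →L[ℝ] St d :=
  ContinuousLinearMap.adjoint (c.σ x μ)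

/-- `a = σ σ†`. -/
def Coeffs.a {d : ℕ} (c : Coeffs d) (x : St d) (μ : Measure (St d)) : St d →L[ℝ] St d :=
  c.σ x μ ∘L c.σadj x μ

/-- Assumption (H0): the coefficients are `Λ`-Lipschitz in all the variables, and `σ` is bounded
by `Λ`. -/
structure H0 {d : ℕ} (Λ : ℝ) (c : Coeffs d) : Prop where
  lip_b : ∀ x x' y y' ν ν', IsP2 ν → IsP2 ν' →
    ‖c.b x y ν - c.b x' y' ν'‖ ≤ Λ * (‖x - x'‖ + |y - y'| + W2joint ν ν')
  lip_σ : ∀ x x' μ μ', IsP2 μ → IsP2 μ' →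
    ‖c.σ x μ - c.σ x' μ'‖ ≤ Λ * (‖x - x'‖ + W2 μ μ')
  lip_f : ∀ x x' y y' z z' ν ν', IsP2 ν → IsP2 ν' →
    |c.f x y z ν - c.f x' y' z' ν'| ≤ Λ * (‖x - x'‖ + |y - y'| + ‖z - z'‖ + W2joint ν ν')
  lip_g : ∀ x x' μ μ', IsP2 μ → IsP2 μ' →
    |c.g x μ - c.g x' μ'| ≤ Λ * (‖x - x'‖ + W2 μ μ')
  bound_σ : ∀ x μ, IsP2 μ → ‖c.σ x μ‖ ≤ Λ

/-- A function `U(t, x, μ)` together with candidates for its derivatives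
`∂ₜU`, `∂ₓU`, `∂²ₓₓU`, `∂_μ U(t, x, μ)(v)`, `∂ᵥ∂_μ U(t, x, μ)(v)`. -/
structure MasterField (d : ℕ) where
  U : ℝ → St d → Measure (St d) → ℝ
  dt : ℝ → St d → Measure (St d) → ℝ
  dx : ℝ → St d → Measure (St d) → St d
  dxx : ℝ → St d → Measure (St d) → (St d →L[ℝ] St d)
  dμ : ℝ → St d → Measure (St d) → St d → St d
  dvdμ : ℝ → St d → Measure (St d) → St d → (St d →L[ℝ] St d)

/-- Lions differentiability.  The lift `X ↦ V([X])` is Fréchet differentiable on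
`L²(Ω₀, P₀; ℝ^d)`, and its gradient at `X` is `D([X])(X)`. -/
def HasLionsDeriv {d : ℕ} {Ω₀ : Type*} {m₀ : MeasurableSpace Ω₀} (P₀ : Measure Ω₀)
    (V : Measure (St d) → ℝ) (D : Measure (St d) → St d → St d) : Prop :=
  ∀ X : Lp (St d) 2 P₀, ∃ G : Lp (St d) 2 P₀,
    (∀ᵐ ω ∂P₀, G ω = D (P₀.map X) (X ω)) ∧
    HasGradientAt (fun X' : Lp (St d) 2 P₀ => V (P₀.map X')) G X

/-- The trace of an endomorphism of `ℝ^d`. -/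
def tr {d : ℕ} (A : St d →L[ℝ] St d) : ℝ := LinearMap.trace ℝ (St d) A.toLinearMap

/-- The image `ν` of `μ` by `x ↦ (x, U(t, x, μ))`. -/
def MasterField.graphLaw {d : ℕ} (u : MasterField d) (t : ℝ) (μ : Measure (St d)) : Measure (St d × ℝ) :=
  μ.map (fun x => (x, u.U t x μ))

/-- `U` is a classical solution of the master equation on `[0, T]`; `P₀` is the probability
measure that carries the lift. -/
structure IsClassicalSolution {d : ℕ} {Ω₀ : Type*} {m₀ : MeasurableSpace Ω₀} (P₀ : Measure Ω₀)
    (T : ℝ) (c : Coeffs d) (u : MasterField d) : Prop where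
  hasDeriv_t : ∀ t ∈ Ico 0 T, ∀ x μ, IsP2 μ →
    HasDerivWithinAt (fun s => u.U s x μ) (u.dt t x μ) (Icc 0 T) t
  hasGradient_x : ∀ t ∈ Icc 0 T, ∀ x μ, IsP2 μ →
    HasGradientAt (fun y => u.U t y μ) (u.dx t x μ) x
  hasFDeriv_dx : ∀ t ∈ Icc 0 T, ∀ x μ, IsP2 μ →
    HasFDerivAt (fun y => u.dx t y μ) (u.dxx t x μ) x
  hasLionsDeriv : ∀ t ∈ Icc 0 T, ∀ x, HasLionsDeriv P₀ (u.U t x) (u.dμ t x)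
  hasFDeriv_dμ : ∀ t ∈ Icc 0 T, ∀ x μ v, IsP2 μ →
    HasFDerivAt (u.dμ t x μ) (u.dvdμ t x μ v) v
  cont_dt : ∀ t ∈ Ico 0 T, ∀ x μ, IsP2 μ →
    Tendsto (fun q : ℝ × St d × Measure (St d) => u.dt q.1 q.2.1 q.2.2)
      (𝓝[Ico 0 T] t ×ˢ 𝓝 x ×ˢ nhdsP2 μ) (𝓝 (u.dt t x μ))
  cont_dx : ∀ t ∈ Icc 0 T, ∀ x μ, IsP2 μ →
    Tendsto (fun q : ℝ × St d × Measure (St d) => u.dx q.1 q.2.1 q.2.2)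
      (𝓝[Icc 0 T] t ×ˢ 𝓝 x ×ˢ nhdsP2 μ) (𝓝 (u.dx t x μ))
  cont_dxx : ∀ t ∈ Icc 0 T, ∀ x μ, IsP2 μ →
    Tendsto (fun q : ℝ × St d × Measure (St d) => u.dxx q.1 q.2.1 q.2.2)
      (𝓝[Icc 0 T] t ×ˢ 𝓝 x ×ˢ nhdsP2 μ) (𝓝 (u.dxx t x μ))
  cont_dμ : ∀ t ∈ Icc 0 T, ∀ x μ, IsP2 μ → ∀ v ∈ μ.support,
    Tendsto (fun q : ℝ × St d × Measure (St d) × St d => u.dμ q.1 q.2.1 q.2.2.1 q.2.2.2)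
      (𝓝[Icc 0 T] t ×ˢ 𝓝 x ×ˢ nhdsP2 μ ×ˢ 𝓝 v) (𝓝 (u.dμ t x μ v))
  cont_dvdμ : ∀ t ∈ Icc 0 T, ∀ x μ, IsP2 μ → ∀ v ∈ μ.support,
    Tendsto (fun q : ℝ × St d × Measure (St d) × St d => u.dvdμ q.1 q.2.1 q.2.2.1 q.2.2.2)
      (𝓝[Icc 0 T] t ×ˢ 𝓝 x ×ˢ nhdsP2 μ ×ˢ 𝓝 v) (𝓝 (u.dvdμ t x μ v))
  master_eq : ∀ t ∈ Ico 0 T, ∀ x μ, IsP2 μ →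
    u.dt t x μ
      + ⟪c.b x (u.U t x μ) (u.graphLaw t μ), u.dx t x μ⟫_ℝ
      + 1 / 2 * tr (u.dxx t x μ ∘L c.a x μ)
      + c.f x (u.U t x μ) (c.σadj x μ (u.dx t x μ)) (u.graphLaw t μ)
      + ∫ v, ⟪u.dμ t x μ v, c.b v (u.U t v μ) (u.graphLaw t μ)⟫_ℝ ∂μ
      + ∫ v, 1 / 2 * tr (u.dvdμ t x μ v ∘L c.a v μ) ∂μ = 0
  terminal : ∀ x μ, IsP2 μ → u.U T x μ = c.g x μ

/-- Assumption (H1), without the solvability of the forward-backward system: `U` is a classical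
solution of the master equation, with the quantitative bounds on its derivatives. -/
structure H1 {d : ℕ} {Ω₀ : Type*} {m₀ : MeasurableSpace Ω₀} (P₀ : Measure Ω₀)
    (T Λ α : ℝ) (c : Coeffs d) (u : MasterField d) : Prop where
  classical : IsClassicalSolution P₀ T c u
  lip_measure : ∀ t ∈ Icc 0 T, ∀ x μ μ', IsP2 μ → IsP2 μ' →
    |u.U t x μ - u.U t x μ'| + ‖u.dx t x μ - u.dx t x μ'‖ ≤ Λ * W2 μ μ'
  bound_first : ∀ t ∈ Icc 0 T, ∀ x μ, IsP2 μ →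
    ‖u.dx t x μ‖ₑ + eLpNorm (u.dμ t x μ) 2 μ ≤ ENNReal.ofReal Λ
  bound_second : ∀ t ∈ Icc 0 T, ∀ x μ, IsP2 μ →
    ‖u.dxx t x μ‖ₑ + eLpNorm (u.dvdμ t x μ) 2 μ ≤ ENNReal.ofReal Λ
  lip_dxx : ∀ t ∈ Icc 0 T, ∀ x x' μ, IsP2 μ →
    ‖u.dxx t x μ - u.dxx t x' μ‖ ≤ Λ * ‖x - x'‖
  holder_time : ∀ h ∈ Ico 0 T, ∀ t ∈ Icc 0 (T - h), ∀ x μ, IsP2 μ →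
    |u.U (t + h) x μ - u.U t x μ| + ‖u.dx (t + h) x μ - u.dx t x μ‖
      ≤ Λ * √h * (1 + ‖x‖ + l2norm μ)
  lip_dvdμ : ∀ t ∈ Icc 0 T, ∀ x μ v v', IsP2 μ →
    ‖u.dvdμ t x μ v - u.dvdμ t x μ v'‖
      ≤ Λ * (1 + ‖v‖ ^ (2 * α) + ‖v'‖ ^ (2 * α) + l2norm μ ^ (2 * α)) ^ (1 / 2 : ℝ) * ‖v - v'‖

/-! ### The filtered probability space -/

/-- The probability space `(Ω, m₀, P)` has no atom. -/
def Atomless {Ω : Type*} (m₀ : MeasurableSpace Ω) (P : @Measure Ω m₀) : Prop :=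
  ∀ A, MeasurableSet[m₀] A → 0 < P A → ∃ B ⊆ A, MeasurableSet[m₀] B ∧ 0 < P B ∧ P B < P A

/-- `W` is a `d`-dimensional Brownian motion on `[0, T]` for the filtration `F`. -/
structure IsBrownianMotion {d : ℕ} {Ω : Type*} {mΩ : MeasurableSpace Ω} (P : Measure Ω)
    (F : Filtration ℝ mΩ) (T : ℝ) (W : ℝ → Ω → St d) : Prop where
  adapted : ∀ t ∈ Icc 0 T, Measurable[F t] (W t)
  zero : ∀ᵐ ω ∂P, W 0 ω = 0
  continuous : ∀ᵐ ω ∂P, ContinuousOn (fun t => W t ω) (Icc 0 T)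
  indep : ∀ s ∈ Icc 0 T, ∀ t ∈ Icc 0 T, s < t →
    Indep (MeasurableSpace.comap (fun ω => W t ω - W s ω) inferInstance) (F s) P
  gaussian : ∀ s ∈ Icc 0 T, ∀ t ∈ Icc 0 T, s < t →
    P.map (fun ω => (√(t - s))⁻¹ • (W t ω - W s ω)) = stdGaussian (St d)

/-! ### Grids and the tree scheme -/

/-- A grid `0 = t₀ < ⋯ < tₙ = T` that contains the equidistant grid `r_k = k T / N`, `k ≤ N`;
`j k` is the index of `r_k`. -/
structure TimeGrid (T : ℝ) (N : ℕ) where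
  n : ℕ
  t : ℕ → ℝ
  j : ℕ → ℕ
  t_zero : t 0 = 0
  t_last : t n = T
  t_strictMono : ∀ i < n, t i < t (i + 1)
  j_le : ∀ k ≤ N, j k ≤ n
  t_j : ∀ k ≤ N, t (j k) = k * (T / N)

/-- The step `h_i = t_{i+1} - t_i`. -/
def TimeGrid.h {T : ℝ} {N : ℕ} (π : TimeGrid T N) (i : ℕ) : ℝ := π.t (i + 1) - π.t i

/-- The mesh `|π| = max_{i < n} h_i`. -/
def TimeGrid.mesh {T : ℝ} {N : ℕ} (π : TimeGrid T N) : ℝ≥0 :=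
  (Finset.range π.n).sup fun i => (π.h i).toNNReal

/-- The quantisation map `Γ_d`: finitely many values, bounded by `Λ`, and the image of the standard
Gaussian law is centred with the identity as covariance matrix. -/
structure IsQuantiser {d : ℕ} (Λ : ℝ) (Γ : St d → St d) : Prop where
  measurable : Measurable Γ
  finite_range : (range Γ).Finite
  bounded : ∀ w, ‖Γ w‖ ≤ Λ
  centred : ∫ w, Γ w ∂(stdGaussian (St d)) = 0
  covariance : ∀ p q : Fin d,
    ∫ w, Γ w p * Γ w q ∂(stdGaussian (St d)) = if p = q then 1 else 0

/-- `ΔW̄_i = h_i^{1/2} Γ_d(h_i^{-1/2} (W_{t_{i+1}} - W_{t_i}))`. -/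
def quantisedIncrement {d : ℕ} {Ω : Type*} {T : ℝ} {N : ℕ} (π : TimeGrid T N)
    (W : ℝ → Ω → St d) (Γ : St d → St d) (i : ℕ) (ω : Ω) : St d :=
  √(π.h i) • Γ ((√(π.h i))⁻¹ • (W (π.t (i + 1)) ω - W (π.t i) ω))

/-- The discrete input of the solver at level `k`: an adapted square-integrable process on `π^k`
(indexed by `i ∈ [j_k, j_{k+1}]`) and a square-integrable terminal value. -/
structure IsInput {d : ℕ} {Ω : Type*} {mΩ : MeasurableSpace Ω} (P : Measure Ω)
    (F : Filtration ℝ mΩ) {T : ℝ} {N : ℕ} (π : TimeGrid T N) (k : ℕ)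
    (Xin : ℕ → Ω → St d) (η : Ω → ℝ) : Prop where
  adapted : ∀ i ∈ Finset.Icc (π.j k) (π.j (k + 1)), Measurable[F (π.t i)] (Xin i)
  memLp : ∀ i ∈ Finset.Icc (π.j k) (π.j (k + 1)), MemLp (Xin i) 2 P
  adapted_terminal : Measurable[F (π.t (π.j (k + 1)))] η
  memLp_terminal : MemLp η 2 P

/-- `(X, Y, Z)` is an output of the tree scheme on `π^k` for the input `(Xin, η)` and the
driver `c.f`. -/
structure IsTreeScheme {d : ℕ} {Ω : Type*} {mΩ : MeasurableSpace Ω} (P : Measure Ω)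
    (F : Filtration ℝ mΩ) (W : ℝ → Ω → St d) (c : Coeffs d) {T : ℝ} {N : ℕ} (π : TimeGrid T N)
    (Γ : St d → St d) (k : ℕ) (Xin : ℕ → Ω → St d) (η : Ω → ℝ)
    (X : ℕ → Ω → St d) (Y : ℕ → Ω → ℝ) (Z : ℕ → Ω → St d) : Prop where
  adapted_X : ∀ i ∈ Finset.Icc (π.j k) (π.j (k + 1)), Measurable[F (π.t i)] (X i)
  adapted_Y : ∀ i ∈ Finset.Icc (π.j k) (π.j (k + 1)), Measurable[F (π.t i)] (Y i)
  adapted_Z : ∀ i ∈ Finset.Icc (π.j k) (π.j (k + 1)), Measurable[F (π.t i)] (Z i)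
  memLp_X : ∀ i ∈ Finset.Icc (π.j k) (π.j (k + 1)), MemLp (X i) 2 P
  memLp_Y : ∀ i ∈ Finset.Icc (π.j k) (π.j (k + 1)), MemLp (Y i) 2 P
  memLp_Z : ∀ i ∈ Finset.Icc (π.j k) (π.j (k + 1)), MemLp (Z i) 2 P
  terminal_Y : Y (π.j (k + 1)) =ᵐ[P] η
  terminal_Z : Z (π.j (k + 1)) =ᵐ[P] 0
  step_Y : ∀ i ∈ Finset.Ico (π.j k) (π.j (k + 1)),
    Y i =ᵐ[P] P[fun ω => Y (i + 1) ω
      + π.h i * c.f (Xin i ω) (Y i ω) (Z i ω) (P.map fun ω' => (Xin i ω', Y i ω'))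
      | F (π.t i)]
  step_Z : ∀ i ∈ Finset.Ico (π.j k) (π.j (k + 1)),
    Z i =ᵐ[P] P[fun ω => (Y (i + 1) ω / π.h i) • quantisedIncrement π W Γ i ω | F (π.t i)]
  initial_X : X (π.j k) =ᵐ[P] Xin (π.j k)
  step_X : ∀ i ∈ Finset.Ico (π.j k) (π.j (k + 1)),
    X (i + 1) =ᵐ[P] fun ω => X i ω
      + π.h i • c.b (X i ω) (Y i ω) (P.map fun ω' => (X i ω', Y i ω'))
      + c.σ (X i ω) (P.map (X i)) (quantisedIncrement π W Γ i ω)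

/-- `‖U(t_i, X_i, [X_i]) - Y_i‖_{2α}`. -/
def fieldError {d : ℕ} {Ω : Type*} {mΩ : MeasurableSpace Ω} (P : Measure Ω) (α : ℝ)
    (u : MasterField d) {T : ℝ} {N : ℕ} (π : TimeGrid T N)
    (X : ℕ → Ω → St d) (Y : ℕ → Ω → ℝ) (i : ℕ) : ℝ≥0∞ :=
  eLpNorm (fun ω => u.U (π.t i) (X i ω) (P.map (X i)) - Y i ω) (ENNReal.ofReal (2 * α)) P

/-- The inequality of condition (A1) at level `k`, with constant `Λ'` and discretisation errors
`D¹`, `D²`.  Norms that are infinite are allowed. -/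
def A1Inequality {d : ℕ} {Ω : Type*} {mΩ : MeasurableSpace Ω} (P : Measure Ω) (α Λ' : ℝ)
    (D1 D2 : ℝ≥0 → ℝ≥0) (u : MasterField d) {T : ℝ} {N : ℕ} (π : TimeGrid T N) (k : ℕ)
    (Xin X : ℕ → Ω → St d) (Y : ℕ → Ω → ℝ) : Prop :=
  (⨆ i ∈ Finset.Icc (π.j k) (π.j (k + 1)), fieldError P α u π X Y i)
    ≤ ENNReal.ofReal (Real.exp (Λ' * (T / N))) * fieldError P α u π X Y (π.j (k + 1))
      + ENNReal.ofReal Λ' * (⨆ i ∈ Finset.Ico (π.j k) (π.j (k + 1)),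
          eLpNorm (fun ω => X i ω - Xin i ω) (ENNReal.ofReal (2 * α)) P)
      + D1 π.mesh
      + D2 π.mesh * (1 + eLpNorm (Xin (π.j k)) (ENNReal.ofReal (2 * α)) P ^ α)

end

end MKV

open MKV

/-! Write `e_i = U(t_i, X_i, [X_i]) - Y_i`. The estimate is a discrete Gronwall argument for a
backward recursion satisfied by `e_i`. Given the information at `t_i`, the conditional mean of
`U(t_{i+1}, X_{i+1}, [X_{i+1}])` is `U(t_i, X_i, [X_i]) - h f + defect`, with `f` evaluated on the
graph of `U`: the master equation removes all the other terms of order `h`. Subtracting the scheme,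
`e_i` is the conditional mean of `e_{i+1}`, minus the defect, plus `h` times a difference of drivers
(`IsBackwardStep.err_eq`).

Size of the defect. The step is joined to its start by the path `X + r² B + r Θ` at time `t + r²`,
with `r` the square root of the elapsed time. The Lions derivative is defined on one atomless space,
but it only sees laws, so the chain rule can be transferred to any probability space
(`HasLionsDeriv.hasDerivAt_quadratic`, `Setting.hasDerivWithinAt_path`). With moments of order `2α`
this gives a defect of order `h (|e| + ‖e‖₂ + √h (|X| + M^α))`, where `M` bounds `K` and the
`2α`-norms of `X` and `e` (`IsStep.abs_defect_le_fine`); the error enters because the drift of the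
scheme uses `Y` and not `U`. With second moments alone one still gets order `h`, linearly in the
moments (`IsStep.abs_defect_le_crude`). The delicate point there is that a centred perturbation of
size `ρ` of the measure changes `U` by `O(ρ²)` although `∂_v ∂_μ U` is only bounded in `L²(μ)`; a
randomised dyadic scaling of the perturbation proves it (`Setting.abs_U_centred_sub_le`).

Backward recursion. The error on `Z` contains the correlation of `e_{i+1}` with the noise, which is
bounded by the conditional standard deviation. After multiplication by `h` it has size `√h` times
this deviation, too large for a recursion on `|e|` but harmless for `e²`, since squared mean plus
variance is the conditional second moment (`IsBackwardStep.sq_err_le`). As conditional expectation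
contracts `L^α`, the recursion passes to `‖e‖_{2α}²`.

Closing the estimate. The state depends on `Y`, and the defect on the moments of the state.
Finiteness of the moments of order `2α` comes from propagating backwards a bound of `e²` by a small
multiple of `|X|²` plus a remainder (`IsRun.exists_quadratic_bound`); forward moments are then at
most a multiple of `K + ‖ξ‖ + max ‖e‖` (`IsRun.lpNorm_X_le`). Since the fine defect is superlinear
in these moments, there are two regimes. If `max ‖e‖ ≤ K + ‖ξ‖`, the fine defect gives the
discretisation error `C √|π| (1 + ‖ξ‖^α)`. Otherwise every remainder is at most a multiple of `max
‖e‖`, and the crude defect produces a term `C δ max ‖e‖²`, absorbed when `δ` is small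
(`IsRun.lpNorm_err_le`). One may thus take `D¹ = 0` and `D²(h) = C √h`. -/

namespace MKV

/-! ### Random variables of any law on an atomless probability space -/

section AtomlessSpace

variable {Ω : Type*} [mΩ : MeasurableSpace Ω] {P : Measure Ω} [IsProbabilityMeasure P]

/-- Cut a set in two pieces of positive measure: one of them has at most half of the measure.
Iterate. -/
lemma Atomless.exists_small (h : Atomless mΩ P) {A : Set Ω} (hA : MeasurableSet A)
    (hpos : 0 < P.real A) {ε : ℝ} (hε : 0 < ε) :
    ∃ B ⊆ A, MeasurableSet B ∧ 0 < P.real B ∧ P.real B < ε := by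
  have half : ∀ C, MeasurableSet C → 0 < P.real C →
      ∃ B ⊆ C, MeasurableSet B ∧ 0 < P.real B ∧ P.real B ≤ P.real C / 2 := by
    intro C hC hCpos
    obtain ⟨B, hBC, hB, hB0, hB1⟩ := h C hC (by
      rw [measureReal_def] at hCpos; exact (ENNReal.toReal_pos_iff.1 hCpos).1)
    have hB0' : 0 < P.real B := ENNReal.toReal_pos hB0.ne' (measure_ne_top _ _)
    have hB1' : P.real B < P.real C := (ENNReal.toReal_lt_toReal (measure_ne_top _ _)
      (measure_ne_top _ _)).2 hB1
    have hd : P.real (C \ B) = P.real C - P.real B := measureReal_sdiff hBC hB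
    by_cases hc : P.real B ≤ P.real C / 2
    · exact ⟨B, hBC, hB, hB0', hc⟩
    · exact ⟨C \ B, sdiff_subset, hC.diff hB, by linarith, by linarith⟩
  have iter : ∀ n : ℕ, ∃ B ⊆ A, MeasurableSet B ∧ 0 < P.real B ∧ P.real B ≤ (1 / 2) ^ n := by
    intro n
    induction n with
    | zero => exact ⟨A, subset_rfl, hA, hpos, by simp⟩
    | succ n ih =>
      obtain ⟨B, hBA, hB, hB0, hB1⟩ := ih
      obtain ⟨C, hCB, hC, hC0, hC1⟩ := half B hB hB0
      exact ⟨C, hCB.trans hBA, hC, hC0, by rw [pow_succ]; linarith⟩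
  obtain ⟨n, hn⟩ := exists_pow_lt_of_lt_one hε (by norm_num : (1 / 2 : ℝ) < 1)
  obtain ⟨B, hBA, hB, hB0, hB1⟩ := iter n
  exact ⟨B, hBA, hB, hB0, hB1.trans_lt hn⟩

/-- Sierpiński's theorem: the measure takes every value between those of two nested sets. -/
lemma Atomless.exists_between (h : Atomless mΩ P) {A C : Set Ω} (hA : MeasurableSet A)
    (hC : MeasurableSet C) (hAC : A ⊆ C) {r : ℝ} (hr : P.real A ≤ r) (hr' : r ≤ P.real C) :
    ∃ B, A ⊆ B ∧ B ⊆ C ∧ MeasurableSet B ∧ P.real B = r := by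
  classical
  let T := {B : Set Ω // MeasurableSet B ∧ A ⊆ B ∧ B ⊆ C ∧ P.real B ≤ r}
  -- Greedy exhaustion: `s B` is the largest measure attainable above `B` without exceeding `r`, and
  -- the next set goes at least halfway to it.
  let s : T → ℝ := fun B => sSup ((fun D : T => P.real D.1) '' {D : T | B.1 ⊆ D.1})
  have hbdd : ∀ B : T, BddAbove ((fun D : T => P.real D.1) '' {D : T | B.1 ⊆ D.1}) :=
    fun B => ⟨1, by rintro _ ⟨D, -, rfl⟩; exact measureReal_le_one⟩
  have hstep : ∀ B : T, ∃ D : T, B.1 ⊆ D.1 ∧ (P.real B.1 + s B) / 2 ≤ P.real D.1 := by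
    intro B
    rcases (le_csSup (hbdd B) ⟨B, subset_refl B.1, rfl⟩ : P.real B.1 ≤ s B).eq_or_lt with he | hl
    · exact ⟨B, subset_rfl, by linarith⟩
    · obtain ⟨_, ⟨D, hD, rfl⟩, hlt⟩ := exists_lt_of_lt_csSup
        (s := (fun D : T => P.real D.1) '' {D : T | B.1 ⊆ D.1}) ⟨_, B, subset_refl B.1, rfl⟩
        (show (P.real B.1 + s B) / 2 < s B by linarith)
      exact ⟨D, hD, hlt.le⟩
  choose nxt hnxt1 hnxt2 using hstep
  let B : ℕ → T := fun n => nxt^[n] ⟨A, hA, subset_rfl, hAC, hr⟩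
  have hBs : ∀ n, B (n + 1) = nxt (B n) := fun n => Function.iterate_succ_apply' _ _ _
  have hmono : Monotone fun n => (B n).1 :=
    monotone_nat_of_le_succ fun n => by rw [hBs]; exact hnxt1 _
  let U : Set Ω := ⋃ n, (B n).1
  have hU : MeasurableSet U := MeasurableSet.iUnion fun n => (B n).2.1
  have hlim : Tendsto (fun n => P.real (B n).1) atTop (𝓝 (P.real U)) :=
    (ENNReal.tendsto_toReal (measure_ne_top _ _)).comp (tendsto_measure_iUnion_atTop hmono)
  have hUr : P.real U ≤ r := le_of_tendsto' hlim fun n => (B n).2.2.2.2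
  have hAU : A ⊆ U := (B 0).2.2.1.trans (subset_iUnion (fun n => (B n).1) 0)
  have hUC : U ⊆ C := iUnion_subset fun n => (B n).2.2.2.1
  refine ⟨U, hAU, hUC, hU, le_antisymm hUr (not_lt.1 fun hlt => ?_)⟩
  have hd : P.real (C \ U) = P.real C - P.real U := measureReal_sdiff hUC hU
  -- If the union fell short of `r`, the same set `E` could be added at every stage, and the halfway
  -- rule would give `P(U) ≥ P(U) + P(E) / 2` in the limit.
  obtain ⟨E, hEC, hE, hE0, hE1⟩ := h.exists_small (hC.diff hU) (by linarith)
    (show 0 < r - P.real U by linarith)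
  have hdisj : Disjoint U E := disjoint_left.2 fun x hx hx' => (hEC hx').2 hx
  have hUE : P.real (U ∪ E) = P.real U + P.real E := measureReal_union hdisj hE
  let D : T := ⟨U ∪ E, hU.union hE, hAU.trans subset_union_left,
    union_subset hUC (hEC.trans sdiff_subset), by rw [hUE]; linarith⟩
  have hs : ∀ n, P.real U + P.real E ≤ s (B n) := fun n => by
    rw [← hUE]
    exact le_csSup (hbdd _) ⟨D, (subset_iUnion (fun n => (B n).1) n).trans subset_union_left, rfl⟩
  have h1 : P.real U ≥ (P.real U + (P.real U + P.real E)) / 2 := by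
    refine le_of_tendsto_of_tendsto' ((hlim.add_const _).div_const 2)
      (hlim.comp (tendsto_add_atTop_nat 1)) fun n => ?_
    have h2 := hnxt2 (B n)
    have h3 := hs n
    simp only [Function.comp_apply, hBs]
    linarith
  linarith

/-- A measurable set of measure `k / 2^n` for every `n` and `k ≤ 2^n`, nested. -/
lemma Atomless.exists_dyadic_chain (h : Atomless mΩ P) :
    ∃ S : ℕ → ℕ → Set Ω, (∀ n k, MeasurableSet (S n k)) ∧ (∀ n, Monotone (S n)) ∧
      (∀ n k, P.real (S n k) = min (k / 2 ^ n : ℝ) 1) ∧ ∀ n k, S (n + 1) (2 * k) = S n k := by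
  classical
  let T : ℕ → Type _ := fun n => {S : ℕ → Set Ω // (∀ k, MeasurableSet (S k)) ∧ Monotone S ∧
    ∀ k : ℕ, P.real (S k) = min (k / 2 ^ n : ℝ) 1}
  have hstep : ∀ n, ∀ S : T n, ∃ S' : T (n + 1), ∀ k, S'.1 (2 * k) = S.1 k := by
    rintro n ⟨S, hS, hm, hP⟩
    -- Each refinement keeps the old sets at even indices and inserts one of intermediate measure at
    -- odd indices. Past index `2 ^ n` the sets have full measure, hence the truncation at 1.
    have hmid : ∀ k : ℕ, ∃ B, S k ⊆ B ∧ B ⊆ S (k + 1) ∧ MeasurableSet B ∧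
        P.real B = min ((2 * k + 1 : ℕ) / 2 ^ (n + 1) : ℝ) 1 := by
      intro k
      have hp : (0 : ℝ) < 2 ^ n := by positivity
      refine h.exists_between (hS k) (hS _) (hm k.le_succ) ?_ ?_
      · rw [hP]
        gcongr ?_ ⊓ _
        rw [div_le_div_iff₀ hp (by positivity), pow_succ]; push_cast; nlinarith
      · rw [hP]
        gcongr ?_ ⊓ _
        rw [div_le_div_iff₀ (by positivity) hp, pow_succ]; push_cast; nlinarith
    choose M hM1 hM2 hM3 hM4 using hmid
    refine ⟨⟨fun k => if Even k then S (k / 2) else M (k / 2), fun k => ?_, ?_, fun k => ?_⟩,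
      fun k => by simp⟩
    · dsimp only; split_ifs
      exacts [hS _, hM3 _]
    · refine monotone_nat_of_le_succ fun k => ?_
      rcases Nat.even_or_odd' k with ⟨j, rfl | rfl⟩
      · have h1 : ¬ Even (2 * j + 1) := by simp
        have h2 : (2 * j + 1) / 2 = j := by omega
        simpa [h1, h2] using hM1 j
      · have h1 : ¬ Even (2 * j + 1) := by simp
        have h2 : (2 * j + 1) / 2 = j := by omega
        have h3 : Even (2 * j + 1 + 1) := ⟨j + 1, by omega⟩
        have h4 : (2 * j + 1 + 1) / 2 = j + 1 := by omega
        simpa only [if_neg h1, if_pos h3, h2, h4] using hM2 j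
    · rcases Nat.even_or_odd' k with ⟨j, rfl | rfl⟩
      · simp [hP, pow_succ, mul_comm (2 : ℝ), mul_div_mul_right]
      · have h1 : ¬ Even (2 * j + 1) := by simp
        have h2 : (2 * j + 1) / 2 = j := by omega
        simpa only [if_neg h1, h2] using hM4 j
  choose nxt hnxt using hstep
  let S0 : T 0 := ⟨fun k => if k = 0 then ∅ else univ, fun k => by dsimp only; split_ifs <;> simp, by
    refine monotone_nat_of_le_succ fun k => by simp, fun k => by
      rcases k with _ | k
      · simp
      · simp⟩
  let S : ∀ n, T n := fun n => Nat.rec S0 (fun n Sn => nxt n Sn) n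
  exact ⟨fun n => (S n).1, fun n => (S n).2.1, fun n => (S n).2.2.1, fun n => (S n).2.2.2,
    fun n k => hnxt n (S n) k⟩

/-- An atomless probability space carries a uniform random variable. -/
lemma Atomless.exists_uniform (h : Atomless mΩ P) :
    ∃ U : Ω → unitInterval, Measurable U ∧ P.map U = volume := by
  obtain ⟨S, hS, hmono, hP, hcons⟩ := h.exists_dyadic_chain
  have hcons' : ∀ m n k, S (n + m) (2 ^ m * k) = S n k := by
    intro m
    induction m with
    | zero => simp
    | succ m ih => intro n k; rw [← add_assoc, pow_succ', mul_assoc, hcons, ih]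
  have hnest : ∀ n k n' k' : ℕ, (k / 2 ^ n : ℝ) ≤ k' / 2 ^ n' → S n k ⊆ S n' k' := by
    intro n k n' k' hle
    rw [← hcons' n' n k, ← hcons' n n' k', add_comm n n']
    refine hmono _ ?_
    rw [div_le_div_iff₀ (by positivity) (by positivity)] at hle
    have : (k * 2 ^ n' : ℕ) ≤ k' * 2 ^ n := by exact_mod_cast hle
    linarith
  -- The infimum of the dyadic levels whose set contains `ω`; the value 1 keeps the family nonempty.
  -- For `t ≤ 1` the event `V < t` is a union of sets of the chain, which forces its measure to be
  -- `t`.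
  let V : Ω → ℝ := fun ω => sInf {x | x = 1 ∨ ∃ n k : ℕ, ω ∈ S n k ∧ x = k / 2 ^ n}
  have hbdd : ∀ ω, BddBelow {x : ℝ | x = 1 ∨ ∃ n k : ℕ, ω ∈ S n k ∧ x = k / 2 ^ n} := fun ω =>
    ⟨0, by rintro x (rfl | ⟨n, k, -, rfl⟩) <;> positivity⟩
  have hV0 : ∀ ω, 0 ≤ V ω := fun ω => Real.sInf_nonneg (by
    rintro x (rfl | ⟨n, k, -, rfl⟩) <;> positivity)
  have hV1 : ∀ ω, V ω ≤ 1 := fun ω => csInf_le (hbdd ω) (Or.inl rfl)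
  have hVlt : ∀ t : ℝ, t ≤ 1 → {ω | V ω < t} = ⋃ (n : ℕ) (k : ℕ) (_ : (k / 2 ^ n : ℝ) < t), S n k := by
    intro t ht
    ext ω
    simp only [mem_ofPred_eq, mem_iUnion, exists_prop]
    constructor
    · intro hlt
      obtain ⟨x, hx | ⟨n, k, hk, rfl⟩, hxt⟩ := exists_lt_of_csInf_lt
        (s := {x : ℝ | x = 1 ∨ ∃ n k : ℕ, ω ∈ S n k ∧ x = k / 2 ^ n}) ⟨1, Or.inl rfl⟩ hlt
      · linarith
      · exact ⟨n, k, hxt, hk⟩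
    · rintro ⟨n, k, hlt, hk⟩
      exact (csInf_le (hbdd ω) (Or.inr ⟨n, k, hk, rfl⟩)).trans_lt hlt
  have hVm : Measurable V := by
    refine measurable_of_Iio fun t => ?_
    change MeasurableSet {ω | V ω < t}
    rcases le_or_gt t 1 with ht | ht
    · rw [hVlt t ht]
      exact MeasurableSet.iUnion fun n => MeasurableSet.iUnion fun k =>
        MeasurableSet.iUnion fun _ => hS n k
    · convert MeasurableSet.univ
      ext ω; simp [(hV1 ω).trans_lt ht]
  have hPlt : ∀ t : ℝ, 0 ≤ t → t ≤ 1 → P.real {ω | V ω < t} = t := by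
    intro t ht0 ht1
    have key : ∀ n : ℕ, t - 1 / 2 ^ n ≤ P.real {ω | V ω < t} ∧
        P.real {ω | V ω < t} ≤ t + 1 / 2 ^ n := by
      intro n
      have hp : (0 : ℝ) < 2 ^ n := by positivity
      constructor
      · have hfl := Nat.ceil_lt_add_one (mul_nonneg ht0 hp.le)
        rcases Nat.eq_zero_or_pos (⌈t * 2 ^ n⌉₊) with h0 | hpos
        · have : t * 2 ^ n ≤ 0 := by simpa using h0
          have ht : t ≤ 0 := by nlinarith
          have : (0 : ℝ) < 1 / 2 ^ n := by positivity
          linarith [measureReal_nonneg (μ := P) (s := {ω | V ω < t})]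
        · obtain ⟨k, hk⟩ : ∃ k : ℕ, ⌈t * 2 ^ n⌉₊ = k + 1 := ⟨_, (Nat.succ_pred_eq_of_pos hpos).symm⟩
          have hkt : (k : ℝ) < t * 2 ^ n := Nat.lt_ceil.1 (by omega)
          have hkt' : (k / 2 ^ n : ℝ) < t := (div_lt_iff₀ hp).2 hkt
          have hle := Nat.le_ceil (t * 2 ^ n)
          rw [hk] at hle; push_cast at hle
          calc t - 1 / 2 ^ n ≤ k / 2 ^ n := by
                rw [sub_le_iff_le_add, ← add_div, le_div_iff₀ hp]; exact hle
            _ = P.real (S n k) := by rw [hP, min_eq_left (by linarith)]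
            _ ≤ _ := measureReal_mono (fun ω hω =>
                (csInf_le (hbdd ω) (Or.inr ⟨n, k, hω, rfl⟩)).trans_lt hkt')
      · have hfl := Nat.ceil_lt_add_one (mul_nonneg ht0 hp.le)
        have hle := Nat.le_ceil (t * 2 ^ n)
        calc P.real {ω | V ω < t} ≤ P.real (S n ⌈t * 2 ^ n⌉₊) := by
              refine measureReal_mono ?_
              rw [hVlt t ht1]
              refine iUnion_subset fun n' => iUnion_subset fun k' => iUnion_subset fun hk' => ?_
              exact hnest _ _ _ _ (hk'.le.trans ((le_div_iff₀ hp).2 hle))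
          _ ≤ ⌈t * 2 ^ n⌉₊ / 2 ^ n := by rw [hP]; exact min_le_left _ _
          _ ≤ t + 1 / 2 ^ n := by
              rw [div_le_iff₀ hp, add_mul, one_div_mul_cancel hp.ne']; exact hfl.le
    have hlim : Tendsto (fun n : ℕ => (1 / 2 ^ n : ℝ)) atTop (𝓝 0) := by
      simpa using tendsto_pow_atTop_nhds_zero_of_lt_one (r := (1 / 2 : ℝ)) (by norm_num)
        (by norm_num)
    have hup : Tendsto (fun n : ℕ => t + 1 / 2 ^ n) atTop (𝓝 t) := by
      simpa using tendsto_const_nhds.add hlim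
    have hlo : Tendsto (fun n : ℕ => t - 1 / 2 ^ n) atTop (𝓝 t) := by
      simpa using tendsto_const_nhds.sub hlim
    exact le_antisymm (ge_of_tendsto' hup fun n => (key n).2) (le_of_tendsto' hlo fun n => (key n).1)
  refine ⟨fun ω => ⟨V ω, hV0 ω, hV1 ω⟩, hVm.subtype_mk, ?_⟩
  have hUm : Measurable fun ω => (⟨V ω, hV0 ω, hV1 ω⟩ : unitInterval) := hVm.subtype_mk
  have : IsProbabilityMeasure (P.map fun ω => (⟨V ω, hV0 ω, hV1 ω⟩ : unitInterval)) :=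
    Measure.isProbabilityMeasure_map hUm.aemeasurable
  refine Measure.ext_of_Ici _ _ fun a => ?_
  rw [Measure.map_apply hUm measurableSet_Ici, unitInterval.volume_Ici]
  have hpre : (fun ω => (⟨V ω, hV0 ω, hV1 ω⟩ : unitInterval)) ⁻¹' Ici a = {ω | V ω < a}ᶜ := by
    ext ω; simp [← Subtype.coe_le_coe]
  have hml : MeasurableSet {ω | V ω < a} := hVm measurableSet_Iio
  rw [hpre, ← ofReal_measureReal, probReal_compl_eq_one_sub hml, hPlt a a.2.1 a.2.2]

/-- An atomless probability space carries a random variable of any given law. -/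
lemma Atomless.exists_map_eq (h : Atomless mΩ P) {E : Type*} [Nonempty E] [MeasurableSpace E]
    [StandardBorelSpace E] (ν : Measure E) [IsProbabilityMeasure ν] :
    ∃ f : Ω → E, Measurable f ∧ P.map f = ν := by
  obtain ⟨U, hU, hUP⟩ := h.exists_uniform
  obtain ⟨f, hf, hfν⟩ := ν.exists_measurable_map_eq
  exact ⟨f ∘ U, hf.comp hU, by rw [← Measure.map_map hf hU, hUP, hfν]⟩

end AtomlessSpace

end MKV

namespace MKV

/-! ### Square-integrable couplings and the Wasserstein distance -/

section Wasserstein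

variable {d : ℕ} {Ω : Type*} [MeasurableSpace Ω] {P : Measure Ω}

/-- No measurability of `f` is needed, because `lpNorm` vanishes by convention on functions that are
not almost everywhere strongly measurable. -/
lemma lpNorm_mono_ae {E : Type*} [NormedAddCommGroup E] {f : Ω → E} {g : Ω → ℝ} {p : ℝ≥0∞}
    (hg : MemLp g p P) (h : ∀ᵐ ω ∂P, ‖f ω‖ ≤ g ω) : lpNorm f p P ≤ lpNorm g p P := by
  by_cases hf : AEStronglyMeasurable f P
  · rw [← toReal_eLpNorm hf, ← toReal_eLpNorm hg.1]
    exact ENNReal.toReal_mono hg.eLpNorm_ne_top (eLpNorm_mono_ae_real h)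
  · rw [lpNorm_of_not_aestronglyMeasurable hf]; exact lpNorm_nonneg

lemma lpNorm_le_const [IsProbabilityMeasure P] {E : Type*} [NormedAddCommGroup E] {f : Ω → E}
    {p : ℝ≥0∞} (hp : p ≠ 0) {C : ℝ} (h : ∀ᵐ ω ∂P, ‖f ω‖ ≤ C) : lpNorm f p P ≤ C := by
  obtain ⟨ω, hω⟩ := h.exists
  have hC : 0 ≤ C := (norm_nonneg _).trans hω
  refine (lpNorm_mono_ae (g := fun _ => C) (memLp_const C) h).trans ?_
  rw [lpNorm_const hp (IsProbabilityMeasure.ne_zero P)]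
  simp [abs_of_nonneg hC]

lemma isP2_map {E : Type*} [NormedAddCommGroup E] [MeasurableSpace E] [BorelSpace E]
    [SecondCountableTopology E] [IsProbabilityMeasure P]
    {X : Ω → E} (hX : Measurable X) (hX2 : MemLp X 2 P) : IsP2 (P.map X) :=
  ⟨Measure.isProbabilityMeasure_map hX.aemeasurable,
    (memLp_map_measure_iff (by fun_prop) hX.aemeasurable).2 hX2⟩

lemma l2norm_map {X : Ω → St d} (hX : Measurable X) : l2norm (P.map X) = lpNorm X 2 P := by
  rw [l2norm, eLpNorm_map_measure (by fun_prop) hX.aemeasurable,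
    ← toReal_eLpNorm hX.aestronglyMeasurable, Function.id_comp]

lemma isP2_prod {X : Ω → St d} {Y : Ω → ℝ} [IsProbabilityMeasure P] (hX : Measurable X)
    (hY : Measurable Y) (hX2 : MemLp X 2 P) (hY2 : MemLp Y 2 P) :
    IsP2 (P.map fun ω => (X ω, Y ω)) :=
  isP2_map (hX.prodMk hY) ((hX2.norm.add hY2.norm).mono (hX.prodMk hY).aestronglyMeasurable
    (ae_of_all _ fun ω => by
      simp only [Pi.add_apply]
      rw [Real.norm_of_nonneg (by positivity), Prod.norm_def]
      exact max_le_add_of_nonneg (norm_nonneg _) (norm_nonneg _)))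

/-- The joint law of `(X, X')` is a coupling. Its cost is finite, so passing to real numbers in `W2`
loses nothing. -/
lemma W2_map_le {X X' : Ω → St d} (hX : Measurable X) (hX' : Measurable X')
    (hX2 : MemLp X 2 P) (hX2' : MemLp X' 2 P) :
    W2 (P.map X) (P.map X') ≤ lpNorm (fun ω => X ω - X' ω) 2 P := by
  have hd : MemLp (fun ω => X ω - X' ω) 2 P := hX2.sub hX2'
  rw [W2, ← toReal_eLpNorm hd.1]
  refine ENNReal.toReal_mono hd.eLpNorm_ne_top ?_
  rw [eLpNorm_eq_lintegral_rpow_enorm_toReal (by norm_num) (by norm_num)]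
  simp only [ENNReal.toReal_ofNat]
  refine ENNReal.rpow_le_rpow ?_ (by norm_num)
  have e1 : (P.map fun ω => (X ω, X' ω)).map Prod.fst = P.map X := by
    rw [Measure.map_map measurable_fst (hX.prodMk hX')]; rfl
  have e2 : (P.map fun ω => (X ω, X' ω)).map Prod.snd = P.map X' := by
    rw [Measure.map_map measurable_snd (hX.prodMk hX')]; rfl
  refine (iInf_le _ ⟨P.map fun ω => (X ω, X' ω), e1, e2⟩).trans_eq ?_
  · rw [lintegral_map (by fun_prop) (hX.prodMk hX')]
    norm_cast

lemma W2joint_map_le {X X' : Ω → St d} {Y Y' : Ω → ℝ} (hX : Measurable X) (hX' : Measurable X')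
    (hY : Measurable Y) (hY' : Measurable Y')
    (hX2 : MemLp X 2 P) (hX2' : MemLp X' 2 P) (hY2 : MemLp Y 2 P) (hY2' : MemLp Y' 2 P) :
    W2joint (P.map fun ω => (X ω, Y ω)) (P.map fun ω => (X' ω, Y' ω))
      ≤ lpNorm (fun ω => X ω - X' ω) 2 P + lpNorm (fun ω => Y ω - Y' ω) 2 P := by
  have hd : MemLp (fun ω => X ω - X' ω) 2 P := hX2.sub hX2'
  have hd' : MemLp (fun ω => Y ω - Y' ω) 2 P := hY2.sub hY2'
  rw [W2joint, ← toReal_eLpNorm hd.1, ← toReal_eLpNorm hd'.1,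
    ← ENNReal.toReal_add hd.eLpNorm_ne_top hd'.eLpNorm_ne_top]
  refine ENNReal.toReal_mono (ENNReal.add_ne_top.2 ⟨hd.eLpNorm_ne_top, hd'.eLpNorm_ne_top⟩) ?_
  rw [eLpNorm_eq_lintegral_rpow_enorm_toReal (by norm_num) (by norm_num),
    eLpNorm_eq_lintegral_rpow_enorm_toReal (by norm_num) (by norm_num)]
  simp only [ENNReal.toReal_ofNat]
  refine le_trans ?_ (ENNReal.rpow_add_le_add_rpow _ _ (by norm_num) (by norm_num))
  refine ENNReal.rpow_le_rpow ?_ (by norm_num)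
  have hm := hX.prodMk hY
  have hm' := hX'.prodMk hY'
  have e1 : (P.map fun ω => ((X ω, Y ω), (X' ω, Y' ω))).map Prod.fst
      = P.map fun ω => (X ω, Y ω) := by
    rw [Measure.map_map measurable_fst (hm.prodMk hm')]; rfl
  have e2 : (P.map fun ω => ((X ω, Y ω), (X' ω, Y' ω))).map Prod.snd
      = P.map fun ω => (X' ω, Y' ω) := by
    rw [Measure.map_map measurable_snd (hm.prodMk hm')]; rfl
  refine (iInf_le _ ⟨P.map fun ω => ((X ω, Y ω), (X' ω, Y' ω)), e1, e2⟩).trans_eq ?_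
  · rw [lintegral_map (by fun_prop) (hm.prodMk hm'),
      lintegral_add_left (by fun_prop)]
    norm_cast

lemma isP2_dirac {E : Type*} [NormedAddCommGroup E] [MeasurableSpace E] [BorelSpace E]
    [SecondCountableTopology E] : IsP2 (Measure.dirac (0 : E)) :=
  ⟨inferInstance, (memLp_const (0 : E)).ae_eq (by
    rw [Filter.EventuallyEq, ae_dirac_iff (measurableSet_eq_fun measurable_const measurable_id)]
    rfl)⟩

lemma W2_map_dirac_le [IsProbabilityMeasure P] {X : Ω → St d} (hX : Measurable X)
    (hX2 : MemLp X 2 P) : W2 (P.map X) (Measure.dirac 0) ≤ lpNorm X 2 P := by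
  have h := W2_map_le hX (measurable_const (a := (0 : St d))) hX2 (memLp_const 0)
  rw [Measure.map_const] at h
  simpa using h

lemma W2joint_map_dirac_le [IsProbabilityMeasure P] {X : Ω → St d} {Y : Ω → ℝ} (hX : Measurable X)
    (hY : Measurable Y) (hX2 : MemLp X 2 P) (hY2 : MemLp Y 2 P) :
    W2joint (P.map fun ω => (X ω, Y ω)) (Measure.dirac 0) ≤ lpNorm X 2 P + lpNorm Y 2 P := by
  have h := W2joint_map_le hX (measurable_const (a := (0 : St d))) hY
    (measurable_const (a := (0 : ℝ))) hX2 (memLp_const 0) hY2 (memLp_const 0)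
  rw [Measure.map_const] at h
  simpa [← Prod.zero_eq_mk] using h

end Wasserstein

/-! ### The chain rule for Lions derivatives -/

section Lions

variable {d : ℕ} {Ω₀ : Type*} {m₀ : MeasurableSpace Ω₀} {P₀ : Measure Ω₀} [IsProbabilityMeasure P₀]
  {Ω : Type*} [MeasurableSpace Ω] {P : Measure Ω} [IsProbabilityMeasure P]

/-- The derivative of `V` along the laws of a quadratic path of square-integrable random variables
on any probability space. -/
lemma HasLionsDeriv.hasDerivAt_quadratic (hat : Atomless m₀ P₀) {V : Measure (St d) → ℝ}
    {D : Measure (St d) → St d → St d} (hV : HasLionsDeriv P₀ V D)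
    (hD : ∀ μ, IsP2 μ → Measurable (D μ)) {X Y Z : Ω → St d} (hX : Measurable X)
    (hY : Measurable Y) (hZ : Measurable Z) (hX2 : MemLp X 2 P) (hY2 : MemLp Y 2 P)
    (hZ2 : MemLp Z 2 P) (r : ℝ) :
    HasDerivAt (fun r => V (P.map fun ω => X ω + r ^ 2 • Y ω + r • Z ω))
      (∫ ω, ⟪D (P.map fun ω => X ω + r ^ 2 • Y ω + r • Z ω) (X ω + r ^ 2 • Y ω + r • Z ω),
        (2 * r) • Y ω + Z ω⟫_ℝ ∂P) r := by
  have : IsProbabilityMeasure (P.map fun ω => (X ω, Y ω, Z ω)) :=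
    Measure.isProbabilityMeasure_map (hX.prodMk (hY.prodMk hZ)).aemeasurable
  -- A copy of `(X, Y, Z)` on the space that carries the lift, where Fréchet differentiability is
  -- available. Both the function and its derivative depend on the joint law only, so the result
  -- comes back to `P`.
  obtain ⟨f, hf, hfν⟩ := hat.exists_map_eq (P.map fun ω => (X ω, Y ω, Z ω))
  have hlaw : ∀ {E : Type} [MeasurableSpace E] (φ : St d × St d × St d → E), Measurable φ →
      P₀.map (fun ω => φ (f ω)) = P.map fun ω => φ (X ω, Y ω, Z ω) := by
    intro E _ φ hφ
    have h1 : P₀.map (φ ∘ f) = (P₀.map f).map φ := (Measure.map_map hφ hf).symm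
    have h2 : P.map (φ ∘ fun ω => (X ω, Y ω, Z ω)) = (P.map fun ω => (X ω, Y ω, Z ω)).map φ :=
      (Measure.map_map hφ (hX.prodMk (hY.prodMk hZ))).symm
    exact h1.trans (by rw [hfν]; exact h2.symm)
  have hmem : ∀ (φ : St d × St d × St d → St d), Measurable φ →
      MemLp (fun ω => φ (X ω, Y ω, Z ω)) 2 P → MemLp (fun ω => φ (f ω)) 2 P₀ := by
    intro φ hφ h
    have e := hlaw φ hφ
    have h' : MemLp id 2 (P.map fun ω => φ (X ω, Y ω, Z ω)) :=
      (memLp_map_measure_iff (by fun_prop) (by fun_prop)).2 h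
    rw [← e] at h'
    exact (memLp_map_measure_iff (f := fun ω => φ (f ω)) (by fun_prop) (by fun_prop)).1 h'
  have hf1 := hmem (fun p => p.1) measurable_fst hX2
  have hf2 := hmem (fun p => p.2.1) (by fun_prop) hY2
  have hf3 := hmem (fun p => p.2.2) (by fun_prop) hZ2
  let γ : ℝ → Lp (St d) 2 P₀ := fun r => hf1.toLp + r ^ 2 • hf2.toLp + r • hf3.toLp
  have hγ : ∀ r, γ r =ᵐ[P₀] fun ω => (f ω).1 + r ^ 2 • (f ω).2.1 + r • (f ω).2.2 := by
    intro r
    have h1 := Lp.coeFn_add (hf1.toLp _ + r ^ 2 • hf2.toLp _) (r • hf3.toLp _)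
    have h2 := Lp.coeFn_add (hf1.toLp _) (r ^ 2 • hf2.toLp _)
    have h3 := Lp.coeFn_smul (r ^ 2) (hf2.toLp _)
    have h4 := Lp.coeFn_smul r (hf3.toLp _)
    filter_upwards [h1, h2, h3, h4, hf1.coeFn_toLp, hf2.coeFn_toLp, hf3.coeFn_toLp]
      with ω e1 e2 e3 e4 e5 e6 e7
    simp only [γ, e1, e2, e3, e4, e5, e6, e7, Pi.add_apply, Pi.smul_apply]
  have hlawγ : ∀ r, P₀.map (γ r) = P.map fun ω => X ω + r ^ 2 • Y ω + r • Z ω := fun r =>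
    (Measure.map_congr (hγ r)).trans
      (hlaw (fun p => p.1 + r ^ 2 • p.2.1 + r • p.2.2) (by fun_prop))
  obtain ⟨G, hG, hgrad⟩ := hV (γ r)
  have hγ' : HasDerivAt γ ((2 * r) • hf2.toLp _ + hf3.toLp _) r := by
    have h1 : HasDerivAt (fun r : ℝ => r ^ 2 • hf2.toLp _) ((2 * r) • hf2.toLp _) r := by
      simpa using (hasDerivAt_pow 2 r).smul_const (hf2.toLp _)
    have h2 : HasDerivAt (fun r : ℝ => r • hf3.toLp _) (hf3.toLp _) r := by
      simpa using (hasDerivAt_id r).smul_const (hf3.toLp _)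
    exact (h1.const_add _).add h2
  have hcomp := hgrad.hasFDerivAt.comp_hasDerivAt r hγ'
  have hfun : ((fun X' : Lp (St d) 2 P₀ => V (P₀.map X')) ∘ γ)
      = fun r => V (P.map fun ω => X ω + r ^ 2 • Y ω + r • Z ω) := by
    ext r; simp only [Function.comp_apply, hlawγ]
  rw [hfun] at hcomp
  refine hcomp.congr_deriv ?_
  rw [InnerProductSpace.toDual_apply_apply, L2.inner_def]
  have hP2 : IsP2 (P.map fun ω => X ω + r ^ 2 • Y ω + r • Z ω) :=
    isP2_map (by fun_prop) ((hX2.add (hY2.const_smul (r ^ 2))).add (hZ2.const_smul r))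
  set μ := P.map fun ω => X ω + r ^ 2 • Y ω + r • Z ω with hμ
  have hDμ := hD μ hP2
  let φ : St d × St d × St d → ℝ := fun p =>
    ⟪D μ (p.1 + r ^ 2 • p.2.1 + r • p.2.2), (2 * r) • p.2.1 + p.2.2⟫_ℝ
  have hφ : Measurable φ := by
    have : Measurable fun p : St d × St d × St d => D μ (p.1 + r ^ 2 • p.2.1 + r • p.2.2) :=
      hDμ.comp (by fun_prop)
    exact this.inner (by fun_prop)
  have e := hlaw φ hφ
  have h5 : ∫ ω, φ (f ω) ∂P₀ = ∫ ω, φ (X ω, Y ω, Z ω) ∂P := by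
    have a1 : ∫ x, x ∂(P₀.map fun ω => φ (f ω)) = ∫ ω, φ (f ω) ∂P₀ :=
      integral_map (by fun_prop) (by fun_prop)
    have a2 : ∫ x, x ∂(P.map fun ω => φ (X ω, Y ω, Z ω)) = ∫ ω, φ (X ω, Y ω, Z ω) ∂P :=
      integral_map (by fun_prop) (by fun_prop)
    rw [← a1, ← a2, e]
  refine Eq.trans (integral_congr_ae ?_) h5
  have h1 := Lp.coeFn_add ((2 * r) • hf2.toLp _) (hf3.toLp _)
  have h2 := Lp.coeFn_smul (2 * r) (hf2.toLp _)
  filter_upwards [hG, hγ r, h1, h2, hf2.coeFn_toLp, hf3.coeFn_toLp] with ω e1 e2 e3 e4 e5 e6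
  rw [e1, e2, hlawγ, e3, Pi.add_apply, e4, Pi.smul_apply, e5, e6]

end Lions

end MKV

namespace MKV

/-! ### Integral inequalities -/

section Integrals

variable {Ω : Type*} [MeasurableSpace Ω] {P : Measure Ω}
  {E : Type*} [NormedAddCommGroup E]

lemma lpNorm_le_of_eLpNorm_le {f : Ω → E} {p : ℝ≥0∞} {C : ℝ} (hC : 0 ≤ C)
    (h : eLpNorm f p P ≤ ENNReal.ofReal C) : lpNorm f p P ≤ C := by
  by_cases hf : AEStronglyMeasurable f P
  · rw [← toReal_eLpNorm hf]; exact ENNReal.toReal_le_of_le_ofReal hC h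
  · rw [lpNorm_of_not_aestronglyMeasurable hf]; exact hC

lemma integral_mul_le_lpNorm {f g : Ω → ℝ} (hf : MemLp f 2 P) (hg : MemLp g 2 P) :
    |∫ ω, f ω * g ω ∂P| ≤ lpNorm f 2 P * lpNorm g 2 P := by
  have h := abs_real_inner_le_norm (hf.toLp f) (hg.toLp g)
  rw [L2.inner_def, Lp.norm_toLp, Lp.norm_toLp, toReal_eLpNorm hf.1, toReal_eLpNorm hg.1] at h
  convert h using 2
  refine integral_congr_ae ?_
  filter_upwards [hf.coeFn_toLp, hg.coeFn_toLp] with ω e1 e2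
  rw [e1, e2]; simp [mul_comm]

lemma integrable_mul_norm {f : Ω → ℝ} {g : Ω → ℝ} (hf : MemLp f 2 P) (hg : MemLp g 2 P) :
    Integrable (fun ω => f ω * g ω) P := hf.integrable_mul hg

lemma abs_integral_le_of_norm_le_mul {f : Ω → ℝ} {F G : Ω → ℝ}
    (hF : MemLp F 2 P) (hG : MemLp G 2 P)
    (h : ∀ᵐ ω ∂P, |f ω| ≤ F ω * G ω) : |∫ ω, f ω ∂P| ≤ lpNorm F 2 P * lpNorm G 2 P := by
  calc |∫ ω, f ω ∂P| ≤ ∫ ω, F ω * G ω ∂P := by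
        rw [← Real.norm_eq_abs]
        exact norm_integral_le_of_norm_le (integrable_mul_norm hF hG) h
    _ ≤ _ := (le_abs_self _).trans (integral_mul_le_lpNorm hF hG)

variable [IsProbabilityMeasure P]

lemma lpNorm_mono_exponent {f : Ω → E} {p q : ℝ≥0∞} (hpq : p ≤ q) (hf : MemLp f q P) :
    lpNorm f p P ≤ lpNorm f q P := by
  rw [← toReal_eLpNorm hf.1, ← toReal_eLpNorm hf.1]
  exact ENNReal.toReal_mono hf.eLpNorm_ne_top (eLpNorm_le_eLpNorm_of_exponent_le hpq hf.1)

/-- Affine bounds pass to `L^p` norms. -/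
lemma lpNorm_le_of_affine {E' : Type*} [NormedAddCommGroup E'] {f : Ω → E} {g : Ω → E'}
    {p : ℝ≥0∞} (hp : 1 ≤ p) (hg : MemLp g p P) {a b : ℝ} (ha : 0 ≤ a) (hb : 0 ≤ b)
    (h : ∀ᵐ ω ∂P, ‖f ω‖ ≤ a + b * ‖g ω‖) : lpNorm f p P ≤ a + b * lpNorm g p P := by
  have hp0 : p ≠ 0 := (zero_lt_one.trans_le hp).ne'
  have hg' : MemLp (fun ω => b * ‖g ω‖) p P := hg.norm.const_mul b
  refine (lpNorm_mono_ae (g := fun ω => a + b * ‖g ω‖) ((memLp_const a).add hg') h).trans ?_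
  refine (lpNorm_add_le (memLp_const a) hp (g := fun ω => b * ‖g ω‖)).trans ?_
  have e1 : lpNorm (fun _ : Ω => a) p P ≤ a :=
    lpNorm_le_const hp0 (ae_of_all _ fun _ => (Real.norm_of_nonneg ha).le)
  have e2 : lpNorm (fun ω => b * ‖g ω‖) p P = b * lpNorm g p P := by
    have := lpNorm_const_smul (p := p) b (fun ω => ‖g ω‖) P
    rw [lpNorm_norm hg.1] at this
    simpa [Pi.smul_def, abs_of_nonneg hb] using this
  linarith

lemma lpNorm_le_of_affine₂ {E₁ E₂ : Type*} [NormedAddCommGroup E₁] [NormedAddCommGroup E₂]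
    {f : Ω → E} {g : Ω → E₁} {g' : Ω → E₂}
    {p : ℝ≥0∞} (hp : 1 ≤ p) (hg : MemLp g p P) (hg' : MemLp g' p P) {a b b' : ℝ} (ha : 0 ≤ a)
    (hb : 0 ≤ b) (hb' : 0 ≤ b') (h : ∀ᵐ ω ∂P, ‖f ω‖ ≤ a + b * ‖g ω‖ + b' * ‖g' ω‖) :
    lpNorm f p P ≤ a + b * lpNorm g p P + b' * lpNorm g' p P := by
  have hg1 : MemLp (fun ω => b * ‖g ω‖) p P := hg.norm.const_mul b
  have hg2 : MemLp (fun ω => b' * ‖g' ω‖) p P := hg'.norm.const_mul b'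
  have h3 := lpNorm_le_of_affine (f := fun ω => b * ‖g ω‖ + b' * ‖g' ω‖)
    (g := fun ω => b * ‖g ω‖ + b' * ‖g' ω‖) hp (hg1.add hg2) le_rfl zero_le_one (by simp)
  refine (lpNorm_le_of_affine (g := fun ω => b * ‖g ω‖ + b' * ‖g' ω‖) hp (hg1.add hg2) ha
    zero_le_one (h.mono fun ω hω => ?_)).trans ?_
  · rw [Real.norm_of_nonneg (by positivity)]; linarith
  · have h4 := lpNorm_add_le hg1 hp (g := fun ω => b' * ‖g' ω‖)
    have h1 := lpNorm_le_of_affine (f := fun ω => b * ‖g ω‖) hp hg le_rfl hb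
      (ae_of_all _ fun ω => by simp [abs_of_nonneg hb])
    have h2 := lpNorm_le_of_affine (f := fun ω => b' * ‖g' ω‖) hp hg' le_rfl hb'
      (ae_of_all _ fun ω => by simp [abs_of_nonneg hb'])
    have h5 : lpNorm (fun ω => b * ‖g ω‖ + b' * ‖g' ω‖) p P
      ≤ lpNorm (fun ω => b * ‖g ω‖) p P + lpNorm (fun ω => b' * ‖g' ω‖) p P := h4
    linarith

end Integrals

/-! ### Traces -/

section Trace

variable {d : ℕ}

lemma tr_sub (A B : St d →L[ℝ] St d) : tr (A - B) = tr A - tr B := by simp [tr]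

lemma abs_tr_le (A : St d →L[ℝ] St d) : |tr A| ≤ d * ‖A‖ := by
  have h := LinearMap.trace_eq_sum_inner A.toLinearMap (EuclideanSpace.basisFun (Fin d) ℝ)
  rw [tr, h]
  refine (Finset.abs_sum_le_sum_abs _ _).trans ?_
  have : ∀ i ∈ Finset.univ, |⟪EuclideanSpace.basisFun (Fin d) ℝ i,
      A.toLinearMap (EuclideanSpace.basisFun (Fin d) ℝ i)⟫_ℝ| ≤ ‖A‖ := by
    intro i _
    refine (abs_real_inner_le_norm _ _).trans ?_
    have h1 : ‖EuclideanSpace.basisFun (Fin d) ℝ i‖ = 1 := by simp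
    have h2 := A.le_opNorm (EuclideanSpace.basisFun (Fin d) ℝ i)
    rw [h1, mul_one] at h2
    rw [h1, one_mul]; exact h2
  refine (Finset.sum_le_sum this).trans ?_
  simp

lemma continuous_tr : Continuous (tr (d := d)) := by
  have : (tr (d := d)) = fun A => ∑ i, ⟪EuclideanSpace.basisFun (Fin d) ℝ i,
      A (EuclideanSpace.basisFun (Fin d) ℝ i)⟫_ℝ := by
    ext A; exact LinearMap.trace_eq_sum_inner A.toLinearMap (EuclideanSpace.basisFun (Fin d) ℝ)
  rw [this]; fun_prop

end Trace

/-! ### Growth and regularity of the coefficients and of the decoupling field -/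

/-- The standing assumptions (H0) and (H1), with constants normalised to be at least one, and a
bound `K` for the coefficients and the decoupling field at the origin. -/
structure Setting {d : ℕ} {Ω₀ : Type*} {m₀ : MeasurableSpace Ω₀} (P₀ : Measure Ω₀)
    (T Λ α K : ℝ) (c : Coeffs d) (u : MasterField d) : Prop where
  one_le_Λ : 1 ≤ Λ
  one_le_α : 1 ≤ α
  T_pos : 0 < T
  atomless : Atomless m₀ P₀
  h0 : H0 Λ c
  h1 : H1 P₀ T Λ α c u
  one_le_K : 1 ≤ K
  b_zero : ‖c.b 0 0 (Measure.dirac 0)‖ ≤ K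
  f_zero : |c.f 0 0 0 (Measure.dirac 0)| ≤ K
  U_zero : ∀ t ∈ Icc 0 T, |u.U t 0 (Measure.dirac 0)| ≤ K

section Field

variable {d : ℕ} {Ω₀ : Type*} {m₀ : MeasurableSpace Ω₀} {P₀ : Measure Ω₀} {T Λ α K : ℝ}
  {c : Coeffs d} {u : MasterField d}

lemma W2_dirac_le {μ : Measure (St d)} (hμ : IsP2 μ) : W2 μ (Measure.dirac 0) ≤ l2norm μ := by
  have := hμ.1
  have h := W2_map_dirac_le (P := μ) measurable_id hμ.2
  rwa [Measure.map_id, ← toReal_eLpNorm hμ.2.1] at h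

lemma IsP2.lpNorm_id {μ : Measure (St d)} (hμ : IsP2 μ) : lpNorm id 2 μ = l2norm μ :=
  (toReal_eLpNorm hμ.2.1).symm

lemma l2norm_nonneg (μ : Measure (St d)) : 0 ≤ l2norm μ := ENNReal.toReal_nonneg

namespace Setting

lemma Λ_pos (S : Setting P₀ T Λ α K c u) : 0 < Λ := zero_lt_one.trans_le S.one_le_Λ

lemma K_pos (S : Setting P₀ T Λ α K c u) : 0 < K := zero_lt_one.trans_le S.one_le_K

lemma norm_dx_le (S : Setting P₀ T Λ α K c u) {t : ℝ} (ht : t ∈ Icc 0 T) (x : St d)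
    {μ : Measure (St d)} (hμ : IsP2 μ) : ‖u.dx t x μ‖ ≤ Λ := by
  have h := (self_le_add_right _ _).trans (S.h1.bound_first t ht x μ hμ)
  rw [← ofReal_norm] at h
  exact (ENNReal.ofReal_le_ofReal_iff S.Λ_pos.le).1 h

lemma norm_dxx_le (S : Setting P₀ T Λ α K c u) {t : ℝ} (ht : t ∈ Icc 0 T) (x : St d)
    {μ : Measure (St d)} (hμ : IsP2 μ) : ‖u.dxx t x μ‖ ≤ Λ := by
  have h := (self_le_add_right _ _).trans (S.h1.bound_second t ht x μ hμ)
  rw [← ofReal_norm] at h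
  exact (ENNReal.ofReal_le_ofReal_iff S.Λ_pos.le).1 h

lemma continuous_dμ (S : Setting P₀ T Λ α K c u) {t : ℝ} (ht : t ∈ Icc 0 T) (x : St d)
    {μ : Measure (St d)} (hμ : IsP2 μ) : Continuous (u.dμ t x μ) :=
  continuous_iff_continuousAt.2 fun v => (S.h1.classical.hasFDeriv_dμ t ht x μ v hμ).continuousAt

/-- The continuity assumed for a classical solution concerns only `v` in the support of `μ`. The
local Lipschitz bound `lip_dvdμ` gives it everywhere, which is what measurability requires. -/
lemma continuous_dvdμ (S : Setting P₀ T Λ α K c u) {t : ℝ} (ht : t ∈ Icc 0 T) (x : St d)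
    {μ : Measure (St d)} (hμ : IsP2 μ) : Continuous (u.dvdμ t x μ) := by
  refine continuous_iff_continuousAt.2 fun v => tendsto_iff_norm_sub_tendsto_zero.2 ?_
  have h2α : 0 ≤ 2 * α := by linarith [S.one_le_α]
  have hc : Continuous fun w : St d => Λ * (1 + ‖w‖ ^ (2 * α) + ‖v‖ ^ (2 * α)
      + l2norm μ ^ (2 * α)) ^ (1 / 2 : ℝ) * ‖w - v‖ := by
    refine Continuous.mul (continuous_const.mul (Continuous.rpow_const ?_ fun _ => Or.inr
      (by norm_num))) (by fun_prop)
    have : Continuous fun w : St d => ‖w‖ ^ (2 * α) :=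
      continuous_norm.rpow_const fun _ => Or.inr h2α
    fun_prop
  refine squeeze_zero (fun _ => norm_nonneg _)
    (fun w => S.h1.lip_dvdμ t ht x μ w v hμ) ?_
  have := hc.tendsto v
  simpa using this

lemma memLp_dμ (S : Setting P₀ T Λ α K c u) {t : ℝ} (ht : t ∈ Icc 0 T) (x : St d)
    {μ : Measure (St d)} (hμ : IsP2 μ) : MemLp (u.dμ t x μ) 2 μ ∧ lpNorm (u.dμ t x μ) 2 μ ≤ Λ := by
  have h := (le_add_self).trans (S.h1.bound_first t ht x μ hμ)
  exact ⟨⟨(S.continuous_dμ ht x hμ).aestronglyMeasurable, h.trans_lt ENNReal.ofReal_lt_top⟩,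
    lpNorm_le_of_eLpNorm_le S.Λ_pos.le h⟩

lemma memLp_dvdμ (S : Setting P₀ T Λ α K c u) {t : ℝ} (ht : t ∈ Icc 0 T) (x : St d)
    {μ : Measure (St d)} (hμ : IsP2 μ) :
    MemLp (u.dvdμ t x μ) 2 μ ∧ lpNorm (u.dvdμ t x μ) 2 μ ≤ Λ := by
  have h := (le_add_self).trans (S.h1.bound_second t ht x μ hμ)
  exact ⟨⟨(S.continuous_dvdμ ht x hμ).aestronglyMeasurable, h.trans_lt ENNReal.ofReal_lt_top⟩,
    lpNorm_le_of_eLpNorm_le S.Λ_pos.le h⟩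

/-- Mean value inequality, first for the gradient, whose derivative is bounded by `Λ`, then for `U`
minus its linear part along the segment. -/
lemma U_taylor (S : Setting P₀ T Λ α K c u) {t : ℝ} (ht : t ∈ Icc 0 T) (x x' : St d)
    {μ : Measure (St d)} (hμ : IsP2 μ) :
    |u.U t x' μ - u.U t x μ| ≤ Λ * ‖x' - x‖ ∧
    ‖u.dx t x' μ - u.dx t x μ‖ ≤ Λ * ‖x' - x‖ ∧
    |u.U t x' μ - u.U t x μ - ⟪u.dx t x μ, x' - x⟫_ℝ| ≤ Λ * ‖x' - x‖ ^ 2 := by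
  have hU : ∀ y, HasFDerivAt (fun y => u.U t y μ)
      (InnerProductSpace.toDual ℝ (St d) (u.dx t y μ)) y := fun y =>
    (S.h1.classical.hasGradient_x t ht y μ hμ).hasFDerivAt
  have hdx : ∀ y y', ‖u.dx t y' μ - u.dx t y μ‖ ≤ Λ * ‖y' - y‖ := fun y y' =>
    convex_univ.norm_image_sub_le_of_norm_hasFDerivWithin_le
      (fun z _ => (S.h1.classical.hasFDeriv_dx t ht z μ hμ).hasFDerivWithinAt)
      (fun z _ => S.norm_dxx_le ht z hμ) (mem_univ _) (mem_univ _)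
  refine ⟨?_, hdx x x', ?_⟩
  · exact convex_univ.norm_image_sub_le_of_norm_hasFDerivWithin_le
      (f := fun y => u.U t y μ) (fun z _ => (hU z).hasFDerivWithinAt)
      (fun z _ => by simpa using S.norm_dx_le ht z hμ) (mem_univ _) (mem_univ _)
  · have h := (convex_segment x x').norm_image_sub_le_of_norm_hasFDerivWithin_le'
      (f := fun y => u.U t y μ) (φ := InnerProductSpace.toDual ℝ (St d) (u.dx t x μ))
      (C := Λ * ‖x' - x‖) (fun z _ => (hU z).hasFDerivWithinAt)
      (fun z hz => by
        rw [← map_sub, LinearIsometryEquiv.norm_map]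
        refine (hdx x z).trans ?_
        gcongr
        · exact S.Λ_pos.le
        · rw [norm_sub_rev, norm_sub_rev x']
          obtain ⟨a, b, ha, hb, hab, rfl⟩ := hz
          have : x - (a • x + b • x') = b • (x - x') := by
            rw [← eq_sub_iff_add_eq] at hab
            rw [hab]; module
          rw [this, norm_smul, Real.norm_of_nonneg hb]
          exact mul_le_of_le_one_left (norm_nonneg _) (by linarith))
      (left_mem_segment ℝ x x') (right_mem_segment ℝ x x')
    rw [InnerProductSpace.toDual_apply_apply, Real.norm_eq_abs] at h
    calc _ ≤ _ := h
      _ = _ := by ring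

lemma U_lip (S : Setting P₀ T Λ α K c u) {t : ℝ} (ht : t ∈ Icc 0 T) (x x' : St d)
    {μ μ' : Measure (St d)} (hμ : IsP2 μ) (hμ' : IsP2 μ') :
    |u.U t x μ - u.U t x' μ'| ≤ Λ * (‖x - x'‖ + W2 μ μ') := by
  have h1 := (S.U_taylor ht x' x hμ).1
  have h2 := S.h1.lip_measure t ht x' μ μ' hμ hμ'
  have h3 := abs_sub_le (u.U t x μ) (u.U t x' μ) (u.U t x' μ')
  have h4 := norm_nonneg (u.dx t x' μ - u.dx t x' μ')
  linarith

lemma dx_lip (S : Setting P₀ T Λ α K c u) {t : ℝ} (ht : t ∈ Icc 0 T) (x x' : St d)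
    {μ μ' : Measure (St d)} (hμ : IsP2 μ) (hμ' : IsP2 μ') :
    ‖u.dx t x μ - u.dx t x' μ'‖ ≤ Λ * (‖x - x'‖ + W2 μ μ') := by
  have h1 := (S.U_taylor ht x' x hμ).2.1
  have h2 := S.h1.lip_measure t ht x' μ μ' hμ hμ'
  have h3 := norm_sub_le_norm_sub_add_norm_sub (u.dx t x μ) (u.dx t x' μ) (u.dx t x' μ')
  have h4 := abs_nonneg (u.U t x' μ - u.U t x' μ')
  linarith

/-- The assumption `holder_time` only allows increments smaller than `T`. Cutting the interval at
its midpoint covers the case `t = 0`, `t' = T`, at the price of a factor 2. -/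
lemma holder (S : Setting P₀ T Λ α K c u) {t t' : ℝ} (ht : 0 ≤ t) (htt : t ≤ t') (ht' : t' ≤ T)
    (x : St d) {μ : Measure (St d)} (hμ : IsP2 μ) :
    |u.U t' x μ - u.U t x μ| + ‖u.dx t' x μ - u.dx t x μ‖
      ≤ 2 * Λ * √(t' - t) * (1 + ‖x‖ + l2norm μ) := by
  have hT := S.T_pos
  set m := (t' - t) / 2 with hm
  have h1 := S.h1.holder_time m ⟨by linarith, by linarith⟩ t ⟨ht, by linarith⟩ x μ hμ
  have h2 := S.h1.holder_time m ⟨by linarith, by linarith⟩ (t + m) ⟨by linarith, by linarith⟩ x μ hμ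
  have e : t + m + m = t' := by linarith
  rw [e] at h2
  have h3 : √m ≤ √(t' - t) := Real.sqrt_le_sqrt (by linarith)
  have h4 := abs_sub_le (u.U t' x μ) (u.U (t + m) x μ) (u.U t x μ)
  have h5 := norm_sub_le_norm_sub_add_norm_sub (u.dx t' x μ) (u.dx (t + m) x μ) (u.dx t x μ)
  have h6 : Λ * √m * (1 + ‖x‖ + l2norm μ) ≤ Λ * √(t' - t) * (1 + ‖x‖ + l2norm μ) := by
    have := l2norm_nonneg μ
    have := S.Λ_pos
    gcongr
  linarith

lemma U_growth (S : Setting P₀ T Λ α K c u) {t : ℝ} (ht : t ∈ Icc 0 T) (x : St d)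
    {μ : Measure (St d)} (hμ : IsP2 μ) : |u.U t x μ| ≤ K + Λ * (‖x‖ + l2norm μ) := by
  have h1 := S.U_lip ht x 0 hμ isP2_dirac
  have h2 := S.U_zero t ht
  have h3 := mul_le_mul_of_nonneg_left (W2_dirac_le hμ) S.Λ_pos.le
  have h4 := abs_sub_abs_le_abs_sub (u.U t x μ) (u.U t 0 (Measure.dirac 0))
  rw [sub_zero] at h1
  linarith

lemma b_growth (S : Setting P₀ T Λ α K c u) (x : St d) (y : ℝ) {ν : Measure (St d × ℝ)}
    (hν : IsP2 ν) : ‖c.b x y ν‖ ≤ K + Λ * (‖x‖ + |y| + W2joint ν (Measure.dirac 0)) := by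
  have h1 := S.h0.lip_b x 0 y 0 ν _ hν isP2_dirac
  have h2 := norm_sub_norm_le (c.b x y ν) (c.b 0 0 (Measure.dirac 0))
  rw [sub_zero, sub_zero] at h1
  linarith [S.b_zero]

lemma f_growth (S : Setting P₀ T Λ α K c u) (x : St d) (y : ℝ) (z : St d) {ν : Measure (St d × ℝ)}
    (hν : IsP2 ν) :
    |c.f x y z ν| ≤ K + Λ * (‖x‖ + |y| + ‖z‖ + W2joint ν (Measure.dirac 0)) := by
  have h1 := S.h0.lip_f x 0 y 0 z 0 ν _ hν isP2_dirac
  have h2 := abs_sub_abs_le_abs_sub (c.f x y z ν) (c.f 0 0 0 (Measure.dirac 0))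
  rw [sub_zero, sub_zero, sub_zero] at h1
  linarith [S.f_zero]

lemma norm_σadj_le (S : Setting P₀ T Λ α K c u) (x : St d) {μ : Measure (St d)} (hμ : IsP2 μ) :
    ‖c.σadj x μ‖ ≤ Λ := by
  rw [Coeffs.σadj, LinearIsometryEquiv.norm_map]; exact S.h0.bound_σ x μ hμ

lemma σadj_lip (S : Setting P₀ T Λ α K c u) (x x' : St d) {μ μ' : Measure (St d)} (hμ : IsP2 μ)
    (hμ' : IsP2 μ') : ‖c.σadj x μ - c.σadj x' μ'‖ ≤ Λ * (‖x - x'‖ + W2 μ μ') := by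
  rw [Coeffs.σadj, Coeffs.σadj, ← map_sub, LinearIsometryEquiv.norm_map]
  exact S.h0.lip_σ x x' μ μ' hμ hμ'

lemma norm_a_le (S : Setting P₀ T Λ α K c u) (x : St d) {μ : Measure (St d)} (hμ : IsP2 μ) :
    ‖c.a x μ‖ ≤ Λ ^ 2 := by
  have := S.Λ_pos.le
  calc ‖c.a x μ‖ ≤ ‖c.σ x μ‖ * ‖c.σadj x μ‖ := ContinuousLinearMap.opNorm_comp_le _ _
    _ ≤ Λ * Λ := by gcongr; exacts [S.h0.bound_σ x μ hμ, S.norm_σadj_le x hμ]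
    _ = Λ ^ 2 := by ring

lemma a_lip (S : Setting P₀ T Λ α K c u) (x x' : St d) {μ μ' : Measure (St d)} (hμ : IsP2 μ)
    (hμ' : IsP2 μ') : ‖c.a x μ - c.a x' μ'‖ ≤ 2 * Λ ^ 2 * (‖x - x'‖ + W2 μ μ') := by
  have h0 := S.Λ_pos.le
  have e : c.a x μ - c.a x' μ' = (c.σ x μ - c.σ x' μ') ∘L c.σadj x μ
      + c.σ x' μ' ∘L (c.σadj x μ - c.σadj x' μ') := by
    simp only [Coeffs.a, ContinuousLinearMap.sub_comp, ContinuousLinearMap.comp_sub]; abel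
  have h1 := S.h0.lip_σ x x' μ μ' hμ hμ'
  have h2 := S.σadj_lip x x' hμ hμ'
  have h3 := (norm_nonneg _).trans h1
  rw [e]
  calc _ ≤ ‖c.σ x μ - c.σ x' μ'‖ * ‖c.σadj x μ‖ + ‖c.σ x' μ'‖ * ‖c.σadj x μ - c.σadj x' μ'‖ :=
        (norm_add_le _ _).trans (add_le_add (ContinuousLinearMap.opNorm_comp_le _ _)
          (ContinuousLinearMap.opNorm_comp_le _ _))
    _ ≤ (Λ * (‖x - x'‖ + W2 μ μ')) * Λ + Λ * (Λ * (‖x - x'‖ + W2 μ μ')) := by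
        gcongr; exacts [S.norm_σadj_le x hμ, S.h0.bound_σ x' μ' hμ']
    _ = _ := by ring

lemma continuous_U (S : Setting P₀ T Λ α K c u) {t : ℝ} (ht : t ∈ Icc 0 T)
    {μ : Measure (St d)} (hμ : IsP2 μ) : Continuous fun x => u.U t x μ :=
  continuous_iff_continuousAt.2 fun x =>
    (S.h1.classical.hasGradient_x t ht x μ hμ).hasFDerivAt.continuousAt

lemma continuous_b (S : Setting P₀ T Λ α K c u) {ν : Measure (St d × ℝ)} (hν : IsP2 ν) :
    Continuous fun p : St d × ℝ => c.b p.1 p.2 ν := by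
  refine (LipschitzWith.of_dist_le_mul (K := (2 * Λ).toNNReal) fun p q => ?_).continuous
  have h := S.h0.lip_b p.1 q.1 p.2 q.2 ν ν hν hν
  have hW : W2joint ν ν ≤ 0 := by
    have := hν.1
    have h1 : Measurable (Prod.fst : St d × ℝ → St d) := measurable_fst
    have h2 : MemLp (Prod.fst : St d × ℝ → St d) 2 ν := hν.2.fst
    have h3 : MemLp (Prod.snd : St d × ℝ → ℝ) 2 ν := hν.2.snd
    have := W2joint_map_le h1 h1 measurable_snd measurable_snd h2 h2 h3 h3
    simpa using this
  have e1 : ‖p.1 - q.1‖ ≤ dist p q := by rw [← dist_eq_norm]; exact le_max_left _ _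
  have e2 : |p.2 - q.2| ≤ dist p q := by rw [← Real.dist_eq]; exact le_max_right _ _
  rw [Real.coe_toNNReal _ (by linarith [S.Λ_pos]), dist_eq_norm]
  have := S.Λ_pos
  calc _ ≤ _ := h
    _ ≤ Λ * (dist p q + dist p q + 0) := by gcongr
    _ = _ := by ring

lemma continuous_σ (S : Setting P₀ T Λ α K c u) {μ : Measure (St d)} (hμ : IsP2 μ) :
    Continuous fun x => c.σ x μ := by
  refine (LipschitzWith.of_dist_le_mul (K := Λ.toNNReal) fun p q => ?_).continuous
  have h := S.h0.lip_σ p q μ μ hμ hμ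
  have hW : W2 μ μ ≤ 0 := by
    have := hμ.1
    have := W2_map_le measurable_id measurable_id hμ.2 hμ.2
    simpa using this
  rw [Real.coe_toNNReal _ S.Λ_pos.le, dist_eq_norm, dist_eq_norm]
  have := S.Λ_pos
  calc _ ≤ _ := h
    _ ≤ Λ * (‖p - q‖ + 0) := by gcongr
    _ = _ := by ring

lemma continuous_a (S : Setting P₀ T Λ α K c u) {μ : Measure (St d)} (hμ : IsP2 μ) :
    Continuous fun x => c.a x μ := by
  have h := S.continuous_σ hμ
  have h2 : Continuous fun x => c.σadj x μ :=
    (ContinuousLinearMap.adjoint (𝕜 := ℝ) (E := St d) (F := St d)).continuous.comp h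
  exact h.clm_comp h2

lemma continuous_f (S : Setting P₀ T Λ α K c u) {ν : Measure (St d × ℝ)} (hν : IsP2 ν) :
    Continuous fun p : St d × ℝ × St d => c.f p.1 p.2.1 p.2.2 ν := by
  refine (LipschitzWith.of_dist_le_mul (K := (3 * Λ).toNNReal) fun p q => ?_).continuous
  have h := S.h0.lip_f p.1 q.1 p.2.1 q.2.1 p.2.2 q.2.2 ν ν hν hν
  have hW : W2joint ν ν ≤ 0 := by
    have := hν.1
    have h1 : Measurable (Prod.fst : St d × ℝ → St d) := measurable_fst
    have h2 : MemLp (Prod.fst : St d × ℝ → St d) 2 ν := hν.2.fst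
    have h3 : MemLp (Prod.snd : St d × ℝ → ℝ) 2 ν := hν.2.snd
    have := W2joint_map_le h1 h1 measurable_snd measurable_snd h2 h2 h3 h3
    simpa using this
  have e1 : ‖p.1 - q.1‖ ≤ dist p q := by rw [← dist_eq_norm]; exact le_max_left _ _
  have e2 : |p.2.1 - q.2.1| ≤ dist p q := by
    rw [← Real.dist_eq]; exact (le_max_left _ _).trans (le_max_right _ _)
  have e3 : ‖p.2.2 - q.2.2‖ ≤ dist p q := by
    rw [← dist_eq_norm]; exact (le_max_right _ _).trans (le_max_right _ _)
  rw [Real.coe_toNNReal _ (by linarith [S.Λ_pos]), Real.dist_eq]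
  have := S.Λ_pos
  calc _ ≤ _ := h
    _ ≤ Λ * (dist p q + dist p q + dist p q + 0) := by gcongr
    _ = _ := by ring

end Setting

end Field

end MKV

/-! ### Growth on the graph of the decoupling field, and Lipschitz continuity in time -/

namespace MKV

namespace Setting

variable {d : ℕ} {Ω₀ : Type*} {m₀ : MeasurableSpace Ω₀} {P₀ : Measure Ω₀} {T Λ α K : ℝ}
  {c : Coeffs d} {u : MasterField d}
  {Ω : Type*} [MeasurableSpace Ω] {P : Measure Ω} [IsProbabilityMeasure P]

lemma memLp_U (S : Setting P₀ T Λ α K c u) {t : ℝ} (ht : t ∈ Icc 0 T) {μ : Measure (St d)}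
    (hμ : IsP2 μ) {p : ℝ≥0∞} {X : Ω → St d} (hX : MemLp X p P) :
    MemLp (fun ω => u.U t (X ω) μ) p P := by
  have h1 : MemLp (fun ω => K + Λ * (‖X ω‖ + l2norm μ)) p P :=
    (memLp_const K).add ((hX.norm.add (memLp_const (l2norm μ))).const_mul Λ)
  refine h1.mono' ((S.continuous_U ht hμ).comp_aestronglyMeasurable hX.1)
    (ae_of_all _ fun ω => S.U_growth ht (X ω) hμ)

lemma lpNorm_U_le (S : Setting P₀ T Λ α K c u) {t : ℝ} (ht : t ∈ Icc 0 T) {μ : Measure (St d)}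
    (hμ : IsP2 μ) {p : ℝ≥0∞} (hp : 1 ≤ p) {X : Ω → St d} (hX : MemLp X p P) :
    lpNorm (fun ω => u.U t (X ω) μ) p P ≤ K + Λ * (lpNorm X p P + l2norm μ) := by
  have h0 := S.Λ_pos.le
  have h1 := S.K_pos.le
  have := lpNorm_le_of_affine (f := fun ω => u.U t (X ω) μ) hp hX
    (a := K + Λ * l2norm μ) (b := Λ) (by have := l2norm_nonneg μ; positivity) h0
    (ae_of_all _ fun ω => (S.U_growth ht (X ω) hμ).trans_eq (by ring))
  linarith

lemma memLp_b (S : Setting P₀ T Λ α K c u) {ν : Measure (St d × ℝ)} (hν : IsP2 ν) {p : ℝ≥0∞}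
    {X : Ω → St d} {Y : Ω → ℝ} (hX : MemLp X p P) (hY : MemLp Y p P) :
    MemLp (fun ω => c.b (X ω) (Y ω) ν) p P := by
  have h1 : MemLp (fun ω => K + Λ * (‖X ω‖ + ‖Y ω‖ + W2joint ν (Measure.dirac 0))) p P :=
    (memLp_const K).add (((hX.norm.add hY.norm).add (memLp_const _)).const_mul Λ)
  exact h1.mono' ((S.continuous_b hν).comp_aestronglyMeasurable (hX.1.prodMk hY.1))
    (ae_of_all _ fun ω => S.b_growth (X ω) (Y ω) hν)

lemma graphLaw_map (S : Setting P₀ T Λ α K c u) {t : ℝ} (ht : t ∈ Icc 0 T) {X : Ω → St d}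
    (hX : Measurable X) (hX2 : MemLp X 2 P) :
    u.graphLaw t (P.map X) = P.map fun ω => (X ω, u.U t (X ω) (P.map X)) := by
  have := (S.continuous_U ht (isP2_map hX hX2)).measurable
  rw [MasterField.graphLaw, Measure.map_map (by fun_prop) hX]
  rfl

lemma isP2_graphLaw (S : Setting P₀ T Λ α K c u) {t : ℝ} (ht : t ∈ Icc 0 T) {μ : Measure (St d)}
    (hμ : IsP2 μ) : IsP2 (u.graphLaw t μ) := by
  have := hμ.1
  exact isP2_prod measurable_id (S.continuous_U ht hμ).measurable hμ.2 (S.memLp_U ht hμ hμ.2)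

lemma W2joint_graphLaw_dirac_le (S : Setting P₀ T Λ α K c u) {t : ℝ} (ht : t ∈ Icc 0 T)
    {μ : Measure (St d)} (hμ : IsP2 μ) :
    W2joint (u.graphLaw t μ) (Measure.dirac 0) ≤ 3 * Λ * (K + l2norm μ) := by
  have := hμ.1
  have h1 := W2joint_map_dirac_le (P := μ) measurable_id (S.continuous_U ht hμ).measurable hμ.2
    (S.memLp_U ht hμ hμ.2)
  have h2 := S.lpNorm_U_le ht hμ (by norm_num) hμ.2
  rw [hμ.lpNorm_id] at h1 h2
  have h3 := S.one_le_Λ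
  have h4 := l2norm_nonneg μ
  have h5 := S.K_pos
  have h6 : l2norm μ ≤ Λ * l2norm μ := le_mul_of_one_le_left h4 h3
  have h7 : K ≤ Λ * K := le_mul_of_one_le_left h5.le h3
  refine h1.trans ?_
  simp only [id_eq] at h2 ⊢
  nlinarith

lemma b_graph_growth (S : Setting P₀ T Λ α K c u) {t : ℝ} (ht : t ∈ Icc 0 T) (x : St d)
    {μ : Measure (St d)} (hμ : IsP2 μ) :
    ‖c.b x (u.U t x μ) (u.graphLaw t μ)‖ ≤ 6 * Λ ^ 2 * (K + ‖x‖ + l2norm μ) := by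
  have h0 := S.b_growth x (u.U t x μ) (S.isP2_graphLaw ht hμ)
  have h1 := S.U_growth ht x hμ
  have h2 := S.W2joint_graphLaw_dirac_le ht hμ
  have h3 := S.one_le_Λ
  have h4 := l2norm_nonneg μ
  have h5 := S.K_pos
  have h6 := norm_nonneg x
  have h7 : Λ ≤ Λ ^ 2 := by nlinarith
  have h8 : 1 ≤ Λ ^ 2 := by nlinarith
  calc _ ≤ _ := h0
    _ ≤ K + Λ * (‖x‖ + (K + Λ * (‖x‖ + l2norm μ)) + 3 * Λ * (K + l2norm μ)) := by gcongr
    _ = 1 * K + Λ * (‖x‖ + K) + Λ ^ 2 * (‖x‖ + l2norm μ + 3 * (K + l2norm μ)) := by ring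
    _ ≤ Λ ^ 2 * K + Λ ^ 2 * (‖x‖ + K) + Λ ^ 2 * (‖x‖ + l2norm μ + 3 * (K + l2norm μ)) := by
        gcongr
    _ ≤ _ := by nlinarith [mul_nonneg (sq_nonneg Λ) h6, mul_nonneg (sq_nonneg Λ) h4,
        mul_nonneg (sq_nonneg Λ) h5.le]

lemma f_graph_growth (S : Setting P₀ T Λ α K c u) {t : ℝ} (ht : t ∈ Icc 0 T) (x : St d)
    {μ : Measure (St d)} (hμ : IsP2 μ) :
    |c.f x (u.U t x μ) (c.σadj x μ (u.dx t x μ)) (u.graphLaw t μ)|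
      ≤ 7 * Λ ^ 3 * (K + ‖x‖ + l2norm μ) := by
  have h0 := S.f_growth x (u.U t x μ) (c.σadj x μ (u.dx t x μ)) (S.isP2_graphLaw ht hμ)
  have h1 := S.U_growth ht x hμ
  have h2 := S.W2joint_graphLaw_dirac_le ht hμ
  have h3 := S.one_le_Λ
  have h4 := l2norm_nonneg μ
  have h5 := S.K_pos
  have hK := S.one_le_K
  have h6 := norm_nonneg x
  have hz : ‖c.σadj x μ (u.dx t x μ)‖ ≤ Λ * Λ :=
    (ContinuousLinearMap.le_opNorm _ _).trans (mul_le_mul (S.norm_σadj_le x hμ)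
      (S.norm_dx_le ht x hμ) (norm_nonneg _) S.Λ_pos.le)
  have h7 : Λ ≤ Λ ^ 3 := by nlinarith [mul_pos S.Λ_pos S.Λ_pos]
  have h8 : 1 ≤ Λ ^ 3 := by linarith
  have h9 : Λ ^ 2 ≤ Λ ^ 3 := pow_le_pow_right₀ h3 (by norm_num)
  have h10 : (0:ℝ) ≤ Λ ^ 3 := by linarith
  calc _ ≤ _ := h0
    _ ≤ K + Λ * (‖x‖ + (K + Λ * (‖x‖ + l2norm μ)) + Λ * Λ + 3 * Λ * (K + l2norm μ)) := by
        have := S.Λ_pos; gcongr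
    _ = 1 * K + Λ * (‖x‖ + K) + Λ ^ 2 * (‖x‖ + l2norm μ + 3 * (K + l2norm μ)) + Λ ^ 3 * 1 := by ring
    _ ≤ Λ ^ 3 * K + Λ ^ 3 * (‖x‖ + K) + Λ ^ 3 * (‖x‖ + l2norm μ + 3 * (K + l2norm μ))
        + Λ ^ 3 * K := by gcongr
    _ ≤ _ := by nlinarith [mul_nonneg h10 h6, mul_nonneg h10 h4, mul_nonneg h10 h5.le]

lemma integral_dμ_b_le (S : Setting P₀ T Λ α K c u) {t : ℝ} (ht : t ∈ Icc 0 T) (x : St d)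
    {μ : Measure (St d)} (hμ : IsP2 μ) :
    |∫ v, ⟪u.dμ t x μ v, c.b v (u.U t v μ) (u.graphLaw t μ)⟫_ℝ ∂μ|
      ≤ 12 * Λ ^ 3 * (K + l2norm μ) := by
  have := hμ.1
  have h1 := S.memLp_dμ ht x hμ
  have hb := S.memLp_b (S.isP2_graphLaw ht hμ) hμ.2 (S.memLp_U ht hμ hμ.2)
  have h2 := abs_integral_le_of_norm_le_mul
    (f := fun v => ⟪u.dμ t x μ v, c.b v (u.U t v μ) (u.graphLaw t μ)⟫_ℝ) h1.1.norm hb.norm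
    (ae_of_all _ fun v => abs_real_inner_le_norm _ _)
  rw [lpNorm_norm h1.1.1, lpNorm_norm hb.1] at h2
  have h3 : lpNorm (fun v => c.b (id v) (u.U t (id v) μ) (u.graphLaw t μ)) 2 μ
      ≤ 6 * Λ ^ 2 * (K + l2norm μ) + 6 * Λ ^ 2 * lpNorm id 2 μ :=
    lpNorm_le_of_affine (by norm_num) hμ.2
      (by have := l2norm_nonneg μ; have := S.K_pos; positivity) (by positivity)
      (ae_of_all _ fun v => (S.b_graph_growth ht v hμ).trans_eq (by simp only [id_eq]; ring))
  rw [hμ.lpNorm_id] at h3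
  have h4 := l2norm_nonneg μ
  have h5 := S.K_pos
  have h6 := S.Λ_pos
  calc _ ≤ _ := h2
    _ ≤ Λ * (6 * Λ ^ 2 * (K + l2norm μ) + 6 * Λ ^ 2 * l2norm μ) := by
        gcongr; exacts [lpNorm_nonneg, h1.2]
    _ ≤ _ := by nlinarith [pow_pos h6 3, mul_pos (pow_pos h6 3) h5]

lemma integral_dvdμ_a_le (S : Setting P₀ T Λ α K c u) {t : ℝ} (ht : t ∈ Icc 0 T) (x : St d)
    {μ : Measure (St d)} (hμ : IsP2 μ) :
    |∫ v, 1 / 2 * tr (u.dvdμ t x μ v ∘L c.a v μ) ∂μ| ≤ d * Λ ^ 3 := by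
  have := hμ.1
  have h1 := S.memLp_dvdμ ht x hμ
  have h0 := S.Λ_pos
  have h2 := abs_integral_le_of_norm_le_mul
    (f := fun v => 1 / 2 * tr (u.dvdμ t x μ v ∘L c.a v μ)) h1.1.norm
    (memLp_const (d * Λ ^ 2)) (ae_of_all _ fun v => by
      rw [abs_mul, abs_of_pos (by norm_num : (0:ℝ) < 1 / 2)]
      have e1 := abs_tr_le (u.dvdμ t x μ v ∘L c.a v μ)
      have e2 := ContinuousLinearMap.opNorm_comp_le (u.dvdμ t x μ v) (c.a v μ)
      have e3 := S.norm_a_le v hμ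
      have e4 : |tr (u.dvdμ t x μ v ∘L c.a v μ)| ≤ d * (‖u.dvdμ t x μ v‖ * Λ ^ 2) :=
        e1.trans (by gcongr; exact e2.trans (by gcongr))
      have := abs_nonneg (tr (u.dvdμ t x μ v ∘L c.a v μ))
      calc _ ≤ |tr (u.dvdμ t x μ v ∘L c.a v μ)| := by linarith
        _ ≤ _ := e4
        _ = _ := by ring)
  rw [lpNorm_norm h1.1.1] at h2
  have h3 : lpNorm (fun _ : St d => (d * Λ ^ 2 : ℝ)) 2 μ ≤ d * Λ ^ 2 :=
    lpNorm_le_const (by norm_num) (ae_of_all _ fun _ => (Real.norm_of_nonneg (by positivity)).le)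
  calc _ ≤ _ := h2
    _ ≤ Λ * (d * Λ ^ 2) := by gcongr; exacts [lpNorm_nonneg, h1.2]
    _ = _ := by ring

/-- The time derivative grows linearly, by the master equation. -/
lemma abs_dt_le (S : Setting P₀ T Λ α K c u) {t : ℝ} (ht : t ∈ Ico 0 T) (x : St d)
    {μ : Measure (St d)} (hμ : IsP2 μ) :
    |u.dt t x μ| ≤ (25 + 2 * d) * Λ ^ 3 * (K + ‖x‖ + l2norm μ) := by
  have ht' : t ∈ Icc 0 T := ⟨ht.1, ht.2.le⟩
  have h := S.h1.classical.master_eq t ht x μ hμ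
  have h0 := S.Λ_pos
  have hQ : 1 ≤ K + ‖x‖ + l2norm μ := by
    linarith [S.one_le_K, norm_nonneg x, l2norm_nonneg μ]
  have h1 : |⟪c.b x (u.U t x μ) (u.graphLaw t μ), u.dx t x μ⟫_ℝ|
      ≤ 6 * Λ ^ 3 * (K + ‖x‖ + l2norm μ) :=
    (abs_real_inner_le_norm _ _).trans <|
      (mul_le_mul (S.b_graph_growth ht' x hμ) (S.norm_dx_le ht' x hμ) (norm_nonneg _)
        (by positivity)).trans_eq (by ring)
  have h2 : |1 / 2 * tr (u.dxx t x μ ∘L c.a x μ)| ≤ d * Λ ^ 3 := by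
    rw [abs_mul, abs_of_pos (by norm_num : (0:ℝ) < 1 / 2)]
    have e1 := abs_tr_le (u.dxx t x μ ∘L c.a x μ)
    have e2 := ContinuousLinearMap.opNorm_comp_le (u.dxx t x μ) (c.a x μ)
    have e3 : |tr (u.dxx t x μ ∘L c.a x μ)| ≤ d * (Λ * Λ ^ 2) :=
      e1.trans (by
        gcongr
        exact e2.trans (mul_le_mul (S.norm_dxx_le ht' x hμ) (S.norm_a_le x hμ)
          (norm_nonneg _) h0.le))
    have := abs_nonneg (tr (u.dxx t x μ ∘L c.a x μ))
    calc _ ≤ |tr (u.dxx t x μ ∘L c.a x μ)| := by linarith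
      _ ≤ _ := e3
      _ = _ := by ring
  have h3 := S.f_graph_growth ht' x hμ
  have h4 := S.integral_dμ_b_le ht' x hμ
  have h5 := S.integral_dvdμ_a_le ht' x hμ
  have h6 : 12 * Λ ^ 3 * (K + l2norm μ) ≤ 12 * Λ ^ 3 * (K + ‖x‖ + l2norm μ) := by
    gcongr; linarith [norm_nonneg x]
  have h7 : d * Λ ^ 3 ≤ d * Λ ^ 3 * (K + ‖x‖ + l2norm μ) :=
    le_mul_of_one_le_right (by positivity) hQ
  have e : u.dt t x μ = -(⟪c.b x (u.U t x μ) (u.graphLaw t μ), u.dx t x μ⟫_ℝ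
      + 1 / 2 * tr (u.dxx t x μ ∘L c.a x μ)
      + c.f x (u.U t x μ) (c.σadj x μ (u.dx t x μ)) (u.graphLaw t μ)
      + ∫ v, ⟪u.dμ t x μ v, c.b v (u.U t v μ) (u.graphLaw t μ)⟫_ℝ ∂μ
      + ∫ v, 1 / 2 * tr (u.dvdμ t x μ v ∘L c.a v μ) ∂μ) := by linarith
  rw [e, abs_neg]
  refine (abs_add_le _ _).trans ?_
  refine (add_le_add_left ((abs_add_le _ _).trans (add_le_add_left ((abs_add_le _ _).trans
    (add_le_add_left (abs_add_le _ _) _)) _)) _).trans ?_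
  linarith

/-- The decoupling field is Lipschitz in time, with linear growth of the constant. -/
lemma U_lip_time (S : Setting P₀ T Λ α K c u) {t t' : ℝ} (ht : 0 ≤ t) (htt : t ≤ t') (ht' : t' ≤ T)
    (x : St d) {μ : Measure (St d)} (hμ : IsP2 μ) :
    |u.U t' x μ - u.U t x μ| ≤ (25 + 2 * d) * Λ ^ 3 * (K + ‖x‖ + l2norm μ) * (t' - t) := by
  have hd : ∀ s ∈ Ico t t', HasDerivWithinAt (fun s => u.U s x μ) (u.dt s x μ) (Icc t t') s :=
    fun s hs => (S.h1.classical.hasDeriv_t s ⟨ht.trans hs.1, hs.2.trans_le ht'⟩ x μ hμ).mono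
      (Icc_subset_Icc ht ht')
  refine norm_image_sub_le_of_norm_deriv_right_le_segment (f := fun s => u.U s x μ)
    (f' := fun s => u.dt s x μ) ?_ (fun s hs => ?_)
    (fun s hs => S.abs_dt_le ⟨ht.trans hs.1, hs.2.trans_le ht'⟩ x hμ) t' ⟨htt, le_rfl⟩
  · intro s hs
    -- The time derivative exists only before `T`. At the right end point, which may be `T`, left
    -- continuity comes from the Hölder bound.
    rcases hs.2.eq_or_lt with rfl | hlt
    · refine tendsto_iff_norm_sub_tendsto_zero.2 ?_
      have hc : Tendsto (fun r : ℝ => 2 * Λ * √(s - r) * (1 + ‖x‖ + l2norm μ)) (𝓝[Icc t s] s)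
          (𝓝 0) := by
        have : Continuous fun r : ℝ => 2 * Λ * √(s - r) * (1 + ‖x‖ + l2norm μ) := by fun_prop
        have h := this.tendsto s
        simp only [sub_self, Real.sqrt_zero, mul_zero, zero_mul] at h
        exact h.mono_left nhdsWithin_le_nhds
      refine squeeze_zero' (Eventually.of_forall fun _ => norm_nonneg _) ?_ hc
      filter_upwards [self_mem_nhdsWithin] with r hr
      have h := S.holder (ht.trans hr.1) hr.2 ht' x hμ
      have h2 := norm_nonneg (u.dx s x μ - u.dx r x μ)
      rw [norm_sub_rev, Real.norm_eq_abs]; linarith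
    · exact (hd s ⟨hs.1, hlt⟩).continuousWithinAt
  · exact (hd s hs).mono_of_mem_nhdsWithin
      (mem_of_superset (Icc_mem_nhdsGE hs.2) (Icc_subset_Icc_left hs.1))

end Setting

end MKV

/-! ### Chain rule along the path `X + r² B + r Θ` at time `t + r²` -/

namespace MKV

open Asymptotics

namespace Setting

variable {d : ℕ} {Ω₀ : Type*} {m₀ : MeasurableSpace Ω₀} {P₀ : Measure Ω₀} {T Λ α K : ℝ}
  {c : Coeffs d} {u : MasterField d}
  {Ω : Type*} [MeasurableSpace Ω] {P : Measure Ω}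

section Path

variable {X B Θ : Ω → St d}

lemma memLp_path {p : ℝ≥0∞} (hX : MemLp X p P) (hB : MemLp B p P) (hΘ : MemLp Θ p P) (r : ℝ) :
    MemLp (fun ω => X ω + r ^ 2 • B ω + r • Θ ω) p P :=
  (hX.add (hB.const_smul (r ^ 2))).add (hΘ.const_smul r)

variable [IsProbabilityMeasure P]

lemma isP2_path (hX : Measurable X) (hB : Measurable B) (hΘ : Measurable Θ)
    (hX2 : MemLp X 2 P) (hB2 : MemLp B 2 P) (hΘ2 : MemLp Θ 2 P) (r : ℝ) :
    IsP2 (P.map fun ω => X ω + r ^ 2 • B ω + r • Θ ω) :=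
  isP2_map (by fun_prop) (memLp_path hX2 hB2 hΘ2 r)

lemma lpNorm_path_sub_le (hB2 : MemLp B 2 P) (hΘ2 : MemLp Θ 2 P) (r r' : ℝ) :
    lpNorm (fun ω => (X ω + r' ^ 2 • B ω + r' • Θ ω) - (X ω + r ^ 2 • B ω + r • Θ ω)) 2 P
      ≤ |r' ^ 2 - r ^ 2| * lpNorm B 2 P + |r' - r| * lpNorm Θ 2 P := by
  have h := lpNorm_le_of_affine₂ (f := fun ω => (X ω + r' ^ 2 • B ω + r' • Θ ω)
      - (X ω + r ^ 2 • B ω + r • Θ ω)) (p := 2) (by norm_num) hB2 hΘ2 le_rfl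
    (abs_nonneg (r' ^ 2 - r ^ 2)) (abs_nonneg (r' - r)) (ae_of_all _ fun ω => by
      have e : (X ω + r' ^ 2 • B ω + r' • Θ ω) - (X ω + r ^ 2 • B ω + r • Θ ω)
        = (r' ^ 2 - r ^ 2) • B ω + (r' - r) • Θ ω := by module
      rw [e, zero_add]
      refine (norm_add_le _ _).trans_eq ?_
      rw [norm_smul, norm_smul, Real.norm_eq_abs, Real.norm_eq_abs])
  rwa [zero_add] at h

lemma W2_path_le (hX : Measurable X) (hB : Measurable B) (hΘ : Measurable Θ)
    (hX2 : MemLp X 2 P) (hB2 : MemLp B 2 P) (hΘ2 : MemLp Θ 2 P) (r r' : ℝ) :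
    W2 (P.map fun ω => X ω + r' ^ 2 • B ω + r' • Θ ω) (P.map fun ω => X ω + r ^ 2 • B ω + r • Θ ω)
      ≤ |r' ^ 2 - r ^ 2| * lpNorm B 2 P + |r' - r| * lpNorm Θ 2 P :=
  (W2_map_le (by fun_prop) (by fun_prop) (memLp_path hX2 hB2 hΘ2 r')
    (memLp_path hX2 hB2 hΘ2 r)).trans (lpNorm_path_sub_le hB2 hΘ2 r r')

lemma W2_nonneg (μ ν : Measure (St d)) : 0 ≤ W2 μ ν := ENNReal.toReal_nonneg

lemma tendsto_W2_path (hX : Measurable X) (hB : Measurable B) (hΘ : Measurable Θ)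
    (hX2 : MemLp X 2 P) (hB2 : MemLp B 2 P) (hΘ2 : MemLp Θ 2 P) (r : ℝ) :
    Tendsto (fun r' => W2 (P.map fun ω => X ω + r' ^ 2 • B ω + r' • Θ ω)
      (P.map fun ω => X ω + r ^ 2 • B ω + r • Θ ω)) (𝓝 r) (𝓝 0) := by
  have hc : Continuous fun r' => |r' ^ 2 - r ^ 2| * lpNorm B 2 P + |r' - r| * lpNorm Θ 2 P := by
    fun_prop
  have h := hc.tendsto r
  simp only [sub_self, abs_zero, zero_mul, add_zero] at h
  exact squeeze_zero (fun _ => W2_nonneg _ _) (fun r' => W2_path_le hX hB hΘ hX2 hB2 hΘ2 r r') h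

lemma tendsto_nhdsP2_path (hX : Measurable X) (hB : Measurable B) (hΘ : Measurable Θ)
    (hX2 : MemLp X 2 P) (hB2 : MemLp B 2 P) (hΘ2 : MemLp Θ 2 P) (r : ℝ) :
    Tendsto (fun r' => P.map fun ω => X ω + r' ^ 2 • B ω + r' • Θ ω) (𝓝 r)
      (nhdsP2 (P.map fun ω => X ω + r ^ 2 • B ω + r • Θ ω)) := by
  refine tendsto_iInf.2 fun ε => tendsto_principal.2 ?_
  have hc : Continuous fun r' => |r ^ 2 - r' ^ 2| * lpNorm B 2 P + |r - r'| * lpNorm Θ 2 P := by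
    fun_prop
  have h := hc.tendsto r
  simp only [sub_self, abs_zero, zero_mul, add_zero] at h
  filter_upwards [h.eventually_lt_const ε.2] with r' hr'
  exact ⟨isP2_path hX hB hΘ hX2 hB2 hΘ2 r', (W2_path_le hX hB hΘ hX2 hB2 hΘ2 r' r).trans_lt hr'⟩

/-- The error of the first order time expansion of `U`, uniformly along a path. -/
lemma time_expansion (S : Setting P₀ T Λ α K c u) (hX : Measurable X) (hB : Measurable B)
    (hΘ : Measurable Θ) (hX2 : MemLp X 2 P) (hB2 : MemLp B 2 P) (hΘ2 : MemLp Θ 2 P)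
    {t r : ℝ} (ht : 0 ≤ t) (hr : 0 ≤ r) (hrT : t + r ^ 2 < T) {x : ℝ → St d}
    (hx : Continuous x) {ε : ℝ} (hε : 0 < ε) :
    ∀ᶠ r' in 𝓝[Ici r] r,
      |u.U (t + r' ^ 2) (x r') (P.map fun ω => X ω + r' ^ 2 • B ω + r' • Θ ω)
        - u.U (t + r ^ 2) (x r') (P.map fun ω => X ω + r' ^ 2 • B ω + r' • Θ ω)
        - u.dt (t + r ^ 2) (x r) (P.map fun ω => X ω + r ^ 2 • B ω + r • Θ ω)
          * (r' ^ 2 - r ^ 2)| ≤ ε * |r' ^ 2 - r ^ 2| := by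
  set μ : ℝ → Measure (St d) := fun r' => P.map fun ω => X ω + r' ^ 2 • B ω + r' • Θ ω with hμ
  have hs0 : t + r ^ 2 ∈ Ico 0 T := ⟨by positivity, hrT⟩
  have hP2 : ∀ r', IsP2 (μ r') := isP2_path hX hB hΘ hX2 hB2 hΘ2
  -- Joint continuity of `dt` provides a neighbourhood in time, space and measure where it varies by
  -- at most `ε`. The mean value inequality is then used in time only, with point and measure frozen
  -- at `r'`.
  have hdt := S.h1.classical.cont_dt (t + r ^ 2) hs0 (x r) (μ r) (hP2 r)
  have hev := hdt.eventually (Metric.closedBall_mem_nhds _ hε)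
  obtain ⟨pa, hpa, pb, hpb, hp⟩ := eventually_prod_iff.1 hev
  have hpath : Tendsto (fun r' => (x r', μ r')) (𝓝 r) (𝓝 (x r) ×ˢ nhdsP2 (μ r)) :=
    (hx.tendsto r).prodMk (tendsto_nhdsP2_path hX hB hΘ hX2 hB2 hΘ2 r)
  have hpa' : ∀ᶠ s in 𝓝[Ici (t + r ^ 2)] (t + r ^ 2), pa s := by
    rw [← nhdsWithin_Ico_eq_nhdsGE hrT]
    exact nhdsWithin_mono _ (Ico_subset_Ico_left hs0.1) hpa
  obtain ⟨v, hv, hvsub⟩ := (mem_nhdsGE_iff_exists_Icc_subset).1 hpa'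
  have hcont : Tendsto (fun r' : ℝ => t + r' ^ 2) (𝓝 r) (𝓝 (t + r ^ 2)) := by
    have : Continuous fun r' : ℝ => t + r' ^ 2 := by fun_prop
    exact this.tendsto r
  filter_upwards [(hpath.eventually hpb).filter_mono nhdsWithin_le_nhds,
    (hcont.eventually_lt_const (show t + r ^ 2 < v from hv)).filter_mono nhdsWithin_le_nhds,
    (hcont.eventually_lt_const hrT).filter_mono nhdsWithin_le_nhds,
    self_mem_nhdsWithin] with r' h1 h2 h3 h4
  have hrr : r ^ 2 ≤ r' ^ 2 := pow_le_pow_left₀ hr h4 2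
  have hder : ∀ s ∈ Icc (t + r ^ 2) (t + r' ^ 2),
      HasDerivWithinAt (fun s => u.U s (x r') (μ r')
        - u.dt (t + r ^ 2) (x r) (μ r) * s)
        (u.dt s (x r') (μ r') - u.dt (t + r ^ 2) (x r) (μ r)) (Icc 0 T) s := by
    intro s hs
    have a := S.h1.classical.hasDeriv_t s ⟨hs0.1.trans hs.1, hs.2.trans_lt h3⟩ (x r') (μ r')
      (hP2 r')
    have b : HasDerivWithinAt (fun s => u.dt (t + r ^ 2) (x r) (μ r) * s)
        (u.dt (t + r ^ 2) (x r) (μ r)) (Icc 0 T) s := by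
      simpa using (hasDerivWithinAt_id s (Icc 0 T)).const_mul (u.dt (t + r ^ 2) (x r) (μ r))
    exact a.sub b
  have key := norm_image_sub_le_of_norm_deriv_right_le_segment (C := ε)
    (fun s hs => (hder s hs).continuousWithinAt.mono
      (Icc_subset_Icc hs0.1 h3.le))
    (fun s hs => (hder s ⟨hs.1, hs.2.le⟩).mono_of_mem_nhdsWithin
      (mem_of_superset (Icc_mem_nhdsGE (hs.2.trans h3)) (Icc_subset_Icc_left (hs0.1.trans hs.1))))
    (fun s hs => by
      have := hp (hvsub ⟨hs.1, hs.2.le.trans h2.le⟩) h1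
      simpa [Real.dist_eq] using this) (t + r' ^ 2) ⟨by linarith, le_rfl⟩
  rw [Real.norm_eq_abs] at key
  rw [abs_of_nonneg (show 0 ≤ r' ^ 2 - r ^ 2 by linarith)]
  calc _ = _ := by congr 1; ring
    _ ≤ _ := key
    _ = _ := by ring

/-- The chain rule for the decoupling field along a quadratic path. -/
lemma hasDerivWithinAt_path (S : Setting P₀ T Λ α K c u) [IsProbabilityMeasure P₀]
    (hX : Measurable X) (hB : Measurable B)
    (hΘ : Measurable Θ) (hX2 : MemLp X 2 P) (hB2 : MemLp B 2 P) (hΘ2 : MemLp Θ 2 P)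
    {t r : ℝ} (ht : 0 ≤ t) (hr : 0 ≤ r) (hrT : t + r ^ 2 < T) (x b θ : St d)
    {xr : St d} (hxr : xr = x + r ^ 2 • b + r • θ)
    {μ : Measure (St d)} (hμ : μ = P.map fun ω => X ω + r ^ 2 • B ω + r • Θ ω) :
    HasDerivWithinAt (fun r => u.U (t + r ^ 2) (x + r ^ 2 • b + r • θ)
        (P.map fun ω => X ω + r ^ 2 • B ω + r • Θ ω))
      (2 * r * u.dt (t + r ^ 2) xr μ + ⟪u.dx (t + r ^ 2) xr μ, (2 * r) • b + θ⟫_ℝ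
        + ∫ ω, ⟪u.dμ (t + r ^ 2) xr μ (X ω + r ^ 2 • B ω + r • Θ ω),
            (2 * r) • B ω + Θ ω⟫_ℝ ∂P) (Ici r) r := by
  subst hxr hμ
  set μ : ℝ → Measure (St d) := fun r' => P.map fun ω => X ω + r' ^ 2 • B ω + r' • Θ ω with hμ
  set x' : ℝ → St d := fun r' => x + r' ^ 2 • b + r' • θ with hx'
  have hs0 : t + r ^ 2 ∈ Icc 0 T := ⟨by positivity, hrT.le⟩
  have hP2 : ∀ r', IsP2 (μ r') := isP2_path hX hB hΘ hX2 hB2 hΘ2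
  have hxd : HasDerivAt x' ((2 * r) • b + θ) r := by
    have h1 : HasDerivAt (fun r : ℝ => r ^ 2 • b) ((2 * r) • b) r := by
      simpa using (hasDerivAt_pow 2 r).smul_const b
    have h2 : HasDerivAt (fun r : ℝ => r • θ) θ r := by
      simpa using (hasDerivAt_id r).smul_const θ
    exact (h1.const_add _).add h2
  have hsd : HasDerivAt (fun r : ℝ => r ^ 2) (2 * r) r := by simpa using hasDerivAt_pow 2 r
  have hIII : HasDerivAt (fun r' => u.U (t + r ^ 2) (x' r) (μ r'))
      (∫ ω, ⟪u.dμ (t + r ^ 2) (x' r) (μ r) (X ω + r ^ 2 • B ω + r • Θ ω),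
        (2 * r) • B ω + Θ ω⟫_ℝ ∂P) r :=
    (S.h1.classical.hasLionsDeriv _ hs0 (x' r)).hasDerivAt_quadratic S.atomless
      (fun μ hμ => (S.continuous_dμ hs0 _ hμ).measurable) hX hB hΘ hX2 hB2 hΘ2 r
  have hII : HasDerivAt (fun r' => ⟪u.dx (t + r ^ 2) (x' r) (μ r), x' r'⟫_ℝ)
      ⟪u.dx (t + r ^ 2) (x' r) (μ r), (2 * r) • b + θ⟫_ℝ r := by
    simpa using (hasDerivAt_const r (u.dx (t + r ^ 2) (x' r) (μ r))).inner ℝ hxd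
  have hI : HasDerivAt (fun r' => u.dt (t + r ^ 2) (x' r) (μ r) * r' ^ 2)
      (u.dt (t + r ^ 2) (x' r) (μ r) * (2 * r)) r := hsd.const_mul _
  -- The variables move one at a time. `R1` is the remainder in time, `R2` the remainder in space,
  -- and the increment in the measure is taken at the base time and point, where the Lions
  -- derivative is available. The gradient in `R2` is frozen at the base measure, which costs its
  -- Lipschitz constant in `W2`.
  let R1 : ℝ → ℝ := fun r' => u.U (t + r' ^ 2) (x' r') (μ r') - u.U (t + r ^ 2) (x' r') (μ r')
    - u.dt (t + r ^ 2) (x' r) (μ r) * (r' ^ 2 - r ^ 2)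
  let R2 : ℝ → ℝ := fun r' => u.U (t + r ^ 2) (x' r') (μ r') - u.U (t + r ^ 2) (x' r) (μ r')
    - ⟪u.dx (t + r ^ 2) (x' r) (μ r), x' r' - x' r⟫_ℝ
  have hR1 : R1 =o[𝓝[Ici r] r] fun r' => r' - r := by
    have h1 : R1 =o[𝓝[Ici r] r] fun r' => r' ^ 2 - r ^ 2 := by
      refine isLittleO_iff.2 fun ε hε => ?_
      exact S.time_expansion hX hB hΘ hX2 hB2 hΘ2 ht hr hrT
        (by fun_prop : Continuous x') hε
    exact h1.trans_isBigO (hsd.isBigO_sub.mono nhdsWithin_le_nhds)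
  have hR2 : R2 =o[𝓝[Ici r] r] fun r' => r' - r := by
    have h1 : R2 =O[𝓝 r] fun r' => ‖x' r' - x' r‖ * (Λ * ‖x' r' - x' r‖ + Λ * W2 (μ r') (μ r)) := by
      refine IsBigO.of_bound 1 (Eventually.of_forall fun r' => ?_)
      have e1 := (S.U_taylor hs0 (x' r) (x' r') (hP2 r')).2.2
      have e2 := S.dx_lip hs0 (x' r) (x' r) (hP2 r') (hP2 r)
      rw [sub_self, norm_zero, zero_add] at e2
      have e3 := abs_real_inner_le_norm (u.dx (t + r ^ 2) (x' r) (μ r')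
        - u.dx (t + r ^ 2) (x' r) (μ r)) (x' r' - x' r)
      rw [inner_sub_left] at e3
      have e4 := mul_le_mul_of_nonneg_right e2 (norm_nonneg (x' r' - x' r))
      have e5 := abs_sub_le (u.U (t + r ^ 2) (x' r') (μ r') - u.U (t + r ^ 2) (x' r) (μ r'))
        ⟪u.dx (t + r ^ 2) (x' r) (μ r'), x' r' - x' r⟫_ℝ
        ⟪u.dx (t + r ^ 2) (x' r) (μ r), x' r' - x' r⟫_ℝ
      rw [one_mul, Real.norm_eq_abs]
      refine le_trans ?_ (le_abs_self _)
      change |u.U (t + r ^ 2) (x' r') (μ r') - u.U (t + r ^ 2) (x' r) (μ r')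
        - ⟪u.dx (t + r ^ 2) (x' r) (μ r), x' r' - x' r⟫_ℝ| ≤ _
      calc _ ≤ _ := e5
        _ ≤ Λ * ‖x' r' - x' r‖ ^ 2 + Λ * W2 (μ r') (μ r) * ‖x' r' - x' r‖ := by linarith
        _ = _ := by ring
    have h2 : (fun r' => Λ * ‖x' r' - x' r‖ + Λ * W2 (μ r') (μ r)) =o[𝓝 r] fun _ => (1 : ℝ) := by
      refine (isLittleO_one_iff ℝ).2 ?_
      have a : Tendsto (fun r' => ‖x' r' - x' r‖) (𝓝 r) (𝓝 0) := by
        have hc : Continuous fun r' => ‖x' r' - x' r‖ := by fun_prop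
        simpa using hc.tendsto r
      simpa using (a.const_mul Λ).add
        ((tendsto_W2_path hX hB hΘ hX2 hB2 hΘ2 r).const_mul Λ)
    have h3 := (hxd.isBigO_sub.norm_left).mul_isLittleO h2
    simp only [mul_one] at h3
    exact (h1.trans_isLittleO h3).mono nhdsWithin_le_nhds
  have hR : HasDerivWithinAt (fun r' => R1 r' + R2 r') 0 (Ici r) r := by
    rw [hasDerivWithinAt_iff_isLittleO]
    have e : R1 r + R2 r = 0 := by simp [R1, R2]
    simpa [e] using hR1.add hR2
  have hsum := ((hIII.hasDerivWithinAt (s := Ici r)).add (hII.hasDerivWithinAt (s := Ici r))).add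
    ((hI.hasDerivWithinAt (s := Ici r)).add hR)
  have hfun : (fun r' => u.U (t + r' ^ 2) (x' r') (μ r')) = fun r' =>
      u.U (t + r ^ 2) (x' r) (μ r') + ⟪u.dx (t + r ^ 2) (x' r) (μ r), x' r'⟫_ℝ
      + (u.dt (t + r ^ 2) (x' r) (μ r) * r' ^ 2 + (R1 r' + R2 r'))
      + (- ⟪u.dx (t + r ^ 2) (x' r) (μ r), x' r⟫_ℝ
          - u.dt (t + r ^ 2) (x' r) (μ r) * r ^ 2) := by
    ext r'; simp only [R1, R2, inner_sub_right]; ring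
  change HasDerivWithinAt (fun r' => u.U (t + r' ^ 2) (x' r') (μ r')) _ _ _
  rw [hfun]
  refine (hsum.add_const _).congr_deriv ?_
  ring

/-- The path may end at time `T`, where no time derivative is available; continuity there rests on
the Hölder bound in time. -/
lemma continuousWithinAt_path (S : Setting P₀ T Λ α K c u)
    (hX : Measurable X) (hB : Measurable B)
    (hΘ : Measurable Θ) (hX2 : MemLp X 2 P) (hB2 : MemLp B 2 P) (hΘ2 : MemLp Θ 2 P)
    {t ρ : ℝ} (ht : 0 ≤ t) (hρT : t + ρ ^ 2 ≤ T) (x b θ : St d) :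
    ContinuousOn (fun r => u.U (t + r ^ 2) (x + r ^ 2 • b + r • θ)
        (P.map fun ω => X ω + r ^ 2 • B ω + r • Θ ω)) (Icc 0 ρ) := by
  intro r hr
  set μ : ℝ → Measure (St d) := fun r' => P.map fun ω => X ω + r' ^ 2 • B ω + r' • Θ ω with hμ
  set x' : ℝ → St d := fun r' => x + r' ^ 2 • b + r' • θ with hx'
  have hP2 : ∀ r', IsP2 (μ r') := isP2_path hX hB hΘ hX2 hB2 hΘ2
  have hT : ∀ r' ∈ Icc 0 ρ, t + r' ^ 2 ∈ Icc 0 T := fun r' h' => ⟨by positivity, by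
    have := pow_le_pow_left₀ h'.1 h'.2 2; linarith⟩
  have hbd : ∀ r' ∈ Icc 0 ρ, |u.U (t + r' ^ 2) (x' r') (μ r') - u.U (t + r ^ 2) (x' r) (μ r)|
      ≤ Λ * (‖x' r' - x' r‖ + W2 (μ r') (μ r))
        + 2 * Λ * √(|r' ^ 2 - r ^ 2|) * (1 + ‖x' r‖ + l2norm (μ r)) := by
    intro r' hr'
    have h1 := S.U_lip (hT r' hr') (x' r') (x' r) (hP2 r') (hP2 r)
    have h2 : |u.U (t + r' ^ 2) (x' r) (μ r) - u.U (t + r ^ 2) (x' r) (μ r)|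
        ≤ 2 * Λ * √(|r' ^ 2 - r ^ 2|) * (1 + ‖x' r‖ + l2norm (μ r)) := by
      rcases le_total r r' with h | h
      · have h3 := pow_le_pow_left₀ hr.1 h 2
        have h4 := S.holder (t := t + r ^ 2) (t' := t + r' ^ 2) (hT r hr).1 (by linarith)
          (hT r' hr').2 (x' r) (hP2 r)
        have h5 := norm_nonneg (u.dx (t + r' ^ 2) (x' r) (μ r) - u.dx (t + r ^ 2) (x' r) (μ r))
        rw [abs_of_nonneg (show 0 ≤ r' ^ 2 - r ^ 2 by linarith)]
        rw [add_sub_add_left_eq_sub] at h4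
        linarith
      · have h3 := pow_le_pow_left₀ hr'.1 h 2
        have h4 := S.holder (t := t + r' ^ 2) (t' := t + r ^ 2) (hT r' hr').1 (by linarith)
          (hT r hr).2 (x' r) (hP2 r)
        have h5 := norm_nonneg (u.dx (t + r ^ 2) (x' r) (μ r) - u.dx (t + r' ^ 2) (x' r) (μ r))
        rw [abs_sub_comm (r' ^ 2), abs_of_nonneg (show 0 ≤ r ^ 2 - r' ^ 2 by linarith),
          abs_sub_comm]
        rw [add_sub_add_left_eq_sub] at h4
        linarith
    have h3 := abs_sub_le (u.U (t + r' ^ 2) (x' r') (μ r')) (u.U (t + r' ^ 2) (x' r) (μ r))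
      (u.U (t + r ^ 2) (x' r) (μ r))
    linarith
  refine tendsto_iff_norm_sub_tendsto_zero.2 (squeeze_zero'
    (Eventually.of_forall fun _ => norm_nonneg _)
    (eventually_of_mem self_mem_nhdsWithin hbd) ?_)
  have a : Tendsto (fun r' => ‖x' r' - x' r‖) (𝓝 r) (𝓝 0) := by
    have : Continuous fun r' => ‖x' r' - x' r‖ := by fun_prop
    simpa using this.tendsto r
  have b : Tendsto (fun r' : ℝ => √(|r' ^ 2 - r ^ 2|)) (𝓝 r) (𝓝 0) := by
    have : Continuous fun r' : ℝ => √(|r' ^ 2 - r ^ 2|) := by fun_prop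
    simpa using this.tendsto r
  have e := ((a.add (tendsto_W2_path hX hB hΘ hX2 hB2 hΘ2 r)).const_mul Λ).add
    ((b.const_mul (2 * Λ)).mul_const (1 + ‖x' r‖ + l2norm (μ r)))
  simp only [add_zero, mul_zero, zero_mul] at e
  exact e.mono_left nhdsWithin_le_nhds

end Path

end Setting

end MKV

namespace MKV

/-! ### Finitely supported centred laws with identity covariance -/

/-- The weights `p` on the finite set `s` define a centred law with identity covariance, supported
in the ball of radius `Λ`. -/
structure IsDesign {d : ℕ} (Λ : ℝ) (s : Finset (St d)) (p : St d → ℝ) : Prop where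
  nonneg : ∀ z ∈ s, 0 ≤ p z
  sum_one : ∑ z ∈ s, p z = 1
  centred : ∑ z ∈ s, p z • z = 0
  cov : ∀ A : St d →L[ℝ] St d, ∑ z ∈ s, p z * ⟪A z, z⟫_ℝ = tr A
  bound : ∀ z ∈ s, ‖z‖ ≤ Λ

section Design

variable {d : ℕ} {Λ : ℝ} {s : Finset (St d)} {p : St d → ℝ}

lemma tr_comp_comm (A B : St d →L[ℝ] St d) : tr (A ∘L B) = tr (B ∘L A) :=
  LinearMap.trace_mul_comm ℝ A.toLinearMap B.toLinearMap

namespace IsDesign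

lemma sum_inner (hs : IsDesign Λ s p) (v : St d) : ∑ z ∈ s, p z * ⟪v, z⟫_ℝ = 0 := by
  have h := congrArg (fun w => ⟪v, w⟫_ℝ) hs.centred
  simpa [inner_sum, inner_smul_right] using h

/-- Identity covariance, tested on the rank one operator `x ↦ ⟪v, x⟫ w`, whose trace is `⟪v, w⟫`.
This is how the scheme recovers a gradient by correlating values with the noise. -/
lemma sum_inner_smul (hs : IsDesign Λ s p) (v : St d) : ∑ z ∈ s, (p z * ⟪v, z⟫_ℝ) • z = v := by
  refine ext_inner_right ℝ fun w => ?_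
  have h := hs.cov ((innerSL ℝ v).smulRight w)
  have ht : tr ((innerSL ℝ v).smulRight w) = ⟪v, w⟫_ℝ := by
    rw [tr, LinearMap.trace_eq_sum_inner _ (EuclideanSpace.basisFun (Fin d) ℝ)]
    rw [← (EuclideanSpace.basisFun (Fin d) ℝ).sum_inner_mul_inner v w]
    refine Finset.sum_congr rfl fun i _ => ?_
    simp [inner_smul_right]
  rw [ht] at h
  rw [← h, sum_inner_eq]
  refine Finset.sum_congr rfl fun z _ => ?_
  simp [inner_smul_left, real_inner_comm, mul_assoc]
where
  sum_inner_eq {w : St d} {s : Finset (St d)} {f : St d → ℝ} :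
      ⟪∑ z ∈ s, f z • z, w⟫_ℝ = ∑ z ∈ s, ⟪f z • z, w⟫_ℝ := by rw [_root_.sum_inner]

lemma abs_sum_le (hs : IsDesign Λ s p) {φ g : St d → ℝ} (h : ∀ z ∈ s, |φ z| ≤ g z) :
    |∑ z ∈ s, p z * φ z| ≤ ∑ z ∈ s, p z * g z := by
  refine (Finset.abs_sum_le_sum_abs _ _).trans (Finset.sum_le_sum fun z hz => ?_)
  rw [abs_mul, abs_of_nonneg (hs.nonneg z hz)]
  exact mul_le_mul_of_nonneg_left (h z hz) (hs.nonneg z hz)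

lemma abs_sum_le_const (hs : IsDesign Λ s p) {φ : St d → ℝ} {C : ℝ} (h : ∀ z ∈ s, |φ z| ≤ C) :
    |∑ z ∈ s, p z * φ z| ≤ C := by
  refine (hs.abs_sum_le h).trans_eq ?_
  rw [← Finset.sum_mul, hs.sum_one, one_mul]

lemma norm_sum_smul_le (hs : IsDesign Λ s p) {E : Type*} [NormedAddCommGroup E] [NormedSpace ℝ E]
    {φ : St d → E} {C : ℝ} (h : ∀ z ∈ s, ‖φ z‖ ≤ C) : ‖∑ z ∈ s, p z • φ z‖ ≤ C := by
  refine (norm_sum_le _ _).trans ?_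
  calc ∑ z ∈ s, ‖p z • φ z‖ ≤ ∑ z ∈ s, p z * C := Finset.sum_le_sum fun z hz => by
        rw [norm_smul, Real.norm_of_nonneg (hs.nonneg z hz)]
        exact mul_le_mul_of_nonneg_left (h z hz) (hs.nonneg z hz)
    _ = C := by rw [← Finset.sum_mul, hs.sum_one, one_mul]

lemma norm_image_le (hs : IsDesign Λ s p) (hΛ : 0 ≤ Λ) {S : St d →L[ℝ] St d} (hS : ‖S‖ ≤ Λ)
    {z : St d} (hz : z ∈ s) : ‖S z‖ ≤ Λ ^ 2 :=
  calc ‖S z‖ ≤ ‖S‖ * ‖z‖ := S.le_opNorm z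
    _ ≤ Λ * Λ := by gcongr; exact hs.bound z hz
    _ = Λ ^ 2 := by ring

/-- Second order expansion of the correlation of a vector field with the noise. -/
lemma expansion (hs : IsDesign Λ s p) (hΛ : 0 ≤ Λ) {S : St d →L[ℝ] St d} (hS : ‖S‖ ≤ Λ)
    {w : St d → St d} {w' : St d → St d →L[ℝ] St d} (hw : ∀ v, HasFDerivAt w (w' v) v)
    (x : St d) {r : ℝ} (hr : 0 ≤ r) {g : St d → ℝ} (hg0 : ∀ z ∈ s, 0 ≤ g z)
    (hg : ∀ z ∈ s, ∀ v ∈ segment ℝ x (x + r • S z), ‖w' v - w' x‖ ≤ g z * ‖v - x‖) :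
    |∑ z ∈ s, p z * (⟪w (x + r • S z), S z⟫_ℝ
        - r * tr (w' (x + r • S z) ∘L (S ∘L ContinuousLinearMap.adjoint S)))|
      ≤ (Λ ^ 6 + d * Λ ^ 4) * r ^ 2 * ∑ z ∈ s, p z * g z := by
  set A : St d →L[ℝ] St d := S ∘L ContinuousLinearMap.adjoint S with hA
  have hAn : ‖A‖ ≤ Λ ^ 2 := by
    calc ‖A‖ ≤ ‖S‖ * ‖ContinuousLinearMap.adjoint S‖ := ContinuousLinearMap.opNorm_comp_le _ _
      _ ≤ Λ * Λ := by rw [LinearIsometryEquiv.norm_map]; gcongr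
      _ = Λ ^ 2 := by ring
  -- The Taylor polynomial at `x` contributes nothing: the noise is centred, and identity covariance
  -- turns the quadratic term into the trace. Only the variation of `w'` on the segment remains.
  have hzero : ∑ z ∈ s, p z * (⟪w x, S z⟫_ℝ + r * (⟪w' x (S z), S z⟫_ℝ - tr (w' x ∘L A))) = 0 := by
    have h1 : ∑ z ∈ s, p z * ⟪w x, S z⟫_ℝ = 0 := by
      simpa [ContinuousLinearMap.adjoint_inner_left] using
        hs.sum_inner (ContinuousLinearMap.adjoint S (w x))
    have h2 : ∑ z ∈ s, p z * ⟪w' x (S z), S z⟫_ℝ = tr (w' x ∘L A) := by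
      have h := hs.cov (ContinuousLinearMap.adjoint S ∘L (w' x ∘L S))
      rw [tr_comp_comm, ContinuousLinearMap.comp_assoc] at h
      rw [← h]
      refine Finset.sum_congr rfl fun z _ => ?_
      simp [ContinuousLinearMap.adjoint_inner_left]
    have h3 : ∑ z ∈ s, p z * tr (w' x ∘L A) = tr (w' x ∘L A) := by
      rw [← Finset.sum_mul, hs.sum_one, one_mul]
    calc _ = ∑ z ∈ s, p z * ⟪w x, S z⟫_ℝ + r * (∑ z ∈ s, p z * ⟪w' x (S z), S z⟫_ℝ
          - ∑ z ∈ s, p z * tr (w' x ∘L A)) := by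
          rw [← Finset.sum_sub_distrib, Finset.mul_sum, ← Finset.sum_add_distrib]
          exact Finset.sum_congr rfl fun z _ => by ring
      _ = 0 := by rw [h1, h2, h3]; ring
  have hterm : ∀ z ∈ s, |(⟪w (x + r • S z), S z⟫_ℝ - r * tr (w' (x + r • S z) ∘L A))
      - (⟪w x, S z⟫_ℝ + r * (⟪w' x (S z), S z⟫_ℝ - tr (w' x ∘L A)))|
      ≤ (Λ ^ 6 + d * Λ ^ 4) * r ^ 2 * g z := by
    intro z hz
    have hSz := hs.norm_image_le hΛ hS hz
    have hd : ‖r • S z‖ ≤ r * Λ ^ 2 := by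
      rw [norm_smul, Real.norm_of_nonneg hr]; gcongr
    have hgz := hg0 z hz
    have h1 : ‖w (x + r • S z) - w x - w' x (r • S z)‖ ≤ g z * (r * Λ ^ 2) * (r * Λ ^ 2) := by
      have h := (convex_segment x (x + r • S z)).norm_image_sub_le_of_norm_hasFDerivWithin_le'
        (f := w) (φ := w' x) (C := g z * (r * Λ ^ 2)) (fun v _ => (hw v).hasFDerivWithinAt)
        (fun v hv => (hg z hz v hv).trans (by
          gcongr
          obtain ⟨a, b, ha, hb, hab, rfl⟩ := hv
          have e : a • x + b • (x + r • S z) - x = b • (r • S z) := by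
            rw [← eq_sub_iff_add_eq] at hab
            rw [hab]; module
          rw [e, norm_smul, Real.norm_of_nonneg hb]
          exact (mul_le_of_le_one_left (norm_nonneg _) (by linarith)).trans hd))
        (left_mem_segment ℝ x _) (right_mem_segment ℝ x _)
      rw [add_sub_cancel_left] at h
      exact h.trans (by gcongr)
    have h2 : |⟪w (x + r • S z) - w x - w' x (r • S z), S z⟫_ℝ|
        ≤ g z * (r * Λ ^ 2) * (r * Λ ^ 2) * Λ ^ 2 :=
      (abs_real_inner_le_norm _ _).trans (by gcongr)
    have h3 : |tr (w' (x + r • S z) ∘L A - w' x ∘L A)| ≤ d * (g z * (r * Λ ^ 2) * Λ ^ 2) := by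
      refine (abs_tr_le _).trans ?_
      gcongr
      rw [← ContinuousLinearMap.sub_comp]
      refine (ContinuousLinearMap.opNorm_comp_le _ _).trans ?_
      gcongr
      have := hg z hz _ (right_mem_segment ℝ x _)
      rw [add_sub_cancel_left] at this
      exact this.trans (by gcongr)
    rw [tr_sub] at h3
    have e : (⟪w (x + r • S z), S z⟫_ℝ - r * tr (w' (x + r • S z) ∘L A))
      - (⟪w x, S z⟫_ℝ + r * (⟪w' x (S z), S z⟫_ℝ - tr (w' x ∘L A)))
      = ⟪w (x + r • S z) - w x - w' x (r • S z), S z⟫_ℝ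
        - r * (tr (w' (x + r • S z) ∘L A) - tr (w' x ∘L A)) := by
      rw [inner_sub_left, inner_sub_left, map_smul, inner_smul_left]
      simp only [conj_trivial]; ring
    rw [e]
    refine (abs_sub _ _).trans ?_
    rw [abs_mul, abs_of_nonneg hr]
    calc _ ≤ g z * (r * Λ ^ 2) * (r * Λ ^ 2) * Λ ^ 2 + r * (d * (g z * (r * Λ ^ 2) * Λ ^ 2)) := by
          gcongr
      _ = _ := by ring
  have h := hs.abs_sum_le hterm
  simp only [mul_sub, Finset.sum_sub_distrib] at h hzero ⊢
  rw [hzero, sub_zero] at h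
  refine h.trans_eq ?_
  rw [Finset.mul_sum]
  exact Finset.sum_congr rfl fun z _ => by ring

end IsDesign

end Design

/-! ### Innovations -/

/-- `ζ` takes values in `s` and, given `G`, has the law with weights `p`. -/
structure IsInnovation {d : ℕ} {Ω : Type*} (G : MeasurableSpace Ω) {mΩ : MeasurableSpace Ω}
    (P : Measure Ω) (ζ : Ω → St d) (s : Finset (St d)) (p : St d → ℝ) : Prop where
  le : G ≤ mΩ
  measurable : Measurable ζ
  mem : ∀ ω, ζ ω ∈ s
  condExp : ∀ z ∈ s, P[(ζ ⁻¹' {z}).indicator (fun _ => (1 : ℝ)) | G] =ᵐ[P] fun _ => p z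

namespace IsInnovation

variable {d : ℕ} {Ω : Type*} {G mΩ : MeasurableSpace Ω} {P : Measure Ω} [IsProbabilityMeasure P]
  {ζ : Ω → St d} {s : Finset (St d)} {p : St d → ℝ}
  {E : Type*} [NormedAddCommGroup E] [NormedSpace ℝ E] [CompleteSpace E]

/-- Since `ζ` takes finitely many values, the integrand is a finite sum of indicators times
`G`-measurable factors, which leave the conditional expectation. -/
lemma condExp_comp (hζ : IsInnovation G P ζ s p) {ψ : St d → Ω → E}
    (hψ : ∀ z ∈ s, StronglyMeasurable[G] (ψ z)) (hint : Integrable (fun ω => ψ (ζ ω) ω) P) :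
    P[fun ω => ψ (ζ ω) ω | G] =ᵐ[P] fun ω => ∑ z ∈ s, p z • ψ z ω := by
  classical
  have hms : ∀ z, MeasurableSet (ζ ⁻¹' {z}) := fun z => hζ.measurable (measurableSet_singleton z)
  have hterm : ∀ z, (ζ ⁻¹' {z}).indicator (fun _ => (1 : ℝ)) • ψ z
      = (ζ ⁻¹' {z}).indicator fun ω => ψ (ζ ω) ω := by
    intro z; ext1 ω
    by_cases h : ζ ω = z
    · simp [h]
    · simp [h]
  have hsum : (fun ω => ψ (ζ ω) ω) = ∑ z ∈ s, (ζ ⁻¹' {z}).indicator (fun _ => (1 : ℝ)) • ψ z := by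
    ext1 ω
    rw [Finset.sum_apply, Finset.sum_eq_single (ζ ω)]
    · simp
    · intro z _ hz; simp [hz.symm]
    · intro h; exact absurd (hζ.mem ω) h
  have hi : ∀ z ∈ s, Integrable ((ζ ⁻¹' {z}).indicator (fun _ => (1 : ℝ)) • ψ z) P := fun z _ => by
    rw [hterm]; exact hint.indicator (hms z)
  have h1 : ∀ z ∈ s, P[(ζ ⁻¹' {z}).indicator (fun _ => (1 : ℝ)) • ψ z | G]
      =ᵐ[P] fun ω => p z • ψ z ω := by
    intro z hz
    have h := condExp_smul_of_aestronglyMeasurable_right (m := G)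
      ((integrable_const (1 : ℝ)).indicator (hms z)) (hi z hz) (hψ z hz).aestronglyMeasurable
    filter_upwards [h, hζ.condExp z hz] with ω e1 e2
    rw [e1, Pi.smul_apply', e2]
  rw [hsum]
  refine (condExp_finsetSum hi G).trans ?_
  have h2 : ∀ᵐ ω ∂P, ∀ z ∈ s, P[(ζ ⁻¹' {z}).indicator (fun _ => (1 : ℝ)) • ψ z | G] ω
      = p z • ψ z ω := (ae_ball_iff s.countable_toSet).2 h1
  filter_upwards [h2] with ω hω
  rw [Finset.sum_apply]
  exact Finset.sum_congr rfl fun z hz => hω z hz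

lemma integral_comp (hζ : IsInnovation G P ζ s p) {ψ : St d → Ω → E}
    (hψ : ∀ z ∈ s, StronglyMeasurable[G] (ψ z)) (hint : Integrable (fun ω => ψ (ζ ω) ω) P) :
    Integrable (fun ω => ∑ z ∈ s, p z • ψ z ω) P ∧
      ∫ ω, ψ (ζ ω) ω ∂P = ∫ ω, ∑ z ∈ s, p z • ψ z ω ∂P := by
  have h := hζ.condExp_comp hψ hint
  refine ⟨integrable_condExp.congr h, ?_⟩
  rw [← integral_congr_ae h, integral_condExp hζ.le]

end IsInnovation

/-! ### Quantised Gaussian increments -/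

section Quantiser

variable {d : ℕ} {Λ : ℝ} {Γ : St d → St d}

/-- The support of the quantised law. -/
noncomputable def IsQuantiser.support (hΓ : IsQuantiser Λ Γ) : Finset (St d) :=
  hΓ.finite_range.toFinset

/-- The weights of the quantised law. -/
noncomputable def quantiserWeight (Γ : St d → St d) (z : St d) : ℝ :=
  (stdGaussian (St d)).real (Γ ⁻¹' {z})

lemma IsQuantiser.integral_comp (hΓ : IsQuantiser Λ Γ) {E : Type*} [NormedAddCommGroup E]
    [NormedSpace ℝ E] [CompleteSpace E] (φ : St d → E) :
    ∫ w, φ (Γ w) ∂(stdGaussian (St d)) = ∑ z ∈ hΓ.support, quantiserWeight Γ z • φ z := by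
  classical
  have hms : ∀ z, MeasurableSet (Γ ⁻¹' {z}) := fun z => hΓ.measurable (measurableSet_singleton z)
  have hsum : (fun w => φ (Γ w)) = fun w => ∑ z ∈ hΓ.support,
      (Γ ⁻¹' {z}).indicator (fun _ => φ z) w := by
    ext1 w
    rw [Finset.sum_eq_single (Γ w)]
    · simp
    · intro z _ hz; simp [hz.symm]
    · intro h; exact absurd (by simp [IsQuantiser.support]) h
  rw [hsum, integral_finsetSum _ fun z _ => (integrable_const (φ z)).indicator (hms z)]
  exact Finset.sum_congr rfl fun z _ => integral_indicator_const _ (hms z)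

lemma IsQuantiser.isDesign (hΓ : IsQuantiser Λ Γ) :
    IsDesign Λ hΓ.support (quantiserWeight Γ) where
  nonneg z _ := measureReal_nonneg
  sum_one := by simpa using (hΓ.integral_comp fun _ => (1 : ℝ)).symm
  centred := by rw [← hΓ.integral_comp fun z => z]; exact hΓ.centred
  bound z hz := by
    simp only [IsQuantiser.support, Finite.mem_toFinset] at hz
    obtain ⟨w, rfl⟩ := hz
    exact hΓ.bounded w
  cov A := by
    have hc : ∀ i j : Fin d, ∑ z ∈ hΓ.support, quantiserWeight Γ z * (z i * z j)
        = if i = j then 1 else 0 := fun i j => by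
      rw [← hΓ.covariance i j]; exact (hΓ.integral_comp fun z => z i * z j).symm
    let e := EuclideanSpace.basisFun (Fin d) ℝ
    have hz : ∀ z : St d, ⟪A z, z⟫_ℝ = ∑ i, ∑ j, (z j * z i) * ⟪e i, A (e j)⟫_ℝ := by
      intro z
      have h1 : z = ∑ j, z j • e j := by
        conv_lhs => rw [← e.sum_repr z]
        simp [e]
      rw [← e.sum_inner_mul_inner (A z) z]
      refine Finset.sum_congr rfl fun i _ => ?_
      have h2 : ⟪e i, z⟫_ℝ = z i := by
        rw [← e.repr_apply_apply]; simp [e]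
      have h3 : ⟪A z, e i⟫_ℝ = ∑ j, z j * ⟪e i, A (e j)⟫_ℝ := by
        conv_lhs => rw [h1]
        rw [map_sum, sum_inner]
        refine Finset.sum_congr rfl fun j _ => ?_
        rw [map_smul, inner_smul_left, real_inner_comm]; rfl
      rw [h2, h3, Finset.sum_mul]
      exact Finset.sum_congr rfl fun j _ => by ring
    have htr : tr A = ∑ i, ⟪e i, A (e i)⟫_ℝ := LinearMap.trace_eq_sum_inner A.toLinearMap e
    calc ∑ z ∈ hΓ.support, quantiserWeight Γ z * ⟪A z, z⟫_ℝ
        = ∑ z ∈ hΓ.support, ∑ i, ∑ j,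
            (quantiserWeight Γ z * (z j * z i)) * ⟪e i, A (e j)⟫_ℝ := by
          refine Finset.sum_congr rfl fun z _ => ?_
          rw [hz, Finset.mul_sum]
          refine Finset.sum_congr rfl fun i _ => ?_
          rw [Finset.mul_sum]
          exact Finset.sum_congr rfl fun j _ => by ring
      _ = ∑ i, ∑ j, (∑ z ∈ hΓ.support, quantiserWeight Γ z * (z j * z i)) * ⟪e i, A (e j)⟫_ℝ := by
          rw [Finset.sum_comm]
          refine Finset.sum_congr rfl fun i _ => ?_
          rw [Finset.sum_comm]
          exact Finset.sum_congr rfl fun j _ => by rw [Finset.sum_mul]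
      _ = tr A := by
          rw [htr]
          refine Finset.sum_congr rfl fun i _ => ?_
          simp [hc]

/-- The normalised quantised increments of a Brownian motion are innovations. -/
lemma IsBrownianMotion.isInnovation {Ω : Type*} {mΩ : MeasurableSpace Ω} {P : Measure Ω}
    [IsProbabilityMeasure P] {F : Filtration ℝ mΩ} {T : ℝ} {W : ℝ → Ω → St d}
    (hW : IsBrownianMotion P F T W) (hΓ : IsQuantiser Λ Γ) {t t' : ℝ} (ht : t ∈ Icc 0 T)
    (ht' : t' ∈ Icc 0 T) (htt : t < t') :
    IsInnovation (F t) P (fun ω => Γ ((√(t' - t))⁻¹ • (W t' ω - W t ω))) hΓ.support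
      (quantiserWeight Γ) := by
  have hm' : Measurable fun ω => W t' ω - W t ω :=
    ((hW.adapted t' ht').mono (F.le t') le_rfl).sub ((hW.adapted t ht).mono (F.le t) le_rfl)
  have hm : Measurable fun ω => (√(t' - t))⁻¹ • (W t' ω - W t ω) :=
    (measurable_const_smul _).comp hm'
  refine ⟨F.le t, hΓ.measurable.comp hm, fun ω => by simp [IsQuantiser.support], fun z _ => ?_⟩
  have hset : MeasurableSet[MeasurableSpace.comap (fun ω => W t' ω - W t ω) inferInstance]
      ((fun ω => Γ ((√(t' - t))⁻¹ • (W t' ω - W t ω))) ⁻¹' {z}) :=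
    ⟨(fun w => Γ ((√(t' - t))⁻¹ • w)) ⁻¹' {z},
      (hΓ.measurable.comp (measurable_const_smul _)) (measurableSet_singleton z), rfl⟩
  have h := condExp_indep_eq (μ := P) hm'.comap_le (F.le t)
    ((stronglyMeasurable_const (b := (1 : ℝ))).indicator hset) (hW.indep t ht t' ht' htt)
  refine h.trans (Eventually.of_forall fun ω => ?_)
  have e1 : P.real ((fun ω => Γ ((√(t' - t))⁻¹ • (W t' ω - W t ω))) ⁻¹' {z})
      = quantiserWeight Γ z := by
    rw [quantiserWeight, ← hW.gaussian t ht t' ht' htt, map_measureReal_apply hm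
      (hΓ.measurable (measurableSet_singleton z))]
    rfl
  dsimp only
  rw [integral_indicator_const _ (hm'.comap_le _ hset), e1, smul_eq_mul, mul_one]

end Quantiser

end MKV

namespace MKV

/-! ### One step of the forward scheme -/

/-- The data of one step of the forward scheme, of length `h` from time `t`: the state `(X, Y)` is
`G`-measurable, `B` is the drift and `Θ` the normalised noise. -/
structure IsStep {d : ℕ} {Ω : Type*} (G : MeasurableSpace Ω) {mΩ : MeasurableSpace Ω}
    (P : Measure Ω) (Λ T : ℝ) (c : Coeffs d) (s : Finset (St d)) (p : St d → ℝ) (t h : ℝ)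
    (X : Ω → St d) (Y : Ω → ℝ) (ζ B Θ : Ω → St d) : Prop where
  meas_X : Measurable[G] X
  meas_Y : Measurable[G] Y
  memLp_X : MemLp X 2 P
  memLp_Y : MemLp Y 2 P
  innov : IsInnovation G P ζ s p
  design : IsDesign Λ s p
  B_eq : B = fun ω => c.b (X ω) (Y ω) (P.map fun ω => (X ω, Y ω))
  Θ_eq : Θ = fun ω => c.σ (X ω) (P.map X) (ζ ω)
  t_nonneg : 0 ≤ t
  h_pos : 0 < h
  h_le_one : h ≤ 1
  le_T : t + h ≤ T

namespace IsStep

variable {d : ℕ} {Ω₀ : Type*} {m₀ : MeasurableSpace Ω₀} {P₀ : Measure Ω₀} {T Λ α K : ℝ}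
  {c : Coeffs d} {u : MasterField d}
  {Ω : Type*} {G mΩ : MeasurableSpace Ω} {P : Measure Ω} [IsProbabilityMeasure P]
  {s : Finset (St d)} {p : St d → ℝ} {t h : ℝ} {X : Ω → St d} {Y : Ω → ℝ} {ζ B Θ : Ω → St d}

lemma measurable_X (D : IsStep G P Λ T c s p t h X Y ζ B Θ) : Measurable X :=
  D.meas_X.mono D.innov.le le_rfl

lemma measurable_Y (D : IsStep G P Λ T c s p t h X Y ζ B Θ) : Measurable Y :=
  D.meas_Y.mono D.innov.le le_rfl

lemma t_mem (D : IsStep G P Λ T c s p t h X Y ζ B Θ) : t ∈ Icc 0 T :=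
  ⟨D.t_nonneg, by linarith [D.le_T, D.h_pos]⟩

lemma isP2 (D : IsStep G P Λ T c s p t h X Y ζ B Θ) : IsP2 (P.map X) :=
  isP2_map D.measurable_X D.memLp_X

lemma isP2_joint (D : IsStep G P Λ T c s p t h X Y ζ B Θ) : IsP2 (P.map fun ω => (X ω, Y ω)) :=
  isP2_prod D.measurable_X D.measurable_Y D.memLp_X D.memLp_Y

lemma l2norm_eq (D : IsStep G P Λ T c s p t h X Y ζ B Θ) : l2norm (P.map X) = lpNorm X 2 P :=
  l2norm_map D.measurable_X

lemma meas_B (D : IsStep G P Λ T c s p t h X Y ζ B Θ) (S : Setting P₀ T Λ α K c u) :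
    Measurable[G] B := by
  rw [D.B_eq]
  exact (S.continuous_b D.isP2_joint).measurable.comp (D.meas_X.prodMk D.meas_Y)

lemma measurable_B (D : IsStep G P Λ T c s p t h X Y ζ B Θ) (S : Setting P₀ T Λ α K c u) :
    Measurable B := (D.meas_B S).mono D.innov.le le_rfl

lemma measurable_Θ (D : IsStep G P Λ T c s p t h X Y ζ B Θ) (S : Setting P₀ T Λ α K c u) :
    Measurable Θ := by
  rw [D.Θ_eq]
  have h1 : Continuous fun q : (St d →L[ℝ] St d) × St d => q.1 q.2 := by fun_prop
  exact h1.measurable.comp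
    (((S.continuous_σ D.isP2).measurable.comp D.measurable_X).prodMk D.innov.measurable)

lemma norm_Θ_le (D : IsStep G P Λ T c s p t h X Y ζ B Θ) (S : Setting P₀ T Λ α K c u) (ω : Ω) :
    ‖Θ ω‖ ≤ Λ ^ 2 := by
  rw [D.Θ_eq]
  exact D.design.norm_image_le S.Λ_pos.le (S.h0.bound_σ _ _ D.isP2) (D.innov.mem ω)

lemma memLp_Θ (D : IsStep G P Λ T c s p t h X Y ζ B Θ) (S : Setting P₀ T Λ α K c u) (q : ℝ≥0∞) :
    MemLp Θ q P :=
  MemLp.of_bound (D.measurable_Θ S).aestronglyMeasurable (Λ ^ 2) (ae_of_all _ (D.norm_Θ_le S))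

lemma lpNorm_Θ_le (D : IsStep G P Λ T c s p t h X Y ζ B Θ) (S : Setting P₀ T Λ α K c u) :
    lpNorm Θ 2 P ≤ Λ ^ 2 := lpNorm_le_const (by norm_num) (ae_of_all _ (D.norm_Θ_le S))

lemma memLp_B (D : IsStep G P Λ T c s p t h X Y ζ B Θ) (S : Setting P₀ T Λ α K c u) {q : ℝ≥0∞}
    (hX : MemLp X q P) (hY : MemLp Y q P) : MemLp B q P := by
  rw [D.B_eq]; exact S.memLp_b D.isP2_joint hX hY

lemma memLp_B_two (D : IsStep G P Λ T c s p t h X Y ζ B Θ) (S : Setting P₀ T Λ α K c u) :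
    MemLp B 2 P := D.memLp_B S D.memLp_X D.memLp_Y

lemma memLp_err (D : IsStep G P Λ T c s p t h X Y ζ B Θ) (S : Setting P₀ T Λ α K c u) {q : ℝ≥0∞}
    (hX : MemLp X q P) (hY : MemLp Y q P) :
    MemLp (fun ω => u.U t (X ω) (P.map X) - Y ω) q P :=
  (S.memLp_U D.t_mem D.isP2 hX).sub hY

/-- The drift is bounded in terms of the state and the error. -/
lemma norm_B_le (D : IsStep G P Λ T c s p t h X Y ζ B Θ) (S : Setting P₀ T Λ α K c u) (ω : Ω) :
    ‖B ω‖ ≤ 4 * Λ ^ 2 * (K + lpNorm X 2 P + lpNorm (fun ω => u.U t (X ω) (P.map X) - Y ω) 2 P)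
      + 4 * Λ ^ 2 * ‖X ω‖ + 4 * Λ ^ 2 * ‖u.U t (X ω) (P.map X) - Y ω‖ := by
  set e : Ω → ℝ := fun ω => u.U t (X ω) (P.map X) - Y ω with he
  have h0 := S.one_le_Λ
  have hK := S.K_pos
  -- `Y` is rewritten as the field minus the error, because the error is the quantity controlled
  -- along the scheme.
  have hY : lpNorm Y 2 P ≤ lpNorm (fun ω => u.U t (X ω) (P.map X)) 2 P + lpNorm e 2 P := by
    have := lpNorm_sub_le (S.memLp_U D.t_mem D.isP2 D.memLp_X) (by norm_num : (1 : ℝ≥0∞) ≤ 2)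
      (g := e)
    have e1 : (fun ω => u.U t (X ω) (P.map X)) - e = Y := by ext ω; simp [he]
    rwa [e1] at this
  have hU := S.lpNorm_U_le D.t_mem D.isP2 (by norm_num : (1 : ℝ≥0∞) ≤ 2) D.memLp_X
  rw [D.l2norm_eq] at hU
  have hW := W2joint_map_dirac_le D.measurable_X D.measurable_Y D.memLp_X D.memLp_Y
  have hy : |Y ω| ≤ ‖e ω‖ + (K + Λ * (‖X ω‖ + lpNorm X 2 P)) := by
    have h1 := S.U_growth D.t_mem (X ω) D.isP2
    rw [D.l2norm_eq] at h1
    have h2 := abs_sub (u.U t (X ω) (P.map X)) (e ω)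
    have e1 : u.U t (X ω) (P.map X) - e ω = Y ω := by simp [he]
    rw [e1] at h2
    rw [Real.norm_eq_abs]; linarith
  have hb := S.b_growth (X ω) (Y ω) D.isP2_joint
  rw [D.B_eq]
  have hN := lpNorm_nonneg (f := X) (p := 2) (μ := P)
  have hε := lpNorm_nonneg (f := e) (p := 2) (μ := P)
  have hx := norm_nonneg (X ω)
  have hee := norm_nonneg (e ω)
  have h2 : Λ ≤ Λ ^ 2 := by nlinarith
  have h3 : 1 ≤ Λ ^ 2 := by nlinarith
  set N := lpNorm X 2 P
  calc _ ≤ _ := hb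
    _ ≤ K + Λ * (‖X ω‖ + (‖e ω‖ + (K + Λ * (‖X ω‖ + N)))
        + (N + ((K + Λ * (N + N)) + lpNorm e 2 P))) := by
        gcongr
        exact hW.trans (by gcongr; exact hY.trans (by gcongr))
    _ = 1 * K + Λ * (‖X ω‖ + ‖e ω‖ + K + N + K + lpNorm e 2 P) + Λ ^ 2 * (‖X ω‖ + 3 * N) := by ring
    _ ≤ Λ ^ 2 * K + Λ ^ 2 * (‖X ω‖ + ‖e ω‖ + K + N + K + lpNorm e 2 P)
        + Λ ^ 2 * (‖X ω‖ + 3 * N) := by gcongr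
    _ ≤ _ := by
        have hp : 0 ≤ Λ ^ 2 := by positivity
        nlinarith [mul_nonneg hp hx, mul_nonneg hp hee, mul_nonneg hp hK.le, mul_nonneg hp hN,
          mul_nonneg hp hε]

lemma lpNorm_B_le (D : IsStep G P Λ T c s p t h X Y ζ B Θ) (S : Setting P₀ T Λ α K c u)
    {q : ℝ≥0∞} (hq : 1 ≤ q) (hX : MemLp X q P) (hY : MemLp Y q P) :
    lpNorm B q P ≤ 4 * Λ ^ 2 * (K + lpNorm X 2 P
      + lpNorm (fun ω => u.U t (X ω) (P.map X) - Y ω) 2 P) + 4 * Λ ^ 2 * lpNorm X q P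
      + 4 * Λ ^ 2 * lpNorm (fun ω => u.U t (X ω) (P.map X) - Y ω) q P := by
  have hK := S.K_pos
  have hN := lpNorm_nonneg (f := X) (p := 2) (μ := P)
  have hε := lpNorm_nonneg (f := fun ω => u.U t (X ω) (P.map X) - Y ω) (p := 2) (μ := P)
  exact lpNorm_le_of_affine₂ hq hX (D.memLp_err S hX hY) (by positivity) (by positivity)
    (by positivity) (ae_of_all _ (D.norm_B_le S))

section Path

variable {r : ℝ}

lemma isP2_path (D : IsStep G P Λ T c s p t h X Y ζ B Θ) (S : Setting P₀ T Λ α K c u) (r : ℝ) :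
    IsP2 (P.map fun ω => X ω + r ^ 2 • B ω + r • Θ ω) :=
  Setting.isP2_path D.measurable_X (D.measurable_B S) (D.measurable_Θ S) D.memLp_X
    (D.memLp_B_two S) (D.memLp_Θ S 2) r

lemma measurable_path (D : IsStep G P Λ T c s p t h X Y ζ B Θ) (S : Setting P₀ T Λ α K c u)
    (r : ℝ) : Measurable fun ω => X ω + r ^ 2 • B ω + r • Θ ω := by
  have h1 := D.measurable_X
  have h2 := D.measurable_B S
  have h3 := D.measurable_Θ S
  fun_prop

lemma memLp_path (D : IsStep G P Λ T c s p t h X Y ζ B Θ) (S : Setting P₀ T Λ α K c u)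
    (r : ℝ) : MemLp (fun ω => X ω + r ^ 2 • B ω + r • Θ ω) 2 P :=
  Setting.memLp_path D.memLp_X (D.memLp_B_two S) (D.memLp_Θ S 2) r

lemma time_mem (D : IsStep G P Λ T c s p t h X Y ζ B Θ) (hr : r ^ 2 ≤ h) :
    t + r ^ 2 ∈ Icc 0 T := ⟨by have := D.t_nonneg; positivity, by linarith [D.le_T]⟩

lemma r_sq_le (D : IsStep G P Λ T c s p t h X Y ζ B Θ) (hr0 : 0 ≤ r) (hr : r ^ 2 ≤ h) :
    r ≤ 1 ∧ r ^ 2 ≤ r := by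
  have h1 : r ≤ 1 := by nlinarith [D.h_le_one]
  exact ⟨h1, by nlinarith⟩

lemma norm_point_sub_le (D : IsStep G P Λ T c s p t h X Y ζ B Θ) (S : Setting P₀ T Λ α K c u)
    (hr0 : 0 ≤ r) (hr : r ^ 2 ≤ h) (ω : Ω) {z : St d} (hz : z ∈ s) :
    ‖X ω - (X ω + r ^ 2 • B ω + r • c.σ (X ω) (P.map X) z)‖ ≤ r * (‖B ω‖ + Λ ^ 2) := by
  have h1 := D.design.norm_image_le S.Λ_pos.le (S.h0.bound_σ (X ω) _ D.isP2) hz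
  have h2 := (D.r_sq_le hr0 hr).2
  have e : X ω - (X ω + r ^ 2 • B ω + r • c.σ (X ω) (P.map X) z)
      = -(r ^ 2 • B ω + r • c.σ (X ω) (P.map X) z) := by abel
  rw [e, norm_neg]
  refine (norm_add_le _ _).trans ?_
  rw [norm_smul, norm_smul, Real.norm_of_nonneg hr0, Real.norm_of_nonneg (sq_nonneg r), mul_add]
  gcongr

lemma lpNorm_X_sub_path_le (D : IsStep G P Λ T c s p t h X Y ζ B Θ) (S : Setting P₀ T Λ α K c u)
    (hr0 : 0 ≤ r) (hr : r ^ 2 ≤ h) :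
    lpNorm (fun ω => X ω - (X ω + r ^ 2 • B ω + r • Θ ω)) 2 P ≤ r * (lpNorm B 2 P + Λ ^ 2) := by
  have h1 := Setting.lpNorm_path_sub_le (X := X) (D.memLp_B_two S) (D.memLp_Θ S 2) r 0
  have h2 := (D.r_sq_le hr0 hr).2
  have h3 := D.lpNorm_Θ_le S
  have h4 : lpNorm B 2 P ≥ 0 := lpNorm_nonneg
  simp only [ne_eq, OfNat.ofNat_ne_zero, not_false_eq_true, zero_pow, zero_smul, add_zero,
    zero_sub, abs_neg, abs_of_nonneg hr0, abs_of_nonneg (sq_nonneg r)] at h1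
  refine h1.trans ?_
  rw [mul_add]
  gcongr

lemma W2_X_path_le (D : IsStep G P Λ T c s p t h X Y ζ B Θ) (S : Setting P₀ T Λ α K c u)
    (hr0 : 0 ≤ r) (hr : r ^ 2 ≤ h) :
    W2 (P.map X) (P.map fun ω => X ω + r ^ 2 • B ω + r • Θ ω) ≤ r * (lpNorm B 2 P + Λ ^ 2) :=
  (W2_map_le D.measurable_X (D.measurable_path S r) D.memLp_X (D.memLp_path S r)).trans
    (D.lpNorm_X_sub_path_le S hr0 hr)

/-- Variation of the decoupling field and its gradient along the path. -/
lemma U_path_sub_le (D : IsStep G P Λ T c s p t h X Y ζ B Θ) (S : Setting P₀ T Λ α K c u)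
    (hr0 : 0 ≤ r) (hr : r ^ 2 ≤ h) (x x' : St d) {b : ℝ} (hb : 0 ≤ b)
    (hx : ‖x - x'‖ ≤ r * (b + Λ ^ 2)) :
    |u.U t x (P.map X) - u.U (t + r ^ 2) x' (P.map fun ω => X ω + r ^ 2 • B ω + r • Θ ω)|
        ≤ 4 * Λ ^ 3 * (r * (1 + ‖x‖ + b + lpNorm X 2 P + lpNorm B 2 P)) ∧
    ‖u.dx t x (P.map X) - u.dx (t + r ^ 2) x' (P.map fun ω => X ω + r ^ 2 • B ω + r • Θ ω)‖
        ≤ 4 * Λ ^ 3 * (r * (1 + ‖x‖ + b + lpNorm X 2 P + lpNorm B 2 P)) := by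
  set μ := P.map fun ω => X ω + r ^ 2 • B ω + r • Θ ω with hμ
  have hP2 : IsP2 μ := D.isP2_path S r
  have ht := D.time_mem hr
  have h1 := S.holder D.t_nonneg (by linarith [sq_nonneg r] : t ≤ t + r ^ 2) ht.2 x D.isP2
  rw [add_sub_cancel_left, Real.sqrt_sq hr0, D.l2norm_eq, abs_sub_comm, norm_sub_rev] at h1
  have h2 := S.U_lip ht x x' D.isP2 hP2
  have h3 := S.dx_lip ht x x' D.isP2 hP2
  have h4 := D.W2_X_path_le S hr0 hr
  have h5 := S.one_le_Λ
  have hβ : 0 ≤ lpNorm B 2 P := lpNorm_nonneg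
  have hN : 0 ≤ lpNorm X 2 P := lpNorm_nonneg
  have hxn := norm_nonneg x
  have h7 : Λ ≤ Λ ^ 3 := by nlinarith [mul_pos S.Λ_pos S.Λ_pos]
  have hsum : Λ * (‖x - x'‖ + W2 (P.map X) μ) + 2 * Λ * r * (1 + ‖x‖ + lpNorm X 2 P)
      ≤ 4 * Λ ^ 3 * (r * (1 + ‖x‖ + b + lpNorm X 2 P + lpNorm B 2 P)) := by
    calc _ ≤ Λ * (r * (b + Λ ^ 2) + r * (lpNorm B 2 P + Λ ^ 2))
          + 2 * Λ * r * (1 + ‖x‖ + lpNorm X 2 P) := by have := S.Λ_pos; gcongr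
      _ = Λ * (r * (b + lpNorm B 2 P + 2 * (1 + ‖x‖ + lpNorm X 2 P))) + Λ ^ 3 * (r * 2) := by ring
      _ ≤ Λ ^ 3 * (r * (b + lpNorm B 2 P + 2 * (1 + ‖x‖ + lpNorm X 2 P))) + Λ ^ 3 * (r * 2) := by
          gcongr
      _ = Λ ^ 3 * (r * (b + lpNorm B 2 P + 2 * (1 + ‖x‖ + lpNorm X 2 P) + 2)) := by ring
      _ ≤ Λ ^ 3 * (r * (4 * (1 + ‖x‖ + b + lpNorm X 2 P + lpNorm B 2 P))) := by
          have := S.Λ_pos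
          gcongr; linarith
      _ = _ := by ring
  have a1 := abs_nonneg (u.U t x (P.map X) - u.U (t + r ^ 2) x (P.map X))
  have a2 := norm_nonneg (u.dx t x (P.map X) - u.dx (t + r ^ 2) x (P.map X))
  refine ⟨?_, ?_⟩
  · have := abs_sub_le (u.U t x (P.map X)) (u.U (t + r ^ 2) x (P.map X)) (u.U (t + r ^ 2) x' μ)
    linarith
  · have := norm_sub_le_norm_sub_add_norm_sub (u.dx t x (P.map X)) (u.dx (t + r ^ 2) x (P.map X))
      (u.dx (t + r ^ 2) x' μ)
    linarith

lemma norm_X_sub_path_le (D : IsStep G P Λ T c s p t h X Y ζ B Θ) (S : Setting P₀ T Λ α K c u)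
    (hr0 : 0 ≤ r) (hr : r ^ 2 ≤ h) (ω : Ω) :
    ‖X ω - (X ω + r ^ 2 • B ω + r • Θ ω)‖ ≤ r * (‖B ω‖ + Λ ^ 2) := by
  have := D.norm_point_sub_le S hr0 hr ω (D.innov.mem ω)
  rw [D.Θ_eq]; exact this

lemma lpNorm_U_path_sub_le (D : IsStep G P Λ T c s p t h X Y ζ B Θ) (S : Setting P₀ T Λ α K c u)
    (hr0 : 0 ≤ r) (hr : r ^ 2 ≤ h) :
    lpNorm (fun ω => u.U t (X ω) (P.map X) - u.U (t + r ^ 2) (X ω + r ^ 2 • B ω + r • Θ ω)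
        (P.map fun ω => X ω + r ^ 2 • B ω + r • Θ ω)) 2 P
      ≤ 8 * Λ ^ 3 * (r * (1 + lpNorm X 2 P + lpNorm B 2 P)) := by
  have hβ : 0 ≤ lpNorm B 2 P := lpNorm_nonneg
  have hN : 0 ≤ lpNorm X 2 P := lpNorm_nonneg
  have h0 := S.Λ_pos
  have := lpNorm_le_of_affine₂ (f := fun ω => u.U t (X ω) (P.map X)
      - u.U (t + r ^ 2) (X ω + r ^ 2 • B ω + r • Θ ω)
        (P.map fun ω => X ω + r ^ 2 • B ω + r • Θ ω)) (by norm_num : (1 : ℝ≥0∞) ≤ 2)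
    D.memLp_X (D.memLp_B_two S) (a := 4 * Λ ^ 3 * (r * (1 + lpNorm X 2 P + lpNorm B 2 P)))
    (b := 4 * Λ ^ 3 * r) (b' := 4 * Λ ^ 3 * r) (by positivity) (by positivity) (by positivity)
    (ae_of_all _ fun ω => ((D.U_path_sub_le S hr0 hr (X ω) _ (norm_nonneg (B ω))
      (D.norm_X_sub_path_le S hr0 hr ω)).1).trans_eq (by ring))
  refine this.trans ?_
  have : 0 ≤ 4 * Λ ^ 3 * r := by positivity
  nlinarith

lemma lpNorm_Y_sub_U_path_le (D : IsStep G P Λ T c s p t h X Y ζ B Θ)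
    (S : Setting P₀ T Λ α K c u) (hr0 : 0 ≤ r) (hr : r ^ 2 ≤ h) :
    lpNorm (fun ω => Y ω - u.U (t + r ^ 2) (X ω + r ^ 2 • B ω + r • Θ ω)
        (P.map fun ω => X ω + r ^ 2 • B ω + r • Θ ω)) 2 P
      ≤ lpNorm (fun ω => u.U t (X ω) (P.map X) - Y ω) 2 P
        + 8 * Λ ^ 3 * (r * (1 + lpNorm X 2 P + lpNorm B 2 P)) := by
  have h1 := D.lpNorm_U_path_sub_le S hr0 hr
  have h2 := lpNorm_add_le (D.memLp_err S D.memLp_X D.memLp_Y).neg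
    (by norm_num : (1 : ℝ≥0∞) ≤ 2) (g := fun ω => u.U t (X ω) (P.map X)
      - u.U (t + r ^ 2) (X ω + r ^ 2 • B ω + r • Θ ω)
        (P.map fun ω => X ω + r ^ 2 • B ω + r • Θ ω))
  rw [lpNorm_neg] at h2
  refine le_trans (le_of_eq ?_) (h2.trans (add_le_add_right h1 _))
  congr 1; ext ω; simp

lemma memLp_U_path (D : IsStep G P Λ T c s p t h X Y ζ B Θ) (S : Setting P₀ T Λ α K c u)
    (hr : r ^ 2 ≤ h) : MemLp (fun ω => u.U (t + r ^ 2) (X ω + r ^ 2 • B ω + r • Θ ω)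
        (P.map fun ω => X ω + r ^ 2 • B ω + r • Θ ω)) 2 P :=
  S.memLp_U (D.time_mem hr) (D.isP2_path S r) (D.memLp_path S r)

lemma measurable_U_path (D : IsStep G P Λ T c s p t h X Y ζ B Θ) (S : Setting P₀ T Λ α K c u)
    (hr : r ^ 2 ≤ h) : Measurable (fun ω => u.U (t + r ^ 2) (X ω + r ^ 2 • B ω + r • Θ ω)
        (P.map fun ω => X ω + r ^ 2 • B ω + r • Θ ω)) :=
  (S.continuous_U (D.time_mem hr) (D.isP2_path S r)).measurable.comp (D.measurable_path S r)

/-- The scheme sees the law of `(X, Y)`, the master equation the law on the graph of `U` at the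
current point of the path. Coupling them through the same `ω` costs the `L²` error plus a
displacement of order `r`. -/
lemma W2joint_state_le (D : IsStep G P Λ T c s p t h X Y ζ B Θ) (S : Setting P₀ T Λ α K c u)
    (hr0 : 0 ≤ r) (hr : r ^ 2 ≤ h) :
    W2joint (P.map fun ω => (X ω, Y ω))
        (u.graphLaw (t + r ^ 2) (P.map fun ω => X ω + r ^ 2 • B ω + r • Θ ω))
      ≤ lpNorm (fun ω => u.U t (X ω) (P.map X) - Y ω) 2 P
        + 9 * Λ ^ 3 * (r * (1 + lpNorm X 2 P + lpNorm B 2 P)) := by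
  rw [S.graphLaw_map (D.time_mem hr) (D.measurable_path S r) (D.memLp_path S r)]
  refine (W2joint_map_le D.measurable_X (D.measurable_path S r) D.measurable_Y
    (D.measurable_U_path S hr) D.memLp_X (D.memLp_path S r) D.memLp_Y
    (D.memLp_U_path S hr)).trans ?_
  have h1 := D.lpNorm_X_sub_path_le S hr0 hr
  have h2 := D.lpNorm_Y_sub_U_path_le S hr0 hr
  have hβ : 0 ≤ lpNorm B 2 P := lpNorm_nonneg
  have hN : 0 ≤ lpNorm X 2 P := lpNorm_nonneg
  have h5 := S.one_le_Λ
  have h3 : lpNorm B 2 P + Λ ^ 2 ≤ Λ ^ 3 * (1 + lpNorm X 2 P + lpNorm B 2 P) := by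
    have e1 : Λ ^ 2 ≤ Λ ^ 3 := pow_le_pow_right₀ h5 (by norm_num)
    have e2 : 1 ≤ Λ ^ 3 := one_le_pow₀ h5
    nlinarith [mul_nonneg (zero_le_one.trans e2) hN]
  have h4 := mul_le_mul_of_nonneg_left h3 hr0
  linarith

lemma W2joint_graph_le (D : IsStep G P Λ T c s p t h X Y ζ B Θ) (S : Setting P₀ T Λ α K c u)
    (hr0 : 0 ≤ r) (hr : r ^ 2 ≤ h) :
    W2joint (u.graphLaw t (P.map X))
        (u.graphLaw (t + r ^ 2) (P.map fun ω => X ω + r ^ 2 • B ω + r • Θ ω))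
      ≤ 9 * Λ ^ 3 * (r * (1 + lpNorm X 2 P + lpNorm B 2 P)) := by
  rw [S.graphLaw_map (D.time_mem hr) (D.measurable_path S r) (D.memLp_path S r),
    S.graphLaw_map D.t_mem D.measurable_X D.memLp_X]
  refine (W2joint_map_le D.measurable_X (D.measurable_path S r)
    (show Measurable fun ω => u.U t (X ω) (P.map X) from
      (S.continuous_U D.t_mem D.isP2).measurable.comp D.measurable_X)
    (D.measurable_U_path S hr) D.memLp_X (D.memLp_path S r) (S.memLp_U D.t_mem D.isP2 D.memLp_X)
    (D.memLp_U_path S hr)).trans ?_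
  have h1 := D.lpNorm_X_sub_path_le S hr0 hr
  have h2 := D.lpNorm_U_path_sub_le S hr0 hr
  have hβ : 0 ≤ lpNorm B 2 P := lpNorm_nonneg
  have hN : 0 ≤ lpNorm X 2 P := lpNorm_nonneg
  have h5 := S.one_le_Λ
  have h3 : lpNorm B 2 P + Λ ^ 2 ≤ Λ ^ 3 * (1 + lpNorm X 2 P + lpNorm B 2 P) := by
    have e1 : Λ ^ 2 ≤ Λ ^ 3 := pow_le_pow_right₀ h5 (by norm_num)
    have e2 : 1 ≤ Λ ^ 3 := one_le_pow₀ h5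
    nlinarith [mul_nonneg (zero_le_one.trans e2) hN]
  have h4 := mul_le_mul_of_nonneg_left h3 hr0
  linarith

end Path

end IsStep

end MKV
namespace MKV
namespace IsStep

/-! ### Fine one-step expansion -/

variable {d : ℕ} {Ω₀ : Type*} {m₀ : MeasurableSpace Ω₀} {P₀ : Measure Ω₀} {T Λ α K : ℝ}
  {c : Coeffs d} {u : MasterField d}
  {Ω : Type*} {G mΩ : MeasurableSpace Ω} {P : Measure Ω} [IsProbabilityMeasure P]
  {s : Finset (St d)} {p : St d → ℝ} {t h : ℝ} {X : Ω → St d} {Y : Ω → ℝ} {ζ B Θ : Ω → St d}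
  {r : ℝ}

/-- Brings the displacements along the path to the common form `Λ² r q`, so that the later bounds
differ only in the choice of `q`. -/
lemma scale_le {r b q Λ : ℝ} (hr0 : 0 ≤ r) (hΛ : 1 ≤ Λ) (hb : 0 ≤ b) (hq : 1 + b ≤ q) :
    r * (b + Λ ^ 2) ≤ Λ ^ 2 * (r * q) := by
  have h1 : 1 ≤ Λ ^ 2 := one_le_pow₀ hΛ
  have h2 : b + Λ ^ 2 ≤ Λ ^ 2 * q := by nlinarith
  calc r * (b + Λ ^ 2) ≤ r * (Λ ^ 2 * q) := mul_le_mul_of_nonneg_left h2 hr0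
    _ = _ := by ring

/-- The drift of the scheme is frozen at `(X, Y)`, while the master equation needs it at the moving
point of the graph. Replacing `Y` by `U` costs the error, pointwise and in `L²`; moving along the
path costs `r`. -/
lemma norm_drift_sub_le (D : IsStep G P Λ T c s p t h X Y ζ B Θ) (S : Setting P₀ T Λ α K c u)
    (hr0 : 0 ≤ r) (hr : r ^ 2 ≤ h) (ω : Ω) {x' : St d} {μ : Measure (St d)}
    (hμ : μ = P.map fun ω => X ω + r ^ 2 • B ω + r • Θ ω)
    (hx : ‖X ω - x'‖ ≤ r * (‖B ω‖ + Λ ^ 2)) :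
    ‖B ω - c.b x' (u.U (t + r ^ 2) x' μ) (u.graphLaw (t + r ^ 2) μ)‖
      ≤ Λ * (|u.U t (X ω) (P.map X) - Y ω| + lpNorm (fun ω => u.U t (X ω) (P.map X) - Y ω) 2 P
        + 14 * Λ ^ 3 * (r * (1 + ‖X ω‖ + ‖B ω‖ + lpNorm X 2 P + lpNorm B 2 P))) := by
  subst hμ
  have h1 := (D.U_path_sub_le S hr0 hr (X ω) x' (norm_nonneg (B ω)) hx).1
  have h2 := D.W2joint_state_le S hr0 hr
  have h3 := S.h0.lip_b (X ω) x' (Y ω) (u.U (t + r ^ 2) x'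
    (P.map fun ω => X ω + r ^ 2 • B ω + r • Θ ω)) _ _ D.isP2_joint
    (S.isP2_graphLaw (D.time_mem hr) (D.isP2_path S r))
  have hβ : 0 ≤ lpNorm B 2 P := lpNorm_nonneg
  have hN : 0 ≤ lpNorm X 2 P := lpNorm_nonneg
  have hΛ := S.one_le_Λ
  have h4 := scale_le hr0 hΛ (norm_nonneg (B ω))
    (by linarith [norm_nonneg (X ω)] : 1 + ‖B ω‖ ≤ 1 + ‖X ω‖ + ‖B ω‖ + lpNorm X 2 P + lpNorm B 2 P)
  have h5 := abs_sub_le (Y ω) (u.U t (X ω) (P.map X)) (u.U (t + r ^ 2) x'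
    (P.map fun ω => X ω + r ^ 2 • B ω + r • Θ ω))
  rw [abs_sub_comm (Y ω) (u.U t (X ω) (P.map X))] at h5
  have h6 : r * (1 + lpNorm X 2 P + lpNorm B 2 P)
      ≤ r * (1 + ‖X ω‖ + ‖B ω‖ + lpNorm X 2 P + lpNorm B 2 P) := by
    gcongr ?_ * ?_; linarith [norm_nonneg (X ω), norm_nonneg (B ω)]
  have h7 : 0 ≤ r * (1 + ‖X ω‖ + ‖B ω‖ + lpNorm X 2 P + lpNorm B 2 P) := by positivity
  have h8 : Λ ^ 2 ≤ Λ ^ 3 := pow_le_pow_right₀ hΛ (by norm_num)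
  have h9 : 0 ≤ Λ ^ 3 := by positivity
  have hb : B ω = c.b (X ω) (Y ω) (P.map fun ω => (X ω, Y ω)) := congrFun D.B_eq ω
  conv_lhs => rw [hb]
  refine h3.trans (mul_le_mul_of_nonneg_left ?_ S.Λ_pos.le)
  have h10 := mul_le_mul_of_nonneg_right h8 h7
  have h11 := mul_le_mul_of_nonneg_left h6 h9
  linarith

/-- Both drivers are evaluated on the graph of `U`, at the start and at the current point, so only
the displacement of order `r` appears and no error term. -/
lemma abs_driver_sub_le (D : IsStep G P Λ T c s p t h X Y ζ B Θ) (S : Setting P₀ T Λ α K c u)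
    (hr0 : 0 ≤ r) (hr : r ^ 2 ≤ h) (ω : Ω) {x' : St d} {μ : Measure (St d)}
    (hμ : μ = P.map fun ω => X ω + r ^ 2 • B ω + r • Θ ω)
    (hx : ‖X ω - x'‖ ≤ r * (‖B ω‖ + Λ ^ 2)) :
    |c.f (X ω) (u.U t (X ω) (P.map X)) (c.σadj (X ω) (P.map X) (u.dx t (X ω) (P.map X)))
        (u.graphLaw t (P.map X))
      - c.f x' (u.U (t + r ^ 2) x' μ) (c.σadj x' μ (u.dx (t + r ^ 2) x' μ))
        (u.graphLaw (t + r ^ 2) μ)|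
      ≤ 20 * Λ ^ 5 * (r * (1 + ‖X ω‖ + ‖B ω‖ + lpNorm X 2 P + lpNorm B 2 P)) := by
  subst hμ
  set μ := P.map fun ω => X ω + r ^ 2 • B ω + r • Θ ω with hμ
  set ρ := 1 + ‖X ω‖ + ‖B ω‖ + lpNorm X 2 P + lpNorm B 2 P with hρ
  have hP2 : IsP2 μ := D.isP2_path S r
  have h1 := D.U_path_sub_le S hr0 hr (X ω) x' (norm_nonneg (B ω)) hx
  rw [← hμ, ← hρ] at h1
  have h2 := D.W2joint_graph_le S hr0 hr
  rw [← hμ] at h2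
  have hβ : 0 ≤ lpNorm B 2 P := lpNorm_nonneg
  have hN : 0 ≤ lpNorm X 2 P := lpNorm_nonneg
  have hΛ := S.one_le_Λ
  have hΛ0 := S.Λ_pos
  have hρ0 : 0 ≤ r * ρ := by positivity
  have h4 := scale_le (q := ρ) hr0 hΛ (norm_nonneg (B ω)) (by linarith [norm_nonneg (X ω)])
  have h4' := scale_le (q := ρ) hr0 hΛ hβ (by linarith [norm_nonneg (X ω), norm_nonneg (B ω)])
  have h5 := D.W2_X_path_le S hr0 hr
  rw [← hμ] at h5
  have h6 : r * (1 + lpNorm X 2 P + lpNorm B 2 P) ≤ r * ρ := by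
    gcongr ?_ * ?_; linarith [norm_nonneg (X ω), norm_nonneg (B ω)]
  have hz : ‖c.σadj (X ω) (P.map X) (u.dx t (X ω) (P.map X))
      - c.σadj x' μ (u.dx (t + r ^ 2) x' μ)‖ ≤ Λ * (2 * Λ ^ 2 * (r * ρ)) * Λ
        + Λ * (4 * Λ ^ 3 * (r * ρ)) := by
    have e : c.σadj (X ω) (P.map X) (u.dx t (X ω) (P.map X)) - c.σadj x' μ (u.dx (t + r ^ 2) x' μ)
        = (c.σadj (X ω) (P.map X) - c.σadj x' μ) (u.dx t (X ω) (P.map X))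
          + c.σadj x' μ (u.dx t (X ω) (P.map X) - u.dx (t + r ^ 2) x' μ) := by
      simp
    rw [e]
    refine (norm_add_le _ _).trans (add_le_add ?_ ?_)
    · refine (ContinuousLinearMap.le_opNorm _ _).trans ?_
      have a1 := S.σadj_lip (X ω) x' D.isP2 hP2
      have a2 := S.norm_dx_le D.t_mem (X ω) D.isP2
      refine mul_le_mul (a1.trans (mul_le_mul_of_nonneg_left ?_ hΛ0.le)) a2 (norm_nonneg _)
        (by positivity)
      linarith
    · refine (ContinuousLinearMap.le_opNorm _ _).trans ?_
      exact mul_le_mul (S.norm_σadj_le x' hP2) h1.2 (norm_nonneg _) hΛ0.le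
  have h3 := S.h0.lip_f (X ω) x' (u.U t (X ω) (P.map X)) (u.U (t + r ^ 2) x' μ)
    (c.σadj (X ω) (P.map X) (u.dx t (X ω) (P.map X))) (c.σadj x' μ (u.dx (t + r ^ 2) x' μ)) _ _
    (S.isP2_graphLaw D.t_mem D.isP2) (S.isP2_graphLaw (D.time_mem hr) hP2)
  have h9 : 0 ≤ Λ ^ 3 := by positivity
  have h11 := mul_le_mul_of_nonneg_left h6 h9
  have p2 : Λ ^ 2 ≤ Λ ^ 4 := pow_le_pow_right₀ hΛ (by norm_num)
  have p3 : Λ ^ 3 ≤ Λ ^ 4 := pow_le_pow_right₀ hΛ (by norm_num)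
  have q2 := mul_le_mul_of_nonneg_right p2 hρ0
  have q3 := mul_le_mul_of_nonneg_right p3 hρ0
  refine h3.trans ?_
  have : ‖X ω - x'‖ + |u.U t (X ω) (P.map X) - u.U (t + r ^ 2) x' μ|
      + ‖c.σadj (X ω) (P.map X) (u.dx t (X ω) (P.map X))
        - c.σadj x' μ (u.dx (t + r ^ 2) x' μ)‖
      + W2joint (u.graphLaw t (P.map X)) (u.graphLaw (t + r ^ 2) μ)
      ≤ 20 * Λ ^ 4 * (r * ρ) := by
    have e : Λ * (2 * Λ ^ 2 * (r * ρ)) * Λ + Λ * (4 * Λ ^ 3 * (r * ρ)) = 6 * (Λ ^ 4 * (r * ρ)) := by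
      ring
    linarith [h1.1]
  calc _ ≤ Λ * (20 * Λ ^ 4 * (r * ρ)) := mul_le_mul_of_nonneg_left this hΛ0.le
    _ = _ := by ring

lemma norm_a_sub_le (D : IsStep G P Λ T c s p t h X Y ζ B Θ) (S : Setting P₀ T Λ α K c u)
    (hr0 : 0 ≤ r) (hr : r ^ 2 ≤ h) (ω : Ω) {x' : St d} {μ : Measure (St d)}
    (hμ : μ = P.map fun ω => X ω + r ^ 2 • B ω + r • Θ ω)
    (hx : ‖X ω - x'‖ ≤ r * (‖B ω‖ + Λ ^ 2)) :
    ‖c.a (X ω) (P.map X) - c.a x' μ‖ ≤ 4 * Λ ^ 4 * (r * (1 + ‖B ω‖ + lpNorm B 2 P)) := by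
  subst hμ
  have hβ : 0 ≤ lpNorm B 2 P := lpNorm_nonneg
  have h1 := S.a_lip (X ω) x' D.isP2 (D.isP2_path S r)
  have h5 := D.W2_X_path_le S hr0 hr
  have h4 := scale_le (q := 1 + ‖B ω‖ + lpNorm B 2 P) hr0 S.one_le_Λ (norm_nonneg (B ω))
    (by linarith)
  have h4' := scale_le (q := 1 + ‖B ω‖ + lpNorm B 2 P) hr0 S.one_le_Λ hβ
    (by linarith [norm_nonneg (B ω)])
  refine h1.trans ?_
  calc _ ≤ 2 * Λ ^ 2 * (2 * (Λ ^ 2 * (r * (1 + ‖B ω‖ + lpNorm B 2 P)))) := by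
        gcongr; linarith
    _ = _ := by ring

/-- The second order terms in the space variable. -/
lemma abs_space_term_le (D : IsStep G P Λ T c s p t h X Y ζ B Θ) (S : Setting P₀ T Λ α K c u)
    (hr0 : 0 ≤ r) (hr : r ^ 2 ≤ h) (ω : Ω) {μ : Measure (St d)}
    (hμ : μ = P.map fun ω => X ω + r ^ 2 • B ω + r • Θ ω) {x' : St d → St d}
    (hx' : x' = fun z => X ω + r ^ 2 • B ω + r • c.σ (X ω) (P.map X) z) :
    |∑ z ∈ s, p z * (⟪u.dx (t + r ^ 2) (x' z) μ, c.σ (X ω) (P.map X) z⟫_ℝ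
        - r * tr (u.dxx (t + r ^ 2) (x' z) μ ∘L c.a (x' z) μ))|
      ≤ (1 + 5 * d) * Λ ^ 7 * (r * (r * (1 + ‖B ω‖ + lpNorm B 2 P))) := by
  have hP2 : IsP2 μ := hμ ▸ D.isP2_path S r
  have hβ : 0 ≤ lpNorm B 2 P := lpNorm_nonneg
  have hΛ := S.one_le_Λ
  have hΛ0 := S.Λ_pos
  set ρ := 1 + ‖B ω‖ + lpNorm B 2 P with hρ
  have hρ1 : 1 ≤ ρ := by linarith [norm_nonneg (B ω)]
  have hs := D.time_mem hr
  have h1 := D.design.expansion S.Λ_pos.le (S.h0.bound_σ (X ω) _ D.isP2)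
    (w := fun v => u.dx (t + r ^ 2) v μ) (w' := fun v => u.dxx (t + r ^ 2) v μ)
    (fun v => S.h1.classical.hasFDeriv_dx _ hs v μ hP2) (X ω + r ^ 2 • B ω) hr0
    (g := fun _ => Λ) (fun _ _ => hΛ0.le) (fun z _ v _ => S.h1.lip_dxx _ hs v _ μ hP2)
  rw [← Finset.sum_mul, D.design.sum_one, one_mul] at h1
  -- The expansion needs the diffusion matrix frozen at the start of the step. Replacing it by the
  -- one at the moving node costs one more factor `r`.
  have h2 : |∑ z ∈ s, p z * (r * tr (u.dxx (t + r ^ 2) (x' z) μ ∘L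
      (c.a (X ω) (P.map X) - c.a (x' z) μ)))| ≤ r * (d * (Λ * (4 * Λ ^ 4 * (r * ρ)))) := by
    refine D.design.abs_sum_le_const fun z hz => ?_
    rw [abs_mul, abs_of_nonneg hr0]
    refine mul_le_mul_of_nonneg_left ((abs_tr_le _).trans ?_) hr0
    refine mul_le_mul_of_nonneg_left ((ContinuousLinearMap.opNorm_comp_le _ _).trans ?_)
      (Nat.cast_nonneg _)
    refine mul_le_mul (S.norm_dxx_le hs _ hP2) ?_ (norm_nonneg _) hΛ0.le
    refine D.norm_a_sub_le S hr0 hr ω hμ ?_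
    rw [hx']; exact D.norm_point_sub_le S hr0 hr ω hz
  have e : ∑ z ∈ s, p z * (⟪u.dx (t + r ^ 2) (x' z) μ, c.σ (X ω) (P.map X) z⟫_ℝ
        - r * tr (u.dxx (t + r ^ 2) (x' z) μ ∘L c.a (x' z) μ))
      = ∑ z ∈ s, p z * (⟪u.dx (t + r ^ 2) (x' z) μ, c.σ (X ω) (P.map X) z⟫_ℝ
        - r * tr (u.dxx (t + r ^ 2) (x' z) μ ∘L c.a (X ω) (P.map X)))
        + ∑ z ∈ s, p z * (r * tr (u.dxx (t + r ^ 2) (x' z) μ ∘L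
      (c.a (X ω) (P.map X) - c.a (x' z) μ))) := by
    rw [← Finset.sum_add_distrib]
    refine Finset.sum_congr rfl fun z _ => ?_
    rw [ContinuousLinearMap.comp_sub, tr_sub]; ring
  rw [e]
  refine (abs_add_le _ _).trans ?_
  have h1' : |∑ z ∈ s, p z * (⟪u.dx (t + r ^ 2) (x' z) μ, c.σ (X ω) (P.map X) z⟫_ℝ
        - r * tr (u.dxx (t + r ^ 2) (x' z) μ ∘L c.a (X ω) (P.map X)))|
      ≤ (Λ ^ 6 + d * Λ ^ 4) * r ^ 2 * Λ := by
    rw [hx']; exact h1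
  have hrr : r ^ 2 ≤ r * (r * ρ) := by nlinarith [mul_nonneg hr0 hr0]
  have hrρ : 0 ≤ r * (r * ρ) := by positivity
  have p5 : Λ ^ 5 ≤ Λ ^ 7 := pow_le_pow_right₀ hΛ (by norm_num)
  have hd : (0:ℝ) ≤ d := Nat.cast_nonneg _
  calc _ ≤ (Λ ^ 6 + d * Λ ^ 4) * r ^ 2 * Λ + r * (d * (Λ * (4 * Λ ^ 4 * (r * ρ)))) :=
        add_le_add h1' h2
    _ = (Λ ^ 7 + d * Λ ^ 5) * r ^ 2 + 4 * d * Λ ^ 5 * (r * (r * ρ)) := by ring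
    _ ≤ (Λ ^ 7 + d * Λ ^ 7) * (r * (r * ρ)) + 4 * d * Λ ^ 7 * (r * (r * ρ)) := by gcongr
    _ = _ := by ring

/-- The drift term in the measure variable. -/
lemma abs_measure_drift_term_le (D : IsStep G P Λ T c s p t h X Y ζ B Θ)
    (S : Setting P₀ T Λ α K c u) (hr0 : 0 ≤ r) (hr : r ^ 2 ≤ h) {μ : Measure (St d)}
    (hμ : μ = P.map fun ω => X ω + r ^ 2 • B ω + r • Θ ω) (x : St d) {xr : Ω → St d}
    (hxr : xr = fun ω => X ω + r ^ 2 • B ω + r • Θ ω) :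
    |∫ ω, ⟪u.dμ (t + r ^ 2) x μ (xr ω), B ω - c.b (xr ω) (u.U (t + r ^ 2) (xr ω) μ)
        (u.graphLaw (t + r ^ 2) μ)⟫_ℝ ∂P|
      ≤ Λ * (Λ * (2 * lpNorm (fun ω => u.U t (X ω) (P.map X) - Y ω) 2 P
        + 28 * Λ ^ 3 * (r * (1 + lpNorm X 2 P + lpNorm B 2 P)))) := by
  have hP2 : IsP2 μ := hμ ▸ D.isP2_path S r
  have hs := D.time_mem hr
  have hΛ0 := S.Λ_pos
  have hβ : 0 ≤ lpNorm B 2 P := lpNorm_nonneg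
  have hN : 0 ≤ lpNorm X 2 P := lpNorm_nonneg
  have hxm : Measurable xr := hxr ▸ D.measurable_path S r
  have hx2 : MemLp xr 2 P := hxr ▸ D.memLp_path S r
  have hμ' : μ = P.map xr := by rw [hμ, hxr]
  set e : Ω → ℝ := fun ω => u.U t (X ω) (P.map X) - Y ω with he
  have heL : MemLp e 2 P := D.memLp_err S D.memLp_X D.memLp_Y
  have hε : 0 ≤ lpNorm e 2 P := lpNorm_nonneg
  have hB := D.memLp_B_two S
  have h1 := S.memLp_dμ hs x hP2
  have hD : MemLp (fun ω => u.dμ (t + r ^ 2) x μ (xr ω)) 2 P := by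
    have := h1.1; rw [hμ'] at this ⊢; exact this.comp_of_map hxm.aemeasurable
  have hDn : lpNorm (fun ω => u.dμ (t + r ^ 2) x μ (xr ω)) 2 P ≤ Λ := by
    refine le_trans (le_of_eq ?_) h1.2
    rw [← toReal_eLpNorm hD.1, ← toReal_eLpNorm h1.1.1]
    congr 1
    have h2 := (S.continuous_dμ hs x hP2).aestronglyMeasurable (μ := P.map xr)
    conv_rhs => rw [hμ']
    rw [hμ'] at h2 ⊢
    exact (eLpNorm_map_measure h2 hxm.aemeasurable).symm
  set E : Ω → St d := fun ω => B ω - c.b (xr ω) (u.U (t + r ^ 2) (xr ω) μ)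
    (u.graphLaw (t + r ^ 2) μ) with hE
  have hEL : MemLp E 2 P := hB.sub
    (S.memLp_b (S.isP2_graphLaw hs hP2) hx2 (S.memLp_U hs hP2 hx2))
  have hEn : lpNorm E 2 P ≤ Λ * (2 * lpNorm e 2 P
      + 28 * Λ ^ 3 * (r * (1 + lpNorm X 2 P + lpNorm B 2 P))) := by
    have hg : MemLp (fun ω => ‖X ω‖ + ‖B ω‖) 2 P := D.memLp_X.norm.add hB.norm
    have h3 := lpNorm_le_of_affine₂ (f := E) (g := e) (g' := fun ω => ‖X ω‖ + ‖B ω‖)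
      (by norm_num : (1 : ℝ≥0∞) ≤ 2) heL hg
      (a := Λ * (lpNorm e 2 P + 14 * Λ ^ 3 * (r * (1 + lpNorm X 2 P + lpNorm B 2 P))))
      (b := Λ) (b' := Λ * (14 * Λ ^ 3 * r)) (by positivity) hΛ0.le (by positivity)
      (ae_of_all _ fun ω => by
        have := D.norm_drift_sub_le S hr0 hr ω (x' := xr ω) hμ
          (by rw [hxr]; exact D.norm_X_sub_path_le S hr0 hr ω)
        refine this.trans_eq ?_
        rw [Real.norm_of_nonneg (show 0 ≤ ‖X ω‖ + ‖B ω‖ by positivity), Real.norm_eq_abs]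
        ring)
    have h4 : lpNorm (fun ω => ‖X ω‖ + ‖B ω‖) 2 P ≤ lpNorm X 2 P + lpNorm B 2 P := by
      have := lpNorm_add_le D.memLp_X.norm (by norm_num : (1 : ℝ≥0∞) ≤ 2) (g := fun ω => ‖B ω‖)
      rwa [lpNorm_norm D.memLp_X.1, lpNorm_norm hB.1] at this
    have h5 := mul_le_mul_of_nonneg_left (h4.trans (by linarith :
      _ ≤ 1 + lpNorm X 2 P + lpNorm B 2 P)) (by positivity : 0 ≤ Λ * (14 * Λ ^ 3 * r))
    refine h3.trans ((add_le_add_right h5 _).trans_eq ?_)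
    ring
  have h6 := abs_integral_le_of_norm_le_mul
    (f := fun ω => ⟪u.dμ (t + r ^ 2) x μ (xr ω), E ω⟫_ℝ) hD.norm hEL.norm
    (ae_of_all _ fun ω => abs_real_inner_le_norm _ _)
  rw [lpNorm_norm hD.1, lpNorm_norm hEL.1] at h6
  exact h6.trans (mul_le_mul hDn hEn lpNorm_nonneg hΛ0.le)

end IsStep
end MKV
-- Noise terms in the measure variable, under moments of order `2α`
namespace MKV

section Aux

variable {Ω : Type*} {mΩ : MeasurableSpace Ω} {P : Measure Ω}
  {E : Type*} [NormedAddCommGroup E] [InnerProductSpace ℝ E]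

lemma integrable_inner_of_memLp {f g : Ω → E} (hf : MemLp f 2 P) (hg : MemLp g 2 P) :
    Integrable (fun ω => ⟪f ω, g ω⟫_ℝ) P :=
  (integrable_mul_norm hf.norm hg.norm).mono' (hf.1.inner hg.1)
    (ae_of_all _ fun _ => abs_real_inner_le_norm _ _)

variable [IsProbabilityMeasure P]

lemma integral_rpow_eq_lpNorm_rpow {f : Ω → ℝ} {q : ℝ} (hq : 0 < q)
    (hf : AEStronglyMeasurable f P) :
    ∫ ω, ‖f ω‖ ^ q ∂P = lpNorm f (ENNReal.ofReal q) P ^ q := by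
  rw [lpNorm_eq_integral_norm_rpow_toReal (by simpa using hq) ENNReal.ofReal_ne_top hf,
    ENNReal.toReal_ofReal hq.le, Real.rpow_inv_rpow (by positivity) hq.ne']

lemma integral_rpow_le_lpNorm {f : Ω → ℝ} {q : ℝ} (hq : 1 ≤ q)
    (hf : MemLp f (ENNReal.ofReal (2 * q)) P) :
    Integrable (fun ω => ‖f ω‖ ^ q) P ∧
      ∫ ω, ‖f ω‖ ^ q ∂P ≤ lpNorm f (ENNReal.ofReal (2 * q)) P ^ q := by
  have hle : ENNReal.ofReal q ≤ ENNReal.ofReal (2 * q) := ENNReal.ofReal_le_ofReal (by linarith)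
  have hf1 : MemLp f (ENNReal.ofReal q) P := hf.mono_exponent hle
  have h0 : 0 < q := by linarith
  constructor
  · have := hf1.integrable_norm_rpow (by simpa using h0) ENNReal.ofReal_ne_top
    rwa [ENNReal.toReal_ofReal h0.le] at this
  · rw [integral_rpow_eq_lpNorm_rpow h0 hf.1]
    exact Real.rpow_le_rpow lpNorm_nonneg (lpNorm_mono_exponent hle hf) h0.le

end Aux

namespace IsStep

variable {d : ℕ} {Ω₀ : Type*} {m₀ : MeasurableSpace Ω₀} {P₀ : Measure Ω₀} {T Λ α K : ℝ}
  {c : Coeffs d} {u : MasterField d}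
  {Ω : Type*} {G mΩ : MeasurableSpace Ω} {P : Measure Ω} [IsProbabilityMeasure P]
  {s : Finset (St d)} {p : St d → ℝ} {t h : ℝ} {X : Ω → St d} {Y : Ω → ℝ} {ζ B Θ : Ω → St d}
  {r : ℝ}

/-- An envelope of the path of the step. -/
noncomputable def envelope (Λ : ℝ) (X B : Ω → St d) (ω : Ω) : ℝ := ‖X ω‖ + ‖B ω‖ + Λ ^ 2

lemma memLp_envelope (D : IsStep G P Λ T c s p t h X Y ζ B Θ) (S : Setting P₀ T Λ α K c u)
    {q : ℝ≥0∞} (hX : MemLp X q P) (hY : MemLp Y q P) : MemLp (envelope Λ X B) q P :=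
  (hX.norm.add (D.memLp_B S hX hY).norm).add (memLp_const _)

lemma one_le_envelope (hΛ : 1 ≤ Λ) (ω : Ω) : 1 ≤ envelope Λ X B ω := by
  have : 1 ≤ Λ ^ 2 := one_le_pow₀ hΛ
  unfold envelope; linarith [norm_nonneg (X ω), norm_nonneg (B ω)]

lemma norm_point_le (D : IsStep G P Λ T c s p t h X Y ζ B Θ) (S : Setting P₀ T Λ α K c u)
    (hr0 : 0 ≤ r) (hr : r ^ 2 ≤ h) (ω : Ω) {z : St d} (hz : z ∈ s) :
    ‖X ω + r ^ 2 • B ω‖ ≤ envelope Λ X B ω ∧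
    ‖X ω + r ^ 2 • B ω + r • c.σ (X ω) (P.map X) z‖ ≤ envelope Λ X B ω := by
  have h1 := D.design.norm_image_le S.Λ_pos.le (S.h0.bound_σ (X ω) _ D.isP2) hz
  have h2 := D.r_sq_le hr0 hr
  have h3 : ‖X ω + r ^ 2 • B ω‖ ≤ ‖X ω‖ + ‖B ω‖ := by
    refine (norm_add_le _ _).trans (by
      gcongr; rw [norm_smul, Real.norm_of_nonneg (sq_nonneg r)]
      exact mul_le_of_le_one_left (norm_nonneg _) (by linarith))
  have h4 : ‖r • c.σ (X ω) (P.map X) z‖ ≤ Λ ^ 2 := by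
    rw [norm_smul, Real.norm_of_nonneg hr0]
    exact (mul_le_of_le_one_left (norm_nonneg _) h2.1).trans h1
  refine ⟨h3.trans (by unfold envelope; linarith [sq_nonneg Λ]), ?_⟩
  exact (norm_add_le _ _).trans (add_le_add h3 h4)

lemma l2norm_path_le (D : IsStep G P Λ T c s p t h X Y ζ B Θ) (S : Setting P₀ T Λ α K c u)
    (hr0 : 0 ≤ r) (hr : r ^ 2 ≤ h) {q : ℝ≥0∞} (hq : 2 ≤ q) (hX : MemLp X q P) (hY : MemLp Y q P) :
    l2norm (P.map fun ω => X ω + r ^ 2 • B ω + r • Θ ω) ≤ lpNorm (envelope Λ X B) q P := by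
  rw [l2norm_map (D.measurable_path S r)]
  refine (lpNorm_mono_ae ((D.memLp_envelope S hX hY).mono_exponent hq) (ae_of_all _ fun ω => ?_)).trans
    (lpNorm_mono_exponent hq (D.memLp_envelope S hX hY))
  have := (D.norm_point_le S hr0 hr ω (D.innov.mem ω)).2
  rw [D.Θ_eq]; exact this

/-- The Lipschitz constant of `dvdμ` is the square root of powers of order `2α`, hence of order `α`
in the envelope of the path. This is the origin of the power `α` in the final estimate. -/
lemma rpow_half_le {V m : ℝ} (hV : 1 ≤ V) (hm : 0 ≤ m) {α : ℝ} (hα : 1 ≤ α) :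
    (1 + V ^ (2 * α) + V ^ (2 * α) + m ^ (2 * α)) ^ (1 / 2 : ℝ) ≤ 2 * V ^ α + m ^ α := by
  have h0 : (0:ℝ) ≤ V := by linarith
  have e : ∀ x : ℝ, 0 ≤ x → x ^ (2 * α) = (x ^ α) ^ 2 := fun x hx => by
    rw [← Real.rpow_natCast, ← Real.rpow_mul hx]; congr 1; push_cast; ring
  rw [e V h0, e m hm, ← Real.sqrt_eq_rpow]
  have h1 : 1 ≤ V ^ α := Real.one_le_rpow hV (by linarith)
  have h2 : 0 ≤ m ^ α := Real.rpow_nonneg hm _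
  refine Real.sqrt_le_iff.2 ⟨by positivity, ?_⟩
  nlinarith [mul_nonneg (zero_le_one.trans h1) h2]

lemma measurable_noise_term (S : Setting P₀ T Λ α K c u) (ht : t ∈ Icc 0 T) (x : St d)
    {μ : Measure (St d)} (hμ : IsP2 μ) {Ω : Type*} {m : MeasurableSpace Ω}
    {x' v : Ω → St d} {a : Ω → St d →L[ℝ] St d} (hx' : Measurable x') (hv : Measurable v)
    (ha : Measurable a) (r : ℝ) :
    Measurable fun ω => ⟪u.dμ t x μ (x' ω), v ω⟫_ℝ - r * tr (u.dvdμ t x μ (x' ω) ∘L a ω) := by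
  have h1 := (S.continuous_dμ ht x hμ).measurable.comp hx'
  have h2 := (S.continuous_dvdμ ht x hμ).measurable.comp hx'
  have h3 : Continuous fun q : (St d →L[ℝ] St d) × (St d →L[ℝ] St d) => tr (q.1 ∘L q.2) :=
    continuous_tr.comp (continuous_fst.clm_comp continuous_snd)
  exact (h1.inner hv).sub ((h3.measurable.comp (h2.prodMk ha)).const_mul r)

/-- The bounds on the Lions derivatives hold in `L²(μ)`; composing with a variable of law `μ` turns
them into bounds in `L²(P)`. They are available only at the position whose law is `μ`, and not at
`X`. -/
lemma memLp_lions (S : Setting P₀ T Λ α K c u) (ht : t ∈ Icc 0 T) (x : St d)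
    {xr : Ω → St d} (hxm : Measurable xr) (hx2 : MemLp xr 2 P) :
    (MemLp (fun ω => u.dμ t x (P.map xr) (xr ω)) 2 P ∧
      lpNorm (fun ω => u.dμ t x (P.map xr) (xr ω)) 2 P ≤ Λ) ∧
    (MemLp (fun ω => u.dvdμ t x (P.map xr) (xr ω)) 2 P ∧
      lpNorm (fun ω => u.dvdμ t x (P.map xr) (xr ω)) 2 P ≤ Λ) := by
  have hP2 := isP2_map hxm hx2
  have key : ∀ {E : Type _} [NormedAddCommGroup E] (F : St d → E), MemLp F 2 (P.map xr) →
      lpNorm F 2 (P.map xr) ≤ Λ → MemLp (fun ω => F (xr ω)) 2 P ∧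
        lpNorm (fun ω => F (xr ω)) 2 P ≤ Λ := by
    intro E _ F h1 h2
    have h3 : MemLp (fun ω => F (xr ω)) 2 P := h1.comp_of_map hxm.aemeasurable
    refine ⟨h3, le_trans (le_of_eq ?_) h2⟩
    rw [← toReal_eLpNorm h3.1, ← toReal_eLpNorm h1.1]
    exact congrArg _ (eLpNorm_map_measure h1.1 hxm.aemeasurable).symm
  exact ⟨key _ (S.memLp_dμ ht x hP2).1 (S.memLp_dμ ht x hP2).2,
    key _ (S.memLp_dvdμ ht x hP2).1 (S.memLp_dvdμ ht x hP2).2⟩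

lemma integrable_trace {A a : Ω → St d →L[ℝ] St d} (hA : MemLp A 2 P)
    (ha : AEStronglyMeasurable a P) {C : ℝ} (hC : ∀ ω, ‖a ω‖ ≤ C) :
    Integrable (fun ω => tr (A ω ∘L a ω)) P := by
  have h3 : Continuous fun q : (St d →L[ℝ] St d) × (St d →L[ℝ] St d) => tr (q.1 ∘L q.2) :=
    continuous_tr.comp (continuous_fst.clm_comp continuous_snd)
  refine ((hA.integrable (by norm_num)).norm.mul_const (d * C)).mono'
    (h3.comp_aestronglyMeasurable (hA.1.prodMk ha)) (ae_of_all _ fun ω => ?_)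
  refine (abs_tr_le _).trans ?_
  calc (d:ℝ) * ‖A ω ∘L a ω‖ ≤ d * (‖A ω‖ * C) := by
        gcongr
        exact (ContinuousLinearMap.opNorm_comp_le _ _).trans (by gcongr; exact hC ω)
    _ = _ := by ring

lemma abs_integral_tr_le {A a : Ω → St d →L[ℝ] St d} (hA : MemLp A 2 P)
    (hΛ : 0 ≤ Λ) (hAn : lpNorm A 2 P ≤ Λ) {g : Ω → ℝ} (hg : MemLp g 2 P) (h : ∀ ω, ‖a ω‖ ≤ g ω) :
    |∫ ω, tr (A ω ∘L a ω) ∂P| ≤ Λ * (d * lpNorm g 2 P) := by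
  have hb : ∀ ω, |tr (A ω ∘L a ω)| ≤ ‖A ω‖ * (d * g ω) := fun ω => by
    refine (abs_tr_le _).trans ?_
    rw [mul_left_comm]
    exact mul_le_mul_of_nonneg_left ((ContinuousLinearMap.opNorm_comp_le _ _).trans
      (mul_le_mul_of_nonneg_left (h ω) (norm_nonneg _))) (Nat.cast_nonneg _)
  have hg' : MemLp (fun ω => d * g ω) 2 P := hg.const_mul (d : ℝ)
  have h1 := abs_integral_le_of_norm_le_mul hA.norm hg' (ae_of_all _ hb)
  rw [lpNorm_norm hA.1] at h1
  refine h1.trans (mul_le_mul hAn (le_of_eq ?_) lpNorm_nonneg hΛ)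
  have h2 := lpNorm_const_smul (d : ℝ) g P (p := 2)
  rw [coe_nnnorm, Real.norm_of_nonneg (Nat.cast_nonneg d)] at h2
  exact h2

lemma memLp_affine_norm {f : Ω → St d} (hf : MemLp f 2 P) {a b : ℝ} (ha : 0 ≤ a) (hb : 0 ≤ b) :
    MemLp (fun ω => a + b * ‖f ω‖) 2 P ∧ lpNorm (fun ω => a + b * ‖f ω‖) 2 P
      ≤ a + b * lpNorm f 2 P := by
  have h1 : MemLp (fun ω => b * ‖f ω‖) 2 P := hf.norm.const_mul b
  refine ⟨(memLp_const a).add h1, ?_⟩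
  refine lpNorm_le_of_affine (f := fun ω => a + b * ‖f ω‖) (g := f) (by norm_num) hf ha hb
    (ae_of_all _ fun ω => le_of_eq (Real.norm_of_nonneg ?_))
  positivity

set_option maxHeartbeats 400000 in
/-- The second order terms in the measure variable. -/
lemma abs_measure_noise_term_le (D : IsStep G P Λ T c s p t h X Y ζ B Θ)
    (S : Setting P₀ T Λ α K c u) (hX : MemLp X (ENNReal.ofReal (2 * α)) P)
    (hY : MemLp Y (ENNReal.ofReal (2 * α)) P) (hr0 : 0 ≤ r) (hr : r ^ 2 ≤ h) {μ : Measure (St d)}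
    (hμ : μ = P.map fun ω => X ω + r ^ 2 • B ω + r • Θ ω) (x : St d) {xr : Ω → St d}
    (hxr : xr = fun ω => X ω + r ^ 2 • B ω + r • Θ ω) :
    |∫ ω, (⟪u.dμ (t + r ^ 2) x μ (xr ω), Θ ω⟫_ℝ
        - r * tr (u.dvdμ (t + r ^ 2) x μ (xr ω) ∘L c.a (xr ω) μ)) ∂P|
      ≤ (3 + 11 * d) * Λ ^ 7 * (r * (r * (1 + lpNorm X 2 P + lpNorm B 2 P
        + lpNorm (envelope Λ X B) (ENNReal.ofReal (2 * α)) P ^ α))) := by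
  have hP2 : IsP2 μ := hμ ▸ D.isP2_path S r
  have hs := D.time_mem hr
  have hΛ := S.one_le_Λ
  have hα := S.one_le_α
  have hΛ0 := S.Λ_pos
  have hβ : 0 ≤ lpNorm B 2 P := lpNorm_nonneg
  have hN : 0 ≤ lpNorm X 2 P := lpNorm_nonneg
  have hxm : Measurable xr := hxr ▸ D.measurable_path S r
  have hx2 : MemLp xr 2 P := hxr ▸ D.memLp_path S r
  have hμ' : μ = P.map xr := by rw [hμ, hxr]
  set q := ENNReal.ofReal (2 * α) with hq
  have hq2 : 2 ≤ q := by
    rw [hq, show (2 : ℝ≥0∞) = ENNReal.ofReal 2 by simp]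
    exact ENNReal.ofReal_le_ofReal (by linarith)
  set V := envelope Λ X B with hV
  set Ψ := lpNorm V q P ^ α with hΨ
  have hΨ0 : 0 ≤ Ψ := Real.rpow_nonneg lpNorm_nonneg _
  have hL := memLp_lions S hs x hxm hx2
  rw [← hμ'] at hL
  have hB := D.memLp_B_two S
  have hΘ := D.memLp_Θ S 2
  have hσm : Measurable[G] fun ω => c.σ (X ω) (P.map X) := (S.continuous_σ D.isP2).measurable.comp D.meas_X
  have ham : Measurable[G] fun ω => c.a (X ω) (P.map X) := (S.continuous_a D.isP2).measurable.comp D.meas_X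
  have ham' : Measurable fun ω => c.a (X ω) (P.map X) := ham.mono D.innov.le le_rfl
  have haxm : Measurable fun ω => c.a (xr ω) μ := (S.continuous_a hP2).measurable.comp hxm
  have hi1 : Integrable (fun ω => ⟪u.dμ (t + r ^ 2) x μ (xr ω), Θ ω⟫_ℝ) P :=
    integrable_inner_of_memLp hL.1.1 hΘ
  have hi2 : Integrable (fun ω => tr (u.dvdμ (t + r ^ 2) x μ (xr ω) ∘L c.a (X ω) (P.map X))) P :=
    integrable_trace hL.2.1 ham'.aestronglyMeasurable fun ω => S.norm_a_le (X ω) D.isP2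
  have hi3 : Integrable (fun ω => tr (u.dvdμ (t + r ^ 2) x μ (xr ω) ∘L
      (c.a (X ω) (P.map X) - c.a (xr ω) μ))) P :=
    integrable_trace hL.2.1 (ham'.sub haxm).aestronglyMeasurable fun ω =>
      (norm_sub_le _ _).trans (add_le_add (S.norm_a_le (X ω) D.isP2) (S.norm_a_le (xr ω) hP2))
  have hi12 : Integrable (fun ω => ⟪u.dμ (t + r ^ 2) x μ (xr ω), Θ ω⟫_ℝ
      - r * tr (u.dvdμ (t + r ^ 2) x μ (xr ω) ∘L c.a (X ω) (P.map X))) P :=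
    hi1.sub (hi2.const_mul r)
  have hdec : ∫ ω, (⟪u.dμ (t + r ^ 2) x μ (xr ω), Θ ω⟫_ℝ
        - r * tr (u.dvdμ (t + r ^ 2) x μ (xr ω) ∘L c.a (xr ω) μ)) ∂P
      = ∫ ω, (⟪u.dμ (t + r ^ 2) x μ (xr ω), Θ ω⟫_ℝ
        - r * tr (u.dvdμ (t + r ^ 2) x μ (xr ω) ∘L c.a (X ω) (P.map X))) ∂P
        + r * ∫ ω, tr (u.dvdμ (t + r ^ 2) x μ (xr ω) ∘L
          (c.a (X ω) (P.map X) - c.a (xr ω) μ)) ∂P := by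
    rw [← integral_const_mul, ← integral_add hi12 (hi3.const_mul r)]
    refine integral_congr_ae (ae_of_all _ fun ω => ?_)
    simp only [ContinuousLinearMap.comp_sub, tr_sub]; ring
  have hA : |∫ ω, (⟪u.dμ (t + r ^ 2) x μ (xr ω), Θ ω⟫_ℝ
        - r * tr (u.dvdμ (t + r ^ 2) x μ (xr ω) ∘L c.a (X ω) (P.map X))) ∂P|
      ≤ (Λ ^ 6 + d * Λ ^ 4) * r ^ 2 * (Λ * (3 * Ψ)) := by
    -- Conditioning on `G` replaces the noise by the weights of the design, and the second order
    -- expansion applies for each `ω`.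
    let ψ : St d → Ω → ℝ := fun z ω =>
      ⟪u.dμ (t + r ^ 2) x μ (X ω + r ^ 2 • B ω + r • c.σ (X ω) (P.map X) z),
        c.σ (X ω) (P.map X) z⟫_ℝ
      - r * tr (u.dvdμ (t + r ^ 2) x μ (X ω + r ^ 2 • B ω + r • c.σ (X ω) (P.map X) z)
          ∘L c.a (X ω) (P.map X))
    have hψ : ∀ z ∈ s, StronglyMeasurable[G] (ψ z) := fun z _ => by
      have hz : Measurable[G] fun ω => c.σ (X ω) (P.map X) z :=
        (ContinuousLinearMap.apply ℝ (St d) z).continuous.measurable.comp hσm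
      have hxz : Measurable[G] fun ω => X ω + r ^ 2 • B ω + r • c.σ (X ω) (P.map X) z :=
        (D.meas_X.add ((D.meas_B S).const_smul (r ^ 2))).add (hz.const_smul r)
      exact (measurable_noise_term S hs x hP2 (m := G) hxz hz ham r).stronglyMeasurable
    have hψζ : (fun ω => ψ (ζ ω) ω) = fun ω => ⟪u.dμ (t + r ^ 2) x μ (xr ω), Θ ω⟫_ℝ
        - r * tr (u.dvdμ (t + r ^ 2) x μ (xr ω) ∘L c.a (X ω) (P.map X)) := by
      ext ω; simp only [ψ, hxr, D.Θ_eq]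
    have h1 := D.innov.integral_comp hψ (by
      rw [hψζ]; exact hi12)
    rw [hψζ] at h1
    rw [h1.2]
    have hVint := integral_rpow_le_lpNorm hα (D.memLp_envelope S hX hY)
    have hVn : ∀ ω, ‖V ω‖ = V ω := fun ω =>
      Real.norm_of_nonneg (zero_le_one.trans (one_le_envelope hΛ ω))
    have hpt : ∀ ω, |∑ z ∈ s, p z • ψ z ω|
        ≤ (Λ ^ 6 + d * Λ ^ 4) * r ^ 2 * (Λ * (2 * ‖V ω‖ ^ α + Ψ)) := by
      intro ω
      have hg0 : 0 ≤ Λ * (2 * ‖V ω‖ ^ α + Ψ) := by positivity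
      have h2 := D.design.expansion hΛ0.le (S.h0.bound_σ (X ω) _ D.isP2)
        (w := u.dμ (t + r ^ 2) x μ) (w' := u.dvdμ (t + r ^ 2) x μ)
        (fun v => S.h1.classical.hasFDeriv_dμ _ hs x μ v hP2) (X ω + r ^ 2 • B ω) hr0
        -- The whole segment lies in the ball of radius `V ω`, and the second moment of `μ` is at
        -- most the norm of the envelope; this bounds the Lipschitz constant of `dvdμ` there.
        (g := fun _ => Λ * (2 * ‖V ω‖ ^ α + Ψ)) (fun _ _ => hg0) (fun z hz v hv => by
          have hb := D.norm_point_le S hr0 hr ω hz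
          have hvV : ‖v‖ ≤ V ω := by
            have := (convex_closedBall (0 : St d) (V ω)).segment_subset
              (by simpa using hb.1) (by simpa using hb.2) hv
            simpa using this
          refine (S.h1.lip_dvdμ _ hs x μ v _ hP2).trans ?_
          refine mul_le_mul_of_nonneg_right (mul_le_mul_of_nonneg_left ?_ hΛ0.le) (norm_nonneg _)
          have hm : l2norm μ ≤ lpNorm V q P := by
            rw [hμ]; exact D.l2norm_path_le S hr0 hr hq2 hX hY
          have hm0 := l2norm_nonneg μ
          refine le_trans ?_ ((rpow_half_le (one_le_envelope (X := X) (B := B) hΛ ω) hm0 hα).trans ?_)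
          · have h2α : 0 ≤ 2 * α := by linarith
            have hV0 : 0 ≤ V ω := zero_le_one.trans (one_le_envelope (X := X) (B := B) hΛ ω)
            refine Real.rpow_le_rpow (by positivity) ?_ (by norm_num)
            have e1 := Real.rpow_le_rpow (norm_nonneg _) hvV h2α
            have e2 := Real.rpow_le_rpow (norm_nonneg _) hb.1 h2α
            change _ ≤ 1 + V ω ^ (2 * α) + V ω ^ (2 * α) + l2norm μ ^ (2 * α)
            linarith
          · rw [hVn]
            have e3 := Real.rpow_le_rpow hm0 hm (by linarith : 0 ≤ α)
            change 2 * V ω ^ α + _ ≤ _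
            linarith)
      rw [← Finset.sum_mul, D.design.sum_one, one_mul] at h2
      exact h2
    have h3 : Integrable (fun ω => (Λ ^ 6 + d * Λ ^ 4) * r ^ 2 * (Λ * (2 * ‖V ω‖ ^ α + Ψ))) P :=
      (((hVint.1.const_mul 2).add (integrable_const Ψ)).const_mul Λ).const_mul _
    refine (norm_integral_le_of_norm_le h3
      (ae_of_all _ fun ω => (Real.norm_eq_abs _).trans_le (hpt ω))).trans ?_
    rw [integral_const_mul, integral_const_mul, integral_add (hVint.1.const_mul 2)
      (integrable_const Ψ), integral_const_mul]
    simp only [integral_const, probReal_univ, one_smul]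
    gcongr
    linarith [hVint.2]
  have hC : |∫ ω, tr (u.dvdμ (t + r ^ 2) x μ (xr ω) ∘L
          (c.a (X ω) (P.map X) - c.a (xr ω) μ)) ∂P|
      ≤ Λ * (d * (8 * Λ ^ 4 * (r * (1 + lpNorm X 2 P + lpNorm B 2 P)))) := by
    have hg := memLp_affine_norm hB (a := 4 * Λ ^ 4 * (r * (1 + lpNorm B 2 P)))
      (b := 4 * Λ ^ 4 * r) (by positivity) (by positivity)
    have h1 := abs_integral_tr_le (a := fun ω => c.a (X ω) (P.map X) - c.a (xr ω) μ)
      hL.2.1 hΛ0.le hL.2.2 hg.1 fun ω => by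
        have h2 := D.norm_a_sub_le S hr0 hr ω (x' := xr ω) hμ
          (by rw [hxr]; exact D.norm_X_sub_path_le S hr0 hr ω)
        exact h2.trans_eq (by ring)
    refine h1.trans (mul_le_mul_of_nonneg_left (mul_le_mul_of_nonneg_left
      (hg.2.trans ?_) (Nat.cast_nonneg _)) hΛ0.le)
    calc 4 * Λ ^ 4 * (r * (1 + lpNorm B 2 P)) + 4 * Λ ^ 4 * r * lpNorm B 2 P
        = 4 * Λ ^ 4 * (r * (1 + 2 * lpNorm B 2 P)) := by ring
      _ ≤ 4 * Λ ^ 4 * (r * (2 * (1 + lpNorm X 2 P + lpNorm B 2 P))) := by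
          gcongr; linarith
      _ = _ := by ring
  rw [hdec]
  refine (abs_add_le _ _).trans ?_
  rw [abs_mul, abs_of_nonneg hr0]
  have hd : (0:ℝ) ≤ d := Nat.cast_nonneg _
  have p5 : Λ ^ 5 ≤ Λ ^ 7 := pow_le_pow_right₀ hΛ (by norm_num)
  set Q := 1 + lpNorm X 2 P + lpNorm B 2 P with hQ
  have hQ0 : 0 ≤ Q := by positivity
  calc _ ≤ (Λ ^ 6 + d * Λ ^ 4) * r ^ 2 * (Λ * (3 * Ψ)) + r * (Λ * (d * (8 * Λ ^ 4 * (r * Q)))) :=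
        add_le_add hA (mul_le_mul_of_nonneg_left hC hr0)
    _ = (3 * Λ ^ 7 + 3 * d * Λ ^ 5) * (r * (r * Ψ)) + 8 * d * Λ ^ 5 * (r * (r * Q)) := by ring
    _ ≤ (3 * Λ ^ 7 + 3 * d * Λ ^ 7) * (r * (r * Ψ)) + 8 * d * Λ ^ 7 * (r * (r * Q)) := by gcongr
    _ ≤ _ := by
      have e1 : 0 ≤ Λ ^ 7 * (r * (r * Ψ)) := by positivity
      have e2 : 0 ≤ Λ ^ 7 * (r * (r * Q)) := by positivity
      have e3 := mul_nonneg hd e1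
      have e4 := mul_nonneg hd e2
      have e : (3 + 11 * d) * Λ ^ 7 * (r * (r * (Q + Ψ))) = 3 * (Λ ^ 7 * (r * (r * Q)))
        + 3 * (Λ ^ 7 * (r * (r * Ψ))) + 11 * (d * (Λ ^ 7 * (r * (r * Q))))
        + 11 * (d * (Λ ^ 7 * (r * (r * Ψ)))) := by ring
      rw [e]; linarith

end IsStep
end MKV
-- Cancellation by the master equation and the fine one-step expansion
namespace MKV
namespace IsStep

variable {d : ℕ} {Ω₀ : Type*} {m₀ : MeasurableSpace Ω₀} {P₀ : Measure Ω₀} {T Λ α K : ℝ}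
  {c : Coeffs d} {u : MasterField d}
  {Ω : Type*} {G mΩ : MeasurableSpace Ω} {P : Measure Ω} [IsProbabilityMeasure P]
  {s : Finset (St d)} {p : St d → ℝ} {t h : ℝ} {X : Ω → St d} {Y : Ω → ℝ} {ζ B Θ : Ω → St d}
  {r : ℝ}

/-- The master equation rewrites the derivative along the path as a sum of small terms. -/
lemma deriv_eq (D : IsStep G P Λ T c s p t h X Y ζ B Θ) (S : Setting P₀ T Λ α K c u)
    (hr : r ^ 2 ≤ h) (hT : t + r ^ 2 < T) {μ : Measure (St d)}
    (hμ : μ = P.map fun ω => X ω + r ^ 2 • B ω + r • Θ ω) {xr : Ω → St d}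
    (hxr : xr = fun ω => X ω + r ^ 2 • B ω + r • Θ ω) (x v b : St d) (F : ℝ) :
    2 * r * u.dt (t + r ^ 2) x μ + ⟪u.dx (t + r ^ 2) x μ, (2 * r) • b + v⟫_ℝ
        + ∫ ω, ⟪u.dμ (t + r ^ 2) x μ (xr ω), (2 * r) • B ω + Θ ω⟫_ℝ ∂P + 2 * r * F
      = 2 * r * ⟪b - c.b x (u.U (t + r ^ 2) x μ) (u.graphLaw (t + r ^ 2) μ),
            u.dx (t + r ^ 2) x μ⟫_ℝ
        + (⟪u.dx (t + r ^ 2) x μ, v⟫_ℝ - r * tr (u.dxx (t + r ^ 2) x μ ∘L c.a x μ))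
        + 2 * r * (F - c.f x (u.U (t + r ^ 2) x μ) (c.σadj x μ (u.dx (t + r ^ 2) x μ))
            (u.graphLaw (t + r ^ 2) μ))
        + 2 * r * ∫ ω, ⟪u.dμ (t + r ^ 2) x μ (xr ω), B ω - c.b (xr ω) (u.U (t + r ^ 2) (xr ω) μ)
            (u.graphLaw (t + r ^ 2) μ)⟫_ℝ ∂P
        + ∫ ω, (⟪u.dμ (t + r ^ 2) x μ (xr ω), Θ ω⟫_ℝ
            - r * tr (u.dvdμ (t + r ^ 2) x μ (xr ω) ∘L c.a (xr ω) μ)) ∂P := by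
  have hP2 : IsP2 μ := hμ ▸ D.isP2_path S r
  have hs := D.time_mem hr
  have hxm : Measurable xr := hxr ▸ D.measurable_path S r
  have hx2 : MemLp xr 2 P := hxr ▸ D.memLp_path S r
  have hμ' : μ = P.map xr := by rw [hμ, hxr]
  have hL := memLp_lions S hs x hxm hx2
  rw [← hμ'] at hL
  have hν := S.isP2_graphLaw hs hP2
  have hUm := (S.continuous_U hs hP2).measurable
  have hbm : Measurable fun v => c.b v (u.U (t + r ^ 2) v μ) (u.graphLaw (t + r ^ 2) μ) :=
    (S.continuous_b hν).measurable.comp (measurable_id.prodMk hUm)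
  have hb : MemLp (fun ω => c.b (xr ω) (u.U (t + r ^ 2) (xr ω) μ) (u.graphLaw (t + r ^ 2) μ)) 2 P :=
    S.memLp_b hν hx2 (S.memLp_U hs hP2 hx2)
  have haxm : Measurable fun v => c.a v μ := (S.continuous_a hP2).measurable
  have hdm := (S.continuous_dμ hs x hP2).measurable
  have hdd := (S.continuous_dvdμ hs x hP2).measurable
  have hi1 := integrable_inner_of_memLp hL.1.1 (D.memLp_Θ S 2)
  have hi2 := integrable_inner_of_memLp hL.1.1 (D.memLp_B_two S)
  have hi3 := integrable_inner_of_memLp hL.1.1 hb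
  have hi4 : Integrable (fun ω => tr (u.dvdμ (t + r ^ 2) x μ (xr ω) ∘L c.a (xr ω) μ)) P :=
    integrable_trace hL.2.1 (haxm.comp hxm).aestronglyMeasurable fun ω => S.norm_a_le (xr ω) hP2
  have hm := S.h1.classical.master_eq (t + r ^ 2) ⟨hs.1, hT⟩ x μ hP2
  have e1 : ∫ v, ⟪u.dμ (t + r ^ 2) x μ v, c.b v (u.U (t + r ^ 2) v μ)
      (u.graphLaw (t + r ^ 2) μ)⟫_ℝ ∂μ = ∫ ω, ⟪u.dμ (t + r ^ 2) x μ (xr ω),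
        c.b (xr ω) (u.U (t + r ^ 2) (xr ω) μ) (u.graphLaw (t + r ^ 2) μ)⟫_ℝ ∂P := by
    have h0 := integral_map (μ := P) hxm.aemeasurable
      (f := fun v => ⟪u.dμ (t + r ^ 2) x μ v, c.b v (u.U (t + r ^ 2) v μ)
      (u.graphLaw (t + r ^ 2) μ)⟫_ℝ) (hdm.inner hbm).aestronglyMeasurable
    rwa [← hμ'] at h0
  have e2 : ∫ v, 1 / 2 * tr (u.dvdμ (t + r ^ 2) x μ v ∘L c.a v μ) ∂μ
      = 1 / 2 * ∫ ω, tr (u.dvdμ (t + r ^ 2) x μ (xr ω) ∘L c.a (xr ω) μ) ∂P := by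
    have h3 : Continuous fun q : (St d →L[ℝ] St d) × (St d →L[ℝ] St d) => tr (q.1 ∘L q.2) :=
      continuous_tr.comp (continuous_fst.clm_comp continuous_snd)
    have h0 := integral_map (μ := P) hxm.aemeasurable
      (f := fun v => tr (u.dvdμ (t + r ^ 2) x μ v ∘L c.a v μ))
      (h3.measurable.comp (hdd.prodMk haxm)).aestronglyMeasurable
    rw [← hμ'] at h0
    rw [integral_const_mul, h0]
  rw [e1, e2] at hm
  have e3 : ∫ ω, ⟪u.dμ (t + r ^ 2) x μ (xr ω), (2 * r) • B ω + Θ ω⟫_ℝ ∂P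
      = 2 * r * ∫ ω, ⟪u.dμ (t + r ^ 2) x μ (xr ω), B ω⟫_ℝ ∂P
        + ∫ ω, ⟪u.dμ (t + r ^ 2) x μ (xr ω), Θ ω⟫_ℝ ∂P := by
    rw [← integral_const_mul, ← integral_add (hi2.const_mul _) hi1]
    simp only [inner_add_right, inner_smul_right]
  have e4 : ∫ ω, ⟪u.dμ (t + r ^ 2) x μ (xr ω), B ω - c.b (xr ω) (u.U (t + r ^ 2) (xr ω) μ)
            (u.graphLaw (t + r ^ 2) μ)⟫_ℝ ∂P
      = ∫ ω, ⟪u.dμ (t + r ^ 2) x μ (xr ω), B ω⟫_ℝ ∂P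
        - ∫ ω, ⟪u.dμ (t + r ^ 2) x μ (xr ω), c.b (xr ω) (u.U (t + r ^ 2) (xr ω) μ)
            (u.graphLaw (t + r ^ 2) μ)⟫_ℝ ∂P := by
    rw [← integral_sub hi2 hi3]
    simp only [inner_sub_right]
  have e5 : ∫ ω, (⟪u.dμ (t + r ^ 2) x μ (xr ω), Θ ω⟫_ℝ
            - r * tr (u.dvdμ (t + r ^ 2) x μ (xr ω) ∘L c.a (xr ω) μ)) ∂P
      = ∫ ω, ⟪u.dμ (t + r ^ 2) x μ (xr ω), Θ ω⟫_ℝ ∂P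
        - r * ∫ ω, tr (u.dvdμ (t + r ^ 2) x μ (xr ω) ∘L c.a (xr ω) μ) ∂P := by
    rw [integral_sub hi1 (hi4.const_mul r), integral_const_mul]
  rw [e3, e4, e5, inner_add_right, inner_smul_right, inner_sub_left,
    real_inner_comm (u.dx (t + r ^ 2) x μ) b]
  -- The factor `2 r` is the derivative of the elapsed time `r²`.
  linear_combination (2 * r) * hm

/-- Every term carries a factor `r`: the drift and driver terms because elapsed time is `r²`, the
noise terms because the noise is centred. Besides this factor stands either the error or one more
power of `r`. -/
lemma abs_deriv_le (D : IsStep G P Λ T c s p t h X Y ζ B Θ) (S : Setting P₀ T Λ α K c u)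
    (hX : MemLp X (ENNReal.ofReal (2 * α)) P)
    (hY : MemLp Y (ENNReal.ofReal (2 * α)) P) (hr0 : 0 ≤ r) (hr : r ^ 2 ≤ h)
    (hT : t + r ^ 2 < T) {μ : Measure (St d)}
    (hμ : μ = P.map fun ω => X ω + r ^ 2 • B ω + r • Θ ω) {xr : Ω → St d}
    (hxr : xr = fun ω => X ω + r ^ 2 • B ω + r • Θ ω) (ω : Ω) {x' : St d → St d}
    (hx' : x' = fun z => X ω + r ^ 2 • B ω + r • c.σ (X ω) (P.map X) z) {F : ℝ}
    (hF : F = c.f (X ω) (u.U t (X ω) (P.map X)) (c.σadj (X ω) (P.map X) (u.dx t (X ω) (P.map X)))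
        (u.graphLaw t (P.map X))) :
    |∑ z ∈ s, p z * (2 * r * u.dt (t + r ^ 2) (x' z) μ
        + ⟪u.dx (t + r ^ 2) (x' z) μ, (2 * r) • B ω + c.σ (X ω) (P.map X) z⟫_ℝ
        + ∫ ω', ⟪u.dμ (t + r ^ 2) (x' z) μ (xr ω'), (2 * r) • B ω' + Θ ω'⟫_ℝ ∂P) + 2 * r * F|
      ≤ (130 + 30 * d) * Λ ^ 7 * (r * (|u.U t (X ω) (P.map X) - Y ω|
        + lpNorm (fun ω => u.U t (X ω) (P.map X) - Y ω) 2 P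
        + r * (1 + ‖X ω‖ + ‖B ω‖ + lpNorm X 2 P + lpNorm B 2 P
          + lpNorm (envelope Λ X B) (ENNReal.ofReal (2 * α)) P ^ α))) := by
  have hP2 : IsP2 μ := hμ ▸ D.isP2_path S r
  have hs := D.time_mem hr
  have hΛ := S.one_le_Λ
  have hΛ0 := S.Λ_pos
  have hβ : 0 ≤ lpNorm B 2 P := lpNorm_nonneg
  have hN : 0 ≤ lpNorm X 2 P := lpNorm_nonneg
  have hΨ : 0 ≤ lpNorm (envelope Λ X B) (ENNReal.ofReal (2 * α)) P ^ α :=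
    Real.rpow_nonneg lpNorm_nonneg _
  have hε : 0 ≤ lpNorm (fun ω => u.U t (X ω) (P.map X) - Y ω) 2 P := lpNorm_nonneg
  have hpt : ∀ z ∈ s, ‖X ω - x' z‖ ≤ r * (‖B ω‖ + Λ ^ 2) := fun z hz => by
    rw [hx']; exact D.norm_point_sub_le S hr0 hr ω hz
  have k1 : |∑ z ∈ s, p z * (2 * r * ⟪B ω - c.b (x' z) (u.U (t + r ^ 2) (x' z) μ)
        (u.graphLaw (t + r ^ 2) μ), u.dx (t + r ^ 2) (x' z) μ⟫_ℝ)|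
      ≤ 2 * r * (Λ * (|u.U t (X ω) (P.map X) - Y ω|
        + lpNorm (fun ω => u.U t (X ω) (P.map X) - Y ω) 2 P
        + 14 * Λ ^ 3 * (r * (1 + ‖X ω‖ + ‖B ω‖ + lpNorm X 2 P + lpNorm B 2 P))) * Λ) := by
    refine D.design.abs_sum_le_const fun z hz => ?_
    rw [abs_mul, abs_of_nonneg (by positivity : 0 ≤ 2 * r)]
    refine mul_le_mul_of_nonneg_left ((abs_real_inner_le_norm _ _).trans ?_) (by positivity)
    exact mul_le_mul (D.norm_drift_sub_le S hr0 hr ω hμ (hpt z hz)) (S.norm_dx_le hs _ hP2)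
      (norm_nonneg _) (by positivity)
  have k2 := D.abs_space_term_le S hr0 hr ω hμ hx'
  have k3 : |∑ z ∈ s, p z * (2 * r * (F - c.f (x' z) (u.U (t + r ^ 2) (x' z) μ)
        (c.σadj (x' z) μ (u.dx (t + r ^ 2) (x' z) μ)) (u.graphLaw (t + r ^ 2) μ)))|
      ≤ 2 * r * (20 * Λ ^ 5 * (r * (1 + ‖X ω‖ + ‖B ω‖ + lpNorm X 2 P + lpNorm B 2 P))) := by
    refine D.design.abs_sum_le_const fun z hz => ?_
    rw [abs_mul, abs_of_nonneg (by positivity : 0 ≤ 2 * r), hF]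
    exact mul_le_mul_of_nonneg_left (D.abs_driver_sub_le S hr0 hr ω hμ (hpt z hz)) (by positivity)
  have k4 : |∑ z ∈ s, p z * (2 * r * ∫ ω', ⟪u.dμ (t + r ^ 2) (x' z) μ (xr ω'),
        B ω' - c.b (xr ω') (u.U (t + r ^ 2) (xr ω') μ) (u.graphLaw (t + r ^ 2) μ)⟫_ℝ ∂P)|
      ≤ 2 * r * (Λ * (Λ * (2 * lpNorm (fun ω => u.U t (X ω) (P.map X) - Y ω) 2 P
        + 28 * Λ ^ 3 * (r * (1 + lpNorm X 2 P + lpNorm B 2 P))))) := by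
    refine D.design.abs_sum_le_const fun z hz => ?_
    rw [abs_mul, abs_of_nonneg (by positivity : 0 ≤ 2 * r)]
    exact mul_le_mul_of_nonneg_left (D.abs_measure_drift_term_le S hr0 hr hμ (x' z) hxr)
      (by positivity)
  have k5 : |∑ z ∈ s, p z * ∫ ω', (⟪u.dμ (t + r ^ 2) (x' z) μ (xr ω'), Θ ω'⟫_ℝ
            - r * tr (u.dvdμ (t + r ^ 2) (x' z) μ (xr ω') ∘L c.a (xr ω') μ)) ∂P| ≤ _ :=
    D.design.abs_sum_le_const fun z hz =>
      D.abs_measure_noise_term_le S hX hY hr0 hr hμ (x' z) hxr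
  have hsplit : ∑ z ∈ s, p z * (2 * r * u.dt (t + r ^ 2) (x' z) μ
        + ⟪u.dx (t + r ^ 2) (x' z) μ, (2 * r) • B ω + c.σ (X ω) (P.map X) z⟫_ℝ
        + ∫ ω', ⟪u.dμ (t + r ^ 2) (x' z) μ (xr ω'), (2 * r) • B ω' + Θ ω'⟫_ℝ ∂P) + 2 * r * F
      = ∑ z ∈ s, p z * (2 * r * ⟪B ω - c.b (x' z) (u.U (t + r ^ 2) (x' z) μ)
        (u.graphLaw (t + r ^ 2) μ), u.dx (t + r ^ 2) (x' z) μ⟫_ℝ)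
      + ∑ z ∈ s, p z * (⟪u.dx (t + r ^ 2) (x' z) μ, c.σ (X ω) (P.map X) z⟫_ℝ
        - r * tr (u.dxx (t + r ^ 2) (x' z) μ ∘L c.a (x' z) μ))
      + ∑ z ∈ s, p z * (2 * r * (F - c.f (x' z) (u.U (t + r ^ 2) (x' z) μ)
        (c.σadj (x' z) μ (u.dx (t + r ^ 2) (x' z) μ)) (u.graphLaw (t + r ^ 2) μ)))
      + ∑ z ∈ s, p z * (2 * r * ∫ ω', ⟪u.dμ (t + r ^ 2) (x' z) μ (xr ω'),
        B ω' - c.b (xr ω') (u.U (t + r ^ 2) (xr ω') μ) (u.graphLaw (t + r ^ 2) μ)⟫_ℝ ∂P)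
      + ∑ z ∈ s, p z * ∫ ω', (⟪u.dμ (t + r ^ 2) (x' z) μ (xr ω'), Θ ω'⟫_ℝ
            - r * tr (u.dvdμ (t + r ^ 2) (x' z) μ (xr ω') ∘L c.a (xr ω') μ)) ∂P := by
    have e0 : 2 * r * F = ∑ z ∈ s, p z * (2 * r * F) := by
      rw [← Finset.sum_mul, D.design.sum_one, one_mul]
    rw [e0]
    simp only [← Finset.sum_add_distrib]
    refine Finset.sum_congr rfl fun z _ => ?_
    rw [← mul_add, D.deriv_eq S hr hT hμ hxr]
    ring
  rw [hsplit]
  have h5 : ∀ a b c d e : ℝ, |a + b + c + d + e| ≤ |a| + |b| + |c| + |d| + |e| := by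
    intro a b c d e
    linarith [abs_add_le (a + b + c + d) e, abs_add_le (a + b + c) d, abs_add_le (a + b) c,
      abs_add_le a b]
  refine (h5 _ _ _ _ _).trans ((add_le_add (add_le_add (add_le_add (add_le_add k1 k2) k3) k4)
    k5).trans ?_)
  set Ψ := lpNorm (envelope Λ X B) (ENNReal.ofReal (2 * α)) P ^ α
  set N := lpNorm X 2 P
  set β := lpNorm B 2 P
  set ε := lpNorm (fun ω => u.U t (X ω) (P.map X) - Y ω) 2 P
  set e := |u.U t (X ω) (P.map X) - Y ω|
  have he : 0 ≤ e := abs_nonneg _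
  set ρ := 1 + ‖X ω‖ + ‖B ω‖ + N + β with hρ
  have hx := norm_nonneg (X ω)
  have hb := norm_nonneg (B ω)
  have hρ0 : 0 ≤ ρ := by positivity
  have hd : (0:ℝ) ≤ d := Nat.cast_nonneg _
  have p2 : Λ ^ 2 ≤ Λ ^ 7 := pow_le_pow_right₀ hΛ (by norm_num)
  have p5 : Λ ^ 5 ≤ Λ ^ 7 := pow_le_pow_right₀ hΛ (by norm_num)
  have s2 : 1 + ‖B ω‖ + β ≤ ρ := by linarith
  have s4 : 1 + N + β ≤ ρ := by linarith
  calc 2 * r * (Λ * (e + ε + 14 * Λ ^ 3 * (r * ρ)) * Λ)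
        + (1 + 5 * d) * Λ ^ 7 * (r * (r * (1 + ‖B ω‖ + β)))
        + 2 * r * (20 * Λ ^ 5 * (r * ρ))
        + 2 * r * (Λ * (Λ * (2 * ε + 28 * Λ ^ 3 * (r * (1 + N + β)))))
        + (3 + 11 * d) * Λ ^ 7 * (r * (r * (1 + N + β + Ψ)))
      ≤ 2 * r * (Λ * (e + ε + 14 * Λ ^ 3 * (r * ρ)) * Λ)
        + (1 + 5 * d) * Λ ^ 7 * (r * (r * ρ))
        + 2 * r * (20 * Λ ^ 5 * (r * ρ))
        + 2 * r * (Λ * (Λ * (2 * ε + 28 * Λ ^ 3 * (r * ρ))))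
        + (3 + 11 * d) * Λ ^ 7 * (r * (r * (ρ + Ψ))) := by gcongr
    _ = Λ ^ 2 * (r * (2 * e + 6 * ε)) + 124 * (Λ ^ 5 * (r * (r * ρ)))
        + (4 + 16 * d) * (Λ ^ 7 * (r * (r * ρ))) + (3 + 11 * d) * (Λ ^ 7 * (r * (r * Ψ))) := by ring
    _ ≤ Λ ^ 7 * (r * (2 * e + 6 * ε)) + 124 * (Λ ^ 7 * (r * (r * ρ)))
        + (4 + 16 * d) * (Λ ^ 7 * (r * (r * ρ))) + (3 + 11 * d) * (Λ ^ 7 * (r * (r * Ψ))) := by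
      gcongr
    _ ≤ (130 + 30 * d) * (Λ ^ 7 * (r * e)) + (130 + 30 * d) * (Λ ^ 7 * (r * ε))
        + (130 + 30 * d) * (Λ ^ 7 * (r * (r * ρ))) + (130 + 30 * d) * (Λ ^ 7 * (r * (r * Ψ))) := by
      have a1 : 0 ≤ Λ ^ 7 * (r * e) := by positivity
      have a2 : 0 ≤ Λ ^ 7 * (r * ε) := by positivity
      have a3 : 0 ≤ Λ ^ 7 * (r * (r * ρ)) := by positivity
      have a4 : 0 ≤ Λ ^ 7 * (r * (r * Ψ)) := by positivity
      linarith [mul_nonneg hd a1, mul_nonneg hd a2, mul_nonneg hd a3, mul_nonneg hd a4]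
    _ = _ := by ring

/-- Fine one-step expansion of the decoupling field along the scheme. -/
lemma abs_increment_le [IsProbabilityMeasure P₀] (D : IsStep G P Λ T c s p t h X Y ζ B Θ) (S : Setting P₀ T Λ α K c u)
    (hX : MemLp X (ENNReal.ofReal (2 * α)) P) (hY : MemLp Y (ENNReal.ofReal (2 * α)) P) (ω : Ω) :
    |∑ z ∈ s, p z * u.U (t + h) (X ω + h • B ω + √h • c.σ (X ω) (P.map X) z)
          (P.map fun ω => X ω + h • B ω + √h • Θ ω)
        - u.U t (X ω) (P.map X)
        + h * c.f (X ω) (u.U t (X ω) (P.map X))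
          (c.σadj (X ω) (P.map X) (u.dx t (X ω) (P.map X))) (u.graphLaw t (P.map X))|
      ≤ (130 + 30 * d) * Λ ^ 7 * (h * (|u.U t (X ω) (P.map X) - Y ω|
        + lpNorm (fun ω => u.U t (X ω) (P.map X) - Y ω) 2 P
        + √h * (1 + ‖X ω‖ + ‖B ω‖ + lpNorm X 2 P + lpNorm B 2 P
          + lpNorm (envelope Λ X B) (ENNReal.ofReal (2 * α)) P ^ α))) := by
  set F := c.f (X ω) (u.U t (X ω) (P.map X))
          (c.σadj (X ω) (P.map X) (u.dx t (X ω) (P.map X))) (u.graphLaw t (P.map X)) with hF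
  set ρ := 1 + ‖X ω‖ + ‖B ω‖ + lpNorm X 2 P + lpNorm B 2 P
          + lpNorm (envelope Λ X B) (ENNReal.ofReal (2 * α)) P ^ α with hρ
  set A := |u.U t (X ω) (P.map X) - Y ω| + lpNorm (fun ω => u.U t (X ω) (P.map X) - Y ω) 2 P
    with hA
  have hΛ0 := S.Λ_pos
  have hβ : 0 ≤ lpNorm B 2 P := lpNorm_nonneg
  have hN : 0 ≤ lpNorm X 2 P := lpNorm_nonneg
  have hΨ : 0 ≤ lpNorm (envelope Λ X B) (ENNReal.ofReal (2 * α)) P ^ α :=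
    Real.rpow_nonneg lpNorm_nonneg _
  have hε : 0 ≤ lpNorm (fun ω => u.U t (X ω) (P.map X) - Y ω) 2 P := lpNorm_nonneg
  have hρ0 : 0 ≤ ρ := by positivity
  have hA0 : 0 ≤ A := by positivity
  have hh := D.h_pos.le
  have hsq : √h ^ 2 = h := Real.sq_sqrt hh
  set C := (130 + 30 * d) * Λ ^ 7 * (A + √h * ρ) with hC
  have hC0 : 0 ≤ C := by positivity
  -- In the variable `r` the path is smooth at the start of the step, which it is not in the elapsed
  -- time. The function vanishes at 0 and is the defect at `√h`.
  let φ : ℝ → ℝ := fun r => ∑ z ∈ s, p z * u.U (t + r ^ 2) (X ω + r ^ 2 • B ω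
      + r • c.σ (X ω) (P.map X) z) (P.map fun ω => X ω + r ^ 2 • B ω + r • Θ ω)
      + (F * r ^ 2 - u.U t (X ω) (P.map X))
  have hφ0 : φ 0 = 0 := by
    simp only [φ, ne_eq, OfNat.ofNat_ne_zero, not_false_eq_true, zero_pow, add_zero, zero_smul,
      mul_zero, zero_sub]
    rw [← Finset.sum_mul, D.design.sum_one]
    change 1 * u.U t (X ω) (P.map X) + _ = 0
    ring
  have hXm := D.measurable_X
  have hBm := D.measurable_B S
  have hΘm := D.measurable_Θ S
  have hB2 := D.memLp_B_two S
  have hΘ2 := D.memLp_Θ S 2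
  have hcont : ContinuousOn φ (Icc 0 (√h)) := by
    refine ContinuousOn.add (continuousOn_finsetSum _ fun z _ => ?_) (by fun_prop)
    exact continuousOn_const.mul (S.continuousWithinAt_path hXm hBm hΘm D.memLp_X hB2 hΘ2
      D.t_nonneg (by rw [hsq]; exact D.le_T) (X ω) (B ω) (c.σ (X ω) (P.map X) z))
  have hder : ∀ r ∈ Ico 0 (√h), HasDerivWithinAt φ
      (∑ z ∈ s, p z * (2 * r * u.dt (t + r ^ 2) (X ω + r ^ 2 • B ω
          + r • c.σ (X ω) (P.map X) z) (P.map fun ω => X ω + r ^ 2 • B ω + r • Θ ω)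
        + ⟪u.dx (t + r ^ 2) (X ω + r ^ 2 • B ω
          + r • c.σ (X ω) (P.map X) z) (P.map fun ω => X ω + r ^ 2 • B ω + r • Θ ω),
          (2 * r) • B ω + c.σ (X ω) (P.map X) z⟫_ℝ
        + ∫ ω', ⟪u.dμ (t + r ^ 2) (X ω + r ^ 2 • B ω
          + r • c.σ (X ω) (P.map X) z) (P.map fun ω => X ω + r ^ 2 • B ω + r • Θ ω)
            (X ω' + r ^ 2 • B ω' + r • Θ ω'), (2 * r) • B ω' + Θ ω'⟫_ℝ ∂P) + 2 * r * F)
      (Ici r) r := by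
    intro r hr
    have hr2 : r ^ 2 < h := by rw [← hsq]; exact pow_lt_pow_left₀ hr.2 hr.1 (by norm_num)
    refine HasDerivWithinAt.add ?_ ?_
    · refine HasDerivWithinAt.fun_sum fun z _ => ?_
      exact (S.hasDerivWithinAt_path hXm hBm hΘm D.memLp_X hB2 hΘ2 D.t_nonneg hr.1
        (by linarith [D.le_T]) (X ω) (B ω) (c.σ (X ω) (P.map X) z) rfl rfl).const_mul (p z)
    · have h1 := ((hasDerivAt_pow 2 r).const_mul F).sub_const (u.U t (X ω) (P.map X))
      refine (h1.congr_deriv ?_).hasDerivWithinAt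
      push_cast; ring
  have hbd : ∀ r ∈ Ico 0 (√h), _ ≤ C * r := fun r hr => by
    have hr2 : r ^ 2 < h := by rw [← hsq]; exact pow_lt_pow_left₀ hr.2 hr.1 (by norm_num)
    refine (D.abs_deriv_le S hX hY hr.1 hr2.le (by linarith [D.le_T]) rfl rfl ω rfl hF).trans ?_
    have h1 : r * (A + r * ρ) ≤ r * (A + √h * ρ) := by
      have := hr.2.le
      have := hr.1
      gcongr
    calc _ ≤ (130 + 30 * d) * Λ ^ 7 * (r * (A + √h * ρ)) :=
          mul_le_mul_of_nonneg_left h1 (by positivity)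
      _ = C * r := by rw [hC]; ring
  -- A derivative bounded by `C r` is compared with the barrier `C r² / 2`, which equals `C h / 2`
  -- at the end of the step.
  have hBd : ∀ r : ℝ, HasDerivAt (fun r => C * r ^ 2 / 2) (C * r) r := fun r => by
    refine (((hasDerivAt_pow 2 r).const_mul C).div_const 2).congr_deriv ?_
    push_cast; ring
  have hfin := image_norm_le_of_norm_deriv_right_le_deriv_boundary (f := φ) hcont hder
    (B := fun r => C * r ^ 2 / 2) (by rw [hφ0]; simp) hBd hbd
    (right_mem_Icc.2 (Real.sqrt_nonneg h))
  simp only [φ, hsq] at hfin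
  rw [Real.norm_eq_abs] at hfin
  have e1 : ∑ z ∈ s, p z * u.U (t + h) (X ω + h • B ω + √h • c.σ (X ω) (P.map X) z)
          (P.map fun ω => X ω + h • B ω + √h • Θ ω) - u.U t (X ω) (P.map X) + h * F
      = ∑ z ∈ s, p z * u.U (t + h) (X ω + h • B ω + √h • c.σ (X ω) (P.map X) z)
          (P.map fun ω => X ω + h • B ω + √h • Θ ω) + (F * h - u.U t (X ω) (P.map X)) := by ring
  rw [e1]
  refine hfin.trans ?_
  have : C * h / 2 ≤ C * h := by linarith [mul_nonneg hC0 hh]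
  refine this.trans_eq ?_
  rw [hC]; ring

end IsStep
end MKV
namespace MKV

/-! ### Second order estimate in the measure variable without moment assumptions -/

section Interpolation

/-- `R` parametrises `[0, M]` with a density bounded below on the part `(0, a]` of the unit interval
on which the velocity `H` is supported. -/
structure IsSpread (R H : ℝ → ℝ) (a M : ℝ) : Prop where
  meas_R : Measurable R
  meas_H : Measurable H
  a_nonneg : 0 ≤ a
  a_le : a ≤ 1
  R_mem : ∀ u ∈ Ioc (0 : ℝ) 1, R u ∈ Icc 0 M
  M_le : M ≤ 1
  H_nonneg : ∀ u ∈ Ioc (0 : ℝ) 1, 0 ≤ H u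
  H_le : ∀ u ∈ Ioc (0 : ℝ) 1, H u ≤ (Iic a).indicator (fun _ => 1) u
  spread : ∀ φ : ℝ → ℝ, Continuous φ → (∀ x, 0 ≤ φ x) →
    a * ∫ x in 0..M, φ x ≤ 2 * ∫ u in 0..a, φ (R u)

variable {R H : ℝ → ℝ} {a M : ℝ}

/-- Each increment of `w` is at most the integral of `|w'|` over `[0, M]`, whatever `u`. Integrating
against the velocity gives a factor `a`, and the spreading condition converts `a ∫ |w'|` into an
average of `|w'|` over the positions `R u` themselves. So `w'` need only be controlled on average
along the family, which is what an `L²(μ)` bound provides. -/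
lemma IsSpread.abs_integral_le (hR : IsSpread R H a M) {w w' : ℝ → ℝ}
    (hw : ∀ x, HasDerivAt w (w' x) x) (hw' : Continuous w') :
    |∫ u in Ioc (0 : ℝ) 1, H u * (w (R u) - w 0)| ≤ 2 * ∫ u in Ioc 0 a, |w' (R u)| := by
  set I := ∫ x in 0..M, |w' x| with hI
  have hpt : ∀ u ∈ Ioc (0 : ℝ) 1, |w (R u) - w 0| ≤ I := by
    intro u hu
    have h1 := hR.R_mem u hu
    rw [← intervalIntegral.integral_eq_sub_of_hasDerivAt (fun x _ => hw x)
      (hw'.intervalIntegrable _ _)]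
    refine (intervalIntegral.abs_integral_le_integral_abs h1.1).trans ?_
    exact intervalIntegral.integral_mono_interval le_rfl h1.1 h1.2
      (ae_of_all _ fun _ => abs_nonneg _) (hw'.abs.intervalIntegrable _ _)
  have hI0 : 0 ≤ I := by
    rcases (Ioc_subset_Ioc_right le_rfl : Ioc (0:ℝ) 1 ⊆ _) (right_mem_Ioc.2 zero_lt_one) with h
    exact (abs_nonneg _).trans (hpt 1 h)
  have hi : IntegrableOn ((Iic a).indicator fun _ => I) (Ioc (0 : ℝ) 1) :=
    (integrable_const I).indicator measurableSet_Iic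
  have h2 : |∫ u in Ioc (0 : ℝ) 1, H u * (w (R u) - w 0)|
      ≤ ∫ u in Ioc (0 : ℝ) 1, (Iic a).indicator (fun _ => I) u := by
    rw [← Real.norm_eq_abs]
    refine norm_integral_le_of_norm_le hi ((ae_restrict_iff' measurableSet_Ioc).2
      (ae_of_all _ fun u hu => ?_))
    rw [Real.norm_eq_abs, abs_mul, abs_of_nonneg (hR.H_nonneg u hu)]
    have h3 := mul_le_mul (hR.H_le u hu) (hpt u hu) (abs_nonneg _)
      (indicator_nonneg (fun _ _ => zero_le_one) _)
    refine h3.trans_eq ?_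
    by_cases h : u ∈ Iic a <;> simp [h]
  have h3 : ∫ u in Ioc (0 : ℝ) 1, (Iic a).indicator (fun _ => I) u = a * I := by
    rw [integral_indicator measurableSet_Iic, Measure.restrict_restrict measurableSet_Iic,
      setIntegral_const, inter_comm, Ioc_inter_Iic, min_eq_right hR.a_le, Real.volume_real_Ioc_of_le hR.a_nonneg]
    simp
  have h4 := hR.spread (fun x => |w' x|) hw'.abs fun _ => abs_nonneg _
  rw [intervalIntegral.integral_of_le hR.a_nonneg] at h4
  linarith

/-- Linear scaling from `0`. -/
lemma isSpread_linear {s : ℝ} (hs : s ∈ Icc (0 : ℝ) 1) :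
    IsSpread (fun u => 0 + s * u) (fun u => u) 1 s where
  meas_R := by fun_prop
  meas_H := measurable_id
  a_nonneg := zero_le_one
  a_le := le_rfl
  R_mem u hu := by
    have := hu.1; have := hs.1
    exact ⟨by positivity, by nlinarith [hu.2]⟩
  M_le := hs.2
  H_nonneg u hu := hu.1.le
  H_le u hu := by simp [hu.2]
  spread φ hφ h0 := by
    have h1 := intervalIntegral.mul_integral_comp_mul_left (f := φ) (c := s) (a := 0) (b := 1)
    have h2 : 0 ≤ ∫ u in (0:ℝ)..1, φ (s * u) :=
      intervalIntegral.integral_nonneg zero_le_one fun _ _ => h0 _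
    simp only [mul_zero, mul_one] at h1
    simp only [zero_add, one_mul]
    rw [← h1]; nlinarith [hs.2]

/-- The stopped dilation `u ↦ min 1 (2ⁿ u)`. -/
noncomputable def dilation (n : ℕ) (u : ℝ) : ℝ := min 1 (2 ^ n * u)

lemma continuous_dilation (n : ℕ) : Continuous (dilation n) := by unfold dilation; fun_prop

lemma dilation_mem (n : ℕ) {u : ℝ} (hu : 0 ≤ u) : dilation n u ∈ Icc (0 : ℝ) 1 :=
  ⟨le_min zero_le_one (by positivity), min_le_left _ _⟩

lemma dilation_eq_one {n : ℕ} {u : ℝ} (hu : (1 / 2) ^ n < u) : dilation n u = 1 := by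
  refine min_eq_left ?_
  have h : (2:ℝ) ^ n * (1 / 2) ^ n = 1 := by rw [← mul_pow]; norm_num
  have := mul_le_mul_of_nonneg_left hu.le (by positivity : (0:ℝ) ≤ 2 ^ n)
  linarith

/-- On the first half of `(0, 2⁻ⁿ]` the interpolated map is linear of slope `2ⁿ (1 + s)` up to the
value `(1 + s) / 2`, on the second half it has slope `2ⁿ (1 - s)` up to 1. Slopes are at most `2 ·
2ⁿ`, whence the factor 2 in the spreading condition. -/
lemma isSpread_dilation (n : ℕ) {s : ℝ} (hs : s ∈ Icc (0 : ℝ) 1) :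
    IsSpread (fun u => dilation n u + s * (dilation (n + 1) u - dilation n u))
      (fun u => dilation (n + 1) u - dilation n u) ((1 / 2) ^ n) 1 where
  meas_R := by
    have := (continuous_dilation n).measurable
    have := (continuous_dilation (n + 1)).measurable
    fun_prop
  meas_H := (continuous_dilation (n + 1)).measurable.sub (continuous_dilation n).measurable
  a_nonneg := by positivity
  a_le := pow_le_one₀ (by norm_num) (by norm_num)
  R_mem u hu := by
    have h1 := dilation_mem n hu.1.le
    have h2 := dilation_mem (n + 1) hu.1.le
    have e : dilation n u + s * (dilation (n + 1) u - dilation n u)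
      = (1 - s) * dilation n u + s * dilation (n + 1) u := by ring
    rw [e]
    have h3 : 0 ≤ 1 - s := by linarith [hs.2]
    exact ⟨add_nonneg (mul_nonneg h3 h1.1) (mul_nonneg hs.1 h2.1), by
      nlinarith [mul_le_mul_of_nonneg_left h1.2 h3, mul_le_mul_of_nonneg_left h2.2 hs.1]⟩
  M_le := le_rfl
  H_nonneg u hu := by
    rw [sub_nonneg]
    refine min_le_min_left _ ?_
    have : (2:ℝ) ^ n ≤ 2 ^ (n + 1) := pow_le_pow_right₀ (by norm_num) (by omega)
    exact mul_le_mul_of_nonneg_right this hu.1.le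
  H_le u hu := by
    have h1 := dilation_mem n hu.1.le
    have h2 := dilation_mem (n + 1) hu.1.le
    by_cases h : u ≤ (1 / 2) ^ n
    · rw [indicator_of_mem (mem_Iic.2 h)]; linarith [h1.1, h2.2]
    · rw [indicator_of_notMem (by simpa using h), dilation_eq_one (not_le.1 h)]
      linarith [h2.2]
  spread φ hφ h0 := by
    set b : ℝ := (1 / 2) ^ n / 2 with hb
    have hb0 : 0 ≤ b := by positivity
    have hbn : (2:ℝ) ^ n * b = 1 / 2 := by
      rw [hb, ← mul_div_assoc, ← mul_pow]; norm_num
    have hbb : ((1:ℝ) / 2) ^ n = 2 * b := by rw [hb]; ring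
    set R := fun u => dilation n u + s * (dilation (n + 1) u - dilation n u) with hR
    have hRc : Continuous R := by
      have := continuous_dilation n
      have := continuous_dilation (n + 1)
      fun_prop
    have hint : ∀ x y, IntervalIntegrable (fun u => φ (R u)) volume x y := fun x y =>
      (hφ.comp hRc).intervalIntegrable x y
    have hint' : ∀ x y, IntervalIntegrable φ volume x y := fun x y => hφ.intervalIntegrable x y
    have e1 : ∫ u in (0:ℝ)..b, φ (R u) = ∫ u in (0:ℝ)..b, φ ((2 ^ n * (1 + s)) * u + 0) := by
      refine intervalIntegral.integral_congr fun u hu => ?_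
      rw [uIcc_of_le hb0] at hu
      have h1 : 2 ^ n * u ≤ 1 / 2 := by
        rw [← hbn]; exact mul_le_mul_of_nonneg_left hu.2 (by positivity)
      have h2 : dilation n u = 2 ^ n * u := min_eq_right (by linarith)
      have h3 : dilation (n + 1) u = 2 * (2 ^ n * u) := by
        rw [dilation, pow_succ, min_eq_right (by linarith)]; ring
      simp only [hR, h2, h3]; congr 1; ring
    have e2 : ∫ u in b..2 * b, φ (R u) = ∫ u in b..2 * b, φ ((2 ^ n * (1 - s)) * u + s) := by
      refine intervalIntegral.integral_congr fun u hu => ?_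
      rw [uIcc_of_le (by linarith)] at hu
      have h1 : 2 ^ n * u ≤ 1 := by
        have := mul_le_mul_of_nonneg_left hu.2 (by positivity : (0:ℝ) ≤ 2 ^ n)
        linarith
      have h1' : 1 / 2 ≤ 2 ^ n * u := by
        rw [← hbn]; exact mul_le_mul_of_nonneg_left hu.1 (by positivity)
      have h2 : dilation n u = 2 ^ n * u := min_eq_right (by linarith)
      have h3 : dilation (n + 1) u = 1 := by
        rw [dilation, pow_succ, min_eq_left (by linarith)]
      simp only [hR, h2, h3]; congr 1; ring
    have f1 := intervalIntegral.mul_integral_comp_mul_add (f := φ) (c := 2 ^ n * (1 + s)) (d := 0)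
      (a := 0) (b := b)
    have f2 := intervalIntegral.mul_integral_comp_mul_add (f := φ) (c := 2 ^ n * (1 - s)) (d := s)
      (a := b) (b := 2 * b)
    have g1 : 2 ^ n * (1 + s) * b + 0 = (1 + s) / 2 := by linear_combination (1 + s) * hbn
    have g2 : 2 ^ n * (1 - s) * b + s = (1 + s) / 2 := by linear_combination (1 - s) * hbn
    have g3 : 2 ^ n * (1 - s) * (2 * b) + s = 1 := by linear_combination 2 * (1 - s) * hbn
    rw [← e1, g1, mul_zero, zero_add] at f1
    rw [← e2, g2, g3] at f2
    have h1 : 0 ≤ ∫ u in (0:ℝ)..b, φ (R u) :=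
      intervalIntegral.integral_nonneg hb0 fun _ _ => h0 _
    have h2 : 0 ≤ ∫ u in b..2 * b, φ (R u) :=
      intervalIntegral.integral_nonneg (by linarith) fun _ _ => h0 _
    rw [hbb, ← intervalIntegral.integral_add_adjacent_intervals (hint 0 b) (hint b (2 * b)),
      ← intervalIntegral.integral_add_adjacent_intervals (hint' 0 ((1 + s) / 2)) (hint' _ 1),
      ← f1, ← f2]
    calc 2 * b * (2 ^ n * (1 + s) * (∫ u in (0:ℝ)..b, φ (R u))
          + 2 ^ n * (1 - s) * ∫ u in b..2 * b, φ (R u))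
        = (1 + s) * (∫ u in (0:ℝ)..b, φ (R u)) + (1 - s) * ∫ u in b..2 * b, φ (R u) := by
          linear_combination (2 * (1 + s) * (∫ u in (0:ℝ)..b, φ (R u))
            + 2 * (1 - s) * ∫ u in b..2 * b, φ (R u)) * hbn
      _ ≤ _ := by nlinarith [hs.1, hs.2]

end Interpolation

section UnitInterval

/-- The uniform law on the unit interval. -/
noncomputable abbrev unitLaw : Measure ℝ := volume.restrict (Ioc (0 : ℝ) 1)

instance : IsProbabilityMeasure unitLaw := ⟨by simp⟩

end UnitInterval

variable {d : ℕ} {Ω₀ : Type*} {m₀ : MeasurableSpace Ω₀} {P₀ : Measure Ω₀} {T Λ α K : ℝ}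
  {c : Coeffs d} {u : MasterField d}
  {Ω : Type*} {G mΩ : MeasurableSpace Ω} {P : Measure Ω} [IsProbabilityMeasure P]
  {s : Finset (St d)} {p : St d → ℝ} {t : ℝ} {X : Ω → St d} {ζ : Ω → St d}
  {A : Ω → St d →L[ℝ] St d}

/-- Along a spread family of positions, the Lions derivative against a centred noise is of second
order. -/
lemma Setting.abs_integral_spread_le (S : Setting P₀ T Λ α K c u) (ht : t ∈ Icc 0 T) (x : St d)
    (hXG : Measurable[G] X) (hX2 : MemLp X 2 P) (hAG : Measurable[G] A) (hA : ∀ ω, ‖A ω‖ ≤ Λ)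
    (hζ : IsInnovation G P ζ s p) (hs : IsDesign Λ s p) {ρ : ℝ} (hρ : 0 ≤ ρ) {R H : ℝ → ℝ}
    {a M : ℝ} (hR : IsSpread R H a M) {μ : Measure (St d)}
    (hμ : μ = (P.prod unitLaw).map fun q => X q.1 + (ρ * R q.2) • A q.1 (ζ q.1)) :
    |∫ q, ⟪u.dμ t x μ (X q.1 + (ρ * R q.2) • A q.1 (ζ q.1)), (ρ * H q.2) • A q.1 (ζ q.1)⟫_ℝ
        ∂(P.prod unitLaw)| ≤ 2 * Λ ^ 5 * ρ ^ 2 * √a := by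
  have hΛ0 := S.Λ_pos
  set P' := P.prod unitLaw with hP'
  set Θ : Ω → St d := fun ω => A ω (ζ ω) with hΘ
  have hX : Measurable X := hXG.mono hζ.le le_rfl
  have hAm : Measurable A := hAG.mono hζ.le le_rfl
  have hΘm : Measurable Θ := by
    have h1 : Continuous fun q : (St d →L[ℝ] St d) × St d => q.1 q.2 := by fun_prop
    exact h1.measurable.comp (hAm.prodMk hζ.measurable)
  have hΘb : ∀ ω, ‖Θ ω‖ ≤ Λ ^ 2 := fun ω => hs.norm_image_le hΛ0.le (hA ω) (hζ.mem ω)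
  have hmem : ∀ᵐ q ∂P', q.2 ∈ Ioc (0 : ℝ) 1 :=
    (measurePreserving_snd (μ := P) (ν := unitLaw)).quasiMeasurePreserving.ae
      (ae_restrict_mem measurableSet_Ioc)
  have hRm := hR.meas_R
  have hHm := hR.meas_H
  set xr : Ω × ℝ → St d := fun q => X q.1 + (ρ * R q.2) • Θ q.1 with hxr
  have hxm : Measurable xr := by fun_prop
  have hsm : ∀ {φ : ℝ → ℝ}, Measurable φ → (∀ v ∈ Ioc (0 : ℝ) 1, |φ v| ≤ 1) →
      MemLp (fun q : Ω × ℝ => (φ q.2) • Θ q.1) 2 P' := fun {φ} hφ hb => by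
    refine MemLp.of_bound (by fun_prop) (Λ ^ 2) (hmem.mono fun q hq => ?_)
    rw [norm_smul]
    calc ‖φ q.2‖ * ‖Θ q.1‖ ≤ 1 * Λ ^ 2 :=
          mul_le_mul (hb _ hq) (hΘb _) (norm_nonneg _) zero_le_one
      _ = _ := one_mul _
  have hRb : ∀ v ∈ Ioc (0 : ℝ) 1, |R v| ≤ 1 := fun v hv =>
    (abs_of_nonneg (hR.R_mem v hv).1).trans_le ((hR.R_mem v hv).2.trans hR.M_le)
  have hHb : ∀ v ∈ Ioc (0 : ℝ) 1, |H v| ≤ 1 := fun v hv => by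
    rw [abs_of_nonneg (hR.H_nonneg v hv)]
    refine (hR.H_le v hv).trans ?_
    by_cases h : v ∈ Iic a <;> simp [h]
  have hx2 : MemLp xr 2 P' := by
    have h1 : MemLp (fun q : Ω × ℝ => X q.1) 2 P' :=
      hX2.comp_measurePreserving (measurePreserving_fst (μ := P) (ν := unitLaw))
    have h2 := (hsm hRm hRb).const_smul ρ
    refine h1.add (h2.congr_norm (by fun_prop) (ae_of_all _ fun q => ?_))
    simp only [Pi.smul_apply, smul_smul]
  have hL := IsStep.memLp_lions S ht x hxm hx2
  rw [← hμ] at hL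
  have hP2 : IsP2 μ := hμ ▸ isP2_map hxm hx2
  -- `w ω τ` is the Lions derivative in the direction of the noise at displacement `ρ τ`; its
  -- derivative `w'` contains a factor `ρ`, the source of the second order.
  let w : Ω → ℝ → ℝ := fun ω τ => ⟪u.dμ t x μ (X ω + (ρ * τ) • Θ ω), Θ ω⟫_ℝ
  let w' : Ω → ℝ → ℝ := fun ω τ => ρ * ⟪u.dvdμ t x μ (X ω + (ρ * τ) • Θ ω) (Θ ω), Θ ω⟫_ℝ
  have hw : ∀ ω τ, HasDerivAt (w ω) (w' ω τ) τ := fun ω τ => by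
    have h1 : HasDerivAt (fun τ : ℝ => X ω + (ρ * τ) • Θ ω) (ρ • Θ ω) τ := by
      simpa using (((hasDerivAt_id τ).const_mul ρ).smul_const (Θ ω)).const_add (X ω)
    have h2 := (S.h1.classical.hasFDeriv_dμ t ht x μ _ hP2).comp_hasDerivAt τ h1
    have h3 := h2.inner ℝ (hasDerivAt_const τ (Θ ω))
    refine h3.congr_deriv ?_
    simp [w', inner_smul_left]
  have hw' : ∀ ω, Continuous (w' ω) := fun ω => by
    have h1 := S.continuous_dvdμ ht x hP2
    have h2 : Continuous fun τ => u.dvdμ t x μ (X ω + (ρ * τ) • Θ ω) := h1.comp (by fun_prop)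
    exact continuous_const.mul ((h2.clm_apply continuous_const).inner continuous_const)
  let f : Ω × ℝ → ℝ := fun q => H q.2 * w q.1 (R q.2)
  have hf : Integrable f P' := by
    have := integrable_inner_of_memLp hL.1.1 (hsm hHm hHb)
    simp only [inner_smul_right] at this
    exact this
  let g : Ω × ℝ → ℝ := fun q => (Iic a).indicator (fun v => |w' q.1 (R v)|) q.2
  have hgle : ∀ q, |g q| ≤ ‖u.dvdμ t x μ (xr q)‖ * (ρ * Λ ^ 4 * (Iic a).indicator 1 q.2) := by
    intro q
    by_cases h : q.2 ∈ Iic a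
    · simp only [g, h, indicator_of_mem, abs_abs, w', Pi.one_apply, mul_one]
      rw [abs_mul, abs_of_nonneg hρ, mul_left_comm]
      refine mul_le_mul_of_nonneg_left ((abs_real_inner_le_norm _ _).trans ?_) hρ
      have h1 := (u.dvdμ t x μ (xr q)).le_opNorm (Θ q.1)
      calc _ ≤ (‖u.dvdμ t x μ (xr q)‖ * ‖Θ q.1‖) * ‖Θ q.1‖ := by gcongr
        _ ≤ (‖u.dvdμ t x μ (xr q)‖ * Λ ^ 2) * Λ ^ 2 := by gcongr <;> exact hΘb _
        _ = _ := by ring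
    · simp [g, h]
  have hind : MemLp (fun q : Ω × ℝ => (Iic a).indicator (1 : ℝ → ℝ) q.2) 2 P' ∧
      lpNorm (fun q : Ω × ℝ => (Iic a).indicator (1 : ℝ → ℝ) q.2) 2 P' ≤ √a := by
    have h1 : MemLp ((Iic a).indicator (1 : ℝ → ℝ)) 2 unitLaw :=
      memLp_indicator_const 2 measurableSet_Iic 1 (Or.inr (measure_ne_top _ _))
    have h2 : MemLp (fun q : Ω × ℝ => (Iic a).indicator (1 : ℝ → ℝ) q.2) 2 P' :=
      h1.comp_measurePreserving (measurePreserving_snd (μ := P) (ν := unitLaw))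
    refine ⟨h2, ?_⟩
    rw [← toReal_eLpNorm h2.1]
    change (eLpNorm ((Iic a).indicator (1 : ℝ → ℝ) ∘ Prod.snd) 2 P').toReal ≤ _
    rw [eLpNorm_comp_measurePreserving h1.1 (measurePreserving_snd (μ := P) (ν := unitLaw))]
    have h3 : eLpNorm ((Iic a).indicator (1 : ℝ → ℝ)) 2 unitLaw
        = ‖(1:ℝ)‖ₑ * unitLaw (Iic a) ^ (1 / (2 : ℝ≥0∞).toReal) :=
      eLpNorm_indicator_const measurableSet_Iic (by norm_num) (by norm_num)
    rw [h3, unitLaw, Measure.restrict_apply measurableSet_Iic, inter_comm, Ioc_inter_Iic,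
      min_eq_right hR.a_le, Real.volume_Ioc, sub_zero, ENNReal.toReal_mul, ← ENNReal.toReal_rpow,
      ENNReal.toReal_ofReal hR.a_nonneg, Real.sqrt_eq_rpow]
    simp
  have hgm : AEStronglyMeasurable g P' := by
    have h1 : Measurable fun q : Ω × ℝ => |w' q.1 (R q.2)| := by
      have h2 := (S.continuous_dvdμ ht x hP2).measurable.comp hxm
      have h3 : Continuous fun q : (St d →L[ℝ] St d) × St d => ρ * ⟪q.1 q.2, q.2⟫_ℝ := by fun_prop
      exact (h3.measurable.comp (h2.prodMk (hΘm.comp measurable_fst))).norm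
    exact (h1.indicator (measurable_snd measurableSet_Iic)).aestronglyMeasurable
  have hGm : MemLp (fun q : Ω × ℝ => ρ * Λ ^ 4 * (Iic a).indicator (1 : ℝ → ℝ) q.2) 2 P' :=
    hind.1.const_mul _
  have hg : Integrable g P' :=
    (integrable_mul_norm hL.2.1.norm hGm).mono' hgm (ae_of_all _ hgle)
  have hgI : ∫ q, g q ∂P' ≤ Λ * (ρ * Λ ^ 4 * √a) := by
    have h1 := abs_integral_le_of_norm_le_mul hL.2.1.norm hGm (ae_of_all _ hgle)
    rw [lpNorm_norm hL.2.1.1] at h1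
    refine (le_abs_self _).trans (h1.trans (mul_le_mul hL.2.2 ?_ lpNorm_nonneg hΛ0.le))
    have h2 := lpNorm_const_smul (ρ * Λ ^ 4)
      (fun q : Ω × ℝ => (Iic a).indicator (1 : ℝ → ℝ) q.2) P' (p := 2)
    rw [coe_nnnorm, Real.norm_of_nonneg (by positivity)] at h2
    exact h2.le.trans (mul_le_mul_of_nonneg_left hind.2 (by positivity))
  have hHi : Integrable H unitLaw := by
    refine Integrable.of_bound hHm.aestronglyMeasurable 1 ?_
    exact (ae_restrict_iff' measurableSet_Ioc).2 (ae_of_all _ fun v hv => hHb v hv)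
  set hbar := ∫ v, H v ∂unitLaw with hhbar
  have hpath : ∀ᵐ ω ∂P, |∫ v, f (ω, v) ∂unitLaw - hbar * w ω 0| ≤ 2 * ∫ v, g (ω, v) ∂unitLaw := by
    filter_upwards [hf.prod_right_ae] with ω hω
    have h1 := hR.abs_integral_le (hw ω) (hw' ω)
    have h2 : ∫ v in Ioc (0 : ℝ) 1, H v * (w ω (R v) - w ω 0)
        = ∫ v, f (ω, v) ∂unitLaw - hbar * w ω 0 := by
      rw [hhbar, ← integral_mul_const, ← integral_sub hω (hHi.mul_const _)]
      simp only [f, mul_sub]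
    have h3 : ∫ v in Ioc 0 a, |w' ω (R v)| = ∫ v, g (ω, v) ∂unitLaw := by
      simp only [g]
      rw [integral_indicator measurableSet_Iic, unitLaw,
        Measure.restrict_restrict measurableSet_Iic, inter_comm, Ioc_inter_Iic,
        min_eq_right hR.a_le]
    rwa [h2, h3] at h1
  have hfi : Integrable (fun ω => ∫ v, f (ω, v) ∂unitLaw) P := hf.integral_prod_left
  have hgi : Integrable (fun ω => ∫ v, g (ω, v) ∂unitLaw) P := hg.integral_prod_left
  have hwm : Measurable fun ω => hbar * w ω 0 := by
    have h1 := ((S.continuous_dμ ht x hP2).measurable.comp hX).inner hΘm (𝕜 := ℝ)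
    simpa [w] using h1.const_mul hbar
  -- `X` itself does not have law `μ`, so the `L²(μ)` bound says nothing about `w ω 0`. Its
  -- integrability follows from the pathwise comparison.
  have hwi : Integrable (fun ω => hbar * w ω 0) P := by
    refine (hfi.norm.add (hgi.const_mul 2)).mono' hwm.aestronglyMeasurable ?_
    filter_upwards [hpath] with ω hω
    have h1 := abs_sub_abs_le_abs_sub (hbar * w ω 0) (∫ v, f (ω, v) ∂unitLaw)
    rw [abs_sub_comm] at h1
    simp only [Real.norm_eq_abs, Pi.add_apply]
    linarith
  -- At zero displacement the noise is centred given `G`; subtracting this term therefore leaves the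
  -- integral unchanged.
  have hw0 : ∫ ω, hbar * w ω 0 ∂P = 0 := by
    let ψ : St d → Ω → ℝ := fun z ω => hbar * ⟪u.dμ t x μ (X ω), A ω z⟫_ℝ
    have hψ : ∀ z ∈ s, StronglyMeasurable[G] (ψ z) := fun z _ => by
      have hz : Measurable[G] fun ω => A ω z :=
        (ContinuousLinearMap.apply ℝ (St d) z).continuous.measurable.comp hAG
      have hd : Measurable[G] fun ω => u.dμ t x μ (X ω) :=
        (S.continuous_dμ ht x hP2).measurable.comp hXG
      exact ((hd.inner hz).const_mul hbar).stronglyMeasurable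
    have e : (fun ω => ψ (ζ ω) ω) = fun ω => hbar * w ω 0 := by ext ω; simp [ψ, w, hΘ]
    have h1 := (hζ.integral_comp hψ (by rw [e]; exact hwi)).2
    rw [e] at h1
    rw [h1]
    refine integral_eq_zero_of_ae (ae_of_all _ fun ω => ?_)
    have h2 := hs.sum_inner (ContinuousLinearMap.adjoint (A ω) (u.dμ t x μ (X ω)))
    simp only [ContinuousLinearMap.adjoint_inner_left] at h2
    simp only [ψ, smul_eq_mul, Pi.zero_apply]
    rw [← mul_zero hbar, ← h2, Finset.mul_sum]
    exact Finset.sum_congr rfl fun z _ => by ring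
  have hmain : |∫ q, f q ∂P'| ≤ 2 * (Λ * (ρ * Λ ^ 4 * √a)) := by
    have e1 : ∫ q, f q ∂P' = ∫ ω, (∫ v, f (ω, v) ∂unitLaw - hbar * w ω 0) ∂P := by
      rw [integral_sub hfi hwi, hw0, sub_zero, hP', integral_prod f hf]
    rw [e1, ← Real.norm_eq_abs]
    refine (norm_integral_le_of_norm_le (hgi.const_mul 2) hpath).trans ?_
    rw [integral_const_mul, ← integral_prod g hg]
    exact mul_le_mul_of_nonneg_left hgI (by norm_num)
  have e2 : ∫ q, ⟪u.dμ t x μ (xr q), (ρ * H q.2) • Θ q.1⟫_ℝ ∂P' = ρ * ∫ q, f q ∂P' := by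
    rw [← integral_const_mul]
    refine integral_congr_ae (ae_of_all _ fun q => ?_)
    simp only [f, w, inner_smul_right, hxr]; ring
  change |∫ q, ⟪u.dμ t x μ (xr q), (ρ * H q.2) • Θ q.1⟫_ℝ ∂P'| ≤ _
  rw [e2, abs_mul, abs_of_nonneg hρ]
  calc _ ≤ ρ * (2 * (Λ * (ρ * Λ ^ 4 * √a))) := mul_le_mul_of_nonneg_left hmain hρ
    _ = _ := by ring

end MKV
namespace MKV

variable {d : ℕ} {Ω₀ : Type*} {m₀ : MeasurableSpace Ω₀} {P₀ : Measure Ω₀} {T Λ α K : ℝ}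
  {c : Coeffs d} {u : MasterField d}
  {Ω : Type*} {G mΩ : MeasurableSpace Ω} {P : Measure Ω} [IsProbabilityMeasure P]
  {s : Finset (St d)} {p : St d → ℝ} {t : ℝ} {X : Ω → St d} {ζ : Ω → St d}
  {A : Ω → St d →L[ℝ] St d}

lemma memLp_spread {Θ : Ω → St d} (hΘm : Measurable Θ) {C : ℝ} (hΘ : ∀ ω, ‖Θ ω‖ ≤ C)
    {φ : ℝ → ℝ} (hφ : Measurable φ) {b : ℝ} (hb : ∀ v ∈ Ioc (0 : ℝ) 1, |φ v| ≤ b) :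
    MemLp (fun q : Ω × ℝ => φ q.2 • Θ q.1) 2 (P.prod unitLaw) := by
  have hmem : ∀ᵐ q ∂(P.prod unitLaw), q.2 ∈ Ioc (0 : ℝ) 1 :=
    (measurePreserving_snd (μ := P) (ν := unitLaw)).quasiMeasurePreserving.ae
      (ae_restrict_mem measurableSet_Ioc)
  refine MemLp.of_bound (by fun_prop) (b * C) (hmem.mono fun q hq => ?_)
  rw [norm_smul]
  exact mul_le_mul (hb _ hq) (hΘ _) (norm_nonneg _) ((abs_nonneg _).trans (hb _ hq))

lemma memLp_fst (hX2 : MemLp X 2 P) : MemLp (fun q : Ω × ℝ => X q.1) 2 (P.prod unitLaw) :=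
  hX2.comp_measurePreserving (measurePreserving_fst (μ := P) (ν := unitLaw))

/-- Differentiate in the interpolation parameter between the scales `R` and `R + H`. Each
intermediate scale is again spread, so `Setting.abs_integral_spread_le` bounds the derivative. -/
lemma Setting.abs_U_spread_sub_le [IsProbabilityMeasure P₀] (S : Setting P₀ T Λ α K c u)
    (ht : t ∈ Icc 0 T) (x : St d)
    (hXG : Measurable[G] X) (hX2 : MemLp X 2 P) (hAG : Measurable[G] A) (hA : ∀ ω, ‖A ω‖ ≤ Λ)
    (hζ : IsInnovation G P ζ s p) (hs : IsDesign Λ s p) {ρ : ℝ} (hρ : 0 ≤ ρ) {R H : ℝ → ℝ}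
    {a : ℝ} {M : ℝ → ℝ} (hRm : Measurable R)
    (hR : ∀ r ∈ Icc (0 : ℝ) 1, IsSpread (fun v => R v + r * H v) H a (M r)) :
    |u.U t x ((P.prod unitLaw).map fun q => X q.1 + (ρ * (R q.2 + H q.2)) • A q.1 (ζ q.1))
      - u.U t x ((P.prod unitLaw).map fun q => X q.1 + (ρ * R q.2) • A q.1 (ζ q.1))|
      ≤ 2 * Λ ^ 5 * ρ ^ 2 * √a := by
  set P' := P.prod unitLaw
  set Θ : Ω → St d := fun ω => A ω (ζ ω) with hΘ
  have hX : Measurable X := hXG.mono hζ.le le_rfl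
  have hAm : Measurable A := hAG.mono hζ.le le_rfl
  have hΘm : Measurable Θ := by
    have h1 : Continuous fun q : (St d →L[ℝ] St d) × St d => q.1 q.2 := by fun_prop
    exact h1.measurable.comp (hAm.prodMk hζ.measurable)
  have hΘb : ∀ ω, ‖Θ ω‖ ≤ Λ ^ 2 := fun ω => hs.norm_image_le S.Λ_pos.le (hA ω) (hζ.mem ω)
  have h0 := hR 0 ⟨le_rfl, zero_le_one⟩
  have hHm := h0.meas_H
  have hRb : ∀ v ∈ Ioc (0 : ℝ) 1, |R v| ≤ 1 := fun v hv => by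
    have h1 := h0.R_mem v hv
    rw [zero_mul, add_zero] at h1
    exact (abs_of_nonneg h1.1).trans_le (h1.2.trans h0.M_le)
  have hHb : ∀ v ∈ Ioc (0 : ℝ) 1, |H v| ≤ 1 := fun v hv => by
    rw [abs_of_nonneg (h0.H_nonneg v hv)]
    refine (h0.H_le v hv).trans ?_
    by_cases h : v ∈ Iic a <;> simp [h]
  have hsm : ∀ {φ : ℝ → ℝ}, Measurable φ → (∀ v ∈ Ioc (0 : ℝ) 1, |φ v| ≤ 1) →
      MemLp (fun q : Ω × ℝ => (ρ * φ q.2) • Θ q.1) 2 P' := fun {φ} hφ hb =>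
    memLp_spread hΘm hΘb (hφ.const_mul ρ) (b := ρ) fun v hv => by
      rw [abs_mul, abs_of_nonneg hρ]; exact mul_le_of_le_one_right hρ (hb v hv)
  have hX'm : Measurable fun q : Ω × ℝ => X q.1 + (ρ * R q.2) • Θ q.1 := by fun_prop
  have hX'2 : MemLp (fun q : Ω × ℝ => X q.1 + (ρ * R q.2) • Θ q.1) 2 P' :=
    (memLp_fst hX2).add (hsm hRm hRb)
  have hZm : Measurable fun q : Ω × ℝ => (ρ * H q.2) • Θ q.1 := by fun_prop
  have hZ2 : MemLp (fun q : Ω × ℝ => (ρ * H q.2) • Θ q.1) 2 P' := hsm hHm hHb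
  have hder := fun r => (S.h1.classical.hasLionsDeriv t ht x).hasDerivAt_quadratic S.atomless
    (fun μ hμ => (S.continuous_dμ ht x hμ).measurable) hX'm (measurable_const (a := (0 : St d))) hZm
    hX'2 (memLp_const 0) hZ2 r
  have hpt : ∀ r, (fun q : Ω × ℝ => X q.1 + (ρ * R q.2) • Θ q.1 + r ^ 2 • (0 : St d)
      + r • (ρ * H q.2) • Θ q.1) = fun q => X q.1 + (ρ * (R q.2 + r * H q.2)) • Θ q.1 := by
    intro r; ext1 q
    rw [smul_zero, add_zero, smul_smul, add_assoc, ← add_smul]; congr 2; ring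
  simp only [smul_zero, zero_add] at hder
  have hpt' : ∀ r (q : Ω × ℝ), X q.1 + (ρ * R q.2) • Θ q.1 + 0
      + r • (ρ * H q.2) • Θ q.1 = X q.1 + (ρ * (R q.2 + r * H q.2)) • Θ q.1 := by
    intro r q
    have := congrFun (hpt r) q
    rwa [smul_zero] at this
  simp only [hpt'] at hder
  have hfin := norm_image_sub_le_of_norm_deriv_le_segment_01' (C := 2 * Λ ^ 5 * ρ ^ 2 * √a)
    (fun r _ => (hder r).hasDerivWithinAt) fun r hr =>
      S.abs_integral_spread_le ht x hXG hX2 hAG hA hζ hs hρ (hR r ⟨hr.1, hr.2.le⟩) rfl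
  simp only [one_mul, zero_mul, add_zero] at hfin
  exact hfin

/-- A conditionally centred perturbation of size `ρ` of the measure argument changes the
decoupling field by `O(ρ²)`. -/
lemma Setting.abs_U_centred_sub_le [IsProbabilityMeasure P₀] (S : Setting P₀ T Λ α K c u)
    (ht : t ∈ Icc 0 T) (x : St d)
    (hXG : Measurable[G] X) (hX2 : MemLp X 2 P) (hAG : Measurable[G] A) (hA : ∀ ω, ‖A ω‖ ≤ Λ)
    (hζ : IsInnovation G P ζ s p) (hs : IsDesign Λ s p) {ρ : ℝ} (hρ : 0 ≤ ρ) :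
    |u.U t x (P.map fun ω => X ω + ρ • A ω (ζ ω)) - u.U t x (P.map X)| ≤ 10 * Λ ^ 5 * ρ ^ 2 := by
  set P' := P.prod unitLaw
  set Θ : Ω → St d := fun ω => A ω (ζ ω) with hΘ
  have hΛ := S.Λ_pos
  have hX : Measurable X := hXG.mono hζ.le le_rfl
  have hAm : Measurable A := hAG.mono hζ.le le_rfl
  have hΘm : Measurable Θ := by
    have h1 : Continuous fun q : (St d →L[ℝ] St d) × St d => q.1 q.2 := by fun_prop
    exact h1.measurable.comp (hAm.prodMk hζ.measurable)
  have hΘb : ∀ ω, ‖Θ ω‖ ≤ Λ ^ 2 := fun ω => hs.norm_image_le hΛ.le (hA ω) (hζ.mem ω)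
  have hfst : ∀ {φ : Ω → St d}, Measurable φ → P'.map (fun q => φ q.1) = P.map φ := fun {φ} hφ => by
    have := (measurePreserving_fst (μ := P) (ν := unitLaw)).map_eq
    rw [← this, Measure.map_map hφ measurable_fst]; rfl
  -- The scale is made random: it goes from 0 to the uniform variable `u`, then along the dilations
  -- `min 1 (2ⁿ u)` towards 1. Stage `n` moves the scale only where `u ≤ 2⁻ⁿ` and costs `D ·
  -- 2^(-n/2)`, which is summable.
  let v : ℕ → ℝ := fun n => u.U t x (P'.map fun q => X q.1 + (ρ * dilation n q.2) • Θ q.1)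
  have hq : √((1:ℝ) / 2) ≤ 3 / 4 := Real.sqrt_le_iff.2 (by norm_num)
  have hq0 := Real.sqrt_nonneg ((1:ℝ) / 2)
  have hsq : ∀ n : ℕ, √(((1:ℝ) / 2) ^ n) = √((1:ℝ) / 2) ^ n := fun n => by
    rw [Real.sqrt_eq_iff_mul_self_eq (by positivity) (by positivity), ← mul_pow,
      Real.mul_self_sqrt (by norm_num)]
  set q := √((1:ℝ) / 2) with hqdef
  set D := 2 * Λ ^ 5 * ρ ^ 2 with hD
  have hD0 : 0 ≤ D := by positivity
  have hstart : |v 0 - u.U t x (P.map X)| ≤ D := by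
    have h1 := S.abs_U_spread_sub_le ht x hXG hX2 hAG hA hζ hs hρ (R := fun _ => 0)
      (H := fun v => v) (a := 1) (M := fun r => r) measurable_const fun r hr => isSpread_linear hr
    simp only [zero_add, mul_zero, zero_smul, add_zero, Real.sqrt_one, mul_one] at h1
    rw [hfst hX] at h1
    have e : P'.map (fun q => X q.1 + (ρ * dilation 0 q.2) • Θ q.1)
        = P'.map (fun q => X q.1 + (ρ * q.2) • Θ q.1) := by
      refine Measure.map_congr ?_
      have hmem : ∀ᵐ q ∂P', q.2 ∈ Ioc (0 : ℝ) 1 :=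
        (measurePreserving_snd (μ := P) (ν := unitLaw)).quasiMeasurePreserving.ae
          (ae_restrict_mem measurableSet_Ioc)
      filter_upwards [hmem] with q hq
      rw [dilation, pow_zero, one_mul, min_eq_right hq.2]
    simp only [v, e]
    exact h1
  have hstep : ∀ n, |v (n + 1) - v n| ≤ D * q ^ n := fun n => by
    have h1 := S.abs_U_spread_sub_le ht x hXG hX2 hAG hA hζ hs hρ (R := dilation n)
      (H := fun u => dilation (n + 1) u - dilation n u) (a := (1 / 2) ^ n) (M := fun _ => 1)
      (continuous_dilation n).measurable fun r hr => isSpread_dilation n hr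
    simp only [add_sub_cancel] at h1
    rw [hsq n] at h1
    exact h1
  have hsum : ∀ n, |v n - u.U t x (P.map X)| ≤ D * (1 + ∑ i ∈ Finset.range n, q ^ i) := by
    intro n
    induction n with
    | zero => simpa using hstart
    | succ n ih =>
      rw [Finset.sum_range_succ]
      have h1 := abs_sub_le (v (n + 1)) (v n) (u.U t x (P.map X))
      have h2 := hstep n
      linarith
  -- With `q ≤ 3 / 4` the geometric sum is at most 4. Together with the initial stage the total is
  -- `5 D`, that is `10 Λ⁵ ρ²`.
  have hgeom : ∀ n, ∑ i ∈ Finset.range n, q ^ i ≤ 4 := fun n => by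
    have h1 := geom_sum_mul q n
    have h2 : 0 ≤ ∑ i ∈ Finset.range n, q ^ i := by positivity
    have h3 : 0 ≤ q ^ n := by positivity
    nlinarith
  -- The dilated scale differs from 1 only on an event of probability `2⁻ⁿ`, so the laws converge in
  -- `W2`.
  have hlim : ∀ n, |u.U t x (P.map fun ω => X ω + ρ • Θ ω) - v n| ≤ Λ * (ρ * Λ ^ 2) * q ^ n := by
    intro n
    have hc := (continuous_dilation n).measurable
    have m1 : Measurable fun q : Ω × ℝ => X q.1 + ρ • Θ q.1 := by fun_prop
    have m2 : Measurable fun q : Ω × ℝ => X q.1 + (ρ * dilation n q.2) • Θ q.1 := by fun_prop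
    have l1 : MemLp (fun q : Ω × ℝ => X q.1 + ρ • Θ q.1) 2 P' :=
      (memLp_fst hX2).add (memLp_spread hΘm hΘb (φ := fun _ => ρ) measurable_const (b := |ρ|)
        fun _ _ => le_rfl)
    have l2 : MemLp (fun q : Ω × ℝ => X q.1 + (ρ * dilation n q.2) • Θ q.1) 2 P' :=
      (memLp_fst hX2).add (memLp_spread hΘm hΘb (hc.const_mul ρ) (b := ρ) fun v hv => by
        have := dilation_mem n hv.1.le
        rw [abs_mul, abs_of_nonneg hρ, abs_of_nonneg this.1]
        exact mul_le_of_le_one_right hρ this.2)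
    have h1 := S.h1.lip_measure t ht x _ _ (isP2_map m1 l1) (isP2_map m2 l2)
    have h2 := W2_map_le m1 m2 l1 l2
    have h3 : lpNorm (fun q : Ω × ℝ => (X q.1 + ρ • Θ q.1)
        - (X q.1 + (ρ * dilation n q.2) • Θ q.1)) 2 P' ≤ ρ * Λ ^ 2 * q ^ n := by
      have i1 : MemLp ((Iic ((1/2:ℝ) ^ n)).indicator (fun _ => ρ * Λ ^ 2)) 2 unitLaw :=
        memLp_indicator_const 2 measurableSet_Iic _ (Or.inr (measure_ne_top _ _))
      have i2 : MemLp (fun q : Ω × ℝ => (Iic ((1/2:ℝ) ^ n)).indicator (fun _ => ρ * Λ ^ 2) q.2)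
          2 P' := i1.comp_measurePreserving (measurePreserving_snd (μ := P) (ν := unitLaw))
      have hmem : ∀ᵐ q ∂P', q.2 ∈ Ioc (0 : ℝ) 1 :=
        (measurePreserving_snd (μ := P) (ν := unitLaw)).quasiMeasurePreserving.ae
          (ae_restrict_mem measurableSet_Ioc)
      refine (lpNorm_mono_ae i2 (hmem.mono fun q hq => ?_)).trans (le_of_eq ?_)
      · have e : X q.1 + ρ • Θ q.1 - (X q.1 + (ρ * dilation n q.2) • Θ q.1)
            = (ρ * (1 - dilation n q.2)) • Θ q.1 := by
          rw [add_sub_add_left_eq_sub, ← sub_smul]; congr 1; ring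
        rw [e, norm_smul, norm_mul, Real.norm_of_nonneg hρ]
        have h4 := dilation_mem n hq.1.le
        by_cases h : q.2 ≤ (1 / 2) ^ n
        · rw [indicator_of_mem (mem_Iic.2 h), Real.norm_of_nonneg (by linarith [h4.2])]
          exact mul_le_mul (mul_le_of_le_one_right hρ (by linarith [h4.1])) (hΘb _)
            (norm_nonneg _) hρ
        · rw [dilation_eq_one (not_le.1 h), indicator_of_notMem (by simpa using h)]; simp
      · rw [← toReal_eLpNorm i2.1]
        change (eLpNorm ((Iic ((1/2:ℝ) ^ n)).indicator (fun _ => ρ * Λ ^ 2) ∘ Prod.snd) 2 P').toReal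
          = _
        rw [eLpNorm_comp_measurePreserving i1.1 (measurePreserving_snd (μ := P) (ν := unitLaw)),
          eLpNorm_indicator_const measurableSet_Iic (by norm_num) (by norm_num),
          unitLaw, Measure.restrict_apply measurableSet_Iic, inter_comm, Ioc_inter_Iic,
          min_eq_right (pow_le_one₀ (by norm_num) (by norm_num)), Real.volume_Ioc, sub_zero,
          ENNReal.toReal_mul, ← ENNReal.toReal_rpow, ENNReal.toReal_ofReal (by positivity),
          toReal_enorm, Real.norm_of_nonneg (by positivity), ← hsq n, Real.sqrt_eq_rpow]
        simp
    have h4 := norm_nonneg (u.dx t x (P'.map fun q => X q.1 + ρ • Θ q.1)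
      - u.dx t x (P'.map fun q => X q.1 + (ρ * dilation n q.2) • Θ q.1))
    have e := hfst (φ := fun ω => X ω + ρ • Θ ω) (by fun_prop)
    rw [e] at h1 h2 h4
    have h5 := mul_le_mul_of_nonneg_left (h2.trans h3) hΛ.le
    change |_ - u.U t x (P'.map fun q => X q.1 + (ρ * dilation n q.2) • Θ q.1)| ≤ _
    linarith
  have hall : ∀ n, |u.U t x (P.map fun ω => X ω + ρ • Θ ω) - u.U t x (P.map X)|
      ≤ 5 * D + Λ * (ρ * Λ ^ 2) * q ^ n := fun n => by
    have h1 := abs_sub_le (u.U t x (P.map fun ω => X ω + ρ • Θ ω)) (v n) (u.U t x (P.map X))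
    have h2 := mul_le_mul_of_nonneg_left (hgeom n) hD0
    linarith [hlim n, hsum n]
  have hten : Tendsto (fun n : ℕ => 5 * D + Λ * (ρ * Λ ^ 2) * q ^ n) atTop
      (𝓝 (5 * D + Λ * (ρ * Λ ^ 2) * 0)) :=
    ((tendsto_pow_atTop_nhds_zero_of_lt_one hq0 (by linarith)).const_mul _).const_add _
  refine (ge_of_tendsto' hten hall).trans (le_of_eq ?_)
  rw [hD]; ring

end MKV
-- Crude one-step bounds from second moments, and fine bounds for the defect
namespace MKV

/-- The constant of the one-step expansions. -/
noncomputable def stepConst (d : ℕ) (Λ α : ℝ) : ℝ := 2000 * (1 + d) * Λ ^ 7 * (40 * Λ ^ 2) ^ α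

namespace IsStep

variable {d : ℕ} {Ω₀ : Type*} {m₀ : MeasurableSpace Ω₀} {P₀ : Measure Ω₀} {T Λ α K : ℝ}
  {c : Coeffs d} {u : MasterField d}
  {Ω : Type*} {G mΩ : MeasurableSpace Ω} {P : Measure Ω} [IsProbabilityMeasure P]
  {s : Finset (St d)} {p : St d → ℝ} {t h : ℝ} {X : Ω → St d} {Y : Ω → ℝ} {ζ B Θ : Ω → St d}

lemma stepConst_aux {Λ α : ℝ} (hΛ : 1 ≤ Λ) (hα : 1 ≤ α) : 40 * Λ ^ 2 ≤ (40 * Λ ^ 2) ^ α := by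
  have h1 : 1 ≤ Λ ^ 2 := one_le_pow₀ hΛ
  exact Real.self_le_rpow_of_one_le (by linarith) hα

lemma one_le_stepConst {Λ α : ℝ} (hΛ : 1 ≤ Λ) (hα : 1 ≤ α) : 1 ≤ stepConst d Λ α := by
  have h1 : 1 ≤ Λ ^ 2 := one_le_pow₀ hΛ
  have h2 := stepConst_aux hΛ hα
  have h3 : 1 ≤ Λ ^ 7 := one_le_pow₀ hΛ
  have h4 : (1 : ℝ) ≤ 2000 * (1 + d) := by have : (0:ℝ) ≤ d := Nat.cast_nonneg _; linarith
  unfold stepConst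
  exact one_le_mul_of_one_le_of_one_le (one_le_mul_of_one_le_of_one_le h4 h3) (by linarith)

variable [IsProbabilityMeasure P₀]

/-- First order expansion of the decoupling field at the nodes of the scheme. -/
lemma abs_U_node_sub_le (D : IsStep G P Λ T c s p t h X Y ζ B Θ) (S : Setting P₀ T Λ α K c u)
    (ω : Ω) {z : St d} (hz : z ∈ s) :
    |u.U (t + h) (X ω + h • B ω + √h • c.σ (X ω) (P.map X) z)
          (P.map fun ω => X ω + h • B ω + √h • Θ ω)
        - u.U t (X ω) (P.map X) - ⟪u.dx t (X ω) (P.map X), √h • c.σ (X ω) (P.map X) z⟫_ℝ|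
      ≤ (90 + 6 * d) * Λ ^ 5 * (h * (K + ‖X ω‖ + ‖B ω‖ + lpNorm X 2 P + lpNorm B 2 P)) := by
  have hΛ := S.one_le_Λ
  have hΛ0 := S.Λ_pos
  have hK := S.one_le_K
  have hh := D.h_pos.le
  have hsq : √h ^ 2 = h := Real.sq_sqrt hh
  have hr : √h ^ 2 ≤ h := hsq.le
  have hβ : 0 ≤ lpNorm B 2 P := lpNorm_nonneg
  have hN : 0 ≤ lpNorm X 2 P := lpNorm_nonneg
  have hx := norm_nonneg (X ω)
  have hb := norm_nonneg (B ω)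
  have hB2 := D.memLp_B_two S
  have hΘ2 := D.memLp_Θ S 2
  set Q := K + ‖X ω‖ + ‖B ω‖ + lpNorm X 2 P + lpNorm B 2 P with hQ
  have hQ1 : 1 ≤ Q := by linarith
  set x' := X ω + h • B ω + √h • c.σ (X ω) (P.map X) z with hx'
  set y := X ω + √h • c.σ (X ω) (P.map X) z with hy
  set μ := P.map fun ω => X ω + h • B ω + √h • Θ ω with hμ
  set μ' := P.map fun ω => X ω + √h • Θ ω with hμ'
  have hP2 : IsP2 μ := by have := D.isP2_path S (√h); rwa [hsq] at this
  have hm' : Measurable fun ω => X ω + √h • Θ ω := by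
    have h1 := D.measurable_X
    have h2 := D.measurable_Θ S
    fun_prop
  have hΘs : MemLp (fun ω => √h • Θ ω) 2 P := hΘ2.const_smul (√h)
  have hL' : MemLp (fun ω => X ω + √h • Θ ω) 2 P := D.memLp_X.add hΘs
  have hP2' : IsP2 μ' := isP2_map hm' hL'
  have hnode := (D.norm_point_le S (Real.sqrt_nonneg h) hr ω hz).2
  rw [hsq, ← hx'] at hnode
  have hl2 := D.l2norm_path_le S (Real.sqrt_nonneg h) hr le_rfl D.memLp_X D.memLp_Y
  rw [hsq, ← hμ] at hl2
  have henv : lpNorm (envelope Λ X B) 2 P ≤ lpNorm X 2 P + lpNorm B 2 P + Λ ^ 2 := by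
    have := lpNorm_le_of_affine₂ (f := envelope Λ X B) (by norm_num : (1 : ℝ≥0∞) ≤ 2) D.memLp_X hB2
      (a := Λ ^ 2) (b := 1) (b' := 1) (by positivity) zero_le_one zero_le_one
      (ae_of_all _ fun ω => by
        rw [Real.norm_of_nonneg (zero_le_one.trans (one_le_envelope hΛ ω)), envelope]
        exact le_of_eq (by ring))
    linarith
  have p2 : 1 ≤ Λ ^ 2 := one_le_pow₀ hΛ
  have k1 := S.U_lip_time D.t_nonneg (by linarith : t ≤ t + h) D.le_T x' hP2
  rw [add_sub_cancel_left] at k1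
  have k1' : K + ‖x'‖ + l2norm μ ≤ 3 * Λ ^ 2 * Q := by
    unfold envelope at hnode
    have : ‖X ω‖ + ‖B ω‖ + lpNorm X 2 P + lpNorm B 2 P + K + 2 * Λ ^ 2 ≤ 3 * Λ ^ 2 * Q := by
      nlinarith
    linarith
  have k2 := S.U_lip D.t_mem x' y hP2 hP2'
  have k2a : ‖x' - y‖ ≤ h * ‖B ω‖ := by
    have e : x' - y = h • B ω := by rw [hx', hy]; abel
    rw [e, norm_smul, Real.norm_of_nonneg hh]
  have k2b : W2 μ μ' ≤ h * lpNorm B 2 P := by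
    have hm : Measurable fun ω => X ω + h • B ω + √h • Θ ω := by
      have := D.measurable_path S (√h); rwa [hsq] at this
    have hL : MemLp (fun ω => X ω + h • B ω + √h • Θ ω) 2 P := by
      have := D.memLp_path S (√h); rwa [hsq] at this
    refine (W2_map_le hm hm' hL hL').trans (le_of_eq ?_)
    have e : (fun ω => X ω + h • B ω + √h • Θ ω - (X ω + √h • Θ ω)) = h • B := by
      ext1 ω; simp only [Pi.smul_apply]; abel
    rw [e, lpNorm_const_smul, coe_nnnorm, Real.norm_of_nonneg hh]
  have k3 : |u.U t y μ' - u.U t y (P.map X)| ≤ 10 * Λ ^ 5 * h := by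
    have h1 := S.abs_U_centred_sub_le D.t_mem y D.meas_X D.memLp_X
      (A := fun ω => c.σ (X ω) (P.map X)) ((S.continuous_σ D.isP2).measurable.comp D.meas_X)
      (fun ω => S.h0.bound_σ (X ω) _ D.isP2) D.innov D.design (Real.sqrt_nonneg h)
    rw [hsq] at h1
    rw [hμ', D.Θ_eq]; exact h1
  have k4 := (S.U_taylor D.t_mem (X ω) y D.isP2).2.2
  have e4 : y - X ω = √h • c.σ (X ω) (P.map X) z := by rw [hy]; abel
  rw [e4] at k4
  have k4' : ‖√h • c.σ (X ω) (P.map X) z‖ ^ 2 ≤ h * Λ ^ 4 := by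
    rw [norm_smul, mul_pow, Real.norm_of_nonneg (Real.sqrt_nonneg h), hsq]
    have := D.design.norm_image_le hΛ0.le (S.h0.bound_σ (X ω) _ D.isP2) hz
    calc h * ‖c.σ (X ω) (P.map X) z‖ ^ 2 ≤ h * (Λ ^ 2) ^ 2 := by gcongr
      _ = _ := by ring
  -- The moves are made one at a time: time, drift, noise in the measure, noise in space. A
  -- Lipschitz bound for the noise in the measure would only give `√h`; centring gives `h`. The
  -- spatial noise keeps its first order term, which is centred over the nodes.
  have htri : |u.U (t + h) x' μ - u.U t (X ω) (P.map X)
        - ⟪u.dx t (X ω) (P.map X), √h • c.σ (X ω) (P.map X) z⟫_ℝ|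
      ≤ |u.U (t + h) x' μ - u.U t x' μ| + |u.U t x' μ - u.U t y μ'|
        + |u.U t y μ' - u.U t y (P.map X)| + |u.U t y (P.map X) - u.U t (X ω) (P.map X)
        - ⟪u.dx t (X ω) (P.map X), √h • c.σ (X ω) (P.map X) z⟫_ℝ| := by
    have h1 := abs_add_three (u.U (t + h) x' μ - u.U t x' μ) (u.U t x' μ - u.U t y μ')
      (u.U t y μ' - u.U t y (P.map X))
    have h2 := abs_add_le (u.U (t + h) x' μ - u.U t x' μ + (u.U t x' μ - u.U t y μ')
      + (u.U t y μ' - u.U t y (P.map X))) (u.U t y (P.map X) - u.U t (X ω) (P.map X)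
        - ⟪u.dx t (X ω) (P.map X), √h • c.σ (X ω) (P.map X) z⟫_ℝ)
    refine le_trans (le_of_eq ?_) (h2.trans (by linarith))
    congr 1; ring
  refine htri.trans ?_
  have hd : (0:ℝ) ≤ d := Nat.cast_nonneg _
  have p1 : Λ ≤ Λ ^ 5 := by simpa using pow_le_pow_right₀ hΛ (show 1 ≤ 5 by norm_num)
  have hhQ : 0 ≤ h * Q := by positivity
  have hhle : h ≤ h * Q := le_mul_of_one_le_right hh hQ1
  have t1 : |u.U (t + h) x' μ - u.U t x' μ| ≤ (75 + 6 * d) * (Λ ^ 5 * (h * Q)) := by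
    refine k1.trans ?_
    calc (25 + 2 * d) * Λ ^ 3 * (K + ‖x'‖ + l2norm μ) * h
        ≤ (25 + 2 * d) * Λ ^ 3 * (3 * Λ ^ 2 * Q) * h := by gcongr
      _ = _ := by ring
  have t2 : |u.U t x' μ - u.U t y μ'| ≤ Λ ^ 5 * (h * Q) := by
    refine k2.trans (mul_le_mul p1 ?_ ?_ (by positivity))
    · calc ‖x' - y‖ + W2 μ μ' ≤ h * ‖B ω‖ + h * lpNorm B 2 P := add_le_add k2a k2b
        _ = h * (‖B ω‖ + lpNorm B 2 P) := by ring
        _ ≤ h * Q := by gcongr; linarith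
    · exact add_nonneg (norm_nonneg _) (Setting.W2_nonneg _ _)
  have t3 : 10 * Λ ^ 5 * h ≤ 10 * (Λ ^ 5 * (h * Q)) := by
    rw [mul_assoc]; gcongr
  have t4 : Λ * ‖√h • c.σ (X ω) (P.map X) z‖ ^ 2 ≤ Λ ^ 5 * (h * Q) := by
    calc _ ≤ Λ * (h * Λ ^ 4) := by gcongr
      _ = Λ ^ 5 * h := by ring
      _ ≤ _ := by gcongr
  have hpos : 0 ≤ Λ ^ 5 * (h * Q) := by positivity
  calc _ ≤ (75 + 6 * d) * (Λ ^ 5 * (h * Q)) + Λ ^ 5 * (h * Q) + 10 * (Λ ^ 5 * (h * Q))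
        + Λ ^ 5 * (h * Q) := by linarith
    _ ≤ _ := by linarith

-- Eliminates the drift `B` in favour of the state and the error, the quantities on which the
-- recursions run.
omit [IsProbabilityMeasure P₀] in
lemma crude_quantity_le (D : IsStep G P Λ T c s p t h X Y ζ B Θ) (S : Setting P₀ T Λ α K c u)
    (ω : Ω) : K + ‖X ω‖ + ‖B ω‖ + lpNorm X 2 P + lpNorm B 2 P
      ≤ 13 * Λ ^ 2 * (|u.U t (X ω) (P.map X) - Y ω|
        + lpNorm (fun ω => u.U t (X ω) (P.map X) - Y ω) 2 P + ‖X ω‖ + lpNorm X 2 P + K) := by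
  have h1 := D.norm_B_le S ω
  have h2 := D.lpNorm_B_le S (by norm_num : (1 : ℝ≥0∞) ≤ 2) D.memLp_X D.memLp_Y
  have hK := S.K_pos
  have hN : 0 ≤ lpNorm X 2 P := lpNorm_nonneg
  have hε : 0 ≤ lpNorm (fun ω => u.U t (X ω) (P.map X) - Y ω) 2 P := lpNorm_nonneg
  have hx := norm_nonneg (X ω)
  have he := abs_nonneg (u.U t (X ω) (P.map X) - Y ω)
  rw [Real.norm_eq_abs] at h1
  have p2 : 1 ≤ Λ ^ 2 := one_le_pow₀ S.one_le_Λ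
  nlinarith [mul_le_mul_of_nonneg_right p2 hK.le, mul_le_mul_of_nonneg_right p2 hN,
    mul_le_mul_of_nonneg_right p2 hx, mul_le_mul_of_nonneg_right p2 hε,
    mul_le_mul_of_nonneg_right p2 he]

/-- The increment of the decoupling field along the scheme, corrected by the driver. -/
noncomputable def defect (P : Measure Ω) (c : Coeffs d) (u : MasterField d) (s : Finset (St d))
    (p : St d → ℝ) (t h : ℝ) (X : Ω → St d) (B Θ : Ω → St d) (ω : Ω) : ℝ :=
  ∑ z ∈ s, p z * u.U (t + h) (X ω + h • B ω + √h • c.σ (X ω) (P.map X) z)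
      (P.map fun ω => X ω + h • B ω + √h • Θ ω)
    - u.U t (X ω) (P.map X)
    + h * c.f (X ω) (u.U t (X ω) (P.map X))
      (c.σadj (X ω) (P.map X) (u.dx t (X ω) (P.map X))) (u.graphLaw t (P.map X))

/-- Averaging the nodal expansions over the design kills the gradient term. The bound uses second
moments only and is linear in them, so it serves before higher moments are known to be finite, and
when the error is large. The coefficient `1` matches the slot `a₁` of `IsBackwardStep.sq_err_le`. -/
lemma abs_defect_le_crude (D : IsStep G P Λ T c s p t h X Y ζ B Θ) (S : Setting P₀ T Λ α K c u)
    (ω : Ω) :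
    |defect P c u s p t h X B Θ ω| ≤ stepConst d Λ α * (h * (|u.U t (X ω) (P.map X) - Y ω|
        + lpNorm (fun ω => u.U t (X ω) (P.map X) - Y ω) 2 P + 1 * ‖X ω‖ + (lpNorm X 2 P + K))) := by
  have hΛ := S.one_le_Λ
  have hh := D.h_pos.le
  have hβ : 0 ≤ lpNorm B 2 P := lpNorm_nonneg
  have hN : 0 ≤ lpNorm X 2 P := lpNorm_nonneg
  have hε : 0 ≤ lpNorm (fun ω => u.U t (X ω) (P.map X) - Y ω) 2 P := lpNorm_nonneg
  have hK := S.K_pos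
  have hd : (0:ℝ) ≤ d := Nat.cast_nonneg _
  set Q := K + ‖X ω‖ + ‖B ω‖ + lpNorm X 2 P + lpNorm B 2 P with hQ
  have hQ0 : 0 ≤ Q := by positivity
  have h1 := D.design.abs_sum_le_const fun z hz => D.abs_U_node_sub_le S ω hz
  have h2 : ∑ z ∈ s, p z * (u.U (t + h) (X ω + h • B ω + √h • c.σ (X ω) (P.map X) z)
          (P.map fun ω => X ω + h • B ω + √h • Θ ω)
        - u.U t (X ω) (P.map X) - ⟪u.dx t (X ω) (P.map X), √h • c.σ (X ω) (P.map X) z⟫_ℝ)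
      = ∑ z ∈ s, p z * u.U (t + h) (X ω + h • B ω + √h • c.σ (X ω) (P.map X) z)
          (P.map fun ω => X ω + h • B ω + √h • Θ ω) - u.U t (X ω) (P.map X) := by
    have e1 := D.design.sum_inner (ContinuousLinearMap.adjoint (c.σ (X ω) (P.map X))
      (u.dx t (X ω) (P.map X)))
    simp only [ContinuousLinearMap.adjoint_inner_left] at e1
    have e2 : ∑ z ∈ s, p z * ⟪u.dx t (X ω) (P.map X), √h • c.σ (X ω) (P.map X) z⟫_ℝ = 0 := by
      rw [← mul_zero (√h), ← e1, Finset.mul_sum]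
      exact Finset.sum_congr rfl fun z _ => by rw [inner_smul_right]; ring
    have e3 : ∑ z ∈ s, p z * u.U t (X ω) (P.map X) = u.U t (X ω) (P.map X) := by
      rw [← Finset.sum_mul, D.design.sum_one, one_mul]
    simp only [mul_sub, Finset.sum_sub_distrib]
    rw [e2, e3, sub_zero]
  rw [h2] at h1
  have h3 := S.f_graph_growth D.t_mem (X ω) D.isP2
  rw [D.l2norm_eq] at h3
  have h4 : |h * c.f (X ω) (u.U t (X ω) (P.map X))
      (c.σadj (X ω) (P.map X) (u.dx t (X ω) (P.map X))) (u.graphLaw t (P.map X))|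
      ≤ 7 * Λ ^ 5 * (h * Q) := by
    rw [abs_mul, abs_of_nonneg hh]
    have p5 : Λ ^ 3 ≤ Λ ^ 5 := pow_le_pow_right₀ hΛ (by norm_num)
    calc _ ≤ h * (7 * Λ ^ 3 * (K + ‖X ω‖ + lpNorm X 2 P)) := mul_le_mul_of_nonneg_left h3 hh
      _ ≤ h * (7 * Λ ^ 5 * Q) := by
        have : K + ‖X ω‖ + lpNorm X 2 P ≤ Q := by
          have := norm_nonneg (B ω); linarith
        gcongr
      _ = _ := by ring
  refine (abs_add_le _ _).trans ((add_le_add h1 h4).trans ?_)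
  have h5 := D.crude_quantity_le S ω
  rw [← hQ] at h5
  set q := |u.U t (X ω) (P.map X) - Y ω| + lpNorm (fun ω => u.U t (X ω) (P.map X) - Y ω) 2 P
    + ‖X ω‖ + lpNorm X 2 P + K with hq
  have hq0 : 0 ≤ q := by positivity
  have p2 : 1 ≤ Λ ^ 2 := one_le_pow₀ hΛ
  have hκ : 1 ≤ (40 * Λ ^ 2) ^ α := by linarith [stepConst_aux hΛ S.one_le_α]
  have hΛ7 : 0 ≤ Λ ^ 7 * (h * q) := by have := S.Λ_pos; positivity
  have hΛ5 := S.Λ_pos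
  calc (90 + 6 * d) * Λ ^ 5 * (h * Q) + 7 * Λ ^ 5 * (h * Q)
      = (97 + 6 * d) * Λ ^ 5 * (h * Q) := by ring
    _ ≤ (97 + 6 * d) * Λ ^ 5 * (h * (13 * Λ ^ 2 * q)) := by gcongr
    _ = (1261 + 78 * d) * (Λ ^ 7 * (h * q)) * 1 := by ring
    _ ≤ (2000 * (1 + d)) * (Λ ^ 7 * (h * q)) * (40 * Λ ^ 2) ^ α := by
        gcongr; linarith
    _ = stepConst d Λ α * (h * q) := by unfold stepConst; ring
    _ = _ := by rw [hq]; ring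

/-- The weighted nodal values of the decoupling field approximate its gradient. -/
lemma norm_gradient_sub_le (D : IsStep G P Λ T c s p t h X Y ζ B Θ) (S : Setting P₀ T Λ α K c u)
    (ω : Ω) :
    ‖c.σadj (X ω) (P.map X) (u.dx t (X ω) (P.map X))
      - (√h)⁻¹ • ∑ z ∈ s, p z • (u.U (t + h) (X ω + h • B ω + √h • c.σ (X ω) (P.map X) z)
          (P.map fun ω => X ω + h • B ω + √h • Θ ω)) • z‖
      ≤ stepConst d Λ α * (√h * (|u.U t (X ω) (P.map X) - Y ω|
        + lpNorm (fun ω => u.U t (X ω) (P.map X) - Y ω) 2 P + ‖X ω‖ + lpNorm X 2 P + K)) := by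
  have hΛ := S.one_le_Λ
  have hh := D.h_pos.le
  have hsqp : 0 < √h := Real.sqrt_pos.2 D.h_pos
  have hsq : √h * √h = h := Real.mul_self_sqrt hh
  have hβ : 0 ≤ lpNorm B 2 P := lpNorm_nonneg
  have hN : 0 ≤ lpNorm X 2 P := lpNorm_nonneg
  have hε : 0 ≤ lpNorm (fun ω => u.U t (X ω) (P.map X) - Y ω) 2 P := lpNorm_nonneg
  have hK := S.K_pos
  have hd : (0:ℝ) ≤ d := Nat.cast_nonneg _
  set Q := K + ‖X ω‖ + ‖B ω‖ + lpNorm X 2 P + lpNorm B 2 P with hQ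
  have hQ0 : 0 ≤ Q := by positivity
  set V : St d → ℝ := fun z => u.U (t + h) (X ω + h • B ω + √h • c.σ (X ω) (P.map X) z)
          (P.map fun ω => X ω + h • B ω + √h • Θ ω) with hV
  set g := c.σadj (X ω) (P.map X) (u.dx t (X ω) (P.map X)) with hg
  have h1 : ∀ z ∈ s, ‖(V z - u.U t (X ω) (P.map X) - √h * ⟪g, z⟫_ℝ) • z‖
      ≤ (90 + 6 * d) * Λ ^ 5 * (h * Q) * Λ := fun z hz => by
    rw [norm_smul]
    refine mul_le_mul ?_ (D.design.bound z hz) (norm_nonneg _) (by have := S.Λ_pos; positivity)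
    have h2 := D.abs_U_node_sub_le S ω hz
    rw [inner_smul_right, ← ContinuousLinearMap.adjoint_inner_left] at h2
    exact h2
  have h2 := D.design.norm_sum_smul_le h1
  -- Correlation with the noise kills the constant term, by centring, and returns the vector of the
  -- linear term, by identity covariance.
  have h3 : ∑ z ∈ s, p z • (V z - u.U t (X ω) (P.map X) - √h * ⟪g, z⟫_ℝ) • z
      = ∑ z ∈ s, p z • (V z) • z - √h • g := by
    have e1 : ∑ z ∈ s, p z • (u.U t (X ω) (P.map X)) • z = 0 := by
      rw [← smul_zero (u.U t (X ω) (P.map X)), ← D.design.centred, Finset.smul_sum]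
      exact Finset.sum_congr rfl fun z _ => smul_comm _ _ _
    have e2 : ∑ z ∈ s, p z • (√h * ⟪g, z⟫_ℝ) • z = √h • g := by
      conv_rhs => rw [← D.design.sum_inner_smul g]
      rw [Finset.smul_sum]
      exact Finset.sum_congr rfl fun z _ => by rw [smul_smul, smul_smul]; congr 1; ring
    simp only [sub_smul, smul_sub, Finset.sum_sub_distrib]
    rw [e1, e2, sub_zero]
  rw [h3] at h2
  have h4 : g - (√h)⁻¹ • ∑ z ∈ s, p z • (V z) • z
      = -((√h)⁻¹ • (∑ z ∈ s, p z • (V z) • z - √h • g)) := by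
    rw [smul_sub, smul_smul, inv_mul_cancel₀ hsqp.ne', one_smul]; abel
  change ‖g - (√h)⁻¹ • ∑ z ∈ s, p z • (V z) • z‖ ≤ _
  rw [h4, norm_neg, norm_smul, norm_inv, Real.norm_of_nonneg hsqp.le]
  have h5 := D.crude_quantity_le S ω
  rw [← hQ] at h5
  set q := |u.U t (X ω) (P.map X) - Y ω| + lpNorm (fun ω => u.U t (X ω) (P.map X) - Y ω) 2 P
    + ‖X ω‖ + lpNorm X 2 P + K with hq
  have hq0 : 0 ≤ q := by positivity
  have h6 : (√h)⁻¹ * h = √h := by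
    rw [inv_mul_eq_div, div_eq_iff hsqp.ne', hsq]
  have hΛ0 := S.Λ_pos
  have p : Λ ^ 8 ≤ Λ ^ 7 * (40 * Λ ^ 2) ^ α := by
    have := stepConst_aux hΛ S.one_le_α
    calc Λ ^ 8 = Λ ^ 7 * Λ := by ring
      _ ≤ Λ ^ 7 * (40 * Λ ^ 2) ^ α := by gcongr; nlinarith
  calc _ ≤ (√h)⁻¹ * ((90 + 6 * d) * Λ ^ 5 * (h * Q) * Λ) := by gcongr
    _ = (90 + 6 * d) * Λ ^ 6 * (((√h)⁻¹ * h) * Q) := by ring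
    _ ≤ (90 + 6 * d) * Λ ^ 6 * (√h * (13 * Λ ^ 2 * q)) := by rw [h6]; gcongr
    _ = (1170 + 78 * d) * (Λ ^ 8 * (√h * q)) := by ring
    _ ≤ (2000 * (1 + d)) * ((Λ ^ 7 * (40 * Λ ^ 2) ^ α) * (√h * q)) := by
        gcongr; linarith
    _ = _ := by unfold stepConst; ring

/-- Compared with the crude bound the state gains a factor `√h`, at the price of `M ^ α` coming from
the growth of the Lipschitz constant of `dvdμ`. As this is superlinear in `M`, the bound is useful
only when `M` is controlled by the initial condition. -/
lemma abs_defect_le_fine (D : IsStep G P Λ T c s p t h X Y ζ B Θ) (S : Setting P₀ T Λ α K c u)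
    (hX : MemLp X (ENNReal.ofReal (2 * α)) P) (hY : MemLp Y (ENNReal.ofReal (2 * α)) P) {M : ℝ}
    (hKM : K ≤ M) (hXM : lpNorm X (ENNReal.ofReal (2 * α)) P ≤ M)
    (heM : lpNorm (fun ω => u.U t (X ω) (P.map X) - Y ω) (ENNReal.ofReal (2 * α)) P ≤ M) (ω : Ω) :
    |defect P c u s p t h X B Θ ω| ≤ stepConst d Λ α * (h * (|u.U t (X ω) (P.map X) - Y ω|
        + lpNorm (fun ω => u.U t (X ω) (P.map X) - Y ω) 2 P + √h * ‖X ω‖ + √h * M ^ α)) := by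
  have hΛ := S.one_le_Λ
  have hα := S.one_le_α
  have hΛ0 := S.Λ_pos
  have hh := D.h_pos.le
  have hsq0 := Real.sqrt_nonneg h
  have hsq1 : √h ≤ 1 := Real.sqrt_le_one.2 D.h_le_one
  have hM1 : 1 ≤ M := S.one_le_K.trans hKM
  have hMα : M ≤ M ^ α := Real.self_le_rpow_of_one_le hM1 hα
  set q := ENNReal.ofReal (2 * α) with hq
  have hq2 : 2 ≤ q := by
    rw [hq, show (2 : ℝ≥0∞) = ENNReal.ofReal 2 by simp]
    exact ENNReal.ofReal_le_ofReal (by linarith)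
  have hq1 : 1 ≤ q := le_trans (by norm_num) hq2
  have heL := D.memLp_err S hX hY
  have hN : lpNorm X 2 P ≤ M := (lpNorm_mono_exponent hq2 hX).trans hXM
  have hε : lpNorm (fun ω => u.U t (X ω) (P.map X) - Y ω) 2 P ≤ M :=
    (lpNorm_mono_exponent hq2 heL).trans heM
  have hε0 : 0 ≤ lpNorm (fun ω => u.U t (X ω) (P.map X) - Y ω) 2 P := lpNorm_nonneg
  have hN0 : 0 ≤ lpNorm X 2 P := lpNorm_nonneg
  have p2 : 1 ≤ Λ ^ 2 := one_le_pow₀ hΛ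
  have h1 := D.abs_increment_le S hX hY ω
  have hb := D.norm_B_le S ω
  rw [Real.norm_eq_abs] at hb
  have hβq := D.lpNorm_B_le S hq1 hX hY
  have hB2 := D.memLp_B S hX hY
  have hβ : lpNorm B 2 P ≤ lpNorm B q P := lpNorm_mono_exponent hq2 hB2
  have hsum : 4 * Λ ^ 2 * (K + lpNorm X 2 P
      + lpNorm (fun ω => u.U t (X ω) (P.map X) - Y ω) 2 P) ≤ 12 * Λ ^ 2 * M := by
    calc _ ≤ 4 * Λ ^ 2 * (M + M + M) := by gcongr
      _ = _ := by ring
  have hβM : lpNorm B q P ≤ 20 * Λ ^ 2 * M := by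
    have a1 := mul_le_mul_of_nonneg_left hXM (by positivity : 0 ≤ 4 * Λ ^ 2)
    have a2 := mul_le_mul_of_nonneg_left heM (by positivity : 0 ≤ 4 * Λ ^ 2)
    linarith
  have henv : lpNorm (envelope Λ X B) q P ≤ 22 * Λ ^ 2 * M := by
    have := lpNorm_le_of_affine₂ (f := envelope Λ X B) hq1 hX hB2
      (a := Λ ^ 2) (b := 1) (b' := 1) (by positivity) zero_le_one zero_le_one
      (ae_of_all _ fun ω => by
        rw [Real.norm_of_nonneg (zero_le_one.trans (one_le_envelope hΛ ω)), envelope]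
        exact le_of_eq (by ring))
    nlinarith
  have hM0 : 0 ≤ M := by linarith
  have hΨ : lpNorm (envelope Λ X B) q P ^ α ≤ (40 * Λ ^ 2) ^ α * M ^ α := by
    rw [← Real.mul_rpow (by positivity) hM0]
    refine Real.rpow_le_rpow lpNorm_nonneg (henv.trans ?_) (by linarith)
    gcongr; norm_num
  have hκ := stepConst_aux hΛ hα
  set κ := (40 * Λ ^ 2) ^ α with hκdef
  set e := |u.U t (X ω) (P.map X) - Y ω| with he
  set ε := lpNorm (fun ω => u.U t (X ω) (P.map X) - Y ω) 2 P with hεdef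
  have he0 : 0 ≤ e := abs_nonneg _
  have hx0 := norm_nonneg (X ω)
  have hκ0 : 1 ≤ κ := by linarith
  -- The terms linear in `M` are absorbed by `κ * M ^ α`, since `M ≥ 1` and `κ ≥ 40 Λ²`.
  have hρ : 1 + ‖X ω‖ + ‖B ω‖ + lpNorm X 2 P + lpNorm B 2 P + lpNorm (envelope Λ X B) q P ^ α
      ≤ κ * ‖X ω‖ + κ * e + 2 * κ * M ^ α := by
    have a1 : 34 * Λ ^ 2 * M ≤ κ * M ^ α := by
      refine mul_le_mul (by linarith) hMα hM0 (by linarith)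
    have a2 : 5 * Λ ^ 2 * ‖X ω‖ ≤ κ * ‖X ω‖ := by gcongr; linarith
    have a3 : 4 * Λ ^ 2 * e ≤ κ * e := by gcongr; linarith
    have a4 := mul_le_mul_of_nonneg_right p2 hx0
    have a5 := mul_le_mul_of_nonneg_right p2 hM0
    linarith
  refine h1.trans ?_
  have hd : (0:ℝ) ≤ d := Nat.cast_nonneg _
  have hMα0 : 0 ≤ M ^ α := by linarith
  have hfin : e + ε + √h * (1 + ‖X ω‖ + ‖B ω‖ + lpNorm X 2 P + lpNorm B 2 P
      + lpNorm (envelope Λ X B) q P ^ α) ≤ 2 * κ * (e + ε + √h * ‖X ω‖ + √h * M ^ α) := by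
    have b1 := mul_le_mul_of_nonneg_left hρ hsq0
    have b2 : √h * (κ * e) ≤ κ * e := mul_le_of_le_one_left (by positivity) hsq1
    have b3 : e ≤ κ * e := le_mul_of_one_le_left he0 hκ0
    have b4 : ε ≤ κ * ε := le_mul_of_one_le_left hε0 hκ0
    have b5 : 0 ≤ κ * (√h * ‖X ω‖) := by positivity
    have b6 : 0 ≤ κ * ε := by positivity
    calc _ ≤ e + ε + √h * (κ * ‖X ω‖ + κ * e + 2 * κ * M ^ α) := by linarith
      _ = e + ε + κ * (√h * ‖X ω‖) + √h * (κ * e) + 2 * κ * (√h * M ^ α) := by ring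
      _ ≤ 2 * (κ * e) + 2 * (κ * ε) + 2 * (κ * (√h * ‖X ω‖)) + 2 * κ * (√h * M ^ α) := by linarith
      _ = _ := by ring
  set w := e + ε + √h * ‖X ω‖ + √h * M ^ α with hw
  have hw0 : 0 ≤ w := by positivity
  calc _ ≤ (130 + 30 * d) * Λ ^ 7 * (h * (2 * κ * w)) := by gcongr
    _ = (260 + 60 * d) * (Λ ^ 7 * κ * (h * w)) := by ring
    _ ≤ (2000 * (1 + d)) * (Λ ^ 7 * κ * (h * w)) := by gcongr; linarith
    _ = _ := by unfold stepConst; ring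

end IsStep
end MKV
namespace MKV

/-! ### The backward step -/

section CondExp

variable {d : ℕ} {Ω : Type*} {G mΩ : MeasurableSpace Ω} {P : Measure Ω} [IsProbabilityMeasure P]
  {s : Finset (St d)} {p : St d → ℝ} {Λ : ℝ} {ζ : Ω → St d}

lemma integrable_smul_noise (hζ : IsInnovation G P ζ s p) (hs : IsDesign Λ s p) {D : Ω → ℝ}
    (hD : Integrable D P) : Integrable (fun ω => D ω • ζ ω) P := by
  refine (hD.norm.mul_const Λ).mono' (hD.1.smul hζ.measurable.aestronglyMeasurable)
    (ae_of_all _ fun ω => ?_)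
  rw [norm_smul]
  exact mul_le_mul_of_nonneg_left (hs.bound _ (hζ.mem ω)) (norm_nonneg _)

/-- The correlation with the noise is controlled by the conditional standard deviation. -/
lemma norm_condExp_smul_noise_le (hζ : IsInnovation G P ζ s p) (hs : IsDesign Λ s p) (hΛ : 0 ≤ Λ)
    {D : Ω → ℝ} (hD : MemLp D 2 P) :
    ∀ᵐ ω ∂P, 0 ≤ P[D ^ 2 | G] ω - P[D | G] ω ^ 2 ∧
      ‖P[fun ω => D ω • ζ ω | G] ω‖ ≤ Λ * √(P[D ^ 2 | G] ω - P[D | G] ω ^ 2) := by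
  have hD1 : Integrable D P := hD.integrable (by norm_num)
  set a : Ω → ℝ := P[D | G] with ha
  have ham : StronglyMeasurable[G] a := stronglyMeasurable_condExp
  have hai : Integrable a P := integrable_condExp
  have ha2 : MemLp a 2 P := MemLp.condExp (by norm_num) hD
  have hDa : MemLp (fun ω => D ω - a ω) 2 P := hD.sub ha2
  have hDa' : MemLp (fun ω => |D ω - a ω|) 2 P := hDa.norm
  -- The noise is centred given `G`, so `D` may be replaced by its deviation from its conditional
  -- mean.
  have e1 : P[fun ω => a ω • ζ ω | G] =ᵐ[P] 0 := by
    have h1 := hζ.condExp_comp (ψ := fun z ω => a ω • z) (fun z _ => ham.smul_const z)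
      (integrable_smul_noise hζ hs hai)
    filter_upwards [h1] with ω h2
    rw [h2]
    simp only [smul_comm (_ : ℝ) (a ω)]
    rw [← Finset.smul_sum, hs.centred, smul_zero]; rfl
  have e2 : P[fun ω => D ω • ζ ω | G] =ᵐ[P] P[fun ω => (D ω - a ω) • ζ ω | G] := by
    have h1 := condExp_sub (integrable_smul_noise hζ hs hD1) (integrable_smul_noise hζ hs hai) G
    have h2 : (fun ω => D ω • ζ ω) - (fun ω => a ω • ζ ω) = fun ω => (D ω - a ω) • ζ ω := by
      ext1 ω; simp [sub_smul]
    rw [h2] at h1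
    filter_upwards [h1, e1] with ω h3 h4
    rw [h3, Pi.sub_apply, h4]; simp
  have e3 := norm_condExp_le (m := G) (μ := P) (fun ω => (D ω - a ω) • ζ ω)
  have e4 : P[fun ω => ‖(D ω - a ω) • ζ ω‖ | G] ≤ᵐ[P] P[Λ • fun ω => |D ω - a ω| | G] := by
    refine condExp_mono (integrable_smul_noise hζ hs (hDa.integrable (by norm_num))).norm
      ((hDa'.integrable (by norm_num)).smul Λ) (ae_of_all _ fun ω => ?_)
    simp only [norm_smul, Pi.smul_apply, smul_eq_mul, Real.norm_eq_abs]
    rw [mul_comm]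
    exact mul_le_mul_of_nonneg_right (hs.bound _ (hζ.mem ω)) (abs_nonneg _)
  have e5 := condExp_smul Λ (fun ω => |D ω - a ω|) G (μ := P)
  -- Conditional Jensen, in the form that the conditional variance of `|D - a|` is nonnegative.
  have e6 := condVar_ae_eq_condExp_sq_sub_sq_condExp hζ.le hDa'
  have e7 : 0 ≤ᵐ[P] Var[fun ω => |D ω - a ω|; P | G] :=
    condExp_nonneg (ae_of_all _ fun ω => sq_nonneg _)
  have e8 := condVar_ae_eq_condExp_sq_sub_sq_condExp hζ.le hD
  have e9 : P[(fun ω => |D ω - a ω|) ^ 2 | G] = Var[D; P | G] := by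
    rw [condVar]; congr 1; ext ω; simp [sq_abs, ha]
  have e10 : 0 ≤ᵐ[P] P[fun ω => |D ω - a ω| | G] :=
    condExp_nonneg (ae_of_all _ fun ω => abs_nonneg _)
  rw [e9] at e6
  filter_upwards [e2, e3, e4, e5, e6, e7, e8, e10] with ω f2 f3 f4 f5 f6 f7 f8 f10
  simp only [Pi.sub_apply, Pi.pow_apply, Pi.zero_apply] at f6 f7 f8 f10
  rw [f6] at f7
  rw [f8] at f7
  constructor
  · linarith [sq_nonneg (P[fun ω => |D ω - a ω| | G] ω)]
  · rw [f2]
    refine f3.trans (f4.trans ?_)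
    rw [f5, Pi.smul_apply, smul_eq_mul]
    refine mul_le_mul_of_nonneg_left (Real.le_sqrt_of_sq_le ?_) hΛ
    linarith

end CondExp

/-- The constant of the backward recursion. -/
noncomputable def backConst (L C : ℝ) : ℝ := 1 + 2 * L ^ 2 + 12 * C * (1 + L ^ 2) + 8 * C ^ 2

/-- In the application `a` and `v` are the conditional mean and variance of the next error, so `a² +
v` is its conditional second moment. The term `√h √v` could not be iterated for `|e|`, but `(|a| + L
√h √v)² ≤ (1 + L² h) (a² + v)`. The implicit `|e|` on the right is absorbed thanks to `h C ≤ 1 / 2`.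
-/
lemma sq_le_of_backward {e a v L C h R : ℝ} (hv : 0 ≤ v) (hL : 0 ≤ L) (hC : 0 ≤ C) (hh : 0 < h)
    (h1 : h ≤ 1) (hhC : h * C ≤ 1 / 2)
    (H : |e| ≤ |a| + L * √h * √v + h * (C * (|e| + R))) :
    e ^ 2 ≤ (1 + backConst L C * h) * (a ^ 2 + v) + backConst L C * h * R ^ 2 := by
  set y := h * C with hy
  have hy0 : 0 ≤ y := by positivity
  set q := |a| + L * √h * √v with hq
  have hq0 : 0 ≤ q := by positivity
  have hsh : √h ^ 2 = h := Real.sq_sqrt hh.le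
  have hsv : √v ^ 2 = v := Real.sq_sqrt hv
  have hqs : q ^ 2 ≤ (1 + L ^ 2 * h) * (a ^ 2 + v) := by
    have e1 : q ^ 2 = a ^ 2 + 2 * (|a| * (L * √h)) * √v + L ^ 2 * h * v := by
      rw [hq]; linear_combination sq_abs a + L ^ 2 * √v ^ 2 * hsh + L ^ 2 * h * hsv
    have e2 : (|a| * (L * √h) - √v) ^ 2 = a ^ 2 * (L ^ 2 * h) - 2 * (|a| * (L * √h)) * √v + v := by
      linear_combination L ^ 2 * h * sq_abs a + |a| ^ 2 * L ^ 2 * hsh + hsv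
    nlinarith [sq_nonneg (|a| * (L * √h) - √v)]
  have H1 : (1 - y) * |e| ≤ q + y * R := by
    have : h * (C * (|e| + R)) = y * |e| + y * R := by rw [hy]; ring
    linarith
  have H2 : (1 - y) ^ 2 * e ^ 2 ≤ (q + y * R) ^ 2 := by
    rw [← sq_abs e, ← mul_pow]
    exact pow_le_pow_left₀ (mul_nonneg (by linarith) (abs_nonneg _)) H1 2
  have H3 : (q + y * R) ^ 2 ≤ (1 + h) * q ^ 2 + 2 * h * C ^ 2 * R ^ 2 := by
    have e1 : 2 * q * (y * R) ≤ h * q ^ 2 + h * (C * R) ^ 2 := by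
      have := mul_nonneg hh.le (sq_nonneg (q - C * R))
      rw [hy]; linarith
    have e2 : (y * R) ^ 2 ≤ h * (C * R) ^ 2 := by
      have : (y * R) ^ 2 = h ^ 2 * (C * R) ^ 2 := by rw [hy]; ring
      rw [this]
      exact mul_le_mul_of_nonneg_right (by nlinarith) (sq_nonneg _)
    linarith
  -- For `y ≤ 1 / 2` this replaces the division by `(1 - y)²`.
  have H4 : 1 ≤ (1 + 6 * y) * (1 - y) ^ 2 := by
    have : (1 + 6 * y) * (1 - y) ^ 2 = 1 + y * ((1 - 2 * y) * (4 - 3 * y)) := by ring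
    rw [this]
    have := mul_nonneg hy0 (mul_nonneg (by linarith : 0 ≤ 1 - 2 * y) (by linarith : 0 ≤ 4 - 3 * y))
    linarith
  have hw : 0 ≤ a ^ 2 + v := by positivity
  set w := a ^ 2 + v with hwdef
  calc e ^ 2 = 1 * e ^ 2 := (one_mul _).symm
    _ ≤ (1 + 6 * y) * (1 - y) ^ 2 * e ^ 2 := mul_le_mul_of_nonneg_right H4 (sq_nonneg _)
    _ = (1 + 6 * y) * ((1 - y) ^ 2 * e ^ 2) := by ring
    _ ≤ (1 + 6 * y) * ((1 + h) * ((1 + L ^ 2 * h) * w) + 2 * h * C ^ 2 * R ^ 2) := by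
        refine mul_le_mul_of_nonneg_left (H2.trans (H3.trans ?_)) (by linarith)
        have := mul_le_mul_of_nonneg_left hqs (by linarith : 0 ≤ 1 + h)
        linarith
    _ = (1 + 6 * y) * ((1 + h) * (1 + L ^ 2 * h)) * w + (1 + 6 * y) * (2 * h * C ^ 2 * R ^ 2) := by
        ring
    _ ≤ (1 + backConst L C * h) * w + backConst L C * h * R ^ 2 := by
        have a1 : (1 + h) * (1 + L ^ 2 * h) ≤ 1 + h * (1 + 2 * L ^ 2) := by
          have := mul_le_mul_of_nonneg_left h1 (by positivity : 0 ≤ L ^ 2 * h)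
          linarith
        have a2 : (1 + 6 * y) * ((1 + h) * (1 + L ^ 2 * h)) ≤ 1 + backConst L C * h := by
          refine (mul_le_mul_of_nonneg_left a1 (by linarith)).trans ?_
          have a3 : h * (1 + 2 * L ^ 2) ≤ 1 + 2 * L ^ 2 := by nlinarith [sq_nonneg L]
          have a4 := mul_le_mul_of_nonneg_left a3 (by linarith : 0 ≤ 6 * y)
          have a5 : 0 ≤ 8 * C ^ 2 * h := by positivity
          unfold backConst
          calc (1 + 6 * y) * (1 + h * (1 + 2 * L ^ 2))
              = 1 + h * (1 + 2 * L ^ 2) + 6 * y + 6 * y * (h * (1 + 2 * L ^ 2)) := by ring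
            _ ≤ 1 + h * (1 + 2 * L ^ 2) + 6 * y + 6 * y * (1 + 2 * L ^ 2) + 8 * C ^ 2 * h := by
              linarith
            _ = _ := by rw [hy]; ring
        have b1 : (1 + 6 * y) * (2 * h * C ^ 2 * R ^ 2) ≤ backConst L C * h * R ^ 2 := by
          have b2 : 0 ≤ h * C ^ 2 * R ^ 2 := by positivity
          have b3 : 0 ≤ (1 + 2 * L ^ 2 + 12 * C * (1 + L ^ 2)) * h * R ^ 2 := by positivity
          calc (1 + 6 * y) * (2 * h * C ^ 2 * R ^ 2) ≤ 4 * (2 * h * C ^ 2 * R ^ 2) := by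
                refine mul_le_mul_of_nonneg_right (by linarith) (by positivity)
            _ = 8 * C ^ 2 * h * R ^ 2 := by ring
            _ ≤ _ := by unfold backConst; linarith
        exact add_le_add (mul_le_mul_of_nonneg_right a2 hw) b1

/-- The backward half of one step of the scheme. -/
structure IsBackwardStep {d : ℕ} {Ω : Type*} (G : MeasurableSpace Ω) {mΩ : MeasurableSpace Ω}
    (P : Measure Ω) (c : Coeffs d) (h : ℝ) (X : Ω → St d) (Y : Ω → ℝ) (ζ B Θ X' : Ω → St d)
    (Y' : Ω → ℝ) (Xin Z : Ω → St d) : Prop where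
  next_X : X' =ᵐ[P] fun ω => X ω + h • B ω + √h • Θ ω
  memLp_Y' : MemLp Y' 2 P
  meas_Xin : Measurable[G] Xin
  memLp_Xin : MemLp Xin 2 P
  meas_Z : Measurable[G] Z
  memLp_Z : MemLp Z 2 P
  step_Y : Y =ᵐ[P] P[fun ω => Y' ω
      + h * c.f (Xin ω) (Y ω) (Z ω) (P.map fun ω' => (Xin ω', Y ω')) | G]
  step_Z : Z =ᵐ[P] P[fun ω => (Y' ω / h) • √h • ζ ω | G]

namespace IsBackwardStep

variable {d : ℕ} {Ω₀ : Type*} {m₀ : MeasurableSpace Ω₀} {P₀ : Measure Ω₀} {T Λ α K : ℝ}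
  {c : Coeffs d} {u : MasterField d}
  {Ω : Type*} {G mΩ : MeasurableSpace Ω} {P : Measure Ω} [IsProbabilityMeasure P]
  {s : Finset (St d)} {p : St d → ℝ} {t h : ℝ} {X : Ω → St d} {Y : Ω → ℝ} {ζ B Θ : Ω → St d}
  {X' Xin Z : Ω → St d} {Y' : Ω → ℝ}

lemma map_next (E : IsBackwardStep G P c h X Y ζ B Θ X' Y' Xin Z) :
    P.map X' = P.map fun ω => X ω + h • B ω + √h • Θ ω := Measure.map_congr E.next_X

lemma isP2_next (E : IsBackwardStep G P c h X Y ζ B Θ X' Y' Xin Z)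
    (D : IsStep G P Λ T c s p t h X Y ζ B Θ) (S : Setting P₀ T Λ α K c u) : IsP2 (P.map X') := by
  have h1 := D.isP2_path S (√h)
  rw [Real.sq_sqrt D.h_pos.le] at h1
  rw [E.map_next]; exact h1

lemma memLp_next (E : IsBackwardStep G P c h X Y ζ B Θ X' Y' Xin Z)
    (D : IsStep G P Λ T c s p t h X Y ζ B Θ) (S : Setting P₀ T Λ α K c u) {q : ℝ≥0∞}
    (hX : MemLp X q P) (hY : MemLp Y q P) : MemLp X' q P := by
  have h1 : MemLp (fun ω => h • B ω) q P := (D.memLp_B S hX hY).const_smul h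
  have h2 : MemLp (fun ω => √h • Θ ω) q P := (D.memLp_Θ S q).const_smul (√h)
  exact ((hX.add h1).add h2).ae_eq E.next_X.symm

lemma memLp_next_U (E : IsBackwardStep G P c h X Y ζ B Θ X' Y' Xin Z)
    (D : IsStep G P Λ T c s p t h X Y ζ B Θ) (S : Setting P₀ T Λ α K c u) :
    MemLp (fun ω => u.U (t + h) (X' ω) (P.map X')) 2 P :=
  S.memLp_U ⟨by linarith [D.t_nonneg, D.h_pos], D.le_T⟩ (E.isP2_next D S)
    (E.memLp_next D S D.memLp_X D.memLp_Y)

lemma memLp_next_err (E : IsBackwardStep G P c h X Y ζ B Θ X' Y' Xin Z)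
    (D : IsStep G P Λ T c s p t h X Y ζ B Θ) (S : Setting P₀ T Λ α K c u) :
    MemLp (fun ω => u.U (t + h) (X' ω) (P.map X') - Y' ω) 2 P :=
  (E.memLp_next_U D S).sub E.memLp_Y'

/-- Conditional expectations of the decoupling field at the end of the step. -/
lemma condExp_next_U (E : IsBackwardStep G P c h X Y ζ B Θ X' Y' Xin Z)
    (D : IsStep G P Λ T c s p t h X Y ζ B Θ) (S : Setting P₀ T Λ α K c u) :
    (P[fun ω => u.U (t + h) (X' ω) (P.map X') | G] =ᵐ[P] fun ω => ∑ z ∈ s, p z *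
      u.U (t + h) (X ω + h • B ω + √h • c.σ (X ω) (P.map X) z)
          (P.map fun ω => X ω + h • B ω + √h • Θ ω)) ∧
    (P[fun ω => u.U (t + h) (X' ω) (P.map X') • ζ ω | G] =ᵐ[P] fun ω => ∑ z ∈ s, p z •
      (u.U (t + h) (X ω + h • B ω + √h • c.σ (X ω) (P.map X) z)
          (P.map fun ω => X ω + h • B ω + √h • Θ ω)) • z) := by
  have hT : t + h ∈ Icc 0 T := ⟨by linarith [D.t_nonneg, D.h_pos], D.le_T⟩
  have hU := E.memLp_next_U D S
  have hP2 := E.isP2_next D S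
  rw [← E.map_next]
  set μ := P.map X' with hμ
  let ψ : St d → Ω → ℝ := fun z ω => u.U (t + h) (X ω + h • B ω + √h • c.σ (X ω) (P.map X) z) μ
  have hσm : Measurable[G] fun ω => c.σ (X ω) (P.map X) :=
    (S.continuous_σ D.isP2).measurable.comp D.meas_X
  have hψ : ∀ z ∈ s, StronglyMeasurable[G] (ψ z) := fun z _ => by
    have hz : Measurable[G] fun ω => c.σ (X ω) (P.map X) z :=
      (ContinuousLinearMap.apply ℝ (St d) z).continuous.measurable.comp hσm
    have hxz : Measurable[G] fun ω => X ω + h • B ω + √h • c.σ (X ω) (P.map X) z :=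
      (D.meas_X.add ((D.meas_B S).const_smul h)).add (hz.const_smul (√h))
    exact ((S.continuous_U hT hP2).measurable.comp hxz).stronglyMeasurable
  have e : (fun ω => u.U (t + h) (X' ω) μ) =ᵐ[P] fun ω => ψ (ζ ω) ω := by
    filter_upwards [E.next_X] with ω h1
    rw [h1, D.Θ_eq]
  have hi : Integrable (fun ω => u.U (t + h) (X' ω) μ) P := hU.integrable (by norm_num)
  have hi2 := integrable_smul_noise D.innov D.design hi
  have e2 : (fun ω => u.U (t + h) (X' ω) μ • ζ ω) =ᵐ[P] fun ω => ψ (ζ ω) ω • ζ ω := by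
    filter_upwards [e] with ω h1
    rw [h1]
  refine ⟨(condExp_congr_ae e).trans (D.innov.condExp_comp hψ (hi.congr e)),
    (condExp_congr_ae e2).trans (D.innov.condExp_comp (ψ := fun z ω => ψ z ω • z)
      (fun z hz => (hψ z hz).smul_const z) (hi2.congr e2))⟩

/-- The error satisfies a backward equation. -/
lemma err_eq (E : IsBackwardStep G P c h X Y ζ B Θ X' Y' Xin Z)
    (D : IsStep G P Λ T c s p t h X Y ζ B Θ) (S : Setting P₀ T Λ α K c u) :
    ∀ᵐ ω ∂P, u.U t (X ω) (P.map X) - Y ω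
        = P[fun ω => u.U (t + h) (X' ω) (P.map X') - Y' ω | G] ω
          - IsStep.defect P c u s p t h X B Θ ω
          + h * (c.f (X ω) (u.U t (X ω) (P.map X))
              (c.σadj (X ω) (P.map X) (u.dx t (X ω) (P.map X))) (u.graphLaw t (P.map X))
            - c.f (Xin ω) (Y ω) (Z ω) (P.map fun ω' => (Xin ω', Y ω'))) := by
  have hXin := E.meas_Xin.mono D.innov.le le_rfl
  have hν : IsP2 (P.map fun ω' => (Xin ω', Y ω')) :=
    isP2_prod hXin D.measurable_Y E.memLp_Xin D.memLp_Y
  have hfm : Measurable[G] fun ω => h * c.f (Xin ω) (Y ω) (Z ω) (P.map fun ω' => (Xin ω', Y ω')) :=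
    ((S.continuous_f hν).measurable.comp
      (E.meas_Xin.prodMk (D.meas_Y.prodMk E.meas_Z))).const_mul h
  have hfi : Integrable
      (fun ω => h * c.f (Xin ω) (Y ω) (Z ω) (P.map fun ω' => (Xin ω', Y ω'))) P := by
    have h1 : MemLp (fun ω => K + Λ * (‖Xin ω‖ + ‖Y ω‖ + ‖Z ω‖ + W2joint
        (P.map fun ω' => (Xin ω', Y ω')) (Measure.dirac 0))) 2 P :=
      (memLp_const K).add ((((E.memLp_Xin.norm.add D.memLp_Y.norm).add E.memLp_Z.norm).add
        (memLp_const _)).const_mul Λ)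
    refine Integrable.const_mul ((h1.integrable (by norm_num)).mono'
      ((S.continuous_f hν).measurable.comp
        (hXin.prodMk (D.measurable_Y.prodMk (E.meas_Z.mono D.innov.le le_rfl)))).aestronglyMeasurable
      (ae_of_all _ fun ω => S.f_growth (Xin ω) (Y ω) (Z ω) hν)) h
  have hY'i : Integrable Y' P := E.memLp_Y'.integrable (by norm_num)
  have e1 := condExp_add hY'i hfi G
  rw [condExp_of_stronglyMeasurable D.innov.le hfm.stronglyMeasurable hfi] at e1
  have e2 := condExp_sub ((E.memLp_next_U D S).integrable (by norm_num)) hY'i G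
  filter_upwards [e1, e2, (E.condExp_next_U D S).1, E.step_Y] with ω f1 f2 f3 f4
  have f1' : P[fun ω => Y' ω + h * c.f (Xin ω) (Y ω) (Z ω) (P.map fun ω' => (Xin ω', Y ω')) | G] ω
      = P[Y' | G] ω + h * c.f (Xin ω) (Y ω) (Z ω) (P.map fun ω' => (Xin ω', Y ω')) := f1
  have f2' : P[fun ω => u.U (t + h) (X' ω) (P.map X') - Y' ω | G] ω
      = P[fun ω => u.U (t + h) (X' ω) (P.map X') | G] ω - P[Y' | G] ω := f2
  rw [f2', f3, IsStep.defect]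
  rw [f1'] at f4
  linarith

/-- The error of the gradient component. -/
lemma norm_Z_err_le [IsProbabilityMeasure P₀] (E : IsBackwardStep G P c h X Y ζ B Θ X' Y' Xin Z)
    (D : IsStep G P Λ T c s p t h X Y ζ B Θ) (S : Setting P₀ T Λ α K c u) :
    ∀ᵐ ω ∂P, ‖c.σadj (X ω) (P.map X) (u.dx t (X ω) (P.map X)) - Z ω‖
      ≤ stepConst d Λ α * (√h * (|u.U t (X ω) (P.map X) - Y ω|
        + lpNorm (fun ω => u.U t (X ω) (P.map X) - Y ω) 2 P + ‖X ω‖ + lpNorm X 2 P + K))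
        + (√h)⁻¹ * ‖P[fun ω => (u.U (t + h) (X' ω) (P.map X') - Y' ω) • ζ ω | G] ω‖ := by
  have hsqp : 0 < √h := Real.sqrt_pos.2 D.h_pos
  have hY'i : Integrable Y' P := E.memLp_Y'.integrable (by norm_num)
  have hUi : Integrable (fun ω => u.U (t + h) (X' ω) (P.map X')) P :=
    (E.memLp_next_U D S).integrable (by norm_num)
  have e1 := condExp_sub (integrable_smul_noise D.innov D.design hUi)
    (integrable_smul_noise D.innov D.design hY'i) G
  have e2 := condExp_smul ((√h)⁻¹) (fun ω => Y' ω • ζ ω) G (μ := P)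
  have e3 : (fun ω => (Y' ω / h) • √h • ζ ω) = (√h)⁻¹ • fun ω => Y' ω • ζ ω := by
    ext1 ω
    simp only [Pi.smul_apply, smul_smul]
    congr 1
    rw [div_mul_eq_mul_div, mul_div_assoc, Real.sqrt_div_self', one_div, mul_comm]
  have e4 : (fun ω => u.U (t + h) (X' ω) (P.map X') • ζ ω) - (fun ω => Y' ω • ζ ω)
      = fun ω => (u.U (t + h) (X' ω) (P.map X') - Y' ω) • ζ ω := by
    ext1 ω; simp [sub_smul]
  rw [e4] at e1
  rw [← e3] at e2
  filter_upwards [e1, e2, (E.condExp_next_U D S).2, E.step_Z] with ω f1 f2 f3 f4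
  have h1 := D.norm_gradient_sub_le S ω
  rw [← f3] at h1
  have h2 : c.σadj (X ω) (P.map X) (u.dx t (X ω) (P.map X)) - Z ω
      = (c.σadj (X ω) (P.map X) (u.dx t (X ω) (P.map X))
        - (√h)⁻¹ • P[fun ω => u.U (t + h) (X' ω) (P.map X') • ζ ω | G] ω)
        + (√h)⁻¹ • P[fun ω => (u.U (t + h) (X' ω) (P.map X') - Y' ω) • ζ ω | G] ω := by
    rw [f1, f4, f2, Pi.sub_apply, Pi.smul_apply, smul_sub]; abel
  rw [h2]
  refine (norm_add_le _ _).trans (add_le_add h1 (le_of_eq ?_))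
  rw [norm_smul, norm_inv, Real.norm_of_nonneg hsqp.le]

/-- One step of the backward recursion for the squared error. -/
lemma sq_err_le [IsProbabilityMeasure P₀] (E : IsBackwardStep G P c h X Y ζ B Θ X' Y' Xin Z)
    (D : IsStep G P Λ T c s p t h X Y ζ B Θ) (S : Setting P₀ T Λ α K c u) {a₁ a₀ : ℝ}
    (ha₁ : √h ≤ a₁) (ha₀ : √h * (lpNorm X 2 P + K) ≤ 2 * a₀)
    (hC : h * (4 * Λ * stepConst d Λ α) ≤ 1 / 2)
    (hdef : ∀ ω, |IsStep.defect P c u s p t h X B Θ ω| ≤ stepConst d Λ α * (h *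
      (|u.U t (X ω) (P.map X) - Y ω| + lpNorm (fun ω => u.U t (X ω) (P.map X) - Y ω) 2 P
        + a₁ * ‖X ω‖ + a₀))) :
    ∀ᵐ ω ∂P, (u.U t (X ω) (P.map X) - Y ω) ^ 2
      ≤ (1 + backConst (Λ ^ 2) (4 * Λ * stepConst d Λ α) * h)
          * P[(fun ω => u.U (t + h) (X' ω) (P.map X') - Y' ω) ^ 2 | G] ω
        + backConst (Λ ^ 2) (4 * Λ * stepConst d Λ α) * h
          * (lpNorm (fun ω => u.U t (X ω) (P.map X) - Y ω) 2 P + a₁ * ‖X ω‖ + a₀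
            + ‖X ω - Xin ω‖ + lpNorm (fun ω => X ω - Xin ω) 2 P) ^ 2 := by
  have hh := D.h_pos
  have hsqp : 0 < √h := Real.sqrt_pos.2 hh
  have hsq : √h * √h = h := Real.mul_self_sqrt hh.le
  have hsq1 : √h ≤ 1 := Real.sqrt_le_one.2 D.h_le_one
  have hΛ := S.one_le_Λ
  have hΛ0 := S.Λ_pos
  have hXin := E.meas_Xin.mono D.innov.le le_rfl
  have hν : IsP2 (P.map fun ω' => (Xin ω', Y ω')) :=
    isP2_prod hXin D.measurable_Y E.memLp_Xin D.memLp_Y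
  have hW : W2joint (u.graphLaw t (P.map X)) (P.map fun ω' => (Xin ω', Y ω'))
      ≤ lpNorm (fun ω => X ω - Xin ω) 2 P
        + lpNorm (fun ω => u.U t (X ω) (P.map X) - Y ω) 2 P := by
    rw [S.graphLaw_map D.t_mem D.measurable_X D.memLp_X]
    exact W2joint_map_le D.measurable_X hXin
      (show Measurable fun ω => u.U t (X ω) (P.map X) from
        (S.continuous_U D.t_mem D.isP2).measurable.comp D.measurable_X) D.measurable_Y
      D.memLp_X E.memLp_Xin (S.memLp_U D.t_mem D.isP2 D.memLp_X) D.memLp_Y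
  have hC1 := IsStep.one_le_stepConst (d := d) hΛ S.one_le_α
  set C₁ := stepConst d Λ α with hC₁
  have hN0 : 0 ≤ lpNorm X 2 P := lpNorm_nonneg
  have hε0 : 0 ≤ lpNorm (fun ω => u.U t (X ω) (P.map X) - Y ω) 2 P := lpNorm_nonneg
  have hδ0 : 0 ≤ lpNorm (fun ω => X ω - Xin ω) 2 P := lpNorm_nonneg
  have hK := S.K_pos
  have ha₁0 : 0 ≤ a₁ := hsqp.le.trans ha₁
  have ha₀0 : 0 ≤ a₀ := by
    have : 0 ≤ √h * (lpNorm X 2 P + K) := by positivity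
    linarith
  filter_upwards [E.err_eq D S, E.norm_Z_err_le D S,
    norm_condExp_smul_noise_le D.innov D.design hΛ0.le (E.memLp_next_err D S)] with ω f1 f2 f3
  set N := ‖P[fun ω => (u.U (t + h) (X' ω) (P.map X') - Y' ω) • ζ ω | G] ω‖
  set a := P[fun ω => u.U (t + h) (X' ω) (P.map X') - Y' ω | G] ω with ha
  set w := P[(fun ω => u.U (t + h) (X' ω) (P.map X') - Y' ω) ^ 2 | G] ω with hw
  set F := c.f (X ω) (u.U t (X ω) (P.map X))
    (c.σadj (X ω) (P.map X) (u.dx t (X ω) (P.map X))) (u.graphLaw t (P.map X))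
  set F' := c.f (Xin ω) (Y ω) (Z ω) (P.map fun ω' => (Xin ω', Y ω'))
  have hF := S.h0.lip_f (X ω) (Xin ω) (u.U t (X ω) (P.map X)) (Y ω)
    (c.σadj (X ω) (P.map X) (u.dx t (X ω) (P.map X))) (Z ω) _ _
    (S.isP2_graphLaw D.t_mem D.isP2) hν
  have hdω := hdef ω
  set ε := lpNorm (fun ω => u.U t (X ω) (P.map X) - Y ω) 2 P
  set δ := lpNorm (fun ω => X ω - Xin ω) 2 P
  set e := u.U t (X ω) (P.map X) - Y ω with he
  set R := ε + a₁ * ‖X ω‖ + a₀ + ‖X ω - Xin ω‖ + δ with hR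
  have hx0 := norm_nonneg (X ω)
  have hxd := norm_nonneg (X ω - Xin ω)
  have he0 := abs_nonneg e
  have hax : 0 ≤ a₁ * ‖X ω‖ := by positivity
  have hR0 : 0 ≤ R := by positivity
  have key : |e| ≤ |a| + Λ ^ 2 * √h * √(w - a ^ 2) + h * (4 * Λ * C₁ * (|e| + R)) := by
    have g1 : |e| ≤ |a| + |IsStep.defect P c u s p t h X B Θ ω| + h * |F - F'| := by
      have h1 := abs_add_le (a - IsStep.defect P c u s p t h X B Θ ω) (h * (F - F'))
      have h2 := abs_sub a (IsStep.defect P c u s p t h X B Θ ω)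
      rw [abs_mul, abs_of_pos hh] at h1
      calc |e| = |a - IsStep.defect P c u s p t h X B Θ ω + h * (F - F')| := by rw [f1]
        _ ≤ _ := by linarith
    -- The pair `(a₁, a₀)` is meant to be `(1, ‖X‖₂ + K)` with the crude defect and `(√h, √h M^α)`
    -- with the fine one. In both cases it dominates the gradient error, which always carries `√h`.
    have g2 : √h * (|e| + ε + ‖X ω‖ + lpNorm X 2 P + K) ≤ |e| + 2 * R := by
      have i1 : √h * |e| ≤ |e| := mul_le_of_le_one_left he0 hsq1
      have i2 : √h * ε ≤ ε := mul_le_of_le_one_left hε0 hsq1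
      have i3 : √h * ‖X ω‖ ≤ a₁ * ‖X ω‖ := mul_le_mul_of_nonneg_right ha₁ hx0
      calc _ = √h * |e| + √h * ε + √h * ‖X ω‖ + √h * (lpNorm X 2 P + K) := by ring
        _ ≤ |e| + ε + a₁ * ‖X ω‖ + 2 * a₀ := by linarith
        _ ≤ _ := by linarith
    -- The weight `1 / √h` in the error on `Z` is compensated by the factor `h` of the driver: what
    -- is left is `√h` times a conditional standard deviation.
    have g3 : h * ((√h)⁻¹ * N) ≤ √h * (Λ * √(w - a ^ 2)) := by
      have : h * ((√h)⁻¹ * N) = √h * N := by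
        rw [← mul_assoc, ← div_eq_mul_inv, Real.div_sqrt]
      rw [this]
      exact mul_le_mul_of_nonneg_left f3.2 hsqp.le
    have g4 : h * |F - F'| ≤ h * (Λ * (|e| + R)) + h * (Λ * (C₁ * (|e| + 2 * R)))
        + Λ * (√h * (Λ * √(w - a ^ 2))) := by
      have i1 : |F - F'| ≤ Λ * ((|e| + R) + (C₁ * (|e| + 2 * R) + (√h)⁻¹ * N)) := by
        refine hF.trans (mul_le_mul_of_nonneg_left ?_ hΛ0.le)
        have i2 := mul_le_mul_of_nonneg_left g2 (by linarith : 0 ≤ C₁)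
        linarith
      calc h * |F - F'| ≤ h * (Λ * ((|e| + R) + (C₁ * (|e| + 2 * R) + (√h)⁻¹ * N))) :=
            mul_le_mul_of_nonneg_left i1 hh.le
        _ = h * (Λ * (|e| + R)) + h * (Λ * (C₁ * (|e| + 2 * R))) + Λ * (h * ((√h)⁻¹ * N)) := by
            ring
        _ ≤ _ := by have := mul_le_mul_of_nonneg_left g3 hΛ0.le; linarith
    have g5 : |IsStep.defect P c u s p t h X B Θ ω| ≤ h * (C₁ * (|e| + R)) := by
      refine hdω.trans ?_
      have : |e| + ε + a₁ * ‖X ω‖ + a₀ ≤ |e| + R := by linarith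
      calc C₁ * (h * (|e| + ε + a₁ * ‖X ω‖ + a₀)) ≤ C₁ * (h * (|e| + R)) := by gcongr
        _ = _ := by ring
    have hΛC : 1 ≤ Λ * C₁ := one_le_mul_of_one_le_of_one_le hΛ hC1
    have j1 : C₁ * (|e| + R) ≤ Λ * C₁ * (|e| + R) := by
      refine mul_le_mul_of_nonneg_right ?_ (by positivity)
      exact le_mul_of_one_le_left (by linarith) hΛ
    have j2 : Λ * (|e| + R) ≤ Λ * C₁ * (|e| + R) := by
      refine mul_le_mul_of_nonneg_right ?_ (by positivity)
      exact le_mul_of_one_le_right hΛ0.le hC1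
    have j3 : Λ * (C₁ * (|e| + 2 * R)) ≤ 2 * (Λ * C₁ * (|e| + R)) := by
      have : 0 ≤ Λ * C₁ * |e| := by positivity
      linarith
    have j : h * (C₁ * (|e| + R)) + (h * (Λ * (|e| + R)) + h * (Λ * (C₁ * (|e| + 2 * R))))
        ≤ h * (4 * Λ * C₁ * (|e| + R)) := by
      rw [← mul_add, ← mul_add]
      exact mul_le_mul_of_nonneg_left (by linarith) hh.le
    calc |e| ≤ |a| + h * (C₁ * (|e| + R)) + (h * (Λ * (|e| + R)) + h * (Λ * (C₁ * (|e| + 2 * R)))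
        + Λ * (√h * (Λ * √(w - a ^ 2)))) := by linarith
      _ ≤ |a| + h * (4 * Λ * C₁ * (|e| + R)) + Λ * (√h * (Λ * √(w - a ^ 2))) := by linarith
      _ = _ := by ring
  -- Applied with `v = w - a²`, so that `a² + v` is the conditional second moment `w`.
  have hfin := sq_le_of_backward f3.1 (by positivity) (by positivity) hh D.h_le_one hC key
  rwa [add_sub_cancel] at hfin

end IsBackwardStep
end MKV
namespace MKV

/-! ### Moments along one step -/

section Squares

variable {Ω E : Type*} {mΩ : MeasurableSpace Ω} {P : Measure Ω} [NormedAddCommGroup E]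

lemma eLpNorm_norm_sq {α : ℝ} (hα : 0 ≤ α) (f : Ω → E) :
    eLpNorm (fun ω => ‖f ω‖ ^ 2) (ENNReal.ofReal α) P
      = eLpNorm f (ENNReal.ofReal (2 * α)) P ^ 2 := by
  have h := eLpNorm_norm_rpow (p := ENNReal.ofReal α) (μ := P) f (q := 2) (by norm_num)
  rw [← ENNReal.ofReal_mul hα, mul_comm α] at h
  have h2 : (fun ω => ‖f ω‖ ^ (2 : ℝ)) = fun ω => ‖f ω‖ ^ 2 := by ext ω; exact Real.rpow_two _
  rw [h2] at h
  rw [h]; exact ENNReal.rpow_two _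

lemma memLp_norm_sq_iff {α : ℝ} (hα : 0 ≤ α) {f : Ω → E} (hf : AEStronglyMeasurable f P) :
    MemLp (fun ω => ‖f ω‖ ^ 2) (ENNReal.ofReal α) P ↔ MemLp f (ENNReal.ofReal (2 * α)) P := by
  have h : AEStronglyMeasurable (fun ω => ‖f ω‖ ^ 2) P := hf.norm.pow 2
  rw [MemLp, MemLp, eLpNorm_norm_sq hα]
  simp [h, hf, ENNReal.pow_lt_top_iff]

lemma lpNorm_norm_sq {α : ℝ} (hα : 0 ≤ α) {f : Ω → E} (hf : AEStronglyMeasurable f P) :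
    lpNorm (fun ω => ‖f ω‖ ^ 2) (ENNReal.ofReal α) P = lpNorm f (ENNReal.ofReal (2 * α)) P ^ 2 := by
  have h : AEStronglyMeasurable (fun ω => ‖f ω‖ ^ 2) P := hf.norm.pow 2
  rw [← toReal_eLpNorm h, ← toReal_eLpNorm hf, eLpNorm_norm_sq hα, ENNReal.toReal_pow]

end Squares

section DesignMoments

variable {d : ℕ} {Λ : ℝ} {s : Finset (St d)} {p : St d → ℝ}

lemma IsDesign.sum_inner_image (D : IsDesign Λ s p) (A : St d →L[ℝ] St d) (v : St d) :
    ∑ z ∈ s, p z * ⟪v, A z⟫_ℝ = 0 := by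
  have : ∑ z ∈ s, p z * ⟪v, A z⟫_ℝ = ⟪v, A (∑ z ∈ s, p z • z)⟫_ℝ := by
    rw [map_sum, inner_sum]
    refine Finset.sum_congr rfl fun z _ => ?_
    rw [map_smul, inner_smul_right]
  rw [this, D.centred, map_zero, inner_zero_right]

lemma norm_add_smul_sq (v w : St d) (r : ℝ) :
    ‖v + r • w‖ ^ 2 = ‖v‖ ^ 2 + 2 * r * ⟪v, w⟫_ℝ + r ^ 2 * ‖w‖ ^ 2 := by
  rw [norm_add_sq_real, inner_smul_right, norm_smul, mul_pow, Real.norm_eq_abs, sq_abs]; ring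

lemma IsDesign.sum_norm_sq_le (D : IsDesign Λ s p) {A : St d →L[ℝ] St d} {ρ : ℝ}
    (hA : ∀ z ∈ s, ‖A z‖ ≤ ρ) (v : St d) (r : ℝ) :
    ∑ z ∈ s, p z * ‖v + r • A z‖ ^ 2 ≤ ‖v‖ ^ 2 + r ^ 2 * ρ ^ 2 := by
  have h1 : ∑ z ∈ s, p z * ‖v + r • A z‖ ^ 2
      ≤ ∑ z ∈ s, (p z * (‖v‖ ^ 2 + r ^ 2 * ρ ^ 2) + 2 * r * (p z * ⟪v, A z⟫_ℝ)) := by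
    refine Finset.sum_le_sum fun z hz => ?_
    rw [norm_add_smul_sq]
    have h2 : ‖A z‖ ^ 2 ≤ ρ ^ 2 := pow_le_pow_left₀ (norm_nonneg _) (hA z hz) 2
    have h3 := mul_le_mul_of_nonneg_left
      (mul_le_mul_of_nonneg_left h2 (sq_nonneg r)) (D.nonneg z hz)
    linarith
  rw [Finset.sum_add_distrib, ← Finset.sum_mul, ← Finset.mul_sum, D.sum_one,
    D.sum_inner_image, mul_zero, add_zero, one_mul] at h1
  exact h1

/-- Bound `1 + τ` by `exp τ` and expand `exp (α τ)` to second order, as `|α τ| ≤ 1`. -/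
lemma one_add_rpow_le {α τ : ℝ} (hα : 1 ≤ α) (h : α * |τ| ≤ 1) :
    (1 + τ) ^ α ≤ 1 + α * τ + α ^ 2 * τ ^ 2 := by
  have h1 : |τ| ≤ 1 := (le_mul_of_one_le_left (abs_nonneg _) hα).trans h
  have h2 : 0 ≤ 1 + τ := by linarith [neg_abs_le τ]
  have h3 : (1 + τ) ^ α ≤ Real.exp (α * τ) := by
    have := Real.rpow_le_rpow h2 (by linarith [Real.add_one_le_exp τ] : 1 + τ ≤ Real.exp τ)
      (by linarith : 0 ≤ α)
    rwa [← Real.exp_mul, mul_comm τ] at this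
  have h4 : |α * τ| ≤ 1 := by rwa [abs_mul, abs_of_pos (by linarith)]
  have h5 := (abs_le.1 (Real.abs_exp_sub_one_sub_id_le h4)).2
  nlinarith

/-- Factoring out `w = 1 + ‖v‖²` makes the relative increment `τ` of order `r ρ` uniformly in `v`.
Its first order part is centred, so the growth is of order `(r ρ)²`, that is `h` in the scheme. -/
lemma IsDesign.sum_one_add_norm_sq_rpow_le (D : IsDesign Λ s p) {A : St d →L[ℝ] St d} {ρ r α : ℝ}
    (hα : 1 ≤ α) (hr : 0 ≤ r) (hρ : 0 ≤ ρ) (hA : ∀ z ∈ s, ‖A z‖ ≤ ρ) (hs : 2 * α * (r * ρ) ≤ 1)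
    (v : St d) :
    ∑ z ∈ s, p z * (1 + ‖v + r • A z‖ ^ 2) ^ α
      ≤ (1 + ‖v‖ ^ 2) ^ α * (1 + (α + 4 * α ^ 2) * (r * ρ) ^ 2) := by
  set w := 1 + ‖v‖ ^ 2 with hw
  have hw1 : 1 ≤ w := by rw [hw]; linarith [sq_nonneg ‖v‖]
  have hw0 : 0 < w := by linarith
  set y := r * ρ with hy
  have hy0 : 0 ≤ y := by positivity
  have hy1 : y ≤ 1 := by nlinarith
  have hαp : 0 < α := by linarith
  let τ : St d → ℝ := fun z => (2 * r * ⟪v, A z⟫_ℝ + r ^ 2 * ‖A z‖ ^ 2) / w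
  have hrA : ∀ z ∈ s, r * ‖A z‖ ≤ y := fun z hz => mul_le_mul_of_nonneg_left (hA z hz) hr
  have hrA2 : ∀ z ∈ s, r ^ 2 * ‖A z‖ ^ 2 ≤ y ^ 2 := fun z hz => by
    rw [← mul_pow]; exact pow_le_pow_left₀ (by positivity) (hrA z hz) 2
  have hτ : ∀ z ∈ s, |τ z| ≤ 2 * y := fun z hz => by
    rw [abs_div, abs_of_pos hw0, div_le_iff₀ hw0]
    have h1 : |⟪v, A z⟫_ℝ| ≤ ‖v‖ * ‖A z‖ := abs_real_inner_le_norm _ _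
    have h2 : |2 * r * ⟪v, A z⟫_ℝ| ≤ 2 * ‖v‖ * y := by
      rw [abs_mul, abs_of_nonneg (by positivity : 0 ≤ 2 * r)]
      calc 2 * r * |⟪v, A z⟫_ℝ| ≤ 2 * r * (‖v‖ * ‖A z‖) := by gcongr
        _ = 2 * ‖v‖ * (r * ‖A z‖) := by ring
        _ ≤ _ := by have := hrA z hz; gcongr
    have h3 := abs_add_le (2 * r * ⟪v, A z⟫_ℝ) (r ^ 2 * ‖A z‖ ^ 2)
    rw [abs_of_nonneg (by positivity : 0 ≤ r ^ 2 * ‖A z‖ ^ 2)] at h3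
    have h4 := hrA2 z hz
    have h5 : y ^ 2 ≤ y := by nlinarith
    have h6 : 2 * ‖v‖ * y ≤ w * y := by
      have : 2 * ‖v‖ ≤ w := by nlinarith [sq_nonneg (‖v‖ - 1)]
      gcongr
    have h7 : y ≤ w * y := le_mul_of_one_le_left hy0 hw1
    linarith
  have hterm : ∀ z ∈ s, p z * (1 + ‖v + r • A z‖ ^ 2) ^ α
      ≤ w ^ α * (p z * (1 + (α + 4 * α ^ 2) * y ^ 2) + 2 * α * r / w * (p z * ⟪v, A z⟫_ℝ)) := by
    intro z hz
    have h1 : 1 + ‖v + r • A z‖ ^ 2 = w * (1 + τ z) := by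
      rw [norm_add_smul_sq]
      simp only [τ]
      field_simp
      rw [hw]; ring
    have hτz := hτ z hz
    have h2 : α * |τ z| ≤ 1 := by nlinarith
    have h3 := one_add_rpow_le hα h2
    have h4 : 0 ≤ 1 + τ z := by
      have : |τ z| ≤ 1 := (le_mul_of_one_le_left (abs_nonneg _) hα).trans h2
      linarith [neg_abs_le (τ z)]
    have h5 : τ z ^ 2 ≤ 4 * y ^ 2 := by
      have := pow_le_pow_left₀ (abs_nonneg _) hτz 2
      rw [sq_abs] at this; linarith
    have h6 : τ z ≤ 2 * r / w * ⟪v, A z⟫_ℝ + y ^ 2 := by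
      have : r ^ 2 * ‖A z‖ ^ 2 / w ≤ y ^ 2 :=
        (div_le_self (by positivity) hw1).trans (hrA2 z hz)
      calc τ z = 2 * r / w * ⟪v, A z⟫_ℝ + r ^ 2 * ‖A z‖ ^ 2 / w := by simp only [τ]; ring
        _ ≤ _ := by linarith
    have h7 : (1 + τ z) ^ α ≤ 1 + (α + 4 * α ^ 2) * y ^ 2 + 2 * α * r / w * ⟪v, A z⟫_ℝ := by
      have i1 := mul_le_mul_of_nonneg_left h6 hαp.le
      have i2 := mul_le_mul_of_nonneg_left h5 (sq_nonneg α)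
      calc (1 + τ z) ^ α ≤ 1 + α * (2 * r / w * ⟪v, A z⟫_ℝ + y ^ 2) + α ^ 2 * (4 * y ^ 2) := by
            linarith
        _ = _ := by ring
    rw [h1, Real.mul_rpow hw0.le h4]
    have h8 := mul_le_mul_of_nonneg_left h7
      (mul_nonneg (D.nonneg z hz) (Real.rpow_nonneg hw0.le α))
    calc _ = p z * w ^ α * (1 + τ z) ^ α := by ring
      _ ≤ _ := h8
      _ = _ := by ring
  refine (Finset.sum_le_sum hterm).trans (le_of_eq ?_)
  rw [← Finset.mul_sum, Finset.sum_add_distrib, ← Finset.sum_mul, ← Finset.mul_sum, D.sum_one,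
    D.sum_inner_image]
  ring

end DesignMoments

/-- The constant of the drift estimate. -/
noncomputable def driftConst (Λ : ℝ) : ℝ := 1 + 96 * Λ ^ 4

/-- The constant of the forward moment estimate. -/
noncomputable def momentConst (Λ α : ℝ) : ℝ := (α + 4 * α ^ 2) * Λ ^ 4

namespace IsStep

variable {d : ℕ} {Ω₀ : Type*} {m₀ : MeasurableSpace Ω₀} {P₀ : Measure Ω₀} {T Λ α K : ℝ}
  {c : Coeffs d} {u : MasterField d}
  {Ω : Type*} {G mΩ : MeasurableSpace Ω} {P : Measure Ω} [IsProbabilityMeasure P]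
  {s : Finset (St d)} {p : St d → ℝ} {t h : ℝ} {X : Ω → St d} {Y : Ω → ℝ} {ζ B Θ : Ω → St d}

lemma norm_drift_sq_le (D : IsStep G P Λ T c s p t h X Y ζ B Θ) (S : Setting P₀ T Λ α K c u)
    (ω : Ω) :
    ‖X ω + h • B ω‖ ^ 2 ≤ (1 + driftConst Λ * h) * ‖X ω‖ ^ 2
      + driftConst Λ * h * ((u.U t (X ω) (P.map X) - Y ω) ^ 2
        + (K + lpNorm X 2 P + lpNorm (fun ω => u.U t (X ω) (P.map X) - Y ω) 2 P) ^ 2) := by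
  have hh := D.h_pos
  have h1 := D.h_le_one
  have hB := D.norm_B_le S ω
  set κ := K + lpNorm X 2 P + lpNorm (fun ω => u.U t (X ω) (P.map X) - Y ω) 2 P with hκ
  have hκ0 : 0 ≤ κ := add_nonneg (add_nonneg S.K_pos.le lpNorm_nonneg) lpNorm_nonneg
  set e := u.U t (X ω) (P.map X) - Y ω with he
  rw [Real.norm_eq_abs e] at hB
  have hx := norm_nonneg (X ω)
  have hb := norm_nonneg (B ω)
  have he0 := abs_nonneg e
  have h2 : ‖X ω + h • B ω‖ ≤ ‖X ω‖ + h * ‖B ω‖ := by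
    refine (norm_add_le _ _).trans ?_
    rw [norm_smul, Real.norm_of_nonneg hh.le]
  have h3 : ‖B ω‖ ^ 2 ≤ 48 * Λ ^ 4 * (κ ^ 2 + ‖X ω‖ ^ 2 + e ^ 2) := by
    have i1 : ‖B ω‖ ^ 2 ≤ (4 * Λ ^ 2 * (κ + ‖X ω‖ + |e|)) ^ 2 :=
      pow_le_pow_left₀ hb (by linarith) 2
    have i2 : (κ + ‖X ω‖ + |e|) ^ 2 ≤ 3 * (κ ^ 2 + ‖X ω‖ ^ 2 + |e| ^ 2) := by
      nlinarith [sq_nonneg (κ - ‖X ω‖), sq_nonneg (κ - |e|), sq_nonneg (‖X ω‖ - |e|)]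
    rw [sq_abs] at i2
    calc ‖B ω‖ ^ 2 ≤ 16 * Λ ^ 4 * (κ + ‖X ω‖ + |e|) ^ 2 := by
          refine i1.trans (le_of_eq ?_); ring
      _ ≤ 16 * Λ ^ 4 * (3 * (κ ^ 2 + ‖X ω‖ ^ 2 + e ^ 2)) := by gcongr
      _ = _ := by ring
  have h4 : (‖X ω‖ + h * ‖B ω‖) ^ 2 ≤ (1 + h) * ‖X ω‖ ^ 2 + 2 * h * ‖B ω‖ ^ 2 := by
    have i1 := mul_nonneg hh.le (sq_nonneg (‖X ω‖ - ‖B ω‖))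
    have i2 : h ^ 2 * ‖B ω‖ ^ 2 ≤ h * ‖B ω‖ ^ 2 :=
      mul_le_mul_of_nonneg_right (by nlinarith) (sq_nonneg _)
    nlinarith
  have h5 := pow_le_pow_left₀ (norm_nonneg _) h2 2
  have h6 := mul_le_mul_of_nonneg_left h3 (by positivity : 0 ≤ 2 * h)
  have h7 : 0 ≤ h * (e ^ 2 + κ ^ 2) := by positivity
  unfold driftConst
  linarith

end IsStep

namespace IsBackwardStep

variable {d : ℕ} {Ω₀ : Type*} {m₀ : MeasurableSpace Ω₀} {P₀ : Measure Ω₀} {T Λ α K : ℝ}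
  {c : Coeffs d} {u : MasterField d}
  {Ω : Type*} {G mΩ : MeasurableSpace Ω} {P : Measure Ω} [IsProbabilityMeasure P]
  {s : Finset (St d)} {p : St d → ℝ} {t h : ℝ} {X : Ω → St d} {Y : Ω → ℝ} {ζ B Θ : Ω → St d}
  {X' Xin Z : Ω → St d} {Y' : Ω → ℝ}

lemma measurable_node (D : IsStep G P Λ T c s p t h X Y ζ B Θ) (S : Setting P₀ T Λ α K c u)
    (z : St d) : Measurable[G] fun ω => X ω + h • B ω + √h • c.σ (X ω) (P.map X) z := by
  have hσm : Measurable[G] fun ω => c.σ (X ω) (P.map X) :=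
    (S.continuous_σ D.isP2).measurable.comp D.meas_X
  have hz : Measurable[G] fun ω => c.σ (X ω) (P.map X) z :=
    (ContinuousLinearMap.apply ℝ (St d) z).continuous.measurable.comp hσm
  exact (D.meas_X.add ((D.meas_B S).const_smul h)).add (hz.const_smul (√h))

lemma condExp_norm_sq_next_le (E : IsBackwardStep G P c h X Y ζ B Θ X' Y' Xin Z)
    (D : IsStep G P Λ T c s p t h X Y ζ B Θ) (S : Setting P₀ T Λ α K c u) :
    ∀ᵐ ω ∂P, P[fun ω => ‖X' ω‖ ^ 2 | G] ω ≤ ‖X ω + h • B ω‖ ^ 2 + h * Λ ^ 4 := by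
  let ψ : St d → Ω → ℝ := fun z ω => ‖X ω + h • B ω + √h • c.σ (X ω) (P.map X) z‖ ^ 2
  have hψ : ∀ z ∈ s, StronglyMeasurable[G] (ψ z) := fun z _ =>
    ((by fun_prop : Measurable fun x : St d => ‖x‖ ^ 2).comp
      (measurable_node D S z)).stronglyMeasurable
  have e : (fun ω => ‖X' ω‖ ^ 2) =ᵐ[P] fun ω => ψ (ζ ω) ω := by
    filter_upwards [E.next_X] with ω h1
    rw [h1, D.Θ_eq]
  have hi : Integrable (fun ω => ‖X' ω‖ ^ 2) P :=
    (E.memLp_next D S D.memLp_X D.memLp_Y).integrable_norm_pow (by norm_num)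
  filter_upwards [(condExp_congr_ae e).trans (D.innov.condExp_comp hψ (hi.congr e))] with ω h1
  rw [h1]
  have h2 := D.design.sum_norm_sq_le (A := c.σ (X ω) (P.map X)) (ρ := Λ ^ 2)
    (fun z hz => D.design.norm_image_le S.Λ_pos.le (S.h0.bound_σ _ _ D.isP2) hz)
    (X ω + h • B ω) (√h)
  rw [Real.sq_sqrt D.h_pos.le, ← pow_mul] at h2
  exact h2

/-- Growth of the moments of order `2α` along one step. -/
lemma lpNorm_next_le (E : IsBackwardStep G P c h X Y ζ B Θ X' Y' Xin Z)
    (D : IsStep G P Λ T c s p t h X Y ζ B Θ) (S : Setting P₀ T Λ α K c u)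
    (hX : MemLp X (ENNReal.ofReal (2 * α)) P) (hY : MemLp Y (ENNReal.ofReal (2 * α)) P)
    (hs : 2 * α * (√h * Λ ^ 2) ≤ 1) :
    lpNorm (fun ω => 1 + ‖X' ω‖ ^ 2) (ENNReal.ofReal α) P
      ≤ (1 + momentConst Λ α * h) * ((1 + driftConst Λ * h) *
          lpNorm (fun ω => 1 + ‖X ω‖ ^ 2) (ENNReal.ofReal α) P
        + driftConst Λ * h * (lpNorm (fun ω => u.U t (X ω) (P.map X) - Y ω)
            (ENNReal.ofReal (2 * α)) P ^ 2
          + (K + lpNorm X 2 P + lpNorm (fun ω => u.U t (X ω) (P.map X) - Y ω) 2 P) ^ 2)) := by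
  have hα := S.one_le_α
  have hα0 : 0 < α := by linarith
  have hh := D.h_pos
  have hα1 : (1 : ℝ≥0∞) ≤ ENNReal.ofReal α := by simpa using hα
  have hme := D.memLp_err S hX hY
  set κ := K + lpNorm X 2 P + lpNorm (fun ω => u.U t (X ω) (P.map X) - Y ω) 2 P with hκ
  have hC : 0 ≤ driftConst Λ := by unfold driftConst; positivity
  have hC' : 0 ≤ momentConst Λ α := by unfold momentConst; positivity
  have sqm : ∀ {f : Ω → St d}, MemLp f (ENNReal.ofReal (2 * α)) P →
      MemLp (fun ω => 1 + ‖f ω‖ ^ 2) (ENNReal.ofReal α) P := fun hf =>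
    (memLp_const (1 : ℝ)).add ((memLp_norm_sq_iff hα0.le hf.1).2 hf)
  have hX' := E.memLp_next D S hX hY
  have hV : MemLp (fun ω => X ω + h • B ω) (ENNReal.ofReal (2 * α)) P := by
    have h1 : MemLp (fun ω => h • B ω) (ENNReal.ofReal (2 * α)) P :=
      (D.memLp_B S hX hY).const_smul h
    exact hX.add h1
  have hJX' := sqm hX'
  have hJV := sqm hV
  have hJX := sqm hX
  have hint : ∀ {f : Ω → St d}, MemLp (fun ω => 1 + ‖f ω‖ ^ 2) (ENNReal.ofReal α) P →
      Integrable (fun ω => (1 + ‖f ω‖ ^ 2) ^ α) P ∧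
      ∫ ω, (1 + ‖f ω‖ ^ 2) ^ α ∂P
        = lpNorm (fun ω => 1 + ‖f ω‖ ^ 2) (ENNReal.ofReal α) P ^ α := fun {f} hf => by
    have e : (fun ω => (1 + ‖f ω‖ ^ 2) ^ α) = fun ω => ‖1 + ‖f ω‖ ^ 2‖ ^ α := by
      ext ω; rw [Real.norm_of_nonneg (by positivity)]
    rw [e]
    refine ⟨?_, integral_rpow_eq_lpNorm_rpow hα0 hf.1⟩
    have := hf.integrable_norm_rpow (by simpa using hα0) ENNReal.ofReal_ne_top
    rwa [ENNReal.toReal_ofReal hα0.le] at this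
  set NX' := lpNorm (fun ω => 1 + ‖X' ω‖ ^ 2) (ENNReal.ofReal α) P
  set NV := lpNorm (fun ω => 1 + ‖X ω + h • B ω‖ ^ 2) (ENNReal.ofReal α) P with hNV
  have hN0 : 0 ≤ NX' := lpNorm_nonneg
  have hV0 : 0 ≤ NV := lpNorm_nonneg
  have step1 : NX' ≤ (1 + momentConst Λ α * h) * NV := by
    let ψ : St d → Ω → ℝ :=
      fun z ω => (1 + ‖X ω + h • B ω + √h • c.σ (X ω) (P.map X) z‖ ^ 2) ^ α
    have hψ : ∀ z ∈ s, StronglyMeasurable[G] (ψ z) := fun z _ =>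
      ((by fun_prop : Measurable fun x : St d => (1 + ‖x‖ ^ 2) ^ α).comp
        (measurable_node D S z)).stronglyMeasurable
    have e : (fun ω => (1 + ‖X' ω‖ ^ 2) ^ α) =ᵐ[P] fun ω => ψ (ζ ω) ω := by
      filter_upwards [E.next_X] with ω h1
      rw [h1, D.Θ_eq]
    have h1 := D.innov.integral_comp hψ ((hint hJX').1.congr e)
    have h2 : NX' ^ α ≤ (1 + momentConst Λ α * h) * NV ^ α := by
      rw [← (hint hJX').2, ← (hint hJV).2, integral_congr_ae e, h1.2, ← integral_const_mul]
      refine integral_mono h1.1 ((hint hJV).1.const_mul _) fun ω => ?_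
      have h3 := D.design.sum_one_add_norm_sq_rpow_le (A := c.σ (X ω) (P.map X)) (ρ := Λ ^ 2) hα
        (Real.sqrt_nonneg h) (by positivity)
        (fun z hz => D.design.norm_image_le S.Λ_pos.le (S.h0.bound_σ _ _ D.isP2) hz) hs
        (X ω + h • B ω)
      rw [mul_pow, Real.sq_sqrt hh.le] at h3
      refine h3.trans (le_of_eq ?_)
      unfold momentConst
      ring
    -- A factor that is at least 1 is bounded by its power `α`; this allows taking roots of order
    -- `α`.
    have h3 : (1 + momentConst Λ α * h) * NV ^ α ≤ ((1 + momentConst Λ α * h) * NV) ^ α := by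
      have i1 : 1 ≤ 1 + momentConst Λ α * h := by
        have : 0 ≤ momentConst Λ α * h := by positivity
        linarith
      rw [Real.mul_rpow (by linarith) hV0]
      exact mul_le_mul_of_nonneg_right (Real.self_le_rpow_of_one_le i1 hα)
        (Real.rpow_nonneg hV0 _)
    exact (Real.rpow_le_rpow_iff hN0 (by positivity) hα0).1 (h2.trans h3)
  refine step1.trans (mul_le_mul_of_nonneg_left ?_ (by positivity))
  have he2 := (memLp_norm_sq_iff hα0.le hme.1).2 hme
  have h4 := lpNorm_le_of_affine₂ (f := fun ω => 1 + ‖X ω + h • B ω‖ ^ 2) hα1 hJX he2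
    (a := driftConst Λ * h * κ ^ 2) (b := 1 + driftConst Λ * h) (b' := driftConst Λ * h)
    (by positivity) (by positivity) (by positivity) (ae_of_all _ fun ω => by
      have h5 := D.norm_drift_sq_le S ω
      rw [Real.norm_of_nonneg (by positivity), Real.norm_of_nonneg (by positivity),
        Real.norm_of_nonneg (by positivity), Real.norm_eq_abs, sq_abs]
      have : 0 ≤ driftConst Λ * h := by positivity
      linarith)
  rw [lpNorm_norm_sq hα0.le hme.1] at h4
  linarith

end IsBackwardStep
end MKV
namespace MKV

/-! ### Integrability and moments along a run of the scheme -/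

/-- The constant of the backward recursion along the scheme. -/
noncomputable def errConst (d : ℕ) (Λ α : ℝ) : ℝ :=
  backConst (Λ ^ 2) (4 * Λ * stepConst d Λ α)

/-- The rate of the quadratic Lyapunov function. -/
noncomputable def lyapunovConst (d : ℕ) (Λ α : ℝ) : ℝ := 5 * driftConst Λ + 7 * errConst d Λ α

lemma one_le_backConst {L C : ℝ} (hC : 0 ≤ C) : 1 ≤ backConst L C := by
  have : 0 ≤ 2 * L ^ 2 + 12 * C * (1 + L ^ 2) + 8 * C ^ 2 := by positivity
  unfold backConst; linarith

lemma one_le_errConst {d : ℕ} {Λ α : ℝ} (hΛ : 1 ≤ Λ) (hα : 1 ≤ α) : 1 ≤ errConst d Λ α := by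
  have := IsStep.one_le_stepConst (d := d) hΛ hα
  exact one_le_backConst (by positivity)

lemma driftConst_pos (Λ : ℝ) : 0 < driftConst Λ := by unfold driftConst; positivity

/-- `E` and `x` stand for the squared error and the squared state, `k` for the coefficient at the
next time, `y` and `w` for the drift and error rates times `h`. The state at the next time involves
`E` again, with coefficient at most `2 y`, which is absorbed on the left. In the conclusion `1 + k`
is multiplied by `exp a`, a form that iterates without loss. -/
lemma lyapunov_step {y w σ E x k κ A D a : ℝ} (hy : 0 ≤ y) (hw : 0 ≤ w) (hy1 : 4 * y ≤ 1)
    (hw1 : w ≤ 1) (hk : 0 ≤ k) (hk1 : k ≤ 1) (hE : 0 ≤ E) (hx : 0 ≤ x) (hκ : 0 ≤ κ)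
    (hσ : 0 ≤ σ) (hA : 0 ≤ A) (hD : 0 ≤ D) (ha : a = 5 * y + 7 * w)
    (H : E ≤ (1 + w) * (k * ((1 + y) * x + y * (E + κ) + σ) + A) + w * (3 * (x + D))) :
    E ≤ (Real.exp a * (1 + k) - 1) * x + (4 * (κ + σ + A) + 6 * D) := by
  have h1 : (1 + w) * k ≤ 2 := by nlinarith
  have h2 : (1 + w) * k * (y * E) ≤ 2 * (y * E) :=
    mul_le_mul_of_nonneg_right h1 (by positivity)
  have h3 : (1 + w) * k * (y * κ + σ) ≤ 2 * (κ + σ) := by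
    have : y * κ ≤ κ := mul_le_of_le_one_left hκ (by linarith)
    calc (1 + w) * k * (y * κ + σ) ≤ 2 * (y * κ + σ) :=
          mul_le_mul_of_nonneg_right h1 (by positivity)
      _ ≤ _ := by linarith
  have h4 : (1 + w) * A ≤ 2 * A := mul_le_mul_of_nonneg_right (by linarith) hA
  have h5 : w * (3 * D) ≤ 3 * D := mul_le_of_le_one_left (by positivity) hw1
  have h6 : (1 - 2 * y) * E ≤ ((1 + w) * (1 + y) * k + 3 * w) * x + (2 * (κ + σ + A) + 3 * D) := by
    linarith
  have h7 : 1 ≤ (1 + 4 * y) * (1 - 2 * y) := by nlinarith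
  have h8 : E ≤ (1 + 4 * y) * (((1 + w) * (1 + y) * k + 3 * w) * x
      + (2 * (κ + σ + A) + 3 * D)) := by
    calc E ≤ (1 + 4 * y) * (1 - 2 * y) * E := le_mul_of_one_le_left hE h7
      _ = (1 + 4 * y) * ((1 - 2 * y) * E) := by ring
      _ ≤ _ := mul_le_mul_of_nonneg_left h6 (by linarith)
  have h9 : (1 + 4 * y) * (2 * (κ + σ + A) + 3 * D) ≤ 4 * (κ + σ + A) + 6 * D := by
    have : 0 ≤ 2 * (κ + σ + A) + 3 * D := by positivity
    nlinarith
  have h10 : (1 + 4 * y) * ((1 + w) * (1 + y) * k + 3 * w) ≤ Real.exp a * (1 + k) - 1 := by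
    have i1 : (1 + 4 * y) * ((1 + w) * (1 + y)) ≤ Real.exp (5 * y + w) := by
      have j1 := Real.add_one_le_exp (4 * y)
      have j2 := Real.add_one_le_exp w
      have j3 := Real.add_one_le_exp y
      have : Real.exp (5 * y + w) = Real.exp (4 * y) * (Real.exp w * Real.exp y) := by
        rw [← Real.exp_add, ← Real.exp_add]; congr 1; ring
      rw [this]
      have e0 := (Real.exp_pos w).le
      have e1 := (Real.exp_pos (4 * y)).le
      refine mul_le_mul (by linarith) (mul_le_mul (by linarith) (by linarith) (by positivity) e0)
        (by positivity) e1
    have i2 : (1 + 4 * y) * (3 * w) ≤ Real.exp (6 * w) - 1 := by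
      have := Real.add_one_le_exp (6 * w)
      nlinarith
    have i3 : Real.exp a = Real.exp (5 * y + w) * Real.exp (6 * w) := by
      rw [ha, ← Real.exp_add]; congr 1; ring
    have i4 : 1 ≤ Real.exp (5 * y + w) := Real.one_le_exp (by positivity)
    have i5 : 1 ≤ Real.exp (6 * w) := Real.one_le_exp (by positivity)
    set p := Real.exp (5 * y + w)
    set q := Real.exp (6 * w)
    have i6 := mul_le_mul_of_nonneg_right i1 hk
    have i7 : 0 ≤ p * ((q - 1) * k) :=
      mul_nonneg (by linarith) (mul_nonneg (by linarith) hk)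
    have i8 : 0 ≤ q * (p - 1) := mul_nonneg (by linarith) (by linarith)
    rw [i3]
    linarith
  have h11 := mul_le_mul_of_nonneg_right h10 hx
  linarith

namespace IsBackwardStep

variable {d : ℕ} {Ω₀ : Type*} {m₀ : MeasurableSpace Ω₀} {P₀ : Measure Ω₀} {T Λ α K : ℝ}
  {c : Coeffs d} {u : MasterField d}
  {Ω : Type*} {G mΩ : MeasurableSpace Ω} {P : Measure Ω} [IsProbabilityMeasure P]
  {s : Finset (St d)} {p : St d → ℝ} {t h : ℝ} {X : Ω → St d} {Y : Ω → ℝ} {ζ B Θ : Ω → St d}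
  {X' Xin Z : Ω → St d} {Y' : Ω → ℝ}

/-- The crude recursion for the squared error. -/
lemma sq_err_le_crude [IsProbabilityMeasure P₀]
    (E : IsBackwardStep G P c h X Y ζ B Θ X' Y' Xin Z)
    (D : IsStep G P Λ T c s p t h X Y ζ B Θ) (S : Setting P₀ T Λ α K c u)
    (hC : h * (4 * Λ * stepConst d Λ α) ≤ 1 / 2) :
    ∀ᵐ ω ∂P, (u.U t (X ω) (P.map X) - Y ω) ^ 2
      ≤ (1 + errConst d Λ α * h)
          * P[(fun ω => u.U (t + h) (X' ω) (P.map X') - Y' ω) ^ 2 | G] ω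
        + errConst d Λ α * h
          * (lpNorm (fun ω => u.U t (X ω) (P.map X) - Y ω) 2 P + 1 * ‖X ω‖ + (lpNorm X 2 P + K)
            + ‖X ω - Xin ω‖ + lpNorm (fun ω => X ω - Xin ω) 2 P) ^ 2 := by
  have h1 : √h ≤ 1 := Real.sqrt_le_one.2 D.h_le_one
  refine E.sq_err_le D S h1 ?_ hC (D.abs_defect_le_crude S)
  have h2 : 0 ≤ lpNorm X 2 P + K := add_nonneg lpNorm_nonneg S.K_pos.le
  nlinarith

/-- A quadratic bound on the error is propagated backwards. -/
lemma exists_quadratic_bound [IsProbabilityMeasure P₀]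
    (E : IsBackwardStep G P c h X Y ζ B Θ X' Y' Xin Z)
    (D : IsStep G P Λ T c s p t h X Y ζ B Θ) (S : Setting P₀ T Λ α K c u)
    (hC : h * (4 * Λ * stepConst d Λ α) ≤ 1 / 2) (hP : 4 * (driftConst Λ * h) ≤ 1)
    (hE : errConst d Λ α * h ≤ 1)
    (hin : MemLp (fun ω => X ω - Xin ω) (ENNReal.ofReal (2 * α)) P) {k : ℝ} (hk : 0 ≤ k)
    (hk1 : k ≤ 1) {A' : Ω → ℝ} (hA' : MemLp A' (ENNReal.ofReal α) P) (hA0 : 0 ≤ᵐ[P] A')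
    (H : ∀ᵐ ω ∂P, (u.U (t + h) (X' ω) (P.map X') - Y' ω) ^ 2 ≤ k * ‖X' ω‖ ^ 2 + A' ω) :
    ∃ A : Ω → ℝ, MemLp A (ENNReal.ofReal α) P ∧ 0 ≤ᵐ[P] A ∧
      ∀ᵐ ω ∂P, (u.U t (X ω) (P.map X) - Y ω) ^ 2
        ≤ (Real.exp (lyapunovConst d Λ α * h) * (1 + k) - 1) * ‖X ω‖ ^ 2 + A ω := by
  have hα := S.one_le_α
  have hα0 : 0 < α := by linarith
  have hh := D.h_pos
  have hα1 : (1 : ℝ≥0∞) ≤ ENNReal.ofReal α := by simpa using hα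
  set e2 := lpNorm (fun ω => u.U t (X ω) (P.map X) - Y ω) 2 P with he2
  set d2 := lpNorm (fun ω => X ω - Xin ω) 2 P with hd2
  set N := lpNorm X 2 P with hN
  have he20 : 0 ≤ e2 := lpNorm_nonneg
  have hd20 : 0 ≤ d2 := lpNorm_nonneg
  have hN0 : 0 ≤ N := lpNorm_nonneg
  have hK := S.K_pos
  have hA'i : Integrable A' P := hA'.integrable hα1
  have hXi : Integrable (fun ω => ‖X' ω‖ ^ 2) P :=
    (E.memLp_next D S D.memLp_X D.memLp_Y).integrable_norm_pow (by norm_num)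
  have hei : Integrable ((fun ω => u.U (t + h) (X' ω) (P.map X') - Y' ω) ^ 2) P :=
    (E.memLp_next_err D S).integrable_sq
  have hin2 := (memLp_norm_sq_iff hα0.le hin.1).2 hin
  have hcond := hA'.condExp (m := G) hα1
  -- The remainder gathers constants built from finite second moments, the conditional expectation
  -- of the next remainder, which stays in `L^α` since `α ≥ 1`, and the displacement of the input.
  refine ⟨fun ω => 4 * ((K + N + e2) ^ 2 + Λ ^ 4 + P[A' | G] ω)
      + 6 * (‖X ω - Xin ω‖ ^ 2 + (e2 + N + K + d2) ^ 2), ?_, ?_, ?_⟩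
  · exact (((memLp_const ((K + N + e2) ^ 2 + Λ ^ 4)).add hcond).const_mul 4).add
      ((hin2.add (memLp_const ((e2 + N + K + d2) ^ 2))).const_mul 6)
  · filter_upwards [condExp_nonneg (m := G) hA0] with ω h1
    simp only [Pi.zero_apply] at h1 ⊢
    positivity
  · have g1 : P[(fun ω => u.U (t + h) (X' ω) (P.map X') - Y' ω) ^ 2 | G]
        ≤ᵐ[P] P[fun ω => k * ‖X' ω‖ ^ 2 + A' ω | G] :=
      condExp_mono hei ((hXi.const_mul k).add hA'i) H
    have g2 := condExp_add (hXi.const_mul k) hA'i G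
    have g3 := condExp_smul k (fun ω => ‖X' ω‖ ^ 2) G (μ := P)
    filter_upwards [g1, g2, g3, E.condExp_norm_sq_next_le D S, E.sq_err_le_crude D S hC,
      condExp_nonneg (m := G) hA0] with ω f1 f2 f3 f4 f5 f6
    have f2' : P[fun ω => k * ‖X' ω‖ ^ 2 + A' ω | G] ω
        = P[fun ω => k * ‖X' ω‖ ^ 2 | G] ω + P[A' | G] ω := f2
    have f3' : P[fun ω => k * ‖X' ω‖ ^ 2 | G] ω = k * P[fun ω => ‖X' ω‖ ^ 2 | G] ω := f3
    rw [f2', f3'] at f1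
    have f7 := D.norm_drift_sq_le S ω
    have hy0 : 0 ≤ driftConst Λ * h := mul_nonneg (driftConst_pos Λ).le hh.le
    have hw0 : 0 ≤ errConst d Λ α * h :=
      mul_nonneg (by linarith [one_le_errConst (d := d) S.one_le_Λ hα]) hh.le
    have hΛ4 : h * Λ ^ 4 ≤ Λ ^ 4 := mul_le_of_le_one_left (by positivity) D.h_le_one
    refine lyapunov_step hy0 hw0 hP hE hk hk1 (sq_nonneg _) (sq_nonneg _) (sq_nonneg _)
      (by positivity) f6 (by positivity) (by unfold lyapunovConst; ring) ?_
    refine f5.trans (add_le_add (mul_le_mul_of_nonneg_left ?_ (by linarith))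
      (mul_le_mul_of_nonneg_left ?_ hw0))
    · refine f1.trans ?_
      have := mul_le_mul_of_nonneg_left (f4.trans (add_le_add f7 hΛ4)) hk
      linarith
    · set x := ‖X ω‖
      set y := ‖X ω - Xin ω‖
      set r := e2 + N + K + d2
      calc (e2 + 1 * x + (N + K) + y + d2) ^ 2 = (x + y + r) ^ 2 := by ring
        _ ≤ 3 * (x ^ 2 + (y ^ 2 + r ^ 2)) := by
          nlinarith [sq_nonneg (x - y), sq_nonneg (x - r), sq_nonneg (y - r)]

/-- The recursion for the `L^{2α}` norm of the error. -/
lemma lpNorm_err_sq_le [IsProbabilityMeasure P₀]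
    (E : IsBackwardStep G P c h X Y ζ B Θ X' Y' Xin Z)
    (D : IsStep G P Λ T c s p t h X Y ζ B Θ) (S : Setting P₀ T Λ α K c u) {a₁ a₀ Q : ℝ}
    (ha₁ : √h ≤ a₁) (ha₀ : √h * (lpNorm X 2 P + K) ≤ 2 * a₀)
    (hC : h * (4 * Λ * stepConst d Λ α) ≤ 1 / 2) (hE : 5 * (errConst d Λ α * h) ≤ 1)
    (hdef : ∀ ω, |IsStep.defect P c u s p t h X B Θ ω| ≤ stepConst d Λ α * (h *
      (|u.U t (X ω) (P.map X) - Y ω| + lpNorm (fun ω => u.U t (X ω) (P.map X) - Y ω) 2 P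
        + a₁ * ‖X ω‖ + a₀)))
    (hX : MemLp X (ENNReal.ofReal (2 * α)) P) (hY : MemLp Y (ENNReal.ofReal (2 * α)) P)
    (he' : MemLp (fun ω => u.U (t + h) (X' ω) (P.map X') - Y' ω) (ENNReal.ofReal (2 * α)) P)
    (hin : MemLp (fun ω => X ω - Xin ω) (ENNReal.ofReal (2 * α)) P)
    (hQ : a₁ * lpNorm X (ENNReal.ofReal (2 * α)) P + a₀
      + 2 * lpNorm (fun ω => X ω - Xin ω) (ENNReal.ofReal (2 * α)) P ≤ Q) :
    lpNorm (fun ω => u.U t (X ω) (P.map X) - Y ω) (ENNReal.ofReal (2 * α)) P ^ 2 + Q ^ 2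
      ≤ Real.exp (5 * errConst d Λ α * h)
        * (lpNorm (fun ω => u.U (t + h) (X' ω) (P.map X') - Y' ω) (ENNReal.ofReal (2 * α)) P ^ 2
          + Q ^ 2) := by
  have hα := S.one_le_α
  have hα0 : 0 < α := by linarith
  have hh := D.h_pos
  have hα1 : (1 : ℝ≥0∞) ≤ ENNReal.ofReal α := by simpa using hα
  have hq1 : (1 : ℝ≥0∞) ≤ ENNReal.ofReal (2 * α) := by
    rw [ENNReal.one_le_ofReal]; linarith
  have hq2 : (2 : ℝ≥0∞) ≤ ENNReal.ofReal (2 * α) := by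
    rw [show (2 : ℝ≥0∞) = ENNReal.ofReal 2 by simp]
    exact ENNReal.ofReal_le_ofReal (by linarith)
  have hme := D.memLp_err S hX hY
  have hK := S.K_pos
  have hsq0 := Real.sqrt_nonneg h
  have ha₁0 : 0 ≤ a₁ := hsq0.trans ha₁
  have ha₀0 : 0 ≤ a₀ := by
    have : 0 ≤ √h * (lpNorm X 2 P + K) := mul_nonneg hsq0 (add_nonneg lpNorm_nonneg hK.le)
    linarith
  have main := E.sq_err_le D S ha₁ ha₀ hC hdef
  set w := errConst d Λ α * h with hw
  have hw0 : 0 ≤ w := mul_nonneg (by linarith [one_le_errConst (d := d) S.one_le_Λ hα]) hh.le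
  set ε2 := lpNorm (fun ω => u.U t (X ω) (P.map X) - Y ω) 2 P with hε2
  set ε := lpNorm (fun ω => u.U t (X ω) (P.map X) - Y ω) (ENNReal.ofReal (2 * α)) P with hε
  set ε' := lpNorm (fun ω => u.U (t + h) (X' ω) (P.map X') - Y' ω) (ENNReal.ofReal (2 * α)) P
    with hε'
  set δ2 := lpNorm (fun ω => X ω - Xin ω) 2 P with hδ2
  set δ := lpNorm (fun ω => X ω - Xin ω) (ENNReal.ofReal (2 * α)) P with hδ
  have hεε : ε2 ≤ ε := lpNorm_mono_exponent hq2 hme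
  have hδδ : δ2 ≤ δ := lpNorm_mono_exponent hq2 hin
  have hε20 : 0 ≤ ε2 := lpNorm_nonneg
  have hε0 : 0 ≤ ε := lpNorm_nonneg
  have hδ0 : 0 ≤ δ := lpNorm_nonneg
  have hδ20 : 0 ≤ δ2 := lpNorm_nonneg
  let R : Ω → ℝ := fun ω => ε2 + a₁ * ‖X ω‖ + a₀ + ‖X ω - Xin ω‖ + δ2
  have hRm : MemLp R (ENNReal.ofReal (2 * α)) P :=
    ((((memLp_const ε2).add (hX.norm.const_mul a₁)).add (memLp_const a₀)).add hin.norm).add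
      (memLp_const δ2)
  have hR : lpNorm R (ENNReal.ofReal (2 * α)) P ≤ ε + Q := by
    have h1 := lpNorm_le_of_affine₂ (f := R) hq1 hX hin (a := ε2 + a₀ + δ2) (b := a₁) (b' := 1)
      (by positivity) ha₁0 zero_le_one (ae_of_all _ fun ω => by
        rw [Real.norm_of_nonneg (by positivity)]
        simp only [R]; linarith)
    linarith
  have hQ0 : 0 ≤ Q := by
    have : 0 ≤ a₁ * lpNorm X (ENNReal.ofReal (2 * α)) P := mul_nonneg ha₁0 lpNorm_nonneg
    linarith
  have hR2 : lpNorm R (ENNReal.ofReal (2 * α)) P ^ 2 ≤ 2 * ε ^ 2 + 2 * Q ^ 2 := by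
    have := pow_le_pow_left₀ lpNorm_nonneg hR 2
    nlinarith [sq_nonneg (ε - Q)]
  have hRsq := (memLp_norm_sq_iff hα0.le hRm.1).2 hRm
  have he'sq := (memLp_norm_sq_iff hα0.le he'.1).2 he'
  have hesq : lpNorm ((fun ω => u.U (t + h) (X' ω) (P.map X') - Y' ω) ^ 2) (ENNReal.ofReal α) P
      = ε' ^ 2 ∧ MemLp ((fun ω => u.U (t + h) (X' ω) (P.map X') - Y' ω) ^ 2)
        (ENNReal.ofReal α) P := by
    have : (fun ω => u.U (t + h) (X' ω) (P.map X') - Y' ω) ^ 2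
        = fun ω => ‖u.U (t + h) (X' ω) (P.map X') - Y' ω‖ ^ 2 := by
      ext ω; simp
    rw [this]
    exact ⟨lpNorm_norm_sq hα0.le he'.1, he'sq⟩
  have hcond := hesq.2.condExp (m := G) hα1
  have hcondle := hesq.2.lpNorm_condExp_le_lpNorm (m := G) hα1
  rw [hesq.1] at hcondle
  -- The `L^α` norm of a square is the square of the `L^{2α}` norm, and conditional expectation is a
  -- contraction of `L^α`.
  have key : ε ^ 2 ≤ (1 + w) * ε' ^ 2 + w * (2 * ε ^ 2 + 2 * Q ^ 2) := by
    have h1 := lpNorm_le_of_affine₂ (f := fun ω => ‖u.U t (X ω) (P.map X) - Y ω‖ ^ 2) hα1 hcond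
      hRsq (a := 0) (b := 1 + w) (b' := w) le_rfl (by linarith) hw0 (by
        filter_upwards [main] with ω f1
        rw [Real.norm_of_nonneg (sq_nonneg _), Real.norm_eq_abs (_ - _), sq_abs,
          Real.norm_of_nonneg (sq_nonneg ‖R ω‖), Real.norm_eq_abs (R ω), sq_abs, zero_add]
        refine f1.trans ?_
        have := mul_le_mul_of_nonneg_left (Real.le_norm_self
          (P[(fun ω => u.U (t + h) (X' ω) (P.map X') - Y' ω) ^ 2 | G] ω)) (by linarith : 0 ≤ 1 + w)
        exact add_le_add this le_rfl)
    rw [lpNorm_norm_sq hα0.le hme.1, lpNorm_norm_sq hα0.le hRm.1, zero_add] at h1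
    refine h1.trans (add_le_add (mul_le_mul_of_nonneg_left hcondle (by linarith))
      (mul_le_mul_of_nonneg_left hR2 hw0))
  have h1 : (1 - 2 * w) * ε ^ 2 ≤ (1 + w) * ε' ^ 2 + 2 * w * Q ^ 2 := by linarith
  have h2 : 1 ≤ (1 + 4 * w) * (1 - 2 * w) := by nlinarith
  have h3 : ε ^ 2 ≤ (1 + 4 * w) * ((1 + w) * ε' ^ 2 + 2 * w * Q ^ 2) := by
    calc ε ^ 2 ≤ (1 + 4 * w) * (1 - 2 * w) * ε ^ 2 := le_mul_of_one_le_left (sq_nonneg _) h2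
      _ = (1 + 4 * w) * ((1 - 2 * w) * ε ^ 2) := by ring
      _ ≤ _ := mul_le_mul_of_nonneg_left h1 (by linarith)
  -- The factor `1 + 4 w` comes from absorbing `2 w ε²` on the left. Adding `Q²` to both sides makes
  -- the recursion purely multiplicative, because `exp (5 w)` also dominates `1 + 2 w (1 + 4 w)`.
  have h4 : (1 + 4 * w) * (1 + w) ≤ Real.exp (5 * errConst d Λ α * h) := by
    have e : Real.exp (5 * errConst d Λ α * h) = Real.exp (4 * w) * Real.exp w := by
      rw [← Real.exp_add]; congr 1; rw [hw]; ring
    rw [e]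
    exact mul_le_mul (by linarith [Real.add_one_le_exp (4 * w)])
      (by linarith [Real.add_one_le_exp w]) (by linarith) (Real.exp_pos _).le
  have h5 : (1 + 4 * w) * (2 * w) + 1 ≤ Real.exp (5 * errConst d Λ α * h) := by
    refine le_trans ?_ h4; nlinarith
  have h6 := mul_le_mul_of_nonneg_right h4 (sq_nonneg ε')
  have h7 := mul_le_mul_of_nonneg_right h5 (sq_nonneg Q)
  linarith

end IsBackwardStep
end MKV
namespace MKV

/-! ### Runs of the scheme -/

/-- The error `U(t_i, X_i, [X_i]) - Y_i` along the scheme. -/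
noncomputable def runErr {d : ℕ} {Ω : Type*} {mΩ : MeasurableSpace Ω} (P : Measure Ω)
    (u : MasterField d) (t : ℕ → ℝ) (X : ℕ → Ω → St d) (Y : ℕ → Ω → ℝ) (i : ℕ) : Ω → ℝ :=
  fun ω => u.U (t i) (X i ω) (P.map (X i)) - Y i ω

/-- The steps with index in `[a, b)` form a run of the scheme. -/
structure IsRun {d : ℕ} {Ω : Type*} (F : ℕ → MeasurableSpace Ω) {mΩ : MeasurableSpace Ω}
    (P : Measure Ω) (Λ T : ℝ) (c : Coeffs d) (s : Finset (St d)) (p : St d → ℝ) (t h : ℕ → ℝ)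
    (X : ℕ → Ω → St d) (Y : ℕ → Ω → ℝ) (ζ B Θ Xin Z : ℕ → Ω → St d) (a b : ℕ) : Prop where
  step : ∀ i ∈ Ico a b, IsStep (F i) P Λ T c s p (t i) (h i) (X i) (Y i) (ζ i) (B i) (Θ i)
  back : ∀ i ∈ Ico a b, IsBackwardStep (F i) P c (h i) (X i) (Y i) (ζ i) (B i) (Θ i)
    (X (i + 1)) (Y (i + 1)) (Xin i) (Z i)
  t_succ : ∀ i ∈ Ico a b, t (i + 1) = t i + h i

/-- The rate of growth of the forward moments. -/
noncomputable def growthConst (Λ α : ℝ) : ℝ := momentConst Λ α + 4 * driftConst Λ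

/-- The constant in the bound for the forward moments. -/
noncomputable def forwardConst (Λ α : ℝ) : ℝ := 2 * Real.exp (growthConst Λ α)

/-- The rate at which a large error is absorbed. -/
noncomputable def absorbConst (d : ℕ) (Λ α : ℝ) : ℝ :=
  500 * errConst d Λ α * forwardConst Λ α ^ 2

/-- The inverse of the largest admissible length of a level. -/
noncomputable def levelConst (d : ℕ) (Λ α : ℝ) : ℝ :=
  1 + 4 * driftConst Λ + 5 * errConst d Λ α + 8 * Λ * stepConst d Λ α
    + 2 * lyapunovConst d Λ α + (2 * α * Λ ^ 2) ^ 2 + 2 * absorbConst d Λ α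

section Constants

variable {d : ℕ} {Λ α : ℝ}

lemma lyapunovConst_pos (hΛ : 1 ≤ Λ) (hα : 1 ≤ α) : 0 < lyapunovConst d Λ α := by
  have := one_le_errConst (d := d) hΛ hα
  have := driftConst_pos Λ
  unfold lyapunovConst; linarith

lemma growthConst_nonneg (hα : 1 ≤ α) : 0 ≤ growthConst Λ α := by
  have := driftConst_pos Λ
  have : 0 ≤ α := by linarith
  unfold growthConst momentConst; positivity

lemma two_le_forwardConst (hα : 1 ≤ α) : 2 ≤ forwardConst Λ α := by
  have := Real.one_le_exp (growthConst_nonneg (Λ := Λ) hα)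
  unfold forwardConst; linarith

lemma absorbConst_nonneg (hΛ : 1 ≤ Λ) (hα : 1 ≤ α) : 0 ≤ absorbConst d Λ α := by
  have := one_le_errConst (d := d) hΛ hα
  unfold absorbConst; positivity

lemma one_le_levelConst (hΛ : 1 ≤ Λ) (hα : 1 ≤ α) : 1 ≤ levelConst d Λ α := by
  have h1 := one_le_errConst (d := d) hΛ hα
  have h2 := driftConst_pos Λ
  have h3 := lyapunovConst_pos (d := d) hΛ hα
  have h4 := absorbConst_nonneg (d := d) hΛ hα
  have h5 := IsStep.one_le_stepConst (d := d) hΛ hα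
  have h6 : 0 ≤ 8 * Λ * stepConst d Λ α := by positivity
  unfold levelConst; nlinarith [sq_nonneg (2 * α * Λ ^ 2)]

/-- The smallness conditions on the length of a level. -/
lemma small_of_levelConst (hΛ : 1 ≤ Λ) (hα : 1 ≤ α) {h : ℝ} (hh : 0 ≤ h)
    (H : h * levelConst d Λ α ≤ 1) :
    h ≤ 1 ∧ 4 * (driftConst Λ * h) ≤ 1 ∧ 5 * (errConst d Λ α * h) ≤ 1 ∧
      h * (4 * Λ * stepConst d Λ α) ≤ 1 / 2 ∧ lyapunovConst d Λ α * h ≤ 1 / 2 ∧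
      2 * α * (√h * Λ ^ 2) ≤ 1 ∧ absorbConst d Λ α * h ≤ 1 / 2 := by
  have h1 : 0 ≤ h * errConst d Λ α :=
    mul_nonneg hh (by linarith [one_le_errConst (d := d) hΛ hα])
  have h2 : 0 ≤ h * driftConst Λ := mul_nonneg hh (driftConst_pos Λ).le
  have h3 : 0 ≤ h * lyapunovConst d Λ α := mul_nonneg hh (lyapunovConst_pos (d := d) hΛ hα).le
  have h4 : 0 ≤ h * absorbConst d Λ α := mul_nonneg hh (absorbConst_nonneg (d := d) hΛ hα)
  have h5 := IsStep.one_le_stepConst (d := d) hΛ hα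
  have h6 : 0 ≤ h * (Λ * stepConst d Λ α) := by positivity
  have h7 : 0 ≤ h * (2 * α * Λ ^ 2) ^ 2 := by positivity
  unfold levelConst at H
  refine ⟨by linarith, by linarith, by linarith, by linarith, by linarith, ?_, by linarith⟩
  have h8 : (√h * (2 * α * Λ ^ 2)) ^ 2 ≤ 1 := by
    rw [mul_pow, Real.sq_sqrt hh]; linarith
  have := (sq_le_one_iff_abs_le_one _).1 h8
  calc 2 * α * (√h * Λ ^ 2) = √h * (2 * α * Λ ^ 2) := by ring
    _ ≤ 1 := (le_abs_self _).trans this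

end Constants

namespace IsRun

variable {d : ℕ} {Ω₀ : Type*} {m₀ : MeasurableSpace Ω₀} {P₀ : Measure Ω₀} [IsProbabilityMeasure P₀]
  {T Λ α K : ℝ} {c : Coeffs d} {u : MasterField d}
  {Ω : Type*} {F : ℕ → MeasurableSpace Ω} {mΩ : MeasurableSpace Ω} {P : Measure Ω}
  [IsProbabilityMeasure P]
  {s : Finset (St d)} {p : St d → ℝ} {t h : ℕ → ℝ} {X : ℕ → Ω → St d} {Y : ℕ → Ω → ℝ}
  {ζ B Θ Xin Z : ℕ → Ω → St d} {a b : ℕ}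

lemma runErr_succ (R : IsRun F P Λ T c s p t h X Y ζ B Θ Xin Z a b) {i : ℕ} (hi : i ∈ Ico a b) :
    runErr P u t X Y (i + 1)
      = fun ω => u.U (t i + h i) (X (i + 1) ω) (P.map (X (i + 1))) - Y (i + 1) ω := by
  ext ω; simp only [runErr, R.t_succ i hi]

lemma t_mono (R : IsRun F P Λ T c s p t h X Y ζ B Θ Xin Z a b) {i j : ℕ} (hai : a ≤ i)
    (hij : i ≤ j) (hjb : j ≤ b) : t i ≤ t j := by
  induction j, hij using Nat.le_induction with
  | base => exact le_rfl
  | succ j hij ih =>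
    have hj : j ∈ Ico a b := ⟨hai.trans hij, hjb⟩
    rw [R.t_succ j hj]
    linarith [ih (by omega), (R.step j hj).h_pos]

lemma h_le (R : IsRun F P Λ T c s p t h X Y ζ B Θ Xin Z a b) {i : ℕ} (hi : i ∈ Ico a b) :
    h i ≤ t b - t a := by
  have h1 := R.t_mono le_rfl hi.1 hi.2.le
  have h2 := R.t_mono (hi.1.trans (Nat.le_succ i)) (Nat.succ_le_of_lt hi.2) le_rfl
  have h3 := R.t_succ i hi
  rw [Nat.succ_eq_add_one] at h2
  linarith

lemma small (R : IsRun F P Λ T c s p t h X Y ζ B Θ Xin Z a b) (S : Setting P₀ T Λ α K c u)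
    (hδ : (t b - t a) * levelConst d Λ α ≤ 1) {i : ℕ} (hi : i ∈ Ico a b) :
    h i * levelConst d Λ α ≤ 1 :=
  (mul_le_mul_of_nonneg_right (R.h_le hi)
    (by linarith [one_le_levelConst (d := d) S.one_le_Λ S.one_le_α])).trans hδ

/-- The squared error is bounded by a small multiple of the squared state, up to a remainder with
a finite moment of order `α`. -/
lemma exists_quadratic_bound (R : IsRun F P Λ T c s p t h X Y ζ B Θ Xin Z a b)
    (S : Setting P₀ T Λ α K c u) (hδ : (t b - t a) * levelConst d Λ α ≤ 1)
    (hb : MemLp (runErr P u t X Y b) (ENNReal.ofReal (2 * α)) P)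
    (hin : ∀ i ∈ Ico a b, MemLp (fun ω => X i ω - Xin i ω) (ENNReal.ofReal (2 * α)) P)
    {i : ℕ} (hai : a ≤ i) (hib : i ≤ b) :
    ∃ A : Ω → ℝ, MemLp A (ENNReal.ofReal α) P ∧ 0 ≤ᵐ[P] A ∧
      ∀ᵐ ω ∂P, runErr P u t X Y i ω ^ 2
        ≤ (Real.exp (lyapunovConst d Λ α * (t b - t i)) - 1) * ‖X i ω‖ ^ 2 + A ω := by
  have hα0 : 0 ≤ α := by linarith [S.one_le_α]
  have hL := lyapunovConst_pos (d := d) S.one_le_Λ S.one_le_α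
  induction hib using Nat.decreasingInduction with
  | self =>
    -- At the final time the coefficient `exp 0 - 1` vanishes, and the remainder is the squared
    -- terminal error.
    refine ⟨fun ω => ‖runErr P u t X Y b ω‖ ^ 2, (memLp_norm_sq_iff hα0 hb.1).2 hb,
      ae_of_all _ fun ω => sq_nonneg _, ae_of_all _ fun ω => ?_⟩
    simp
  | of_succ i hib ih =>
    have hi : i ∈ Ico a b := ⟨hai, hib⟩
    obtain ⟨A', hA', hA0, H⟩ := ih (by omega)
    have D := R.step i hi
    obtain ⟨-, s2, s3, s4, -⟩ :=
      small_of_levelConst S.one_le_Λ S.one_le_α D.h_pos.le (R.small S hδ hi)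
    have hta := R.t_mono le_rfl (hai.trans (Nat.le_succ i)) hib
    have htb := R.t_mono (hai.trans (Nat.le_succ i)) hib le_rfl
    rw [Nat.succ_eq_add_one] at hta htb
    obtain ⟨-, -, -, -, s5, -⟩ := small_of_levelConst S.one_le_Λ S.one_le_α
      (by linarith : 0 ≤ t b - t a) hδ
    set k := Real.exp (lyapunovConst d Λ α * (t b - t (i + 1))) - 1 with hk
    have hk0 : 0 ≤ k := by
      have := Real.one_le_exp (mul_nonneg hL.le (by linarith : 0 ≤ t b - t (i + 1)))
      linarith
    -- The length of the level keeps the exponent below `1 / 2`, and `exp (1 / 2) ≤ 2`; the bound `k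
    -- ≤ 1` is what allows absorbing `E` in `lyapunov_step`.
    have hk1 : k ≤ 1 := by
      have h1 : lyapunovConst d Λ α * (t b - t (i + 1)) ≤ 1 / 2 :=
        (mul_le_mul_of_nonneg_left (by linarith) hL.le).trans s5
      have h2 := Real.exp_le_exp.2 h1
      have h3 : Real.exp (1 / 2 : ℝ) ≤ 2 := by
        have h4 : Real.exp (1 / 2 : ℝ) ^ 2 = Real.exp 1 := by
          rw [← Real.exp_nat_mul]; norm_num
        have h5 := Real.exp_one_lt_d9
        nlinarith [Real.exp_pos (1 / 2 : ℝ)]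
      linarith
    rw [R.runErr_succ hi] at H
    obtain ⟨A, hA, hA0, HA⟩ := (R.back i hi).exists_quadratic_bound D S s4 s2 (by linarith)
      (hin i hi) hk0 hk1 hA' hA0 H
    refine ⟨A, hA, hA0, HA.mono fun ω hω => ?_⟩
    have e : Real.exp (lyapunovConst d Λ α * h i) * (1 + k)
        = Real.exp (lyapunovConst d Λ α * (t b - t i)) := by
      rw [hk, add_sub_cancel, ← Real.exp_add, R.t_succ i hi]
      congr 1; ring
    rwa [e] at hω

/-- Second moments belong to the data of each step. No step starts at `b`, so the last index is
reached as the end of the preceding one. -/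
lemma memLp_two (R : IsRun F P Λ T c s p t h X Y ζ B Θ Xin Z a b) (S : Setting P₀ T Λ α K c u)
    (hab : a < b) {i : ℕ} (hai : a ≤ i) (hib : i ≤ b) :
    MemLp (X i) 2 P ∧ MemLp (runErr P u t X Y i) 2 P := by
  rcases hib.lt_or_eq with hib | rfl
  · have D := R.step i ⟨hai, hib⟩
    exact ⟨D.memLp_X, D.memLp_err S D.memLp_X D.memLp_Y⟩
  · obtain ⟨j, rfl⟩ : ∃ j, i = j + 1 := ⟨i - 1, by omega⟩
    have hj : j ∈ Ico a (j + 1) := ⟨by omega, by omega⟩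
    have D := R.step j hj
    refine ⟨(R.back j hj).memLp_next D S D.memLp_X D.memLp_Y, ?_⟩
    rw [R.runErr_succ hj]
    exact (R.back j hj).memLp_next_err D S

/-- The moments of order `2α` are finite along a run. -/
lemma memLp (R : IsRun F P Λ T c s p t h X Y ζ B Θ Xin Z a b) (S : Setting P₀ T Λ α K c u)
    (hab : a < b) (hδ : (t b - t a) * levelConst d Λ α ≤ 1)
    (hb : MemLp (runErr P u t X Y b) (ENNReal.ofReal (2 * α)) P)
    (hin : ∀ i ∈ Ico a b, MemLp (fun ω => X i ω - Xin i ω) (ENNReal.ofReal (2 * α)) P)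
    (hξ : MemLp (X a) (ENNReal.ofReal (2 * α)) P) {i : ℕ} (hai : a ≤ i) (hib : i ≤ b) :
    MemLp (X i) (ENNReal.ofReal (2 * α)) P ∧
      MemLp (runErr P u t X Y i) (ENNReal.ofReal (2 * α)) P := by
  have hα0 : 0 ≤ α := by linarith [S.one_le_α]
  -- Moments of the state at `j + 1` require those of `Y` at `j`, which depends on the future. The
  -- quadratic bound breaks this circle: the error at `j` has a moment of order `2α` as soon as the
  -- state at `j` has one, and a forward induction follows.
  have herr : ∀ j, a ≤ j → j ≤ b → MemLp (X j) (ENNReal.ofReal (2 * α)) P →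
      MemLp (runErr P u t X Y j) (ENNReal.ofReal (2 * α)) P := by
    intro j haj hjb hX
    obtain ⟨A, hA, -, H⟩ := R.exists_quadratic_bound S hδ hb hin haj hjb
    have hm := (R.memLp_two S hab haj hjb).2.1
    refine (memLp_norm_sq_iff hα0 hm).1 ?_
    have h1 := ((memLp_norm_sq_iff hα0 hX.1).2 hX).const_mul
      (Real.exp (lyapunovConst d Λ α * (t b - t j)) - 1)
    refine (h1.add hA).mono' (hm.norm.pow 2) (H.mono fun ω hω => ?_)
    rw [Real.norm_of_nonneg (sq_nonneg _), Real.norm_eq_abs, sq_abs]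
    exact hω
  have hX : MemLp (X i) (ENNReal.ofReal (2 * α)) P := by
    induction i, hai using Nat.le_induction with
    | base => exact hξ
    | succ i hai ih =>
      have hi : i ∈ Ico a b := ⟨hai, hib⟩
      have D := R.step i hi
      have hXi := ih (by omega)
      have he := herr i hai (by omega) hXi
      have hY : MemLp (Y i) (ENNReal.ofReal (2 * α)) P := by
        have := (S.memLp_U D.t_mem D.isP2 hXi).sub he
        refine this.ae_eq (ae_of_all _ fun ω => ?_)
        simp [runErr]
      exact (R.back i hi).memLp_next D S hXi hY
  exact ⟨hX, herr i hai hib hX⟩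

lemma memLp_Y (R : IsRun F P Λ T c s p t h X Y ζ B Θ Xin Z a b) (S : Setting P₀ T Λ α K c u)
    {i : ℕ} (hi : i ∈ Ico a b) {q : ℝ≥0∞} (hX : MemLp (X i) q P)
    (he : MemLp (runErr P u t X Y i) q P) : MemLp (Y i) q P := by
  have D := R.step i hi
  refine ((S.memLp_U D.t_mem D.isP2 hX).sub he).ae_eq (ae_of_all _ fun ω => ?_)
  simp [runErr]

/-- Forward moments in terms of the initial moment and of the error. -/
lemma lpNorm_X_le (R : IsRun F P Λ T c s p t h X Y ζ B Θ Xin Z a b) (S : Setting P₀ T Λ α K c u)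
    (hδ : (t b - t a) * levelConst d Λ α ≤ 1)
    (hX : ∀ i, a ≤ i → i ≤ b → MemLp (X i) (ENNReal.ofReal (2 * α)) P)
    (he : ∀ i, a ≤ i → i ≤ b → MemLp (runErr P u t X Y i) (ENNReal.ofReal (2 * α)) P)
    {ε : ℝ} (hε : ∀ i, a ≤ i → i ≤ b →
      lpNorm (runErr P u t X Y i) (ENNReal.ofReal (2 * α)) P ≤ ε)
    {i : ℕ} (hai : a ≤ i) (hib : i ≤ b) :
    lpNorm (X i) (ENNReal.ofReal (2 * α)) P
      ≤ forwardConst Λ α * (K + lpNorm (X a) (ENNReal.ofReal (2 * α)) P + ε) := by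
  have hα := S.one_le_α
  have hα0 : 0 ≤ α := by linarith
  have hα1 : (1 : ℝ≥0∞) ≤ ENNReal.ofReal α := by simpa using hα
  have hq2 : (2 : ℝ≥0∞) ≤ ENNReal.ofReal (2 * α) := by
    rw [show (2 : ℝ≥0∞) = ENNReal.ofReal 2 by simp]
    exact ENNReal.ofReal_le_ofReal (by linarith)
  have hK := S.K_pos
  have hε0 : 0 ≤ ε := lpNorm_nonneg.trans (hε a le_rfl (hai.trans hib))
  have hC := driftConst_pos Λ
  have hC' : 0 ≤ momentConst Λ α := by unfold momentConst; positivity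
  have hg := growthConst_nonneg (Λ := Λ) hα
  set N : ℕ → ℝ := fun i => lpNorm (fun ω => 1 + ‖X i ω‖ ^ 2) (ENNReal.ofReal α) P with hN
  have hsq : ∀ i, a ≤ i → i ≤ b →
      MemLp (fun ω => ‖X i ω‖ ^ 2) (ENNReal.ofReal α) P := fun i h1 h2 =>
    (memLp_norm_sq_iff hα0 (hX i h1 h2).1).2 (hX i h1 h2)
  have hXN : ∀ i, a ≤ i → i ≤ b → lpNorm (X i) (ENNReal.ofReal (2 * α)) P ^ 2 ≤ N i := by
    intro i h1 h2
    rw [← lpNorm_norm_sq hα0 (hX i h1 h2).1]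
    refine lpNorm_mono_ae ((memLp_const (1 : ℝ)).add (hsq i h1 h2)) (ae_of_all _ fun ω => ?_)
    rw [Real.norm_of_nonneg (sq_nonneg _)]; linarith
  have hNa : N a ≤ 1 + lpNorm (X a) (ENNReal.ofReal (2 * α)) P ^ 2 := by
    have h1 := hX a le_rfl (hai.trans hib)
    have h2 := lpNorm_le_of_affine (f := fun ω => 1 + ‖X a ω‖ ^ 2) hα1
      (hsq a le_rfl (hai.trans hib)) zero_le_one zero_le_one (ae_of_all _ fun ω => by
        rw [Real.norm_of_nonneg (by positivity), Real.norm_of_nonneg (by positivity), one_mul])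
    rwa [lpNorm_norm_sq hα0 h1.1, one_mul] at h2
  -- Adding `K² + ε²` turns the affine recursion for the moments into a multiplicative one.
  have hrec : ∀ i, a ≤ i → i ≤ b →
      N i + (K ^ 2 + ε ^ 2) ≤ Real.exp (growthConst Λ α * (t i - t a)) * (N a + (K ^ 2 + ε ^ 2)) := by
    intro i hai
    induction i, hai using Nat.le_induction with
    | base => intro _; simp
    | succ i hai ih =>
      intro hib
      have hi : i ∈ Ico a b := ⟨hai, hib⟩
      have D := R.step i hi
      have hh := D.h_pos
      have hXi := hX i hai (by omega)
      have hei := he i hai (by omega)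
      obtain ⟨-, -, -, -, -, s6, -⟩ :=
        small_of_levelConst S.one_le_Λ S.one_le_α D.h_pos.le (R.small S hδ hi)
      have h1 := (R.back i hi).lpNorm_next_le D S hXi (R.memLp_Y S hi hXi hei) s6
      have h2 : lpNorm (fun ω => u.U (t i) (X i ω) (P.map (X i)) - Y i ω)
          (ENNReal.ofReal (2 * α)) P ≤ ε := hε i hai (by omega)
      have h3 : lpNorm (fun ω => u.U (t i) (X i ω) (P.map (X i)) - Y i ω) 2 P ≤ ε :=
        (lpNorm_mono_exponent hq2 hei).trans h2
      have h4 : lpNorm (X i) 2 P ≤ lpNorm (X i) (ENNReal.ofReal (2 * α)) P :=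
        lpNorm_mono_exponent hq2 hXi
      have h5 := hXN i hai (by omega)
      have h20 : 0 ≤ lpNorm (fun ω => u.U (t i) (X i ω) (P.map (X i)) - Y i ω)
          (ENNReal.ofReal (2 * α)) P := lpNorm_nonneg
      have h30 : 0 ≤ lpNorm (fun ω => u.U (t i) (X i ω) (P.map (X i)) - Y i ω) 2 P := lpNorm_nonneg
      have h40 : 0 ≤ lpNorm (X i) 2 P := lpNorm_nonneg
      set x := lpNorm (X i) (ENNReal.ofReal (2 * α)) P
      set x2 := lpNorm (X i) 2 P
      set e := lpNorm (fun ω => u.U (t i) (X i ω) (P.map (X i)) - Y i ω) (ENNReal.ofReal (2 * α)) P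
      set e2 := lpNorm (fun ω => u.U (t i) (X i ω) (P.map (X i)) - Y i ω) 2 P
      have h6 : e ^ 2 ≤ ε ^ 2 := pow_le_pow_left₀ h20 h2 2
      have h7 : (K + x2 + e2) ^ 2 ≤ 3 * (K ^ 2 + N i + ε ^ 2) := by
        have i1 : e2 ^ 2 ≤ ε ^ 2 := pow_le_pow_left₀ h30 h3 2
        have i2 : x2 ^ 2 ≤ x ^ 2 := pow_le_pow_left₀ h40 h4 2
        nlinarith [sq_nonneg (K - x2), sq_nonneg (K - e2), sq_nonneg (x2 - e2)]
      set m := momentConst Λ α * h i with hm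
      set y := driftConst Λ * h i with hy
      have hm0 : 0 ≤ m := by positivity
      have hy0 : 0 ≤ y := by positivity
      have hNi : N (i + 1) ≤ (1 + m) * ((1 + y) * N i + y * (e ^ 2 + (K + x2 + e2) ^ 2)) := h1
      set w := K ^ 2 + ε ^ 2 with hw
      have hw0 : 0 ≤ w := by positivity
      have hNi0 : 0 ≤ N i := lpNorm_nonneg
      have h8 : (1 + y) * N i + y * (e ^ 2 + (K + x2 + e2) ^ 2) ≤ (1 + 4 * y) * N i + 4 * y * w := by
        have := mul_le_mul_of_nonneg_left (add_le_add h6 h7) hy0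
        have : 0 ≤ y * K ^ 2 := by positivity
        rw [hw]; linarith
      have h9 : N (i + 1) + w ≤ (1 + m) * ((1 + 4 * y) * (N i + w)) := by
        have := mul_le_mul_of_nonneg_left h8 (by linarith : 0 ≤ 1 + m)
        have : 0 ≤ m * w := by positivity
        linarith
      have h10 : (1 + m) * (1 + 4 * y) ≤ Real.exp (growthConst Λ α * h i) := by
        have e1 : Real.exp (growthConst Λ α * h i) = Real.exp m * Real.exp (4 * y) := by
          rw [← Real.exp_add, growthConst]; congr 1; rw [hm, hy]; ring
        rw [e1]
        exact mul_le_mul (by linarith [Real.add_one_le_exp m])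
          (by linarith [Real.add_one_le_exp (4 * y)]) (by positivity) (Real.exp_pos _).le
      calc N (i + 1) + w ≤ (1 + m) * (1 + 4 * y) * (N i + w) := by linarith
        _ ≤ Real.exp (growthConst Λ α * h i) * (N i + w) := by gcongr
        _ ≤ Real.exp (growthConst Λ α * h i)
            * (Real.exp (growthConst Λ α * (t i - t a)) * (N a + w)) := by
          have := ih (by omega); gcongr
        _ = _ := by
          rw [← mul_assoc, ← Real.exp_add, R.t_succ i hi]; congr 2; ring
  have hti : t i - t a ≤ 1 := by
    have h1 := R.t_mono hai hib le_rfl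
    have h2 := R.t_mono le_rfl hai hib
    have := (small_of_levelConst S.one_le_Λ hα (by linarith : 0 ≤ t b - t a) hδ).1
    linarith
  have h1 := hrec i hai hib
  have h2 := hXN i hai hib
  set x := lpNorm (X i) (ENNReal.ofReal (2 * α)) P with hx
  set ξ := lpNorm (X a) (ENNReal.ofReal (2 * α)) P with hξ
  have hξ0 : 0 ≤ ξ := lpNorm_nonneg
  have hK1 := S.one_le_K
  set g := Real.exp (growthConst Λ α) with hgdef
  have hg1 : 1 ≤ g := Real.one_le_exp hg
  have h3 : Real.exp (growthConst Λ α * (t i - t a)) ≤ g :=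
    Real.exp_le_exp.2 (mul_le_of_le_one_right hg hti)
  have h4 : N a + (K ^ 2 + ε ^ 2) ≤ 2 * (K + ξ + ε) ^ 2 := by
    nlinarith [mul_nonneg hK.le hξ0, mul_nonneg hK.le hε0, mul_nonneg hξ0 hε0]
  have h5 : x ^ 2 ≤ (2 * g * (K + ξ + ε)) ^ 2 := by
    have hNa0 : 0 ≤ N a := lpNorm_nonneg
    calc x ^ 2 ≤ N i + (K ^ 2 + ε ^ 2) := by nlinarith
      _ ≤ g * (2 * (K + ξ + ε) ^ 2) := h1.trans (mul_le_mul h3 h4 (by positivity) (by linarith))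
      _ ≤ _ := by
        have : g ≤ g ^ 2 := by nlinarith
        nlinarith [sq_nonneg (K + ξ + ε)]
  exact (abs_le.1 (abs_le_of_sq_le_sq h5 (by positivity))).2

/-- The backward recursion summed along a run. -/
lemma lpNorm_err_sq_le (R : IsRun F P Λ T c s p t h X Y ζ B Θ Xin Z a b)
    (S : Setting P₀ T Λ α K c u) (hδ : (t b - t a) * levelConst d Λ α ≤ 1)
    (hX : ∀ i, a ≤ i → i ≤ b → MemLp (X i) (ENNReal.ofReal (2 * α)) P)
    (he : ∀ i, a ≤ i → i ≤ b → MemLp (runErr P u t X Y i) (ENNReal.ofReal (2 * α)) P)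
    (hin : ∀ i ∈ Ico a b, MemLp (fun ω => X i ω - Xin i ω) (ENNReal.ofReal (2 * α)) P)
    {Q : ℝ} {a₁ a₀ : ℕ → ℝ} (ha₁ : ∀ i ∈ Ico a b, √(h i) ≤ a₁ i)
    (ha₀ : ∀ i ∈ Ico a b, √(h i) * (lpNorm (X i) 2 P + K) ≤ 2 * a₀ i)
    (hdef : ∀ i ∈ Ico a b, ∀ ω, |IsStep.defect P c u s p (t i) (h i) (X i) (B i) (Θ i) ω|
      ≤ stepConst d Λ α * (h i * (|u.U (t i) (X i ω) (P.map (X i)) - Y i ω|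
        + lpNorm (fun ω => u.U (t i) (X i ω) (P.map (X i)) - Y i ω) 2 P
        + a₁ i * ‖X i ω‖ + a₀ i)))
    (hQ : ∀ i ∈ Ico a b, a₁ i * lpNorm (X i) (ENNReal.ofReal (2 * α)) P + a₀ i
      + 2 * lpNorm (fun ω => X i ω - Xin i ω) (ENNReal.ofReal (2 * α)) P ≤ Q)
    {i : ℕ} (hai : a ≤ i) (hib : i ≤ b) :
    lpNorm (runErr P u t X Y i) (ENNReal.ofReal (2 * α)) P ^ 2
      ≤ Real.exp (5 * errConst d Λ α * (t b - t a))
          * lpNorm (runErr P u t X Y b) (ENNReal.ofReal (2 * α)) P ^ 2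
        + 10 * errConst d Λ α * (t b - t a) * Q ^ 2 := by
  have hα := S.one_le_α
  have hE := one_le_errConst (d := d) S.one_le_Λ hα
  have hta : 0 ≤ t b - t a := by linarith [R.t_mono le_rfl (hai.trans hib) le_rfl]
  obtain ⟨-, -, r3, -⟩ := small_of_levelConst S.one_le_Λ hα hta hδ
  set v : ℕ → ℝ := fun i => lpNorm (runErr P u t X Y i) (ENNReal.ofReal (2 * α)) P ^ 2 with hv
  -- Here `Q` must bound the remainder of every step of the level, so that the same `Q²` can be
  -- carried along the whole recursion.
  have hrec : v i + Q ^ 2 ≤ Real.exp (5 * errConst d Λ α * (t b - t i)) * (v b + Q ^ 2) := by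
    induction hib using Nat.decreasingInduction with
    | self => simp
    | of_succ i hib ih =>
      have hi : i ∈ Ico a b := ⟨hai, hib⟩
      have D := R.step i hi
      have hXi := hX i hai hib.le
      have hei := he i hai hib.le
      obtain ⟨-, -, s3, s4, -⟩ :=
        small_of_levelConst S.one_le_Λ S.one_le_α D.h_pos.le (R.small S hδ hi)
      have he' := he (i + 1) (by omega) hib
      rw [R.runErr_succ hi] at he'
      have h1 := (R.back i hi).lpNorm_err_sq_le D S (ha₁ i hi) (ha₀ i hi) s4 s3 (hdef i hi) hXi
        (R.memLp_Y S hi hXi hei) he' (hin i hi) (hQ i hi)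
      rw [← R.runErr_succ hi] at h1
      have h2 : v i + Q ^ 2 ≤ Real.exp (5 * errConst d Λ α * h i) * (v (i + 1) + Q ^ 2) := h1
      calc v i + Q ^ 2 ≤ Real.exp (5 * errConst d Λ α * h i) * (v (i + 1) + Q ^ 2) := h2
        _ ≤ Real.exp (5 * errConst d Λ α * h i)
            * (Real.exp (5 * errConst d Λ α * (t b - t (i + 1))) * (v b + Q ^ 2)) := by
          have := ih (by omega); gcongr
        _ = _ := by
          rw [← mul_assoc, ← Real.exp_add, R.t_succ i hi]; congr 2; ring
  have h1 : Real.exp (5 * errConst d Λ α * (t b - t i))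
      ≤ Real.exp (5 * errConst d Λ α * (t b - t a)) := by
    refine Real.exp_le_exp.2 (mul_le_mul_of_nonneg_left ?_ (by linarith))
    linarith [R.t_mono le_rfl hai hib]
  set x := 5 * errConst d Λ α * (t b - t a) with hx
  have hx0 : 0 ≤ x := by positivity
  -- The level is short enough for `x ≤ 1`. The remainder is then multiplied by `2 x`, hence by the
  -- length of the level; the absorption of a large error relies on this factor.
  have h2 : Real.exp x - 1 ≤ 2 * x := by
    have := Real.abs_exp_sub_one_le (x := x) (by rw [abs_of_nonneg hx0]; linarith)
    rw [abs_of_nonneg hx0] at this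
    exact (le_abs_self _).trans this
  have hvb : 0 ≤ v b + Q ^ 2 := by positivity
  have h3 := hrec.trans (mul_le_mul_of_nonneg_right h1 hvb)
  have h4 := mul_le_mul_of_nonneg_right h2 (sq_nonneg Q)
  have h5 : 10 * errConst d Λ α * (t b - t a) * Q ^ 2 = 2 * x * Q ^ 2 := by rw [hx]; ring
  rw [h5]
  change v i ≤ Real.exp x * v b + 2 * x * Q ^ 2
  linarith

end IsRun
end MKV
namespace MKV

/-! ### The stability estimate on one level -/

/-- The universal constant of the stability estimate. -/
noncomputable def stabilityConst (d : ℕ) (Λ α : ℝ) : ℝ :=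
  absorbConst d Λ α + 160 * errConst d Λ α

/-- The constant of the discretisation error. -/
noncomputable def meshConst (d : ℕ) (Λ α K : ℝ) : ℝ :=
  20 * errConst d Λ α * (4 * forwardConst Λ α * K) ^ α

lemma le_add_of_sq_le {e A B : ℝ} (hA : 0 ≤ A) (hB : 0 ≤ B) (h : e ^ 2 ≤ A ^ 2 + B ^ 2) :
    e ≤ A + B :=
  (abs_le.1 (abs_le_of_sq_le_sq (by nlinarith [mul_nonneg hA hB]) (by positivity))).2

/-- Compare `1 + x` with `2 max(1, x)`; the power of a maximum is the maximum of the powers. -/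
lemma rpow_le_of_le_mul_one_add {α x A M : ℝ} (hα : 1 ≤ α) (hx : 0 ≤ x) (hA : 0 ≤ A) (hM : 0 ≤ M)
    (h : M ≤ A * (1 + x)) : M ^ α ≤ (2 * A) ^ α * (1 + x ^ α) := by
  have hα0 : 0 ≤ α := by linarith
  have hm : 0 ≤ max 1 x := zero_le_one.trans (le_max_left _ _)
  have h1 : M ≤ 2 * A * max 1 x := by
    refine h.trans ?_
    have : 1 + x ≤ 2 * max 1 x := by linarith [le_max_left 1 x, le_max_right 1 x]
    calc A * (1 + x) ≤ A * (2 * max 1 x) := mul_le_mul_of_nonneg_left this hA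
      _ = _ := by ring
  refine (Real.rpow_le_rpow hM h1 hα0).trans ?_
  rw [Real.mul_rpow (by positivity) hm]
  refine mul_le_mul_of_nonneg_left ?_ (Real.rpow_nonneg (by positivity) _)
  rcases le_total 1 x with h2 | h2
  · rw [max_eq_right h2]; linarith
  · rw [max_eq_left h2, Real.one_rpow]; linarith [Real.rpow_nonneg hx α]

namespace IsRun

variable {d : ℕ} {Ω₀ : Type*} {m₀ : MeasurableSpace Ω₀} {P₀ : Measure Ω₀} [IsProbabilityMeasure P₀]
  {T Λ α K : ℝ} {c : Coeffs d} {u : MasterField d}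
  {Ω : Type*} {F : ℕ → MeasurableSpace Ω} {mΩ : MeasurableSpace Ω} {P : Measure Ω}
  [IsProbabilityMeasure P]
  {s : Finset (St d)} {p : St d → ℝ} {t h : ℕ → ℝ} {X : ℕ → Ω → St d} {Y : ℕ → Ω → ℝ}
  {ζ B Θ Xin Z : ℕ → Ω → St d} {a b : ℕ}

/-- Stability when the error is dominated by the size of the initial condition. -/
lemma lpNorm_err_le_of_le (R : IsRun F P Λ T c s p t h X Y ζ B Θ Xin Z a b)
    (S : Setting P₀ T Λ α K c u) (hδ : (t b - t a) * levelConst d Λ α ≤ 1)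
    (hX : ∀ i, a ≤ i → i ≤ b → MemLp (X i) (ENNReal.ofReal (2 * α)) P)
    (he : ∀ i, a ≤ i → i ≤ b → MemLp (runErr P u t X Y i) (ENNReal.ofReal (2 * α)) P)
    (hin : ∀ i ∈ Ico a b, MemLp (fun ω => X i ω - Xin i ω) (ENNReal.ofReal (2 * α)) P)
    {m Δ ε : ℝ} (hm : ∀ i ∈ Ico a b, h i ≤ m)
    (hΔ : ∀ i ∈ Ico a b, lpNorm (fun ω => X i ω - Xin i ω) (ENNReal.ofReal (2 * α)) P ≤ Δ)
    (hΔ0 : 0 ≤ Δ)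
    (hε : ∀ i, a ≤ i → i ≤ b → lpNorm (runErr P u t X Y i) (ENNReal.ofReal (2 * α)) P ≤ ε)
    (hεK : ε ≤ K + lpNorm (X a) (ENNReal.ofReal (2 * α)) P) {i : ℕ} (hai : a ≤ i) (hib : i ≤ b) :
    lpNorm (runErr P u t X Y i) (ENNReal.ofReal (2 * α)) P
      ≤ Real.exp (stabilityConst d Λ α * (t b - t a))
          * lpNorm (runErr P u t X Y b) (ENNReal.ofReal (2 * α)) P
        + stabilityConst d Λ α * Δ
        + meshConst d Λ α K * √m
          * (1 + lpNorm (X a) (ENNReal.ofReal (2 * α)) P ^ α) := by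
  have hα := S.one_le_α
  have hK := S.one_le_K
  have hE := one_le_errConst (d := d) S.one_le_Λ hα
  have hA := absorbConst_nonneg (d := d) S.one_le_Λ hα
  have hq2 : (2 : ℝ≥0∞) ≤ ENNReal.ofReal (2 * α) := by
    rw [show (2 : ℝ≥0∞) = ENNReal.ofReal 2 by simp]
    exact ENNReal.ofReal_le_ofReal (by linarith)
  have hta : 0 ≤ t b - t a := by linarith [R.t_mono le_rfl (hai.trans hib) le_rfl]
  obtain ⟨r1, -⟩ := small_of_levelConst S.one_le_Λ hα hta hδ
  have hξ0 : 0 ≤ lpNorm (X a) (ENNReal.ofReal (2 * α)) P := lpNorm_nonneg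
  have hv0 : 0 ≤ lpNorm (runErr P u t X Y b) (ENNReal.ofReal (2 * α)) P := lpNorm_nonneg
  have hfw := fun i => R.lpNorm_X_le S hδ hX he hε (i := i)
  set ξ := lpNorm (X a) (ENNReal.ofReal (2 * α)) P with hξ
  set Cx := forwardConst Λ α with hCx
  have hCx2 : 2 ≤ Cx := two_le_forwardConst hα
  -- In this regime the error is at most `K + ξ`, so the forward moments are controlled by the
  -- initial condition alone and the fine defect is affordable.
  set M := 2 * Cx * (K + ξ) with hM
  have hXM : ∀ i, a ≤ i → i ≤ b → lpNorm (X i) (ENNReal.ofReal (2 * α)) P ≤ M := by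
    intro i h1 h2
    refine (hfw i h1 h2).trans ?_
    calc Cx * (K + ξ + ε) ≤ Cx * (K + ξ + (K + ξ)) := by gcongr
      _ = M := by rw [hM]; ring
  have hKM : K + ξ ≤ M := by
    rw [hM]; exact le_mul_of_one_le_left (by linarith) (by linarith)
  have hM1 : 1 ≤ M := by linarith
  have hMα : M ≤ M ^ α := Real.self_le_rpow_of_one_le hM1 hα
  -- The two halves of `2 * M ^ α` come from the state and from the constant in the fine defect. The
  -- displacement of the input counts twice, through its value and through its law.
  have key := R.lpNorm_err_sq_le S hδ hX he hin (Q := √m * (2 * M ^ α) + 2 * Δ)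
    (a₁ := fun i => √(h i)) (a₀ := fun i => √(h i) * M ^ α) (fun i _ => le_rfl)
    (fun i hi => by
      have h1 := (lpNorm_mono_exponent hq2 (hX i hi.1 hi.2.le)).trans (hXM i hi.1 hi.2.le)
      have h2 : lpNorm (X i) 2 P + K ≤ 2 * M ^ α := by linarith
      have := mul_le_mul_of_nonneg_left h2 (Real.sqrt_nonneg (h i))
      linarith)
    (fun i hi => (R.step i hi).abs_defect_le_fine S (hX i hi.1 hi.2.le)
      (R.memLp_Y S hi (hX i hi.1 hi.2.le) (he i hi.1 hi.2.le)) (by linarith)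
      (hXM i hi.1 hi.2.le) ((hε i hi.1 hi.2.le).trans (hεK.trans hKM)))
    (fun i hi => by
      have h1 : √(h i) ≤ √m := Real.sqrt_le_sqrt (hm i hi)
      have h2 := hXM i hi.1 hi.2.le
      have h3 : √(h i) * lpNorm (X i) (ENNReal.ofReal (2 * α)) P + √(h i) * M ^ α
          ≤ √m * (2 * M ^ α) := by
        rw [← mul_add]
        exact mul_le_mul h1 (by linarith) (add_nonneg lpNorm_nonneg (by linarith))
          (Real.sqrt_nonneg _)
      have := hΔ i hi
      linarith)
    hai hib
  set e := lpNorm (runErr P u t X Y i) (ENNReal.ofReal (2 * α)) P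
  set v := lpNorm (runErr P u t X Y b) (ENNReal.ofReal (2 * α)) P
  set Q := √m * (2 * M ^ α) + 2 * Δ with hQ
  have hQ0 : 0 ≤ Q := by
    have : 0 ≤ M ^ α := by linarith
    positivity
  set C := errConst d Λ α with hC
  have h1 : e ^ 2 ≤ (Real.exp (stabilityConst d Λ α * (t b - t a)) * v) ^ 2 + (10 * C * Q) ^ 2 := by
    refine key.trans (add_le_add ?_ ?_)
    · rw [mul_pow, ← Real.exp_nat_mul]
      refine mul_le_mul_of_nonneg_right (Real.exp_le_exp.2 ?_) (sq_nonneg _)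
      rw [← mul_assoc]
      refine mul_le_mul_of_nonneg_right ?_ hta
      unfold stabilityConst; push_cast; linarith
    · rw [mul_pow]
      refine mul_le_mul_of_nonneg_right ?_ (sq_nonneg _)
      calc 10 * C * (t b - t a) ≤ 10 * C * 1 := by gcongr
        _ ≤ (10 * C) ^ 2 := by nlinarith
  have h2 := le_add_of_sq_le (by positivity) (by positivity) h1
  have h3 : M ^ α ≤ (4 * Cx * K) ^ α * (1 + ξ ^ α) := by
    have := rpow_le_of_le_mul_one_add (A := 2 * Cx * K) hα hξ0 (by positivity) (by linarith)
      (show M ≤ 2 * Cx * K * (1 + ξ) by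
        have : ξ ≤ K * ξ := le_mul_of_one_le_left hξ0 hK
        calc M ≤ 2 * Cx * (K + K * ξ) := by rw [hM]; gcongr
          _ = _ := by ring)
    rwa [show 2 * (2 * Cx * K) = 4 * Cx * K by ring] at this
  have h4 : 10 * C * Q ≤ stabilityConst d Λ α * Δ
      + meshConst d Λ α K * √m * (1 + ξ ^ α) := by
    have i1 : 20 * C * Δ ≤ stabilityConst d Λ α * Δ := by
      refine mul_le_mul_of_nonneg_right ?_ hΔ0
      unfold stabilityConst; linarith
    have i2 : 20 * C * √m * M ^ α ≤ meshConst d Λ α K * √m * (1 + ξ ^ α) := by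
      calc 20 * C * √m * M ^ α ≤ 20 * C * √m * ((4 * Cx * K) ^ α * (1 + ξ ^ α)) := by gcongr
        _ = _ := by unfold meshConst; ring
    calc 10 * C * Q = 20 * C * Δ + 20 * C * √m * M ^ α := by rw [hQ]; ring
      _ ≤ _ := by linarith
  linarith

/-- Stability when the error dominates the size of the initial condition. -/
lemma lpNorm_err_le_of_ge (R : IsRun F P Λ T c s p t h X Y ζ B Θ Xin Z a b)
    (S : Setting P₀ T Λ α K c u) (hδ : (t b - t a) * levelConst d Λ α ≤ 1)
    (hX : ∀ i, a ≤ i → i ≤ b → MemLp (X i) (ENNReal.ofReal (2 * α)) P)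
    (he : ∀ i, a ≤ i → i ≤ b → MemLp (runErr P u t X Y i) (ENNReal.ofReal (2 * α)) P)
    (hin : ∀ i ∈ Ico a b, MemLp (fun ω => X i ω - Xin i ω) (ENNReal.ofReal (2 * α)) P)
    {Δ : ℝ}
    (hΔ : ∀ i ∈ Ico a b, lpNorm (fun ω => X i ω - Xin i ω) (ENNReal.ofReal (2 * α)) P ≤ Δ)
    (hΔ0 : 0 ≤ Δ) {j : ℕ} (haj : a ≤ j) (hjb : j ≤ b)
    (hε : ∀ i, a ≤ i → i ≤ b → lpNorm (runErr P u t X Y i) (ENNReal.ofReal (2 * α)) P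
      ≤ lpNorm (runErr P u t X Y j) (ENNReal.ofReal (2 * α)) P)
    (hεK : K + lpNorm (X a) (ENNReal.ofReal (2 * α)) P
      ≤ lpNorm (runErr P u t X Y j) (ENNReal.ofReal (2 * α)) P) :
    lpNorm (runErr P u t X Y j) (ENNReal.ofReal (2 * α)) P
      ≤ Real.exp (stabilityConst d Λ α * (t b - t a))
          * lpNorm (runErr P u t X Y b) (ENNReal.ofReal (2 * α)) P
        + stabilityConst d Λ α * Δ := by
  have hα := S.one_le_α
  have hK := S.one_le_K
  have hE := one_le_errConst (d := d) S.one_le_Λ hα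
  have hA := absorbConst_nonneg (d := d) S.one_le_Λ hα
  have hq2 : (2 : ℝ≥0∞) ≤ ENNReal.ofReal (2 * α) := by
    rw [show (2 : ℝ≥0∞) = ENNReal.ofReal 2 by simp]
    exact ENNReal.ofReal_le_ofReal (by linarith)
  have hta : 0 ≤ t b - t a := by linarith [R.t_mono le_rfl (haj.trans hjb) le_rfl]
  obtain ⟨r1, -, -, -, -, -, r7⟩ := small_of_levelConst S.one_le_Λ hα hta hδ
  have hξ0 : 0 ≤ lpNorm (X a) (ENNReal.ofReal (2 * α)) P := lpNorm_nonneg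
  have hv0 : 0 ≤ lpNorm (runErr P u t X Y b) (ENNReal.ofReal (2 * α)) P := lpNorm_nonneg
  have hfw := fun i => R.lpNorm_X_le S hδ hX he hε (i := i)
  set ε := lpNorm (runErr P u t X Y j) (ENNReal.ofReal (2 * α)) P with hεdef
  set ξ := lpNorm (X a) (ENNReal.ofReal (2 * α)) P with hξ
  have hε0 : 0 ≤ ε := by linarith
  have hCx2 : 2 ≤ forwardConst Λ α := two_le_forwardConst hα
  have habs : absorbConst d Λ α = 500 * errConst d Λ α * forwardConst Λ α ^ 2 := rfl
  set Cx := forwardConst Λ α with hCx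
  have hXM : ∀ i, a ≤ i → i ≤ b → lpNorm (X i) (ENNReal.ofReal (2 * α)) P ≤ 2 * Cx * ε := by
    intro i h1 h2
    refine (hfw i h1 h2).trans ?_
    calc Cx * (K + ξ + ε) ≤ Cx * (ε + ε) := by gcongr
      _ = _ := by ring
  have hεCx : ε ≤ Cx * ε := le_mul_of_one_le_left hε0 (by linarith)
  -- All moments are now dominated by the maximal error: `‖X‖` in `L^{2α}` and in `L²` contribute `2
  -- Cx ε` each, and `K` at most `Cx ε`, which makes `5 Cx ε`.
  have key := R.lpNorm_err_sq_le S hδ hX he hin (Q := 5 * Cx * ε + 2 * Δ)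
    (a₁ := fun _ => 1) (a₀ := fun i => lpNorm (X i) 2 P + K)
    (fun i hi => Real.sqrt_le_one.2 (R.step i hi).h_le_one)
    (fun i hi => by
      have h1 : √(h i) ≤ 1 := Real.sqrt_le_one.2 (R.step i hi).h_le_one
      have h2 : 0 ≤ lpNorm (X i) 2 P + K := add_nonneg lpNorm_nonneg (by linarith)
      have := mul_le_mul_of_nonneg_right h1 h2
      linarith)
    (fun i hi => (R.step i hi).abs_defect_le_crude S)
    (fun i hi => by
      have h1 := hXM i hi.1 hi.2.le
      have h2 := (lpNorm_mono_exponent hq2 (hX i hi.1 hi.2.le)).trans h1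
      have := hΔ i hi
      linarith)
    haj hjb
  set v := lpNorm (runErr P u t X Y b) (ENNReal.ofReal (2 * α)) P
  set δ := t b - t a with hδdef
  set C := errConst d Λ α with hC
  have h1 : (5 * Cx * ε + 2 * Δ) ^ 2 ≤ 50 * Cx ^ 2 * ε ^ 2 + 8 * Δ ^ 2 := by
    nlinarith [sq_nonneg (5 * Cx * ε - 2 * Δ)]
  -- The remainder contributes `10 C δ · 50 Cx² ε² = y ε²`, which explains `absorbConst`. As `y ≤ 1
  -- / 2` on a short level, it is absorbed on the left.
  set y := absorbConst d Λ α * δ with hy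
  have hy0 : 0 ≤ y := by positivity
  set x := 5 * C * δ with hx
  have hx0 : 0 ≤ x := by positivity
  set w := Real.exp x * v ^ 2 + 80 * C * Δ ^ 2 with hw
  have hw0 : 0 ≤ w := by positivity
  have h2 : (1 - y) * ε ^ 2 ≤ w := by
    have i1 := mul_le_mul_of_nonneg_left h1 (by positivity : 0 ≤ 10 * C * δ)
    have i2 : 80 * C * Δ ^ 2 * δ ≤ 80 * C * Δ ^ 2 := mul_le_of_le_one_right (by positivity) r1
    have i3 : y * ε ^ 2 = 10 * C * δ * (50 * Cx ^ 2 * ε ^ 2) := by rw [hy, habs]; ring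
    rw [hw]
    linarith
  have h3 : 1 ≤ (1 + 2 * y) * (1 - y) := by nlinarith
  have h4 : ε ^ 2 ≤ (1 + 2 * y) * w := by
    calc ε ^ 2 ≤ (1 + 2 * y) * (1 - y) * ε ^ 2 := le_mul_of_one_le_left (sq_nonneg _) h3
      _ = (1 + 2 * y) * ((1 - y) * ε ^ 2) := by ring
      _ ≤ _ := mul_le_mul_of_nonneg_left h2 (by linarith)
  have h5 : ε ^ 2 ≤ (Real.exp (stabilityConst d Λ α * δ) * v) ^ 2
      + (stabilityConst d Λ α * Δ) ^ 2 := by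
    have i1 : (1 + 2 * y) * (Real.exp x * v ^ 2)
        ≤ (Real.exp (stabilityConst d Λ α * δ) * v) ^ 2 := by
      rw [mul_pow, ← mul_assoc]
      refine mul_le_mul_of_nonneg_right ?_ (sq_nonneg _)
      calc (1 + 2 * y) * Real.exp x ≤ Real.exp (2 * y) * Real.exp x := by
            have := Real.add_one_le_exp (2 * y)
            exact mul_le_mul_of_nonneg_right (by linarith) (Real.exp_pos _).le
        _ = Real.exp (2 * y + x) := (Real.exp_add _ _).symm
        _ ≤ Real.exp ((2 : ℕ) * (stabilityConst d Λ α * δ)) := by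
            refine Real.exp_le_exp.2 ?_
            have : 0 ≤ C * δ := by positivity
            rw [hy, hx]; unfold stabilityConst; push_cast; linarith
        _ = _ := Real.exp_nat_mul _ 2
    have i2 : (1 + 2 * y) * (80 * C * Δ ^ 2) ≤ (stabilityConst d Λ α * Δ) ^ 2 := by
      rw [mul_pow]
      have j1 : (160 * C) ^ 2 ≤ stabilityConst d Λ α ^ 2 := by
        refine pow_le_pow_left₀ (by positivity) ?_ 2
        unfold stabilityConst; linarith
      calc (1 + 2 * y) * (80 * C * Δ ^ 2) ≤ 2 * (80 * C * Δ ^ 2) :=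
            mul_le_mul_of_nonneg_right (by linarith) (by positivity)
        _ = 160 * C * Δ ^ 2 := by ring
        _ ≤ (160 * C) ^ 2 * Δ ^ 2 := mul_le_mul_of_nonneg_right (by nlinarith) (sq_nonneg _)
        _ ≤ _ := mul_le_mul_of_nonneg_right j1 (sq_nonneg _)
    calc ε ^ 2 ≤ (1 + 2 * y) * w := h4
      _ = (1 + 2 * y) * (Real.exp x * v ^ 2) + (1 + 2 * y) * (80 * C * Δ ^ 2) := by rw [hw]; ring
      _ ≤ _ := add_le_add i1 i2
  have hst : 0 ≤ stabilityConst d Λ α := by unfold stabilityConst; linarith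
  exact le_add_of_sq_le (by positivity) (by positivity) h5

/-- The stability estimate on one level. -/
theorem lpNorm_err_le (R : IsRun F P Λ T c s p t h X Y ζ B Θ Xin Z a b)
    (S : Setting P₀ T Λ α K c u) (hab : a < b) (hδ : (t b - t a) * levelConst d Λ α ≤ 1)
    (hb : MemLp (runErr P u t X Y b) (ENNReal.ofReal (2 * α)) P)
    (hin : ∀ i ∈ Ico a b, MemLp (fun ω => X i ω - Xin i ω) (ENNReal.ofReal (2 * α)) P)
    (hξ : MemLp (X a) (ENNReal.ofReal (2 * α)) P)
    {m Δ : ℝ} (hm : ∀ i ∈ Ico a b, h i ≤ m)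
    (hΔ : ∀ i ∈ Ico a b, lpNorm (fun ω => X i ω - Xin i ω) (ENNReal.ofReal (2 * α)) P ≤ Δ)
    {i : ℕ} (hai : a ≤ i) (hib : i ≤ b) :
    MemLp (runErr P u t X Y i) (ENNReal.ofReal (2 * α)) P ∧
    lpNorm (runErr P u t X Y i) (ENNReal.ofReal (2 * α)) P
      ≤ Real.exp (stabilityConst d Λ α * (t b - t a))
          * lpNorm (runErr P u t X Y b) (ENNReal.ofReal (2 * α)) P
        + stabilityConst d Λ α * Δ
        + meshConst d Λ α K * √m
          * (1 + lpNorm (X a) (ENNReal.ofReal (2 * α)) P ^ α) := by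
  have hmem := fun i (h1 : a ≤ i) (h2 : i ≤ b) => R.memLp S hab hδ hb hin hξ h1 h2
  have hX := fun i (h1 : a ≤ i) (h2 : i ≤ b) => (hmem i h1 h2).1
  have he := fun i (h1 : a ≤ i) (h2 : i ≤ b) => (hmem i h1 h2).2
  refine ⟨he i hai hib, ?_⟩
  have hΔ0 : 0 ≤ Δ := lpNorm_nonneg.trans (hΔ a ⟨le_rfl, hab⟩)
  -- The largest error on the level decides between the two regimes. When it dominates the initial
  -- condition, the bound is proved for this maximum and the mesh term is simply added.
  obtain ⟨j, hj, hmax⟩ := (Finset.Icc a b).exists_max_image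
    (fun i => lpNorm (runErr P u t X Y i) (ENNReal.ofReal (2 * α)) P)
    ⟨a, Finset.mem_Icc.2 ⟨le_rfl, hab.le⟩⟩
  rw [Finset.mem_Icc] at hj
  have hε := fun i (h1 : a ≤ i) (h2 : i ≤ b) => hmax i (Finset.mem_Icc.2 ⟨h1, h2⟩)
  rcases le_total (lpNorm (runErr P u t X Y j) (ENNReal.ofReal (2 * α)) P)
    (K + lpNorm (X a) (ENNReal.ofReal (2 * α)) P) with hc | hc
  · exact R.lpNorm_err_le_of_le S hδ hX he hin hm hΔ hΔ0 hε hc hai hib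
  · have h1 := R.lpNorm_err_le_of_ge S hδ hX he hin hΔ hΔ0 hj.1 hj.2 hε hc
    have h2 := one_le_errConst (d := d) S.one_le_Λ S.one_le_α
    have h3 := two_le_forwardConst (Λ := Λ) S.one_le_α
    have h4 := S.one_le_K
    have h5 : 0 ≤ meshConst d Λ α K * √m
        * (1 + lpNorm (X a) (ENNReal.ofReal (2 * α)) P ^ α) := by
      have := Real.rpow_nonneg (lpNorm_nonneg (f := X a) (p := ENNReal.ofReal (2 * α)) (μ := P)) α
      have : 0 ≤ meshConst d Λ α K := by
        unfold meshConst
        have := Real.rpow_nonneg (by positivity : 0 ≤ 4 * forwardConst Λ α * K) α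
        positivity
      positivity
    linarith [hε i hai hib]

end IsRun
end MKV
namespace MKV

/-! ### The tree scheme as a run -/

section Monotonicity

variable {d : ℕ} {Λ Λ' : ℝ}

lemma H0.mono {c : Coeffs d} (H : H0 Λ c) (hΛ : Λ ≤ Λ') : H0 Λ' c where
  lip_b x x' y y' ν ν' h h' := (H.lip_b x x' y y' ν ν' h h').trans
    (mul_le_mul_of_nonneg_right hΛ (by have : 0 ≤ W2joint ν ν' := ENNReal.toReal_nonneg; positivity))
  lip_σ x x' μ μ' h h' := (H.lip_σ x x' μ μ' h h').trans
    (mul_le_mul_of_nonneg_right hΛ (by have : 0 ≤ W2 μ μ' := ENNReal.toReal_nonneg; positivity))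
  lip_f x x' y y' z z' ν ν' h h' := (H.lip_f x x' y y' z z' ν ν' h h').trans
    (mul_le_mul_of_nonneg_right hΛ (by have : 0 ≤ W2joint ν ν' := ENNReal.toReal_nonneg; positivity))
  lip_g x x' μ μ' h h' := (H.lip_g x x' μ μ' h h').trans
    (mul_le_mul_of_nonneg_right hΛ (by have : 0 ≤ W2 μ μ' := ENNReal.toReal_nonneg; positivity))
  bound_σ x μ h := (H.bound_σ x μ h).trans hΛ

lemma H1.mono {Ω₀ : Type*} {m₀ : MeasurableSpace Ω₀} {P₀ : Measure Ω₀} {T α : ℝ} {c : Coeffs d}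
    {u : MasterField d} (H : H1 P₀ T Λ α c u) (hΛ : Λ ≤ Λ') : H1 P₀ T Λ' α c u where
  classical := H.classical
  lip_measure t ht x μ μ' h h' := (H.lip_measure t ht x μ μ' h h').trans
    (mul_le_mul_of_nonneg_right hΛ ENNReal.toReal_nonneg)
  bound_first t ht x μ h := (H.bound_first t ht x μ h).trans (ENNReal.ofReal_le_ofReal hΛ)
  bound_second t ht x μ h := (H.bound_second t ht x μ h).trans (ENNReal.ofReal_le_ofReal hΛ)
  lip_dxx t ht x x' μ h := (H.lip_dxx t ht x x' μ h).trans
    (mul_le_mul_of_nonneg_right hΛ (norm_nonneg _))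
  holder_time h hh t ht x μ hμ := by
    have h0 : 0 ≤ l2norm μ := ENNReal.toReal_nonneg
    refine (H.holder_time h hh t ht x μ hμ).trans ?_
    gcongr
  lip_dvdμ t ht x μ v v' h := by
    have h0 : 0 ≤ l2norm μ := ENNReal.toReal_nonneg
    refine (H.lip_dvdμ t ht x μ v v' h).trans ?_
    gcongr

lemma IsQuantiser.mono {Γ : St d → St d} (H : IsQuantiser Λ Γ) (hΛ : Λ ≤ Λ') : IsQuantiser Λ' Γ :=
  ⟨H.measurable, H.finite_range, fun w => (H.bounded w).trans hΛ, H.centred, H.covariance⟩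

end Monotonicity

/-- The bound on the field at the origin must be uniform in time. The Hölder assumption is applied
to two increments `t / 2`, as it excludes an increment equal to `T`. -/
lemma exists_setting {d : ℕ} {Ω₀ : Type*} {m₀ : MeasurableSpace Ω₀} {P₀ : Measure Ω₀}
    {T Λ α : ℝ} {c : Coeffs d} {u : MasterField d} (hΛ : 1 ≤ Λ) (hα : 1 ≤ α) (hT : 0 < T)
    (hat : Atomless m₀ P₀) (h0 : H0 Λ c) (h1 : H1 P₀ T Λ α c u) :
    ∃ K, Setting P₀ T Λ α K c u := by
  set x := |u.U 0 0 (Measure.dirac 0)| with hx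
  set l := l2norm (Measure.dirac (0 : St d)) with hl
  have hl0 : 0 ≤ l := ENNReal.toReal_nonneg
  have hx0 : 0 ≤ x := abs_nonneg _
  have hU : ∀ t ∈ Icc 0 T, |u.U t 0 (Measure.dirac 0)| ≤ x + 2 * (Λ * √T * (1 + l)) := by
    have hstep : ∀ m ∈ Ico 0 T, ∀ t ∈ Icc 0 (T - m), |u.U (t + m) 0 (Measure.dirac 0)|
        ≤ |u.U t 0 (Measure.dirac 0)| + Λ * √T * (1 + l) := by
      intro m hm t ht
      have h2 := h1.holder_time m hm t ht 0 _ isP2_dirac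
      rw [norm_zero, add_zero] at h2
      have h3 : Λ * √m * (1 + l) ≤ Λ * √T * (1 + l) := by
        have := Real.sqrt_le_sqrt hm.2.le
        gcongr
      have h4 := abs_sub_abs_le_abs_sub (u.U (t + m) 0 (Measure.dirac 0))
        (u.U t 0 (Measure.dirac 0))
      have h5 := norm_nonneg (u.dx (t + m) 0 (Measure.dirac 0) - u.dx t 0 (Measure.dirac 0))
      linarith
    intro t ht
    have h2 := hstep (t / 2) ⟨by linarith [ht.1], by linarith [ht.1, ht.2]⟩ 0
      ⟨le_rfl, by linarith [ht.1, ht.2]⟩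
    have h3 := hstep (t / 2) ⟨by linarith [ht.1], by linarith [ht.1, ht.2]⟩ (t / 2)
      ⟨by linarith [ht.1], by linarith [ht.1, ht.2]⟩
    rw [add_halves] at h3
    rw [zero_add] at h2
    linarith
  have hr : 0 ≤ 2 * (Λ * √T * (1 + l)) := by positivity
  refine ⟨1 + ‖c.b 0 0 (Measure.dirac 0)‖ + |c.f 0 0 0 (Measure.dirac 0)|
    + (x + 2 * (Λ * √T * (1 + l))), hΛ, hα, hT, hat, h0, h1, ?_, ?_, ?_, fun t ht => ?_⟩
  all_goals have hb := norm_nonneg (c.b 0 0 (Measure.dirac 0))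
  all_goals have hf := abs_nonneg (c.f 0 0 0 (Measure.dirac 0))
  · linarith
  · linarith
  · linarith
  · linarith [hU t ht]

namespace TimeGrid

variable {T : ℝ} {N : ℕ} (π : TimeGrid T N)

lemma t_mono {i j : ℕ} (hij : i ≤ j) (hj : j ≤ π.n) : π.t i ≤ π.t j := by
  induction j, hij using Nat.le_induction with
  | base => exact le_rfl
  | succ j hij ih => exact (ih (by omega)).trans (π.t_strictMono j (by omega)).le

lemma t_mem {i : ℕ} (hi : i ≤ π.n) : π.t i ∈ Icc 0 T := by
  have h1 := π.t_mono (Nat.zero_le i) hi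
  have h2 := π.t_mono hi le_rfl
  rw [π.t_zero] at h1
  rw [π.t_last] at h2
  exact ⟨h1, h2⟩

lemma t_level {k : ℕ} (hk : k < N) : π.t (π.j (k + 1)) - π.t (π.j k) = T / N := by
  rw [π.t_j k hk.le, π.t_j (k + 1) hk]; push_cast; ring

lemma j_lt (hT : 0 < T) {k : ℕ} (hk : k < N) : π.j k < π.j (k + 1) := by
  by_contra! h
  have h1 := π.t_mono h (π.j_le k hk.le)
  have h2 := π.t_level hk
  have h3 : 0 < T / N := div_pos hT (by exact_mod_cast (Nat.zero_le k).trans_lt hk)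
  linarith

lemma h_pos {i : ℕ} (hi : i < π.n) : 0 < π.h i := sub_pos.2 (π.t_strictMono i hi)

lemma h_le_mesh {i : ℕ} (hi : i < π.n) : π.h i ≤ π.mesh := by
  have h1 : (π.h i).toNNReal ≤ π.mesh :=
    Finset.le_sup (f := fun i => (π.h i).toNNReal) (Finset.mem_range.2 hi)
  exact (Real.le_coe_toNNReal _).trans (NNReal.coe_le_coe.2 h1)

end TimeGrid

/-- The normalised quantised noise on the step `i`. -/
noncomputable def stepNoise {d : ℕ} {Ω : Type*} {T : ℝ} {N : ℕ} (π : TimeGrid T N)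
    (W : ℝ → Ω → St d) (Γ : St d → St d) (i : ℕ) (ω : Ω) : St d :=
  Γ ((√(π.h i))⁻¹ • (W (π.t (i + 1)) ω - W (π.t i) ω))

section Scheme

variable {d : ℕ} {Λ α : ℝ} {Ω : Type*} {mΩ : MeasurableSpace Ω} {P : Measure Ω}
  [IsProbabilityMeasure P] {F : Filtration ℝ mΩ} {T : ℝ} {W : ℝ → Ω → St d} {c : Coeffs d}
  {N : ℕ} {π : TimeGrid T N} {Γ : St d → St d} {k : ℕ} {Xin : ℕ → Ω → St d} {η : Ω → ℝ}
  {X : ℕ → Ω → St d} {Y : ℕ → Ω → ℝ} {Z : ℕ → Ω → St d}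

lemma IsTreeScheme.isRun (H : IsTreeScheme P F W c π Γ k Xin η X Y Z)
    (hin : IsInput P F π k Xin η) (hW : IsBrownianMotion P F T W) (hΓ : IsQuantiser Λ Γ)
    (hk : k < N) (hδ : T / N ≤ 1) :
    IsRun (fun i => F (π.t i)) P Λ T c hΓ.support (quantiserWeight Γ) π.t π.h X Y
      (stepNoise π W Γ) (fun i ω => c.b (X i ω) (Y i ω) (P.map fun ω => (X i ω, Y i ω)))
      (fun i ω => c.σ (X i ω) (P.map (X i)) (stepNoise π W Γ i ω)) Xin Z
      (π.j k) (π.j (k + 1)) := by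
  have hn := π.j_le (k + 1) hk
  have hIcc : ∀ i ∈ Ico (π.j k) (π.j (k + 1)), i ∈ Finset.Icc (π.j k) (π.j (k + 1)) ∧
      i + 1 ∈ Finset.Icc (π.j k) (π.j (k + 1)) ∧ i ∈ Finset.Ico (π.j k) (π.j (k + 1)) ∧
      i < π.n := fun i hi => by
    have := hi.1
    have := hi.2
    simp only [Finset.mem_Icc, Finset.mem_Ico]
    omega
  have hinc : ∀ i ω, quantisedIncrement π W Γ i ω = √(π.h i) • stepNoise π W Γ i ω :=
    fun _ _ => rfl
  refine ⟨fun i hi => ?_, fun i hi => ?_, fun i hi => ?_⟩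
  · obtain ⟨h1, h2, h3, h4⟩ := hIcc i hi
    have ht := π.t_mem h4.le
    have ht' := π.t_mem (Nat.succ_le_of_lt h4)
    refine ⟨H.adapted_X i h1, H.adapted_Y i h1, H.memLp_X i h1, H.memLp_Y i h1,
      hW.isInnovation hΓ ht ht' (π.t_strictMono i h4), hΓ.isDesign, rfl, rfl, ht.1, π.h_pos h4,
      ?_, ?_⟩
    · have i1 := π.t_mono hi.1 h4.le
      have i2 := π.t_mono (Nat.succ_le_of_lt hi.2) hn
      have i3 := π.t_level hk
      rw [Nat.succ_eq_add_one] at i2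
      unfold TimeGrid.h
      linarith
    · have := ht'.2
      rw [Nat.succ_eq_add_one] at this
      unfold TimeGrid.h
      linarith
  · obtain ⟨h1, h2, h3, h4⟩ := hIcc i hi
    refine ⟨?_, H.memLp_Y _ h2, hin.adapted i h1, hin.memLp i h1, H.adapted_Z i h1, H.memLp_Z i h1,
      H.step_Y i h3, H.step_Z i h3⟩
    filter_upwards [H.step_X i h3] with ω hω
    rw [hω, hinc, map_smul]
  · unfold TimeGrid.h; ring

end Scheme

end MKV

open MKV

theorem mainTheorem4 (d : ℕ) (Λ α : ℝ) (hΛ : 0 ≤ Λ) (hα : 1 ≤ α) :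
    ∃ Λ' c₀ : ℝ, 0 ≤ Λ' ∧ 0 < c₀ ∧
      ∀ (Ω : Type*) (mΩ : MeasurableSpace Ω) (P : Measure Ω) (_ : IsProbabilityMeasure P)
        (F : Filtration ℝ mΩ) (_ : Atomless (F 0) (P.trim (F.le 0)))
        (T : ℝ) (_ : 0 < T)
        (W : ℝ → Ω → St d) (_ : IsBrownianMotion P F T W)
        (c : Coeffs d) (_ : H0 Λ c)
        (u : MasterField d) (_ : H1 (P.trim (F.le 0)) T Λ α c u),
      ∃ (C : ℝ) (D1 D2 : ℝ≥0 → ℝ≥0),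
        Tendsto D1 (𝓝[>] 0) (𝓝 0) ∧ Tendsto D2 (𝓝[>] 0) (𝓝 0) ∧
        (∀ h : ℝ≥0, (D1 h : ℝ) ≤ C * √(h : ℝ)) ∧ (∀ h : ℝ≥0, (D2 h : ℝ) ≤ C * √(h : ℝ)) ∧
        ∀ (N : ℕ) (_ : 1 ≤ N) (_ : T / N ≤ c₀)
          (π : TimeGrid T N) (Γ : St d → St d) (_ : IsQuantiser Λ Γ)
          (k : ℕ) (_ : k < N)
          (Xin : ℕ → Ω → St d) (η : Ω → ℝ) (_ : IsInput P F π k Xin η)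
          (X : ℕ → Ω → St d) (Y : ℕ → Ω → ℝ) (Z : ℕ → Ω → St d)
          (_ : IsTreeScheme P F W c π Γ k Xin η X Y Z),
          A1Inequality P α Λ' D1 D2 u π k Xin X Y := by
  -- All the assumptions are monotone in `Λ`, so `Λ` may be replaced by `max Λ 1`; the constants
  -- still depend on `d`, `Λ` and `α` only.
  have hL : 1 ≤ max Λ 1 := le_max_right _ _
  have hlc := one_le_levelConst (d := d) hL hα
  have hE := one_le_errConst (d := d) hL hα
  have hst : 0 < stabilityConst d (max Λ 1) α := by
    have := absorbConst_nonneg (d := d) hL hα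
    unfold stabilityConst; linarith
  refine ⟨stabilityConst d (max Λ 1) α, (levelConst d (max Λ 1) α)⁻¹, hst.le,
    inv_pos.2 (by linarith), ?_⟩
  intro Ω mΩ P hP F hat T hT W hW c h0 u h1
  -- The lift lives on `F 0`, whereas the states of the scheme are measurable for later σ-algebras
  -- only. Equality in law in `HasLionsDeriv.hasDerivAt_quadratic` bridges the two.
  have : IsProbabilityMeasure (P.trim (F.le 0)) :=
    ⟨by rw [trim_measurableSet_eq (F.le 0) MeasurableSet.univ]; exact measure_univ⟩
  obtain ⟨K, S⟩ := exists_setting hL hα hT hat (h0.mono (le_max_left Λ 1))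
    (h1.mono (le_max_left Λ 1))
  have hC : 0 < meshConst d (max Λ 1) α K := by
    have h2 := two_le_forwardConst (Λ := max Λ 1) hα
    have h3 := S.one_le_K
    have := Real.rpow_pos_of_pos (by positivity : 0 < 4 * forwardConst (max Λ 1) α * K) α
    unfold meshConst; positivity
  set C := meshConst d (max Λ 1) α K with hCdef
  -- `K`, which depends on the whole setting, enters the mesh constant `C` but neither `Λ'` nor
  -- `c₀`. The error `D¹` is not needed, since `‖ξ‖^α` comes with the constant 1.
  refine ⟨C, fun _ => 0, fun h => C.toNNReal * NNReal.sqrt h, tendsto_const_nhds, ?_,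
    fun h => by simp only [NNReal.coe_zero]; positivity, fun h => ?_, ?_⟩
  · have hcont : Continuous fun h : ℝ≥0 => C.toNNReal * NNReal.sqrt h := by fun_prop
    have := hcont.tendsto 0
    simp only [NNReal.sqrt_zero, mul_zero] at this
    exact this.mono_left nhdsWithin_le_nhds
  · simp [Real.coe_toNNReal _ hC.le, Real.coe_sqrt]
  intro N hN hδ π Γ hΓ k hk Xin η hin X Y Z H
  have hδ1 : T / N * levelConst d (max Λ 1) α ≤ 1 := by
    have := mul_le_mul_of_nonneg_right hδ (by linarith : 0 ≤ levelConst d (max Λ 1) α)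
    rwa [inv_mul_cancel₀ (by linarith)] at this
  have hδ2 : T / N ≤ 1 := hδ.trans (inv_le_one_of_one_le₀ hlc)
  have R := H.isRun hin hW (hΓ.mono (le_max_left Λ 1)) hk hδ2
  have hab := π.j_lt hT hk
  have hn := π.j_le (k + 1) hk
  have hlev := π.t_level hk
  set a := π.j k with ha
  set b := π.j (k + 1) with hb
  have hmesh : (0 : ℝ) < π.mesh := (π.h_pos (hab.trans_le hn)).trans_le
    (π.h_le_mesh (hab.trans_le hn))
  have hξ : eLpNorm (Xin a) (ENNReal.ofReal (2 * α)) P = eLpNorm (X a) (ENNReal.ofReal (2 * α)) P :=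
    eLpNorm_congr_ae H.initial_X.symm
  have hXa := (R.memLp_two S hab le_rfl hab.le).1
  have hmb := (R.memLp_two S hab hab.le le_rfl).2
  unfold A1Inequality
  rw [hξ]
  set q := ENNReal.ofReal (2 * α) with hq
  set Δ := ⨆ i ∈ Finset.Ico a b, eLpNorm (fun ω => X i ω - Xin i ω) q P with hΔ
  have hD2 : ((C.toNNReal * NNReal.sqrt π.mesh : ℝ≥0) : ℝ≥0∞) = ENNReal.ofReal (C * √π.mesh) := by
    rw [ENNReal.ofReal_mul hC.le, ENNReal.coe_mul]
    congr 1
    rw [← Real.coe_sqrt, ENNReal.ofReal_coe_nnreal]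
  have hpos : 0 < C * √(π.mesh : ℝ) := mul_pos hC (Real.sqrt_pos.2 hmesh)
  rw [hD2]
  -- If one of the three norms on the right is infinite, so is the right-hand side, because the
  -- coefficients are positive. For the norm of the initial condition this uses that the mesh is
  -- positive.
  by_cases hfb : fieldError P α u π X Y b = ⊤
  · rw [hfb, ENNReal.mul_top (by simpa using Real.exp_pos _)]
    simp
  by_cases hfΔ : Δ = ⊤
  · rw [hfΔ, ENNReal.mul_top (by simpa using hst)]
    simp
  by_cases hfξ : eLpNorm (X a) q P = ⊤
  · rw [hfξ, ENNReal.top_rpow_of_pos (by linarith), add_top,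
      ENNReal.mul_top (by simpa using hpos)]
    simp
  have hmem_b : MemLp (runErr P u π.t X Y b) q P := ⟨hmb.1, lt_top_iff_ne_top.2 hfb⟩
  have hmem_ξ : MemLp (X a) q P := ⟨hXa.1, lt_top_iff_ne_top.2 hfξ⟩
  have hleΔ : ∀ i ∈ Ico a b, eLpNorm (fun ω => X i ω - Xin i ω) q P ≤ Δ := fun i hi =>
    le_iSup₂_of_le (f := fun i (_ : i ∈ Finset.Ico a b) => eLpNorm (fun ω => X i ω - Xin i ω) q P)
      i (Finset.mem_Ico.2 hi) le_rfl
  have hmeas : ∀ i ∈ Ico a b, AEStronglyMeasurable (fun ω => X i ω - Xin i ω) P := fun i hi =>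
    (R.step i hi).memLp_X.1.sub (R.back i hi).memLp_Xin.1
  have hmem_in : ∀ i ∈ Ico a b, MemLp (fun ω => X i ω - Xin i ω) q P := fun i hi =>
    ⟨hmeas i hi, (hleΔ i hi).trans_lt (lt_top_iff_ne_top.2 hfΔ)⟩
  refine iSup₂_le fun i hi => ?_
  rw [Finset.mem_Icc] at hi
  rw [← hlev] at hδ1
  obtain ⟨hmem, hle⟩ := R.lpNorm_err_le S hab hδ1 hmem_b hmem_in hmem_ξ
    (m := π.mesh) (Δ := Δ.toReal) (fun i hi => π.h_le_mesh (hi.2.trans_le hn))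
    (fun i hi => by
      rw [← toReal_eLpNorm (hmeas i hi)]
      exact ENNReal.toReal_mono hfΔ (hleΔ i hi))
    hi.1 hi.2
  rw [hlev] at hle
  have e1 : fieldError P α u π X Y i = ENNReal.ofReal (lpNorm (runErr P u π.t X Y i) q P) :=
    (ofReal_lpNorm hmem).symm
  have e2 : fieldError P α u π X Y b = ENNReal.ofReal (lpNorm (runErr P u π.t X Y b) q P) :=
    (ofReal_lpNorm hmem_b).symm
  have e3 : Δ = ENNReal.ofReal Δ.toReal := (ENNReal.ofReal_toReal hfΔ).symm
  have n1 : 0 ≤ lpNorm (runErr P u π.t X Y b) q P := lpNorm_nonneg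
  have n2 : 0 ≤ lpNorm (X a) q P := lpNorm_nonneg
  have n3 : 0 ≤ lpNorm (X a) q P ^ α := Real.rpow_nonneg n2 _
  have n4 := (Real.exp_pos (stabilityConst d (max Λ 1) α * (T / N))).le
  have n5 : 0 ≤ Δ.toReal := ENNReal.toReal_nonneg
  rw [e1, e2, e3, ← ofReal_lpNorm hmem_ξ, ENNReal.ofReal_rpow_of_nonneg n2 (by linarith),
    ENNReal.coe_zero, add_zero, ← ENNReal.ofReal_one, ← ENNReal.ofReal_add zero_le_one n3,
    ← ENNReal.ofReal_mul n4, ← ENNReal.ofReal_mul hst.le, ← ENNReal.ofReal_mul hpos.le,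
    ← ENNReal.ofReal_add (by positivity) (by positivity),
    ← ENNReal.ofReal_add (by positivity) (by positivity)]
  exact ENNReal.ofReal_le_ofReal hle
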